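/- Let $\tau\in(0,1)$, $\gamma>0$, $0\le c<1$ and $\alpha>(c-1)/2$ be constants and let $p$ be a fixed integer. For each $n$ consider the linear model with $g=g_n$ groups of $p$ variables $$Y_i=\mathbb X_i^t\beta^0+\varepsilon_i,\qquad i=1,\dots,n,$$ where the $\mathbb X_i=(\mathbf X_{i,1},\dots,\mathbf X_{i,g})\in\mathbb R^{gp}$ are deterministic and $\beta^0=(\beta^0_1,\dots,\beta^0_g)$, $\beta^0_j\in\mathbb R^p$; $g$, $\mathbb X_i$, $\beta^0$ may depend on $n$. Let $\rho_\tau(u)=u(\tau-1_{u<0})$ and $G_n(\beta)=\sum_{i=1}^n\rho_\tau(Y_i-\mathbb X_i^t\beta)$, let $\widetilde\beta$ be a (measurable) minimizer of $G_n$ on $\mathbb R^{gp}$, and let $\widehat\beta$ be a (measurable) minimizer on $\mathbb R^{gp}$ of $$E_n(\beta)=G_n(\beta)+\lambda_{1n}\sum_{j=1}^g\|\widetilde\beta_j\|_2^{-\gamma}\,\|\beta_j\|_2+\lambda_{2n}\sum_{j=1}^g\|\beta_j\|_2^2,\qquad \lambda_{1n},\lambda_{2n}\ge0,$$ with the conventions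 $0^{-\gamma}=\infty$, $\infty\cdot0=0$. Put $\mathcal A^0=\{j:\beta^0_j\ne0\}$ and $\widehat{\mathcal A}_n=\{j:\widehat\beta_j\neq0\}$. For a set $A$ of group indices let $\beta_A$ be the subvector of the groups $\beta_j$, $j\in A$, and $\mathbb X_{i,A}$ that of the groups $\mathbf X_{i,j}$, $j\in A$. Suppose: (A1) the $\varepsilon_i$ are i.i.d. with density $f$ and $\mathbb P[\varepsilon_i<0]=\tau$; in a neighbourhood of $0$ the function $f$ is strictly positive and differentiable with bounded derivative; (A2) there are constants $0<m_0\le M_0<\infty$ such that, for $n$ large enough, all the eigenvalues of $n^{-1}\sum_{i=1}^n\mathbb X_i\mathbb X_i^t$ lie in $[m_0,M_0]$; (A3) $(g/n)^{1/2}\max_{1\le i\le n}\|\mathbb X_i\|_2\to0$; (A4) $g=O(n^c)$; (A5) there is $M>0$ such that, for $n$ large enough, $n^{-\alpha}\|\beta^0_j\|_2\ge M$ for all $j\in\mathcal A^0$; moreover the norms $\|\beta^0_j\|_2$ are bounded, uniformly in $j$ and in $n$ large enough; and, as $n\to\infty$, $\lambda_{1n}\to\infty$, $\lambda_{1n}n^{(c-1)/2-\alpha\gamma}\to0$,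 $\lambda_{2n}\to\infty$, $\lambda_{2n}n^{(c-1)/2}\to0$, $\lambda_{1n}n^{(1-c)(1+\gamma)/2-1}\to\infty$, $\lambda_{1n}|\mathcal A^0|n^{-(1+c)/2}\to0$ and $\lambda_{2n}|\mathcal A^0|n^{-(1+c)/2}\to0$. Then: (i) $\mathbb P[\widehat{\mathcal A}_n=\mathcal A^0]\to1$ as $n\to\infty$. (ii) With $U_{n,\mathcal A^0}=n^{-1}\sum_{i=1}^n\mathbb X_{i,\mathcal A^0}\mathbb X_{i,\mathcal A^0}^t$, for every sequence of vectors $u=u_n$ of size $p|\mathcal A^0|$ with $\|u\|_2=1$ (for $n$ large enough), $$n^{1/2}\,(u^tU_{n,\mathcal A^0}^{-1}u)^{-1/2}\,u^t(\widehat\beta-\beta^0)_{\mathcal A^0}\ \xrightarrow{\ \mathcal L\ }\ \mathcal N\Big(0,\frac{\tau(1-\tau)}{f(0)^2}\Big).$$ -/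

import Mathlib

open MeasureTheory ProbabilityTheory Filter Topology Asymptotics
open scoped NNReal ENNReal

noncomputable section

/-- Vectors of `ℝ^(g p)` made of `g` groups of `p` coordinates, with the Euclidean norm. -/
abbrev GroupVec (g p : ℕ) : Type := EuclideanSpace ℝ (Fin g × Fin p)

/-- The `j`-th group `β_j ∈ ℝ^p` of `β`. -/
def block {g p : ℕ} (β : GroupVec g p) (j : Fin g) : EuclideanSpace ℝ (Fin p) :=
  WithLp.toLp 2 fun k => β (j, k)

/-- The set of indices of the nonzero groups of `β`. -/
def activeSet {g p : ℕ} (β : GroupVec g p) : Finset (Fin g) :=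
  open Classical in Finset.univ.filter fun j => block β j ≠ 0

/-- The subvector `β_A` of `β` made of the groups `β_j` with `j ∈ A`. -/
def restrictGroups {g p : ℕ} (A : Finset (Fin g)) (β : GroupVec g p) :
    EuclideanSpace ℝ (A × Fin p) :=
  WithLp.toLp 2 fun k => β (k.1, k.2)

/-- The matrix `n⁻¹ ∑ᵢ xᵢ xᵢᵗ`. -/
def gramMatrix {ι : Type*} {n : ℕ} (x : Fin n → EuclideanSpace ℝ ι) : Matrix ι ι ℝ :=
  (n : ℝ)⁻¹ • ∑ i, Matrix.vecMulVec (x i) (x i)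

/-- The quantile loss `ρ_τ(u) = u (τ - 1_{u < 0})`. -/
def quantileLoss (τ u : ℝ) : ℝ := u * (τ - Set.indicator {v : ℝ | v < 0} 1 u)

/-- The quantile process `G_n(β) = ∑ᵢ ρ_τ(Yᵢ - Xᵢᵗ β)`. -/
def quantileProcess {g p n : ℕ} (τ : ℝ) (X : Fin n → GroupVec g p) (Y : Fin n → ℝ)
    (β : GroupVec g p) : ℝ :=
  ∑ i, quantileLoss τ (Y i - inner ℝ (X i) β)

/-- The adaptive elastic-net group quantile process
`G_n(β) + lam1 ∑ⱼ ‖β'_j‖^(-γ) ‖β_j‖ + lam2 ∑ⱼ ‖β_j‖²`, where `β'` is the preliminary estimator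
from which the weights are computed. It is nonnegative for `τ ∈ (0, 1)`, and takes its values in
`[0, ∞]`: for `γ > 0` a group with `β'_j = 0` has the weight `0^(-γ) = ∞` (with `∞ * 0 = 0`). -/
def elasticNetProcess {g p n : ℕ} (τ γ : ℝ) (lam1 lam2 : ℝ≥0) (X : Fin n → GroupVec g p)
    (Y : Fin n → ℝ) (β' β : GroupVec g p) : ℝ≥0∞ :=
  ENNReal.ofReal (quantileProcess τ X Y β)
    + lam1 * ∑ j, ‖block β' j‖ₑ ^ (-γ) * ‖block β j‖ₑ
    + lam2 * ∑ j, ‖block β j‖ₑ ^ 2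

end

/-! Whitening (`IsConditioned.exists_isWhitening`) turns the regressors into a Parseval frame $x_j$
of a space of dimension $d$ with $\sum_j\|x_j\|^2=d$, and the estimators into points at distance
$O(\sqrt g)$ from the origin. On a ball of radius $\rho$ of that order, (A3) says only that
$b=\max_j\|x_j\|\rho$ is small. No expansion of the loss uniform over the ball is used; the
probabilistic part rests on resampling one error at a time.

Let $\theta(e)$ maximize a base function minus the increment of the quantile loss. With the other
errors fixed, the fit $z=\langle x_j,\theta\rangle$ is nondecreasing in $e_j$, and $\theta$ does not
move while $e_j$ stays on one side of the fit (`FrozenProfile`). Hence $1_{e_j<z}-1_{e_j<0}$ has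
conditional mean $f(0)z$, up to $z^2$ and up to the width of the interval swept by the fit
(`QuantileNoise.linearization`). This width is the covariance of the fit with the centred variable
`tailContrast`, so weighted sums of widths reduce, by Cauchy-Schwarz, to the norm of a sum of
independent centred vectors and are $O(b)$ (`integral_contrast_le`, `sum_width_le`). The sum over
$j$ is `integral_counting_le`: tested against a function of the errors that reacts little to each of
them, the counting process is linear in $\theta$.

The fit is not known to be such a test function, but the maximal value $H(q)$ of the
ridge-regularized objective with linear term $\langle q,t\rangle$ provides some: its differences in
$q$ are frozen in both tails of each error, and their oscillation is controlled by the widths and by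
the strict convexity of the loss at its kinks (`sum_ridgeOsc_le`). As $H$ is convex with subgradient
$\theta$, its increments stand for $\langle w,\theta\rangle$ from one side. Testing the first-order
condition `score_le` against their positive parts gives a self-improving inequality, whence second
moments of order one in every direction (`hasMomentBound`). Testing it against a clipped difference
with the linear statistic gives `integral_clip_sq_le`. For every almost minimizer $s$ of the loss
minus $\langle q,\cdot\rangle$ one has $t\langle w,s\rangle\le H(q+tw)-H(q)+$ error; used for $w$
and $-w$, this shows that $\langle w,s\rangle$ is close to $f(0)^{-1}\sum_j\langle
x_j,w\rangle(\tau-1_{e_j<0})$ (`exists_abs_inner_sub_le`).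

For the support, `exists_growth` gives quadratic growth of the loss up to a random constant of order
$g$, which traps both estimators within $R\sqrt g$ with large probability, and `exists_upper` bounds
the loss above by a multiple of $g$. By convexity, deleting the groups outside $\mathcal A^0$, of
norm $\|v\|$, raises the loss by $O(\sqrt{ng}\,\|v\|)$, while it saves at least a multiple of
$\lambda_{1n}(g/n)^{-\gamma/2}\|v\|$ in the penalty; the selection condition on $\lambda_{1n}$ makes
the saving larger (`elasticNet_support`). This is (i).

On the true support the penalty is linear up to a negligible error, with a negligible slope, so the
estimator almost minimizes the loss of the restricted design (`elasticNet_almost_min`). The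
linearization, a central limit theorem for weighted sums (`tendstoInDistribution_weighted_sum`) and
Slutsky's lemma give (ii). -/

set_option linter.unusedSectionVars false

/-! ### Bounded functions on probability spaces -/

section Bounded

variable {α : Type*} [MeasurableSpace α] {μ : Measure α} [IsProbabilityMeasure μ]

/-- Measurable and bounded real functions. -/
def BddMeas (f : α → ℝ) : Prop := Measurable f ∧ ∃ C, ∀ a, |f a| ≤ C

lemma BddMeas.integrable {f : α → ℝ} (hf : BddMeas f) : Integrable f μ := by
  obtain ⟨hm, C, hC⟩ := hf
  exact Integrable.of_bound hm.aestronglyMeasurable C (ae_of_all _ hC)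

lemma BddMeas.const (c : ℝ) : BddMeas (fun _ : α => c) := ⟨measurable_const, |c|, fun _ => le_rfl⟩

lemma BddMeas.add {f g : α → ℝ} (hf : BddMeas f) (hg : BddMeas g) :
    BddMeas (fun a => f a + g a) := by
  obtain ⟨hm, C, hC⟩ := hf
  obtain ⟨hm', C', hC'⟩ := hg
  exact ⟨hm.add hm', C + C', fun a => (abs_add_le _ _).trans (add_le_add (hC a) (hC' a))⟩

lemma BddMeas.neg {f : α → ℝ} (hf : BddMeas f) : BddMeas (fun a => - f a) := by
  obtain ⟨hm, C, hC⟩ := hf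
  exact ⟨hm.neg, C, fun a => by rw [abs_neg]; exact hC a⟩

lemma BddMeas.sub {f g : α → ℝ} (hf : BddMeas f) (hg : BddMeas g) :
    BddMeas (fun a => f a - g a) := by
  simpa only [sub_eq_add_neg] using hf.add hg.neg

lemma BddMeas.mul {f g : α → ℝ} (hf : BddMeas f) (hg : BddMeas g) :
    BddMeas (fun a => f a * g a) := by
  obtain ⟨hm, C, hC⟩ := hf
  obtain ⟨hm', C', hC'⟩ := hg
  refine ⟨hm.mul hm', C * C', fun a => ?_⟩
  rw [abs_mul]
  exact mul_le_mul (hC a) (hC' a) (abs_nonneg _) ((abs_nonneg _).trans (hC a))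

lemma BddMeas.abs {f : α → ℝ} (hf : BddMeas f) : BddMeas (fun a => |f a|) := by
  obtain ⟨hm, C, hC⟩ := hf
  exact ⟨hm.abs, C, fun a => by rw [abs_abs]; exact hC a⟩

lemma BddMeas.sq {f : α → ℝ} (hf : BddMeas f) : BddMeas (fun a => f a ^ 2) := by
  simpa only [pow_two] using hf.mul hf

lemma BddMeas.const_mul {f : α → ℝ} (hf : BddMeas f) (c : ℝ) : BddMeas (fun a => c * f a) :=
  (BddMeas.const c).mul hf

lemma BddMeas.max {f g : α → ℝ} (hf : BddMeas f) (hg : BddMeas g) :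
    BddMeas (fun a => max (f a) (g a)) := by
  obtain ⟨hm, C, hC⟩ := hf
  obtain ⟨hm', C', hC'⟩ := hg
  refine ⟨hm.max hm', Max.max C C', fun a => ?_⟩
  exact abs_max_le_max_abs_abs.trans (max_le_max (hC a) (hC' a))

lemma BddMeas.min {f g : α → ℝ} (hf : BddMeas f) (hg : BddMeas g) :
    BddMeas (fun a => min (f a) (g a)) := by
  obtain ⟨hm, C, hC⟩ := hf
  obtain ⟨hm', C', hC'⟩ := hg
  refine ⟨hm.min hm', Max.max C C', fun a => ?_⟩
  exact abs_min_le_max_abs_abs.trans (max_le_max (hC a) (hC' a))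

lemma BddMeas.sum {ι : Type*} (s : Finset ι) {f : ι → α → ℝ} (hf : ∀ i, BddMeas (f i)) :
    BddMeas (fun a => ∑ i ∈ s, f i a) := by
  classical
  induction s using Finset.induction_on with
  | empty => simpa using BddMeas.const (α := α) 0
  | insert i s hi ih => simpa [Finset.sum_insert hi] using (hf i).add ih

lemma BddMeas.comp {β : Type*} [MeasurableSpace β] {f : α → ℝ} (hf : BddMeas f) {g : β → α}
    (hg : Measurable g) : BddMeas (fun b => f (g b)) :=
  ⟨hf.1.comp hg, hf.2.imp fun _ h b => h (g b)⟩

/-- Cauchy-Schwarz inequality for bounded functions. -/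
lemma BddMeas.integral_mul_le {f g : α → ℝ} (hf : BddMeas f) (hg : BddMeas g) :
    ∫ a, f a * g a ∂μ ≤ √(∫ a, f a ^ 2 ∂μ) * √(∫ a, g a ^ 2 ∂μ) := by
  have hA : 0 ≤ ∫ a, f a ^ 2 ∂μ := integral_nonneg fun a => sq_nonneg _
  rw [← Real.sqrt_mul hA]
  refine Real.le_sqrt_of_sq_le ?_
  have key : ∀ t : ℝ, 0 ≤ (∫ a, f a ^ 2 ∂μ) * (t * t) + (2 * ∫ a, f a * g a ∂μ) * t
      + ∫ a, g a ^ 2 ∂μ := by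
    intro t
    have h0 : 0 ≤ ∫ a, (t * f a + g a) ^ 2 ∂μ := integral_nonneg fun a => sq_nonneg _
    have h1 : ∫ a, (t * f a + g a) ^ 2 ∂μ
        = ∫ a, ((t * t) * f a ^ 2 + (2 * t) * (f a * g a)) + g a ^ 2 ∂μ := by
      congr 1; ext a; ring
    rw [h1, integral_add ((hf.sq.const_mul _).add ((hf.mul hg).const_mul _)).integrable
      hg.sq.integrable, integral_add (hf.sq.const_mul _).integrable
      ((hf.mul hg).const_mul _).integrable, integral_const_mul, integral_const_mul] at h0
    linarith
  have := discrim_le_zero key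
  unfold discrim at this
  nlinarith

lemma BddMeas.integral_abs_le_sqrt {f : α → ℝ} (hf : BddMeas f) :
    ∫ a, |f a| ∂μ ≤ √(∫ a, f a ^ 2 ∂μ) := by
  have := hf.abs.integral_mul_le (μ := μ) (BddMeas.const (α := α) 1)
  simpa using this

lemma BddMeas.integral_mono {f g : α → ℝ} (hf : BddMeas f) (hg : BddMeas g)
    (h : ∀ a, f a ≤ g a) : ∫ a, f a ∂μ ≤ ∫ a, g a ∂μ :=
  MeasureTheory.integral_mono hf.integrable hg.integrable h

end Bounded

/-! ### Resampling one coordinate of a product measure -/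

section Resample

variable {n : ℕ} {ν : Measure ℝ} [IsProbabilityMeasure ν]

lemma measurable_update_prod (j : Fin n) :
    Measurable (fun q : (Fin n → ℝ) × ℝ => Function.update q.1 j q.2) := by
  rw [measurable_pi_iff]
  intro i
  by_cases h : i = j
  · subst h; simpa using measurable_snd
  · simp only [Function.update_of_ne h]
    exact (measurable_pi_apply i).comp measurable_fst

lemma measurable_update_const (j : Fin n) (y : ℝ) :
    Measurable (fun e : Fin n → ℝ => Function.update e j y) :=
  (measurable_update_prod j).comp (measurable_id.prodMk measurable_const)

lemma measurable_update_snd (e : Fin n → ℝ) (j : Fin n) :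
    Measurable (fun y : ℝ => Function.update e j y) :=
  (measurable_update_prod j).comp (measurable_const.prodMk measurable_id)

/-- An independent copy in place of one coordinate does not change a product law. Through
`integral_resample` this replaces conditioning on the other errors. -/
lemma measurePreserving_resample (j : Fin n) :
    MeasurePreserving (fun q : (Fin n → ℝ) × ℝ => Function.update q.1 j q.2)
      ((Measure.pi fun _ => ν).prod ν) (Measure.pi fun _ => ν) := by
  refine ⟨measurable_update_prod j, ?_⟩
  symm
  refine Measure.pi_eq fun s hs => ?_
  rw [Measure.map_apply (measurable_update_prod j) (MeasurableSet.univ_pi hs)]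
  have : (fun q : (Fin n → ℝ) × ℝ => Function.update q.1 j q.2) ⁻¹' (Set.univ.pi s)
      = (Set.univ.pi (Function.update s j Set.univ)) ×ˢ (s j) := by
    ext q
    simp only [Set.mem_preimage, Set.mem_pi, Set.mem_univ, true_implies, Set.mem_prod]
    constructor
    · intro h
      refine ⟨fun i => ?_, by simpa using h j⟩
      by_cases hi : i = j
      · subst hi; simp
      · simpa [Function.update_of_ne hi] using h i
    · rintro ⟨h1, h2⟩ i
      by_cases hi : i = j
      · subst hi; simpa using h2
      · simpa [Function.update_of_ne hi] using h1 i
  rw [this, Measure.prod_prod, Measure.pi_pi, ← Finset.mul_prod_erase _ _ (Finset.mem_univ j),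
    ← Finset.mul_prod_erase _ (fun i => ν (s i)) (Finset.mem_univ j), mul_comm]
  simp only [Function.update_self, measure_univ, one_mul]
  congr 1
  refine Finset.prod_congr rfl fun i hi => ?_
  rw [Function.update_of_ne (Finset.ne_of_mem_erase hi)]

lemma integral_resample (j : Fin n) {f : (Fin n → ℝ) → ℝ} (hf : BddMeas f) :
    ∫ e, f e ∂(Measure.pi fun _ => ν)
      = ∫ e, ∫ y, f (Function.update e j y) ∂ν ∂(Measure.pi fun _ => ν) := by
  have h := measurePreserving_resample (ν := ν) j
  have hm : BddMeas (fun q : (Fin n → ℝ) × ℝ => f (Function.update q.1 j q.2)) :=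
    hf.comp (measurable_update_prod j)
  rw [← integral_prod (fun q : (Fin n → ℝ) × ℝ => f (Function.update q.1 j q.2)) hm.integrable,
    ← h.map_eq, integral_map h.measurable.aemeasurable
    (by rw [h.map_eq]; exact hf.1.aestronglyMeasurable), h.map_eq]

lemma bddMeas_resample (j : Fin n) {f : (Fin n → ℝ) → ℝ} (hf : BddMeas f) :
    BddMeas (fun e => ∫ y, f (Function.update e j y) ∂ν) := by
  have hm := hf.comp (measurable_update_prod j)
  refine ⟨(hm.1.stronglyMeasurable.integral_prod_right').measurable, ?_⟩
  obtain ⟨C, hC⟩ := hf.2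
  refine ⟨C, fun e => ?_⟩
  have := norm_integral_le_of_norm_le_const (μ := ν) (f := fun y => f (Function.update e j y))
    (C := C) (ae_of_all _ fun y => hC _)
  simpa using this

/-- A one-coordinate inequality between conditional expectations integrates. -/
lemma integral_le_of_resample (j : Fin n) {f g : (Fin n → ℝ) → ℝ} (hf : BddMeas f)
    (hg : BddMeas g)
    (h : ∀ e, ∫ y, f (Function.update e j y) ∂ν ≤ ∫ y, g (Function.update e j y) ∂ν) :
    ∫ e, f e ∂(Measure.pi fun _ => ν) ≤ ∫ e, g e ∂(Measure.pi fun _ => ν) := by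
  rw [integral_resample j hf, integral_resample j hg]
  exact (bddMeas_resample j hf).integral_mono (bddMeas_resample j hg) h

lemma integral_coord_mul_coord {χ : ℝ → ℝ} (hχ : BddMeas χ) (h0 : ∫ y, χ y ∂ν = 0) {i j : Fin n}
    (hij : i ≠ j) : ∫ e, χ (e i) * χ (e j) ∂(Measure.pi fun _ : Fin n => ν) = 0 := by
  rw [integral_resample j ((hχ.comp (measurable_pi_apply i)).mul (hχ.comp (measurable_pi_apply j)))]
  simp only [Function.update_self, Function.update_of_ne hij]
  simp [integral_const_mul, h0]

lemma integral_coord {χ : ℝ → ℝ} (hχ : BddMeas χ) (j : Fin n) :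
    ∫ e, χ (e j) ∂(Measure.pi fun _ : Fin n => ν) = ∫ y, χ y ∂ν := by
  rw [integral_resample j (hχ.comp (measurable_pi_apply j))]
  simp

/-- Second moment of a weighted sum of independent centred variables, in a Hilbert space. -/
lemma integral_norm_sq_sum_le {E : Type*} [NormedAddCommGroup E] [InnerProductSpace ℝ E]
    {χ : ℝ → ℝ} (hχ : BddMeas χ) (h0 : ∫ y, χ y ∂ν = 0) {v : ℝ} (hv : ∫ y, χ y ^ 2 ∂ν ≤ v)
    (x : Fin n → E) :
    ∫ e, ‖∑ j, χ (e j) • x j‖ ^ 2 ∂(Measure.pi fun _ : Fin n => ν) ≤ v * ∑ j, ‖x j‖ ^ 2 := by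
  have h1 : ∀ e : Fin n → ℝ, ‖∑ j, χ (e j) • x j‖ ^ 2
      = ∑ i, ∑ j, inner ℝ (x i) (x j) * (χ (e i) * χ (e j)) := by
    intro e
    rw [← real_inner_self_eq_norm_sq, sum_inner]
    refine Finset.sum_congr rfl fun i _ => ?_
    rw [inner_sum]
    refine Finset.sum_congr rfl fun j _ => ?_
    rw [real_inner_smul_left, real_inner_smul_right]; ring
  have hb : ∀ i j : Fin n, BddMeas (fun e : Fin n → ℝ => χ (e i) * χ (e j)) := fun i j =>
    (hχ.comp (measurable_pi_apply i)).mul (hχ.comp (measurable_pi_apply j))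
  simp_rw [h1]
  rw [integral_finsetSum _ fun i _ => (BddMeas.sum _ fun j => (hb i j).const_mul _).integrable,
    Finset.mul_sum]
  refine Finset.sum_le_sum fun i _ => ?_
  rw [integral_finsetSum _ fun j _ => ((hb i j).const_mul _).integrable,
    Finset.sum_eq_single i]
  · rw [integral_const_mul, real_inner_self_eq_norm_sq]
    have : ∫ e : Fin n → ℝ, χ (e i) * χ (e i) ∂(Measure.pi fun _ : Fin n => ν)
        = ∫ y, χ y ^ 2 ∂ν := by
      rw [← integral_coord (ν := ν) hχ.sq i]; simp only [pow_two]
    rw [this, mul_comm v]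
    exact mul_le_mul_of_nonneg_left hv (sq_nonneg _)
  · intro j _ hj
    rw [integral_const_mul, integral_coord_mul_coord hχ h0 (Ne.symm hj), mul_zero]
  · simp

end Resample

/-! ### The quantile loss and its increments -/

section Loss

/-- The increment `ρ_τ(e - z) - ρ_τ(e)` of the quantile loss. -/
noncomputable def checkLoss (τ e z : ℝ) : ℝ := quantileLoss τ (e - z) - quantileLoss τ e

/-- The derivative `τ - 1_{e < 0}` of the quantile loss. -/
noncomputable def checkScore (τ e : ℝ) : ℝ := if e < 0 then τ - 1 else τ

/-- The remainder `∫₀ᶻ (1_{e < u} - 1_{e < 0}) du` of the linearization of the quantile loss. -/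
noncomputable def checkRem (e z : ℝ) : ℝ := if e < 0 then max (e - z) 0 else max (z - e) 0

lemma quantileLoss_of_neg {τ u : ℝ} (h : u < 0) : quantileLoss τ u = (τ - 1) * u := by
  have : u ∈ {v : ℝ | v < 0} := h
  simp [quantileLoss, this]; ring

lemma quantileLoss_of_nonneg {τ u : ℝ} (h : 0 ≤ u) : quantileLoss τ u = τ * u := by
  have : u ∉ {v : ℝ | v < 0} := not_lt.2 h
  simp [quantileLoss, this]; ring

lemma quantileLoss_eq_max (τ u : ℝ) : quantileLoss τ u = max (τ * u) ((τ - 1) * u) := by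
  rcases lt_or_ge u 0 with h | h
  · rw [quantileLoss_of_neg h, max_eq_right]; nlinarith
  · rw [quantileLoss_of_nonneg h, max_eq_left]; nlinarith

/-- Knight's identity. The score part is centred under the error law and the remainder is
nonnegative, so the two are always estimated separately. -/
lemma checkLoss_eq (τ e z : ℝ) : checkLoss τ e z = -checkScore τ e * z + checkRem e z := by
  unfold checkLoss checkScore checkRem
  split_ifs with h
  · rw [quantileLoss_of_neg h]
    rcases lt_or_ge (e - z) 0 with h1 | h1
    · rw [quantileLoss_of_neg h1, max_eq_right h1.le]; ring
    · rw [quantileLoss_of_nonneg h1, max_eq_left h1]; ring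
  · push Not at h
    rw [quantileLoss_of_nonneg h]
    rcases lt_or_ge (e - z) 0 with h1 | h1
    · rw [quantileLoss_of_neg h1, max_eq_left (by linarith)]; ring
    · rw [quantileLoss_of_nonneg h1, max_eq_right (by linarith)]; ring

lemma checkRem_nonneg (e z : ℝ) : 0 ≤ checkRem e z := by
  unfold checkRem; split_ifs <;> exact le_max_right _ _

@[simp] lemma checkLoss_zero (τ e : ℝ) : checkLoss τ e 0 = 0 := by simp [checkLoss]

/-- On one side of the kink the error enters only through an additive constant: it plays no role in
the comparison of two fits lying on that side. -/
lemma checkLoss_eq_right {τ e z : ℝ} (h : z ≤ e) :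
    checkLoss τ e z = τ * (e - z) - quantileLoss τ e := by
  unfold checkLoss; rw [quantileLoss_of_nonneg (by linarith : 0 ≤ e - z)]

lemma checkLoss_eq_left {τ e z : ℝ} (h : e ≤ z) :
    checkLoss τ e z = (τ - 1) * (e - z) - quantileLoss τ e := by
  unfold checkLoss; rw [quantileLoss_eq_max τ (e - z), max_eq_right (by nlinarith)]

lemma continuous_quantileLoss (τ : ℝ) : Continuous (quantileLoss τ) := by
  have : quantileLoss τ = fun u => max (τ * u) ((τ - 1) * u) := by
    ext u; exact quantileLoss_eq_max τ u
  rw [this]; fun_prop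

lemma continuous_checkLoss (τ : ℝ) : Continuous (fun q : ℝ × ℝ => checkLoss τ q.1 q.2) := by
  have := continuous_quantileLoss τ
  unfold checkLoss
  fun_prop

/-- Increments of the quantile loss have slopes in `[τ - 1, τ]`. -/
lemma quantileLoss_sub_le {τ u v : ℝ} (h : u ≤ v) :
    quantileLoss τ v - quantileLoss τ u ≤ τ * (v - u) := by
  rw [quantileLoss_eq_max, quantileLoss_eq_max, sub_le_iff_le_add]
  refine max_le ?_ ?_
  · linarith [le_max_left (τ * u) ((τ - 1) * u)]
  · nlinarith [le_max_right (τ * u) ((τ - 1) * u)]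

lemma le_quantileLoss_sub {τ u v : ℝ} (h : u ≤ v) :
    (τ - 1) * (v - u) ≤ quantileLoss τ v - quantileLoss τ u := by
  rw [quantileLoss_eq_max, quantileLoss_eq_max, le_sub_iff_add_le, ← le_sub_iff_add_le']
  refine max_le ?_ ?_
  · rw [le_sub_iff_add_le]; nlinarith [le_max_left (τ * v) ((τ - 1) * v)]
  · rw [le_sub_iff_add_le]; nlinarith [le_max_right (τ * v) ((τ - 1) * v)]

lemma abs_quantileLoss_sub_le {τ : ℝ} (h0 : 0 ≤ τ) (h1 : τ ≤ 1) (u v : ℝ) :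
    |quantileLoss τ v - quantileLoss τ u| ≤ |v - u| := by
  rcases le_total u v with h | h
  · have a := quantileLoss_sub_le (τ := τ) h
    have b := le_quantileLoss_sub (τ := τ) h
    rw [abs_of_nonneg (by linarith : 0 ≤ v - u), abs_le]
    constructor <;> nlinarith
  · have a := quantileLoss_sub_le (τ := τ) h
    have b := le_quantileLoss_sub (τ := τ) h
    rw [abs_of_nonpos (by linarith : v - u ≤ 0), abs_le]
    constructor <;> nlinarith

lemma abs_checkLoss_sub_le {τ : ℝ} (h0 : 0 ≤ τ) (h1 : τ ≤ 1) (e z z' : ℝ) :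
    |checkLoss τ e z - checkLoss τ e z'| ≤ |z - z'| := by
  have := abs_quantileLoss_sub_le h0 h1 (e - z') (e - z)
  unfold checkLoss
  rw [abs_sub_comm z z']
  convert this using 2 <;> ring

lemma abs_checkLoss_le {τ : ℝ} (h0 : 0 ≤ τ) (h1 : τ ≤ 1) (e z : ℝ) :
    |checkLoss τ e z| ≤ |z| := by
  simpa using abs_checkLoss_sub_le h0 h1 e z 0

lemma abs_checkLoss_sub_left_le {τ : ℝ} (h0 : 0 ≤ τ) (h1 : τ ≤ 1) (e e' z : ℝ) :
    |checkLoss τ e z - checkLoss τ e' z| ≤ 2 * |e - e'| := by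
  have a := abs_quantileLoss_sub_le h0 h1 (e' - z) (e - z)
  have b := abs_quantileLoss_sub_le h0 h1 e' e
  unfold checkLoss
  calc _ = |(quantileLoss τ (e - z) - quantileLoss τ (e' - z))
        - (quantileLoss τ e - quantileLoss τ e')| := by congr 1; ring
    _ ≤ _ := abs_sub _ _
    _ ≤ |e - e'| + |e - e'| := by
        refine add_le_add (a.trans (le_of_eq ?_)) b
        congr 1; ring
    _ = _ := by ring

lemma abs_checkScore_le {τ : ℝ} (h0 : 0 ≤ τ) (h1 : τ ≤ 1) (e : ℝ) : |checkScore τ e| ≤ 1 := by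
  unfold checkScore; split_ifs <;> rw [abs_le] <;> constructor <;> linarith

lemma measurable_checkScore (τ : ℝ) : Measurable (checkScore τ) :=
  Measurable.ite measurableSet_Iio measurable_const measurable_const

/-- Exchange inequality: the loss increment between two errors is antitone in the fit. -/
lemma checkLoss_exchange {τ e e' z z' : ℝ} (he : e ≤ e') (hz : z ≤ z') :
    checkLoss τ e' z' - checkLoss τ e z' ≤ checkLoss τ e' z - checkLoss τ e z := by
  -- This is convexity of $\rho_\tau$: both sides are increments over intervals of length $e'-e$,
  -- and the interval for $z'$ lies to the left of the one for $z$.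
  unfold checkLoss
  simp only [quantileLoss_eq_max]
  rcases le_total (e - z) 0 with h1 | h1 <;> rcases le_total (e' - z) 0 with h2 | h2 <;>
  rcases le_total (e - z') 0 with h3 | h3 <;> rcases le_total (e' - z') 0 with h4 | h4
  all_goals
    simp only [fun u (h : u ≤ 0) => (max_eq_right (by nlinarith) : max (τ * u) ((τ - 1) * u) = _),
      fun u (h : 0 ≤ u) => (max_eq_left (by nlinarith) : max (τ * u) ((τ - 1) * u) = _), h1,
      h2, h3, h4]
    nlinarith

/-- Convexity of the quantile loss at midpoints, with the gain due to a kink. -/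
lemma checkLoss_midpoint (τ e z z' : ℝ) :
    max 0 (min (e - z) (z' - e))
      ≤ checkLoss τ e z + checkLoss τ e z' - 2 * checkLoss τ e ((z + z') / 2) := by
  -- The linear part cancels at midpoints, so only $|u|/2$ matters; it gains exactly when the error
  -- lies between the two fits.
  have hq : ∀ u, quantileLoss τ u = (τ - 1 / 2) * u + |u| / 2 := by
    intro u
    rcases lt_or_ge u 0 with h | h
    · rw [quantileLoss_of_neg h, abs_of_neg h]; ring
    · rw [quantileLoss_of_nonneg h, abs_of_nonneg h]; ring
  unfold checkLoss
  simp only [hq]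
  have e1 : e - (z + z') / 2 = ((e - z) + (e - z')) / 2 := by ring
  rw [e1, abs_div, abs_two]
  refine max_le ?_ ?_
  · linarith [abs_add_le (e - z) (e - z')]
  · rcases le_total (e - z) (z' - e) with h | h
    · refine (min_le_left _ _).trans ?_
      rcases le_total 0 (e - z) with h1 | h1
      · have h2 : e - z' ≤ 0 := by linarith
        have h3 : e - z + (e - z') ≤ 0 := by linarith
        rw [abs_of_nonneg h1, abs_of_nonpos h2, abs_of_nonpos h3]; linarith
      · linarith [abs_add_le (e - z) (e - z')]
    · refine (min_le_right _ _).trans ?_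
      rcases le_total 0 (z' - e) with h1 | h1
      · have h2 : e - z' ≤ 0 := by linarith
        have h3 : 0 ≤ e - z + (e - z') := by linarith
        rw [abs_of_nonneg (by linarith : 0 ≤ e - z), abs_of_nonpos h2, abs_of_nonneg h3]; linarith
      · linarith [abs_add_le (e - z) (e - z')]

/-- Small increments of the loss are linear away from the kink. -/
lemma checkLoss_add_le (τ e z δ : ℝ) :
    checkLoss τ e (z + δ) - checkLoss τ e z
      ≤ -checkScore τ (e - z) * δ + (if |e - z| ≤ |δ| then |δ| else 0) := by
  have := checkLoss_eq τ (e - z) δ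
  have h2 : checkLoss τ e (z + δ) - checkLoss τ e z = checkLoss τ (e - z) δ := by
    unfold checkLoss; rw [show e - (z + δ) = e - z - δ by ring]; ring
  rw [h2, this]
  gcongr
  unfold checkRem
  split_ifs with a b b
  · refine max_le ?_ (abs_nonneg _)
    linarith [neg_abs_le δ]
  · refine max_le ?_ le_rfl
    push Not at b
    rw [abs_of_neg a] at b; linarith [neg_abs_le δ]
  · refine max_le ?_ (abs_nonneg _)
    push Not at a
    linarith [le_abs_self δ]
  · refine max_le ?_ le_rfl
    push Not at a b
    rw [abs_of_nonneg a] at b; linarith [le_abs_self δ]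

end Loss

/-! ### Regularity of the error law near its quantile -/

/-- The error law `ν` has `τ`-quantile `0` and, on `[-b₀, b₀]`, a density between two positive
constants which is Lipschitz at `0`; it charges both tails. All constants are controlled by `K`. -/
structure QuantileNoise (ν : Measure ℝ) (τ f₀ b₀ K : ℝ) : Prop where
  one_le : 1 ≤ K
  tau_pos : 0 < τ
  tau_lt_one : τ < 1
  b₀_pos : 0 < b₀
  density_lower : 1 ≤ K * f₀
  density_upper : f₀ ≤ K
  mass_lower : ∀ x y, -b₀ ≤ x → x ≤ y → y ≤ b₀ → y - x ≤ K * ν.real (Set.Ioo x y)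
  mass_upper : ∀ x y, -b₀ ≤ x → x ≤ y → y ≤ b₀ → ν.real (Set.Icc x y) ≤ K * (y - x)
  quantile : ν.real (Set.Iio 0) = τ
  expansion : ∀ z, |z| ≤ b₀ → |ν.real (Set.Iio z) - τ - f₀ * z| ≤ K * z ^ 2
  right_tail : 1 ≤ K * ν.real (Set.Ici b₀)
  left_tail : 1 ≤ K * ν.real (Set.Iic (-b₀))

/-! ### Conditional analysis of a single error -/

section OneDim

variable {ν : Measure ℝ} [IsProbabilityMeasure ν] {τ f₀ b₀ K : ℝ}

lemma BddMeas.ite {α : Type*} [MeasurableSpace α] {p : α → Prop} [DecidablePred p]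
    (hp : MeasurableSet {a | p a}) : BddMeas (fun a => if p a then (1 : ℝ) else 0) := by
  refine ⟨Measurable.ite hp measurable_const measurable_const, 1, fun a => ?_⟩
  dsimp only
  split_ifs <;> simp

lemma integral_ite_eq {α : Type*} [MeasurableSpace α] {μ : Measure α} {p : α → Prop}
    [DecidablePred p] (hp : MeasurableSet {a | p a}) :
    ∫ a, (if p a then (1 : ℝ) else 0) ∂μ = μ.real {a | p a} := by
  have : (fun a => if p a then (1 : ℝ) else 0) = Set.indicator {a | p a} (fun _ => 1) := by
    ext a; simp [Set.indicator_apply]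
  rw [this, integral_indicator_const _ hp]; simp

/-- The normalized contrast between the two tails of the error law. -/
noncomputable def tailContrast (ν : Measure ℝ) (b₀ y : ℝ) : ℝ :=
  (if b₀ ≤ y then (1 : ℝ) else 0) / ν.real (Set.Ici b₀)
    - (if y ≤ -b₀ then (1 : ℝ) else 0) / ν.real (Set.Iic (-b₀))

lemma bddMeas_tailContrast : BddMeas (tailContrast ν b₀) := by
  unfold tailContrast
  simp only [div_eq_inv_mul]
  exact ((BddMeas.ite measurableSet_Ici).const_mul _).sub
    ((BddMeas.ite measurableSet_Iic).const_mul _)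

namespace QuantileNoise

variable (N : QuantileNoise ν τ f₀ b₀ K)
include N

lemma K_pos : 0 < K := lt_of_lt_of_le one_pos N.one_le

lemma f₀_pos : 0 < f₀ := by
  by_contra h
  push Not at h
  nlinarith [N.density_lower, N.K_pos]

lemma right_pos : 0 < ν.real (Set.Ici b₀) := by
  by_contra h
  nlinarith [N.right_tail, N.K_pos]

lemma left_pos : 0 < ν.real (Set.Iic (-b₀)) := by
  by_contra h
  nlinarith [N.left_tail, N.K_pos]

lemma integral_tailContrast : ∫ y, tailContrast ν b₀ y ∂ν = 0 := by
  unfold tailContrast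
  simp only [div_eq_inv_mul]
  rw [integral_sub ((BddMeas.ite measurableSet_Ici).const_mul _).integrable
    ((BddMeas.ite measurableSet_Iic).const_mul _).integrable, integral_const_mul,
    integral_const_mul, integral_ite_eq measurableSet_Ici, integral_ite_eq measurableSet_Iic]
  change (ν.real (Set.Ici b₀))⁻¹ * ν.real (Set.Ici b₀)
    - (ν.real (Set.Iic (-b₀)))⁻¹ * ν.real (Set.Iic (-b₀)) = 0
  rw [inv_mul_cancel₀ N.right_pos.ne', inv_mul_cancel₀ N.left_pos.ne', sub_self]

/-- Each tail indicator is divided by its mass, so only the two frozen values remain. The increment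
of a frozen function thus becomes an expectation, which can be summed over the observations. -/
lemma integral_mul_tailContrast {g : ℝ → ℝ} {cp cm : ℝ}
    (hp : ∀ y, b₀ ≤ y → g y = cp) (hm : ∀ y, y ≤ -b₀ → g y = cm) :
    ∫ y, g y * tailContrast ν b₀ y ∂ν = cp - cm := by
  have e : ∀ y, g y * tailContrast ν b₀ y
      = (cp * (ν.real (Set.Ici b₀))⁻¹) * (if b₀ ≤ y then (1 : ℝ) else 0)
        - (cm * (ν.real (Set.Iic (-b₀)))⁻¹) * (if y ≤ -b₀ then (1 : ℝ) else 0) := by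
    intro y
    unfold tailContrast
    have := N.b₀_pos
    by_cases h1 : b₀ ≤ y
    · have h2 : ¬ y ≤ -b₀ := by linarith
      simp [h1, h2, hp y h1, div_eq_mul_inv]
    · by_cases h2 : y ≤ -b₀
      · simp [h1, h2, hm y h2, div_eq_mul_inv]
      · simp [h1, h2]
  simp_rw [e]
  rw [integral_sub ((BddMeas.ite measurableSet_Ici).const_mul _).integrable
    ((BddMeas.ite measurableSet_Iic).const_mul _).integrable, integral_const_mul,
    integral_const_mul, integral_ite_eq measurableSet_Ici, integral_ite_eq measurableSet_Iic]
  change cp * (ν.real (Set.Ici b₀))⁻¹ * ν.real (Set.Ici b₀)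
    - cm * (ν.real (Set.Iic (-b₀)))⁻¹ * ν.real (Set.Iic (-b₀)) = _
  rw [mul_assoc, mul_assoc, inv_mul_cancel₀ N.right_pos.ne', inv_mul_cancel₀ N.left_pos.ne']
  ring

lemma integral_tailContrast_sq_le : ∫ y, tailContrast ν b₀ y ^ 2 ∂ν ≤ 2 * K := by
  have := N.b₀_pos
  simp only [pow_two]
  -- The contrast is itself constant on each tail, so its second moment is the sum of the two
  -- inverse tail masses.
  rw [N.integral_mul_tailContrast (cp := (ν.real (Set.Ici b₀))⁻¹)
    (cm := -(ν.real (Set.Iic (-b₀)))⁻¹)]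
  · have h1 : (ν.real (Set.Ici b₀))⁻¹ ≤ K := by
      rw [inv_le_iff_one_le_mul₀ N.right_pos]; exact N.right_tail
    have h2 : (ν.real (Set.Iic (-b₀)))⁻¹ ≤ K := by
      rw [inv_le_iff_one_le_mul₀ N.left_pos]; exact N.left_tail
    linarith
  · intro y hy
    have h2 : ¬ y ≤ -b₀ := by linarith
    simp [tailContrast, hy, h2]
  · intro y hy
    have h1 : ¬ b₀ ≤ y := by linarith
    simp [tailContrast, hy, h1]

lemma integral_checkScore : ∫ y, checkScore τ y ∂ν = 0 := by
  have e : ∀ y, checkScore τ y = τ - (if y < 0 then (1 : ℝ) else 0) := by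
    intro y; unfold checkScore; split_ifs <;> ring
  simp_rw [e]
  rw [integral_sub (BddMeas.const _).integrable (BddMeas.ite measurableSet_Iio).integrable,
    integral_ite_eq measurableSet_Iio]
  change ∫ _, τ ∂ν - ν.real (Set.Iio 0) = 0
  rw [N.quantile]; simp

lemma bddMeas_checkScore : BddMeas (checkScore τ) :=
  ⟨measurable_checkScore τ, 1, abs_checkScore_le N.tau_pos.le N.tau_lt_one.le⟩

lemma integral_checkScore_sq : ∫ y, checkScore τ y ^ 2 ∂ν = τ * (1 - τ) := by
  have e : ∀ y, checkScore τ y ^ 2 = τ ^ 2 + (1 - 2 * τ) * (if y < 0 then (1 : ℝ) else 0) := by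
    intro y; unfold checkScore; split_ifs <;> ring
  simp_rw [e]
  rw [integral_add (BddMeas.const _).integrable
    ((BddMeas.ite measurableSet_Iio).const_mul _).integrable, integral_const_mul,
    integral_ite_eq measurableSet_Iio]
  change ∫ _, τ ^ 2 ∂ν + (1 - 2 * τ) * ν.real (Set.Iio 0) = _
  rw [N.quantile]; simp; ring

end QuantileNoise

/-- The dependence of a fit and of a test function on one error: frozen outside an interval. -/
structure FrozenProfile (b₀ b : ℝ) (z : ℝ → ℝ) : Prop where
  meas : Measurable z
  abs_le : ∀ y, |z y| ≤ b
  lower : ∀ y, z (-b₀) ≤ z y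
  upper : ∀ y, z y ≤ z b₀
  left : ∀ y, y ≤ z (-b₀) → z y = z (-b₀)
  right : ∀ y, z b₀ ≤ y → z y = z b₀

namespace FrozenProfile

variable {b : ℝ} {z : ℝ → ℝ} (Z : FrozenProfile b₀ b z)
include Z

lemma bddMeas : BddMeas z := ⟨Z.meas, b, Z.abs_le⟩

lemma left' (hb : b ≤ b₀) {y : ℝ} (hy : y ≤ -b₀) : z y = z (-b₀) :=
  Z.left y (by linarith [neg_le_of_abs_le (Z.abs_le (-b₀))])

lemma right' (hb : b ≤ b₀) {y : ℝ} (hy : b₀ ≤ y) : z y = z b₀ :=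
  Z.right y (by linarith [le_of_abs_le (Z.abs_le b₀)])

end FrozenProfile

namespace QuantileNoise

variable (N : QuantileNoise ν τ f₀ b₀ K) {b D : ℝ} {z φ : ℝ → ℝ}
include N

lemma mass_between {a : ℝ} (h : |a| ≤ b₀) :
    ν.real (Set.Icc (min a 0) (max a 0)) ≤ K * |a| := by
  have h1 := neg_le_of_abs_le h
  have h2 := le_of_abs_le h
  have h3 := N.b₀_pos
  have := N.mass_upper (min a 0) (max a 0) (le_min h1 (by linarith)) min_le_max (max_le h2 h3.le)
  rwa [max_sub_min_eq_abs, zero_sub, abs_neg] at this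

/-- Weighted length of the interval of indeterminacy of the fit. -/
lemma width_le (hb : b ≤ b₀) (Z : FrozenProfile b₀ b z)
    (hosc : ∀ y, |φ y - φ (-b₀)| ≤ D) (hl : ∀ y, y ≤ -b₀ → φ y = φ (-b₀))
    (hr : ∀ y, b₀ ≤ y → φ y = φ b₀) :
    |φ (-b₀)| * (z b₀ - z (-b₀)) ≤ ∫ y, |φ y| * z y * tailContrast ν b₀ y ∂ν + b * D := by
  rw [N.integral_mul_tailContrast (cp := |φ b₀| * z b₀)
    (cm := |φ (-b₀)| * z (-b₀))
    (fun y hy => by rw [hr y hy, Z.right' hb hy]) (fun y hy => by rw [hl y hy, Z.left' hb hy])]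
  -- The contrast produces $|\varphi(b_0)|z(b_0)-|\varphi(-b_0)|z(-b_0)$; giving both terms the same
  -- weight costs $bD$.
  have h1 : |(|φ b₀| - |φ (-b₀)|)| ≤ D := (abs_abs_sub_abs_le_abs_sub _ _).trans (hosc b₀)
  have h2 := Z.abs_le b₀
  have h3 : |(|φ b₀| - |φ (-b₀)|) * z b₀| ≤ D * b := by
    rw [abs_mul]; exact mul_le_mul h1 h2 (abs_nonneg _) ((abs_nonneg _).trans h1)
  nlinarith [neg_le_of_abs_le h3]

/-- Both factors are frozen below $-b_0$, and that tail has mass at least $1/K$: the value at one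
point is paid for by the average. -/
lemma left_sq_le (hb : b ≤ b₀) (Z : FrozenProfile b₀ b z) (hφ : BddMeas φ)
    (hl : ∀ y, y ≤ -b₀ → φ y = φ (-b₀)) :
    |φ (-b₀)| * z (-b₀) ^ 2 ≤ K * ∫ y, |φ y| * z y ^ 2 ∂ν := by
  have h1 : |φ (-b₀)| * z (-b₀) ^ 2 * ν.real (Set.Iic (-b₀)) ≤ ∫ y, |φ y| * z y ^ 2 ∂ν := by
    rw [show ν.real (Set.Iic (-b₀)) = ∫ y, (if y ≤ -b₀ then (1 : ℝ) else 0) ∂ν from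
      (integral_ite_eq measurableSet_Iic).symm, ← integral_const_mul]
    refine BddMeas.integral_mono ((BddMeas.ite measurableSet_Iic).const_mul _)
      (hφ.abs.mul Z.bddMeas.sq) fun y => ?_
    split_ifs with h
    · rw [hl y h, Z.left' hb h, mul_one]
    · rw [mul_zero]; positivity
  have h2 : 0 ≤ |φ (-b₀)| * z (-b₀) ^ 2 := by positivity
  calc |φ (-b₀)| * z (-b₀) ^ 2 ≤ |φ (-b₀)| * z (-b₀) ^ 2 * (K * ν.real (Set.Iic (-b₀))) :=
        le_mul_of_one_le_right h2 N.left_tail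
    _ = K * (|φ (-b₀)| * z (-b₀) ^ 2 * ν.real (Set.Iic (-b₀))) := by ring
    _ ≤ _ := mul_le_mul_of_nonneg_left h1 N.K_pos.le

/-- One-coordinate linearization: the conditional expectation of the counting term is linear in the
fit, up to the width of the interval of indeterminacy and the oscillation of the test function. -/
lemma linearization (hb : b ≤ b₀) (Z : FrozenProfile b₀ b z) (hφ : BddMeas φ)
    (hosc : ∀ y, |φ y - φ (-b₀)| ≤ D) (hl : ∀ y, y ≤ -b₀ → φ y = φ (-b₀))
    (hr : ∀ y, b₀ ≤ y → φ y = φ b₀) :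
    ∫ y, (φ y * (f₀ * z y - ((if y < z y then (1 : ℝ) else 0) - if y < 0 then (1 : ℝ) else 0))
        + |φ y| * if y = z y then (1 : ℝ) else 0) ∂ν
      ≤ K ^ 2 * ∫ y, |φ y| * z y ^ 2 ∂ν + 3 * K * ∫ y, |φ y| * z y * tailContrast ν b₀ y ∂ν
        + 11 * K * b * D := by
  set zm := z (-b₀) with hzm
  set zp := z b₀ with hzp
  set φm := φ (-b₀) with hφm
  set η := zp - zm with hη
  have hη0 : 0 ≤ η := sub_nonneg.2 (Z.upper (-b₀))
  have hD : 0 ≤ D := (abs_nonneg _).trans (hosc 0)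
  have hK := N.K_pos
  have hf := N.f₀_pos
  have hfK := N.density_upper
  have azm : |zm| ≤ b := Z.abs_le _
  have azp : |zp| ≤ b := Z.abs_le _
  have hb0 : 0 ≤ b := (abs_nonneg _).trans azm
  have hηb : η ≤ 2 * b := by linarith [neg_le_of_abs_le azm, le_of_abs_le azp]
  have hI : ν.real (Set.Icc zm zp) ≤ K * η := N.mass_upper zm zp
    (by linarith [neg_le_of_abs_le azm]) (Z.upper (-b₀)) (by linarith [le_of_abs_le azp])
  have hI0 : ν.real (Set.Icc (min zm 0) (max zm 0)) ≤ K * b :=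
    (N.mass_between (azm.trans hb)).trans (mul_le_mul_of_nonneg_left azm hK.le)
  have m1 : BddMeas (fun y : ℝ => if y < zm then (1 : ℝ) else 0) := BddMeas.ite measurableSet_Iio
  have m2 : BddMeas (fun y : ℝ => if y < 0 then (1 : ℝ) else 0) := BddMeas.ite measurableSet_Iio
  have m3 : BddMeas (fun y : ℝ => if y ∈ Set.Icc zm zp then (1 : ℝ) else 0) :=
    BddMeas.ite measurableSet_Icc
  have m4 : BddMeas (fun y : ℝ => if y ∈ Set.Icc (min zm 0) (max zm 0) then (1 : ℝ) else 0) :=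
    BddMeas.ite measurableSet_Icc
  have m5 : BddMeas (fun y : ℝ => if y < z y then (1 : ℝ) else 0) :=
    BddMeas.ite (measurableSet_lt measurable_id Z.meas)
  have m6 : BddMeas (fun y : ℝ => if y = z y then (1 : ℝ) else 0) :=
    BddMeas.ite (measurableSet_eq_fun measurable_id Z.meas)
  -- Everything is compared with the left ends `φm` and `zm`. The error is the oscillation $D$ times
  -- quantities of order $b$, plus the width `η`; outside $[z_m,z_p]$ the indicators of `z y` and
  -- `zm` agree and $y\ne z(y)$.
  have key : ∀ y, φ y * (f₀ * z y - ((if y < z y then (1 : ℝ) else 0)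
        - if y < 0 then (1 : ℝ) else 0)) + |φ y| * (if y = z y then (1 : ℝ) else 0)
      ≤ φm * (f₀ * zm - ((if y < zm then (1 : ℝ) else 0) - if y < 0 then (1 : ℝ) else 0))
        + (D * (f₀ * b + if y ∈ Set.Icc (min zm 0) (max zm 0) then (1 : ℝ) else 0)
        + (|φm| + D) * (f₀ * η + 2 * if y ∈ Set.Icc zm zp then (1 : ℝ) else 0)) := by
    intro y
    have hφy : |φ y| ≤ |φm| + D := by
      have := abs_add_le φm (φ y - φm)
      rw [add_sub_cancel] at this
      linarith [hosc y]
    have c1 : |(if y < zm then (1 : ℝ) else 0) - (if y < 0 then (1 : ℝ) else 0)|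
        ≤ if y ∈ Set.Icc (min zm 0) (max zm 0) then (1 : ℝ) else 0 := by
      by_cases h1 : y < zm <;> by_cases h2 : y < 0
      · simp [h1, h2]; split_ifs <;> norm_num
      · have : y ∈ Set.Icc (min zm 0) (max zm 0) :=
          ⟨(min_le_right _ _).trans (not_lt.1 h2), h1.le.trans (le_max_left _ _)⟩
        rw [if_pos this]; simp [h1, h2]
      · have : y ∈ Set.Icc (min zm 0) (max zm 0) :=
          ⟨(min_le_left _ _).trans (not_lt.1 h1), h2.le.trans (le_max_right _ _)⟩
        rw [if_pos this]; simp [h1, h2]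
      · simp [h1, h2]; split_ifs <;> norm_num
    have c2 : |(if y < z y then (1 : ℝ) else 0) - (if y < zm then (1 : ℝ) else 0)|
        + (if y = z y then (1 : ℝ) else 0)
        ≤ 2 * if y ∈ Set.Icc zm zp then (1 : ℝ) else 0 := by
      by_cases hy : y ∈ Set.Icc zm zp
      · rw [if_pos hy]
        have : |(if y < z y then (1 : ℝ) else 0) - (if y < zm then (1 : ℝ) else 0)| ≤ 1 := by
          split_ifs <;> norm_num
        split_ifs at this ⊢ <;> linarith
      · rw [if_neg hy]
        rcases lt_or_ge y zm with h | h
        · have h1 : z y = zm := Z.left y h.le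
          rw [h1]; simp [h, h.ne]
        · have h' : zp < y := by by_contra h2; exact hy ⟨h, not_lt.1 h2⟩
          have h1 : z y = zp := Z.right y h'.le
          rw [h1]
          have h3 : ¬ y < zp := not_lt.2 h'.le
          have h4 : ¬ y < zm := not_lt.2 h
          simp [h3, h4, h'.ne']
    have c3 : |z y - zm| ≤ η := by
      rw [abs_of_nonneg (sub_nonneg.2 (Z.lower y))]; linarith [Z.upper y]
    set A := (if y < zm then (1 : ℝ) else 0) - (if y < 0 then (1 : ℝ) else 0) with hA
    set B := (if y < z y then (1 : ℝ) else 0) - (if y < zm then (1 : ℝ) else 0) with hB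
    have e1 : φ y * (f₀ * z y - ((if y < z y then (1 : ℝ) else 0)
        - if y < 0 then (1 : ℝ) else 0)) = φm * (f₀ * zm - A) + (φ y - φm) * (f₀ * zm - A)
        + φ y * (f₀ * (z y - zm) - B) := by rw [hA, hB]; ring
    rw [e1]
    have d1 : (φ y - φm) * (f₀ * zm - A)
        ≤ D * (f₀ * b + if y ∈ Set.Icc (min zm 0) (max zm 0) then (1 : ℝ) else 0) := by
      refine (le_abs_self _).trans ?_
      rw [abs_mul]
      refine mul_le_mul (hosc y) ?_ (abs_nonneg _) hD
      refine (abs_sub _ _).trans (add_le_add ?_ c1)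
      rw [abs_mul, abs_of_pos hf]
      exact mul_le_mul_of_nonneg_left azm hf.le
    have d2 : φ y * (f₀ * (z y - zm) - B) ≤ |φ y| * (f₀ * η + |B|) := by
      refine (le_abs_self _).trans ?_
      rw [abs_mul]
      refine mul_le_mul_of_nonneg_left ((abs_sub _ _).trans (add_le_add ?_ le_rfl)) (abs_nonneg _)
      rw [abs_mul, abs_of_pos hf]
      exact mul_le_mul_of_nonneg_left c3 hf.le
    have d3 : |φ y| * (f₀ * η + |B|) + |φ y| * (if y = z y then (1 : ℝ) else 0)
        ≤ (|φm| + D) * (f₀ * η + 2 * if y ∈ Set.Icc zm zp then (1 : ℝ) else 0) := by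
      rw [← mul_add]
      refine mul_le_mul hφy (by linarith) ?_ (by positivity)
      have : (0 : ℝ) ≤ if y = z y then (1 : ℝ) else 0 := by split_ifs <;> norm_num
      positivity
    linarith
  have h1 : ∫ y, (φ y * (f₀ * z y - ((if y < z y then (1 : ℝ) else 0)
        - if y < 0 then (1 : ℝ) else 0)) + |φ y| * if y = z y then (1 : ℝ) else 0) ∂ν
      ≤ φm * (f₀ * zm - (ν.real (Set.Iio zm) - τ))
        + (D * (f₀ * b + ν.real (Set.Icc (min zm 0) (max zm 0)))
        + (|φm| + D) * (f₀ * η + 2 * ν.real (Set.Icc zm zp))) := by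
    refine (BddMeas.integral_mono
      ((hφ.mul ((Z.bddMeas.const_mul _).sub (m5.sub m2))).add (hφ.abs.mul m6))
      ((((BddMeas.const _).sub (m1.sub m2)).const_mul _).add
        ((((BddMeas.const _).add m4).const_mul _).add
        (((BddMeas.const _).add (m3.const_mul _)).const_mul _))) key).trans (le_of_eq ?_)
    rw [integral_add (((BddMeas.const _).sub (m1.sub m2)).const_mul _).integrable
      ((((BddMeas.const _).add m4).const_mul _).add
        (((BddMeas.const _).add (m3.const_mul _)).const_mul _)).integrable,
      integral_add (((BddMeas.const _).add m4).const_mul _).integrable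
        (((BddMeas.const _).add (m3.const_mul _)).const_mul _).integrable,
      integral_const_mul, integral_const_mul, integral_const_mul,
      integral_sub (BddMeas.const _).integrable (m1.sub m2).integrable,
      integral_sub m1.integrable m2.integrable,
      integral_add (BddMeas.const _).integrable m4.integrable,
      integral_add (BddMeas.const _).integrable (m3.const_mul _).integrable,
      integral_const_mul (2 : ℝ), integral_ite_eq measurableSet_Iio,
      integral_ite_eq measurableSet_Iio,
      integral_ite_eq (p := fun y => y ∈ Set.Icc (min zm 0) (max zm 0)) measurableSet_Icc,
      integral_ite_eq (p := fun y => y ∈ Set.Icc zm zp) measurableSet_Icc]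
    change φm * (_ - (ν.real (Set.Iio zm) - ν.real (Set.Iio 0))) + (D * (_ + ν.real (Set.Icc _ _))
      + (|φm| + D) * (_ + 2 * ν.real (Set.Icc _ _))) = _
    rw [N.quantile]
    simp
  have h2 : φm * (f₀ * zm - (ν.real (Set.Iio zm) - τ)) ≤ |φm| * (K * zm ^ 2) := by
    refine (le_abs_self _).trans ?_
    rw [abs_mul]
    refine mul_le_mul_of_nonneg_left ?_ (abs_nonneg _)
    rw [abs_sub_comm]
    exact N.expansion zm (azm.trans hb)
  -- Quantities taken at the left end are turned back into integrals, since only these can be summed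
  -- over the observations.
  have h3 := N.width_le hb Z hosc hl hr
  have h4 := N.left_sq_le hb Z hφ hl
  rw [← hφm, ← hzm] at h4
  rw [← hφm, ← hzm, ← hzp, ← hη] at h3
  have h5 : D * (f₀ * b + ν.real (Set.Icc (min zm 0) (max zm 0))) ≤ D * (2 * K * b) := by
    refine mul_le_mul_of_nonneg_left ?_ hD
    nlinarith
  have h6 : (|φm| + D) * (f₀ * η + 2 * ν.real (Set.Icc zm zp)) ≤ (|φm| + D) * (3 * K * η) := by
    refine mul_le_mul_of_nonneg_left ?_ (by positivity)
    nlinarith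
  have h7 : D * (3 * K * η) ≤ D * (3 * K * (2 * b)) := by gcongr
  have h8 : 3 * K * (|φm| * η) ≤ 3 * K * (∫ y, |φ y| * z y * tailContrast ν b₀ y ∂ν + b * D) := by
    gcongr
  have h9 : K * (|φm| * zm ^ 2) ≤ K * (K * ∫ y, |φ y| * z y ^ 2 ∂ν) := by gcongr
  -- The terms in $KbD$ are 2 from `h5`, 6 from `h7` and 3 from `h8`, whence 11.
  nlinarith

end QuantileNoise

end OneDim

/-! ### Selected maximizers of the quantile objective -/

section Selection

open scoped RealInnerProductSpace

variable {E : Type*} [NormedAddCommGroup E] [InnerProductSpace ℝ E] {n : ℕ}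

/-- The objective `base t - ∑ⱼ (ρ_τ(eⱼ - ⟪xⱼ, t⟫) - ρ_τ(eⱼ))`. -/
noncomputable def objective (τ : ℝ) (x : Fin n → E) (base : E → ℝ) (e : Fin n → ℝ) (t : E) : ℝ :=
  base t - ∑ j, checkLoss τ (e j) ⟪x j, t⟫

/-- A measurable selection of maximizers of the objective over `T`, which does not depend on the
errors when the set of maximizers allows it. -/
structure IsSelection [MeasurableSpace E] (τ : ℝ) (x : Fin n → E) (ρ : ℝ) (base : E → ℝ)
    (T : Set E) (θ : (Fin n → ℝ) → E) : Prop where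
  meas : Measurable θ
  mem : ∀ e, θ e ∈ T
  norm_le : ∀ e, ‖θ e‖ ≤ ρ
  isMaxOn : ∀ e, ∀ t ∈ T, objective τ x base e t ≤ objective τ x base e (θ e)
  consistent : ∀ e e', objective τ x base e (θ e) ≤ objective τ x base e (θ e') →
    objective τ x base e' (θ e') ≤ objective τ x base e' (θ e) → θ e = θ e'

/-- A Parseval frame. -/
def IsParseval (x : Fin n → E) : Prop := ∀ t, ∑ j, ⟪x j, t⟫ ^ 2 = ‖t‖ ^ 2

lemma IsParseval.sum_mul {x : Fin n → E} (hx : IsParseval x) (s t : E) :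
    ∑ j, ⟪x j, s⟫ * ⟪x j, t⟫ = ⟪s, t⟫ := by
  have h1 := hx (s + t)
  have h2 := hx s
  have h3 := hx t
  rw [norm_add_sq_real, ← h2, ← h3] at h1
  simp only [inner_add_right, add_sq, Finset.sum_add_distrib] at h1
  have : ∑ j, 2 * ⟪x j, s⟫ * ⟪x j, t⟫ = 2 * ∑ j, ⟪x j, s⟫ * ⟪x j, t⟫ := by
    rw [Finset.mul_sum]; exact Finset.sum_congr rfl fun _ _ => by ring
  linarith

/-- This is where smallness comes from: as $\|x_j\|\rho\le b$ for every $j$ and $\sum c_j^2\le1$,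
the factor $\rho$ is absorbed, whatever the number of observations. -/
lemma mul_sqrt_weighted_le {x : Fin n → E} {ρ b v : ℝ} (hb : ∀ j, ‖x j‖ * ρ ≤ b) (hρ : 0 ≤ ρ)
    (hb0 : 0 ≤ b) {c : Fin n → ℝ} (hc : ∑ j, c j ^ 2 ≤ 1) (hv : 0 ≤ v) :
    ρ * √(v * ∑ j, c j ^ 2 * ‖x j‖ ^ 2) ≤ √v * b := by
  have h : ρ ^ 2 * ∑ j, c j ^ 2 * ‖x j‖ ^ 2 ≤ b ^ 2 := by
    calc ρ ^ 2 * ∑ j, c j ^ 2 * ‖x j‖ ^ 2 = ∑ j, c j ^ 2 * (‖x j‖ * ρ) ^ 2 := by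
          rw [Finset.mul_sum]; exact Finset.sum_congr rfl fun j _ => by ring
      _ ≤ ∑ j, c j ^ 2 * b ^ 2 := Finset.sum_le_sum fun j _ =>
          mul_le_mul_of_nonneg_left (pow_le_pow_left₀ (by positivity) (hb j) 2) (sq_nonneg _)
      _ = (∑ j, c j ^ 2) * b ^ 2 := by rw [Finset.sum_mul]
      _ ≤ b ^ 2 := mul_le_of_le_one_left (sq_nonneg _) hc
  calc _ = √(ρ ^ 2 * (v * ∑ j, c j ^ 2 * ‖x j‖ ^ 2)) := by
        rw [Real.sqrt_mul (sq_nonneg ρ), Real.sqrt_sq hρ]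
    _ ≤ √(v * b ^ 2) := Real.sqrt_le_sqrt (by nlinarith)
    _ = _ := by rw [Real.sqrt_mul hv, Real.sqrt_sq hb0]

lemma objective_update_sub (τ : ℝ) (x : Fin n → E) (base : E → ℝ) (e : Fin n → ℝ) (j : Fin n)
    (y y' : ℝ) (t : E) :
    objective τ x base (Function.update e j y) t - objective τ x base (Function.update e j y') t
      = checkLoss τ y' ⟪x j, t⟫ - checkLoss τ y ⟪x j, t⟫ := by
  unfold objective
  have h : ∀ a, ∑ i, checkLoss τ (Function.update e j a i) ⟪x i, t⟫
      = checkLoss τ a ⟪x j, t⟫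
        + ∑ i ∈ Finset.univ.erase j, checkLoss τ (e i) ⟪x i, t⟫ := by
    intro a
    rw [← Finset.add_sum_erase _ _ (Finset.mem_univ j), Function.update_self]
    congr 1
    exact Finset.sum_congr rfl fun i hi => by rw [Function.update_of_ne (Finset.ne_of_mem_erase hi)]
  rw [h, h]; ring

namespace IsSelection

variable [MeasurableSpace E] {τ ρ b b₀ : ℝ} {x : Fin n → E} {base : E → ℝ} {T : Set E}
  {θ : (Fin n → ℝ) → E} (S : IsSelection τ x ρ base T θ)
include S

/-- If exchanging the two maximizers loses nothing in total, each of them is optimal for both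
samples, and the consistent choice among ties makes them equal. -/
lemma eq_of_add_le {e e' : Fin n → ℝ}
    (h : objective τ x base e (θ e) + objective τ x base e' (θ e')
      ≤ objective τ x base e (θ e') + objective τ x base e' (θ e)) : θ e = θ e' :=
  S.consistent e e' (by linarith [S.isMaxOn e' (θ e) (S.mem e)])
    (by linarith [S.isMaxOn e (θ e') (S.mem e')])

lemma update_eq {e : Fin n → ℝ} {j : Fin n} {y y' : ℝ}
    (h : checkLoss τ y' ⟪x j, θ (Function.update e j y')⟫
        + checkLoss τ y ⟪x j, θ (Function.update e j y)⟫
      ≥ checkLoss τ y' ⟪x j, θ (Function.update e j y)⟫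
        + checkLoss τ y ⟪x j, θ (Function.update e j y')⟫) :
    θ (Function.update e j y) = θ (Function.update e j y') := by
  refine S.eq_of_add_le ?_
  have h1 := objective_update_sub τ x base e j y y' (θ (Function.update e j y))
  have h2 := objective_update_sub τ x base e j y y' (θ (Function.update e j y'))
  linarith

/-- If the fit decreased, the exchange inequality would make swapping the two maximizers free, and
they would coincide. -/
lemma fit_mono (e : Fin n → ℝ) (j : Fin n) {y y' : ℝ} (h : y ≤ y') :
    ⟪x j, θ (Function.update e j y)⟫ ≤ ⟪x j, θ (Function.update e j y')⟫ := by
  by_contra hlt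
  push Not at hlt
  have := checkLoss_exchange (τ := τ) h hlt.le
  have h2 := S.update_eq (e := e) (j := j) (y := y) (y' := y') (by linarith)
  rw [h2] at hlt
  exact lt_irrefl _ hlt

/-- While the error stays above the fit, the $j$-th loss is affine with a fixed slope at both
maximizers, so moving the error adds the same constant to both and their exchange is free. -/
lemma update_eq_of_ge {e : Fin n → ℝ} {j : Fin n} {y y' : ℝ}
    (h1 : ⟪x j, θ (Function.update e j y')⟫ ≤ y) (h2 : y ≤ y') :
    θ (Function.update e j y) = θ (Function.update e j y') := by
  have h3 := S.fit_mono e j h2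
  refine S.update_eq ?_
  rw [checkLoss_eq_right (h1.trans h2), checkLoss_eq_right (h3.trans h1),
    checkLoss_eq_right h1, checkLoss_eq_right ((h3.trans h1).trans h2)]
  linarith

lemma update_eq_of_le {e : Fin n → ℝ} {j : Fin n} {y y' : ℝ}
    (h1 : y ≤ ⟪x j, θ (Function.update e j y')⟫) (h2 : y' ≤ y) :
    θ (Function.update e j y) = θ (Function.update e j y') := by
  have h3 := S.fit_mono e j h2
  refine S.update_eq ?_
  rw [checkLoss_eq_left (h2.trans h1), checkLoss_eq_left (h1.trans h3),
    checkLoss_eq_left h1, checkLoss_eq_left (h2.trans (h1.trans h3))]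
  linarith

lemma abs_fit_le (hb : ∀ j, ‖x j‖ * ρ ≤ b) (e : Fin n → ℝ) (j : Fin n) : |⟪x j, θ e⟫| ≤ b :=
  (abs_real_inner_le_norm _ _).trans
    ((mul_le_mul_of_nonneg_left (S.norm_le e) (norm_nonneg _)).trans (hb j))

lemma update_eq_right (hb : ∀ j, ‖x j‖ * ρ ≤ b) (hb₀ : b ≤ b₀) {e : Fin n → ℝ} {j : Fin n} {y : ℝ}
    (h : ⟪x j, θ (Function.update e j b₀)⟫ ≤ y) :
    θ (Function.update e j y) = θ (Function.update e j b₀) := by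
  rcases le_total y b₀ with h1 | h1
  · exact S.update_eq_of_ge h h1
  · exact (S.update_eq_of_ge ((le_of_abs_le (S.abs_fit_le hb _ j)).trans hb₀) h1).symm

lemma update_eq_left (hb : ∀ j, ‖x j‖ * ρ ≤ b) (hb₀ : b ≤ b₀) {e : Fin n → ℝ} {j : Fin n} {y : ℝ}
    (h : y ≤ ⟪x j, θ (Function.update e j (-b₀))⟫) :
    θ (Function.update e j y) = θ (Function.update e j (-b₀)) := by
  rcases le_total (-b₀) y with h1 | h1
  · exact S.update_eq_of_le h h1
  · refine (S.update_eq_of_le ?_ h1).symm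
    linarith [neg_le_of_abs_le (S.abs_fit_le hb (Function.update e j y) j)]

variable [BorelSpace E]

lemma measurable_fit (j : Fin n) : Measurable fun e => ⟪x j, θ e⟫ :=
  (by fun_prop : Continuous fun t : E => ⟪x j, t⟫).measurable.comp S.meas

lemma bddMeas_fit (hb : ∀ j, ‖x j‖ * ρ ≤ b) (j : Fin n) : BddMeas fun e => ⟪x j, θ e⟫ :=
  ⟨S.measurable_fit j, b, fun e => S.abs_fit_le hb e j⟩

lemma bddMeas_inner (w : E) : BddMeas fun e => ⟪w, θ e⟫ :=
  ⟨(by fun_prop : Continuous fun t : E => ⟪w, t⟫).measurable.comp S.meas, ‖w‖ * ρ, fun e =>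
    (abs_real_inner_le_norm _ _).trans
      (mul_le_mul_of_nonneg_left (S.norm_le e) (norm_nonneg _))⟩

lemma bddMeas_norm : BddMeas fun e => ‖θ e‖ :=
  ⟨S.meas.norm, ρ, fun e => by rw [abs_norm]; exact S.norm_le e⟩

lemma frozenProfile (hb : ∀ j, ‖x j‖ * ρ ≤ b) (hb₀ : b ≤ b₀) (e : Fin n → ℝ) (j : Fin n) :
    FrozenProfile b₀ b fun y => ⟪x j, θ (Function.update e j y)⟫ where
  meas := (S.measurable_fit j).comp (measurable_update_snd e j)
  abs_le y := S.abs_fit_le hb _ j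
  lower y := by
    rcases le_total (-b₀) y with h | h
    · exact S.fit_mono e j h
    · rw [S.update_eq_left hb hb₀ (y := y)
        (by linarith [neg_le_of_abs_le (S.abs_fit_le hb (Function.update e j (-b₀)) j)])]
  upper y := by
    rcases le_total y b₀ with h | h
    · exact S.fit_mono e j h
    · rw [S.update_eq_right hb hb₀ (y := y)
        (by linarith [le_of_abs_le (S.abs_fit_le hb (Function.update e j b₀) j)])]
  left y h := by rw [S.update_eq_left hb hb₀ h]
  right y h := by rw [S.update_eq_right hb hb₀ h]

end IsSelection

/-- A test function of the errors whose dependence on each error is frozen in the tails and has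
oscillation at most `D`. -/
structure IsTest (b₀ : ℝ) (Φ : (Fin n → ℝ) → ℝ) (D : Fin n → (Fin n → ℝ) → ℝ) : Prop where
  bdd : BddMeas Φ
  bdd_osc : ∀ j, BddMeas (D j)
  osc_update : ∀ e j y, D j (Function.update e j y) = D j e
  osc_le : ∀ e j y, |Φ (Function.update e j y) - Φ (Function.update e j (-b₀))| ≤ D j e
  left : ∀ e j y, y ≤ -b₀ → Φ (Function.update e j y) = Φ (Function.update e j (-b₀))
  right : ∀ e j y, b₀ ≤ y → Φ (Function.update e j y) = Φ (Function.update e j b₀)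

namespace QuantileNoise

variable [MeasurableSpace E] [BorelSpace E] {ν : Measure ℝ} [IsProbabilityMeasure ν]
  {τ f₀ b₀ K ρ b : ℝ} (N : QuantileNoise ν τ f₀ b₀ K)
  {x : Fin n → E} {base : E → ℝ} {T : Set E} {θ : (Fin n → ℝ) → E}
  (S : IsSelection τ x ρ base T θ)
include N S

/-- Weighted average of the fits against the tail contrasts. -/
lemma integral_contrast_le {Φ : (Fin n → ℝ) → ℝ} (hΦ : BddMeas Φ) (c : Fin n → ℝ) :
    ∫ e, |Φ e| * ∑ j, c j * (⟪x j, θ e⟫ * tailContrast ν b₀ (e j)) ∂(Measure.pi fun _ => ν)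
      ≤ √(∫ e, (|Φ e| * ‖θ e‖) ^ 2 ∂(Measure.pi fun _ => ν))
        * √(2 * K * ∑ j, (c j) ^ 2 * ‖x j‖ ^ 2) := by
  -- The maximizer depends on all the errors. Cauchy-Schwarz takes it out of the sum, and what
  -- remains is a sum of independent centred vectors.
  set v : (Fin n → ℝ) → E := fun e => ∑ j, tailContrast ν b₀ (e j) • (c j • x j) with hv
  have hvb : BddMeas fun e => ‖v e‖ := by
    obtain ⟨hm, C, hC⟩ := (bddMeas_tailContrast : BddMeas (tailContrast ν b₀))
    refine ⟨?_, ∑ j, C * ‖c j • x j‖, fun e => ?_⟩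
    · have hc : Continuous fun a : Fin n → ℝ => ‖∑ j, a j • (c j • x j)‖ := by fun_prop
      exact hc.measurable.comp (measurable_pi_lambda (fun e : Fin n → ℝ => fun j =>
        tailContrast ν b₀ (e j)) fun j => hm.comp (measurable_pi_apply j))
    · rw [abs_norm]
      refine (norm_sum_le _ _).trans (Finset.sum_le_sum fun j _ => ?_)
      rw [norm_smul]
      exact mul_le_mul_of_nonneg_right (hC _) (norm_nonneg _)
  have h1 : ∀ e, |Φ e| * ∑ j, c j * (⟪x j, θ e⟫ * tailContrast ν b₀ (e j))
      ≤ (|Φ e| * ‖θ e‖) * ‖v e‖ := by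
    intro e
    rw [mul_assoc]
    refine mul_le_mul_of_nonneg_left ?_ (abs_nonneg _)
    have : ∑ j, c j * (⟪x j, θ e⟫ * tailContrast ν b₀ (e j)) = ⟪θ e, v e⟫ := by
      rw [hv]; simp only [inner_sum, inner_smul_right]
      exact Finset.sum_congr rfl fun j _ => by rw [real_inner_comm]; ring
    rw [this]; exact real_inner_le_norm _ _
  have hcb : BddMeas fun e : Fin n → ℝ =>
      |Φ e| * ∑ j, c j * (⟪x j, θ e⟫ * tailContrast ν b₀ (e j)) :=
    hΦ.abs.mul (BddMeas.sum _ fun j => ((S.bddMeas_inner (x j)).mul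
      (bddMeas_tailContrast.comp (measurable_pi_apply j))).const_mul _)
  have hpb := hΦ.abs.mul S.bddMeas_norm
  refine (BddMeas.integral_mono hcb (hpb.mul hvb) h1).trans ((hpb.integral_mul_le hvb).trans ?_)
  refine mul_le_mul_of_nonneg_left (Real.sqrt_le_sqrt ?_) (Real.sqrt_nonneg _)
  refine (integral_norm_sq_sum_le bddMeas_tailContrast N.integral_tailContrast
    N.integral_tailContrast_sq_le fun j => c j • x j).trans (le_of_eq ?_)
  congr 1
  exact Finset.sum_congr rfl fun j _ => by rw [norm_smul, mul_pow, Real.norm_eq_abs, sq_abs]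

/-- Total width of the intervals of indeterminacy of the fits. -/
lemma sum_width_le (hb : ∀ j, ‖x j‖ * ρ ≤ b) (hb₀ : b ≤ b₀) {c : Fin n → ℝ} (hc : ∀ j, 0 ≤ c j) :
    ∑ j, c j * ∫ e, (⟪x j, θ (Function.update e j b₀)⟫ - ⟪x j, θ (Function.update e j (-b₀))⟫)
        ∂(Measure.pi fun _ => ν)
      ≤ √(∫ e, ‖θ e‖ ^ 2 ∂(Measure.pi fun _ => ν)) * √(2 * K * ∑ j, (c j) ^ 2 * ‖x j‖ ^ 2) := by
  have h := N.integral_contrast_le S (BddMeas.const 1) c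
  simp only [abs_one, one_mul] at h
  refine le_trans ?_ h
  have hm : ∀ j, BddMeas fun e : Fin n → ℝ => ⟪x j, θ e⟫ * tailContrast ν b₀ (e j) := fun j =>
    (S.bddMeas_inner (x j)).mul (bddMeas_tailContrast.comp (measurable_pi_apply j))
  rw [integral_finsetSum _ fun j _ => ((hm j).const_mul _).integrable]
  refine Finset.sum_le_sum fun j _ => ?_
  rw [integral_const_mul]
  refine mul_le_mul_of_nonneg_left ?_ (hc j)
  -- With the other errors fixed, the contrast extracts the width of the $j$-th fit.
  rw [integral_resample j (hm j)]
  refine le_of_eq (integral_congr_ae (ae_of_all _ fun e => ?_))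
  have := N.integral_mul_tailContrast (g := fun y => ⟪x j, θ (Function.update e j y)⟫)
    (fun y hy => (S.frozenProfile hb hb₀ e j).right' hb₀ hy)
    (fun y hy => (S.frozenProfile hb hb₀ e j).left' hb₀ hy)
  simp only [Function.update_self]
  exact this.symm

/-- Linearization of the empirical counting process at the selected maximizer, tested against
a function of the errors. -/
theorem integral_counting_le (hx : IsParseval x) (hb : ∀ j, ‖x j‖ * ρ ≤ b) (hb₀ : b ≤ b₀)
    {Φ : (Fin n → ℝ) → ℝ} {D : Fin n → (Fin n → ℝ) → ℝ} (hΦ : IsTest b₀ Φ D) {w : E}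
    (hρ : 0 ≤ ρ) (hb0 : 0 ≤ b) (hw : ‖w‖ ≤ 1) :
    ∫ e, (Φ e * (f₀ * ⟪w, θ e⟫ - ∑ j, ⟪x j, w⟫ *
        ((if e j < ⟪x j, θ e⟫ then (1 : ℝ) else 0) - if e j < 0 then (1 : ℝ) else 0))
        + |Φ e| * ∑ j, |⟪x j, w⟫| * if e j = ⟪x j, θ e⟫ then (1 : ℝ) else 0)
        ∂(Measure.pi fun _ => ν)
      ≤ K ^ 2 * ∑ j, |⟪x j, w⟫| * ∫ e, |Φ e| * ⟪x j, θ e⟫ ^ 2 ∂(Measure.pi fun _ => ν)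
        + 3 * K * (√(2 * K) * b * √(∫ e, Φ e ^ 2 ∂(Measure.pi fun _ => ν)))
        + 11 * K * b * ∑ j, |⟪x j, w⟫| * ∫ e, D j e ∂(Measure.pi fun _ => ν) := by
  have hz := fun j => S.bddMeas_inner (x j)
  have m5 : ∀ j, BddMeas fun e : Fin n → ℝ => if e j < ⟪x j, θ e⟫ then (1 : ℝ) else 0 := fun j =>
    BddMeas.ite (measurableSet_lt (measurable_pi_apply j) (hz j).1)
  have m6 : ∀ j, BddMeas fun e : Fin n → ℝ => if e j = ⟪x j, θ e⟫ then (1 : ℝ) else 0 := fun j =>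
    BddMeas.ite (measurableSet_eq_fun (measurable_pi_apply j) (hz j).1)
  have m2 : ∀ j, BddMeas fun e : Fin n → ℝ => if e j < 0 then (1 : ℝ) else 0 := fun j =>
    BddMeas.ite (measurableSet_lt (measurable_pi_apply j) measurable_const)
  have mξ : ∀ j, BddMeas fun e : Fin n → ℝ => tailContrast ν b₀ (e j) := fun j =>
    bddMeas_tailContrast.comp (measurable_pi_apply j)
  -- The Parseval identity writes $\langle w,\theta\rangle$ as a sum over the observations, so the
  -- claim splits into one-coordinate inequalities.
  have e1 : ∀ e, Φ e * (f₀ * ⟪w, θ e⟫ - ∑ j, ⟪x j, w⟫ *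
        ((if e j < ⟪x j, θ e⟫ then (1 : ℝ) else 0) - if e j < 0 then (1 : ℝ) else 0))
        + |Φ e| * ∑ j, |⟪x j, w⟫| * (if e j = ⟪x j, θ e⟫ then (1 : ℝ) else 0)
      = ∑ j, ((⟪x j, w⟫ * Φ e) * (f₀ * ⟪x j, θ e⟫ -
        ((if e j < ⟪x j, θ e⟫ then (1 : ℝ) else 0) - if e j < 0 then (1 : ℝ) else 0))
        + |⟪x j, w⟫ * Φ e| * if e j = ⟪x j, θ e⟫ then (1 : ℝ) else 0) := by
    intro e
    rw [← hx.sum_mul w (θ e), Finset.mul_sum, ← Finset.sum_sub_distrib, Finset.mul_sum,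
      Finset.mul_sum, ← Finset.sum_add_distrib]
    refine Finset.sum_congr rfl fun j _ => ?_
    rw [abs_mul]; ring
  simp_rw [e1]
  have hL : ∀ j, BddMeas fun e => (⟪x j, w⟫ * Φ e) * (f₀ * ⟪x j, θ e⟫ -
        ((if e j < ⟪x j, θ e⟫ then (1 : ℝ) else 0) - if e j < 0 then (1 : ℝ) else 0))
        + |⟪x j, w⟫ * Φ e| * if e j = ⟪x j, θ e⟫ then (1 : ℝ) else 0 := fun j =>
    ((hΦ.bdd.const_mul _).mul (((hz j).const_mul _).sub ((m5 j).sub (m2 j)))).add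
      ((hΦ.bdd.const_mul _).abs.mul (m6 j))
  have hA : ∀ j, BddMeas fun e => |Φ e| * ⟪x j, θ e⟫ ^ 2 := fun j => hΦ.bdd.abs.mul (hz j).sq
  have hB : ∀ j, BddMeas fun e => |Φ e| * (⟪x j, θ e⟫ * tailContrast ν b₀ (e j)) := fun j =>
    hΦ.bdd.abs.mul ((hz j).mul (mξ j))
  rw [integral_finsetSum _ fun j _ => (hL j).integrable]
  have key : ∀ j, ∫ e, ((⟪x j, w⟫ * Φ e) * (f₀ * ⟪x j, θ e⟫ -
        ((if e j < ⟪x j, θ e⟫ then (1 : ℝ) else 0) - if e j < 0 then (1 : ℝ) else 0))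
        + |⟪x j, w⟫ * Φ e| * if e j = ⟪x j, θ e⟫ then (1 : ℝ) else 0) ∂(Measure.pi fun _ => ν)
      ≤ K ^ 2 * |⟪x j, w⟫| * ∫ e, |Φ e| * ⟪x j, θ e⟫ ^ 2 ∂(Measure.pi fun _ => ν)
        + 3 * K * |⟪x j, w⟫| * ∫ e, |Φ e| * (⟪x j, θ e⟫ * tailContrast ν b₀ (e j))
          ∂(Measure.pi fun _ => ν)
        + 11 * K * b * |⟪x j, w⟫| * ∫ e, D j e ∂(Measure.pi fun _ => ν) := by
    intro j
    rw [← integral_const_mul, ← integral_const_mul, ← integral_const_mul,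
      ← integral_add ((hA j).const_mul _).integrable ((hB j).const_mul _).integrable,
      ← integral_add (((hA j).const_mul _).add ((hB j).const_mul _)).integrable
        ((hΦ.bdd_osc j).const_mul _).integrable]
    refine integral_le_of_resample j (hL j)
      ((((hA j).const_mul _).add ((hB j).const_mul _)).add ((hΦ.bdd_osc j).const_mul _)) fun e => ?_
    have hφ : BddMeas fun y => ⟪x j, w⟫ * Φ (Function.update e j y) :=
      (hΦ.bdd.comp (measurable_update_snd e j)).const_mul _
    have hlin := N.linearization hb₀ (S.frozenProfile hb hb₀ e j) hφ
      (D := |⟪x j, w⟫| * D j e)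
      (fun y => by
        rw [← mul_sub, abs_mul]
        exact mul_le_mul_of_nonneg_left (hΦ.osc_le e j y) (abs_nonneg _))
      (fun y hy => by rw [hΦ.left e j y hy]) (fun y hy => by rw [hΦ.right e j y hy])
    simp only [Function.update_self, hΦ.osc_update]
    refine hlin.trans (le_of_eq ?_)
    have hA' := (hA j).comp (measurable_update_snd e j)
    have hB' := (hB j).comp (measurable_update_snd e j)
    simp only [Function.update_self] at hA' hB'
    rw [integral_add ((hA'.const_mul _).add (hB'.const_mul _)).integrable (integrable_const _),
      integral_add (hA'.const_mul _).integrable (hB'.const_mul _).integrable, integral_const_mul,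
      integral_const_mul]
    have r1 : ∫ y, |⟪x j, w⟫ * Φ (Function.update e j y)| * ⟪x j, θ (Function.update e j y)⟫ ^ 2 ∂ν
        = |⟪x j, w⟫| * ∫ y, |Φ (Function.update e j y)|
          * ⟪x j, θ (Function.update e j y)⟫ ^ 2 ∂ν := by
      rw [← integral_const_mul]; congr 1; ext y; rw [abs_mul]; ring
    have r2 : ∫ y, |⟪x j, w⟫ * Φ (Function.update e j y)| * ⟪x j, θ (Function.update e j y)⟫
          * tailContrast ν b₀ y ∂ν
        = |⟪x j, w⟫| * ∫ y, |Φ (Function.update e j y)|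
          * (⟪x j, θ (Function.update e j y)⟫ * tailContrast ν b₀ y) ∂ν := by
      rw [← integral_const_mul]; congr 1; ext y; rw [abs_mul]; ring
    rw [r1, r2]
    simp
    ring
  refine (Finset.sum_le_sum fun j _ => key j).trans ?_
  rw [Finset.sum_add_distrib, Finset.sum_add_distrib]
  have s1 : ∑ j, K ^ 2 * |⟪x j, w⟫| * ∫ e, |Φ e| * ⟪x j, θ e⟫ ^ 2 ∂(Measure.pi fun _ => ν)
      = K ^ 2 * ∑ j, |⟪x j, w⟫| * ∫ e, |Φ e| * ⟪x j, θ e⟫ ^ 2 ∂(Measure.pi fun _ => ν) := by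
    rw [Finset.mul_sum]; exact Finset.sum_congr rfl fun j _ => by ring
  have s3 : ∑ j, 11 * K * b * |⟪x j, w⟫| * ∫ e, D j e ∂(Measure.pi fun _ => ν)
      = 11 * K * b * ∑ j, |⟪x j, w⟫| * ∫ e, D j e ∂(Measure.pi fun _ => ν) := by
    rw [Finset.mul_sum]; exact Finset.sum_congr rfl fun j _ => by ring
  rw [s1, s3]
  have hC := N.integral_contrast_le S hΦ.bdd fun j => |⟪x j, w⟫|
  have s2 : ∑ j, 3 * K * |⟪x j, w⟫| * ∫ e, |Φ e| * (⟪x j, θ e⟫ * tailContrast ν b₀ (e j))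
        ∂(Measure.pi fun _ => ν)
      = 3 * K * ∫ e, |Φ e| * ∑ j, |⟪x j, w⟫| * (⟪x j, θ e⟫ * tailContrast ν b₀ (e j))
        ∂(Measure.pi fun _ => ν) := by
    simp only [Finset.mul_sum]
    rw [integral_finsetSum]
    · rw [Finset.mul_sum]
      refine Finset.sum_congr rfl fun j _ => ?_
      rw [mul_assoc, ← integral_const_mul]
      congr 2; ext e; ring
    · intro j _
      exact (hΦ.bdd.abs.mul (((hz j).mul (mξ j)).const_mul _)).integrable
  rw [s2]
  gcongr
  · linarith [N.K_pos]
  refine hC.trans ?_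
  have t1 : √(∫ e, (|Φ e| * ‖θ e‖) ^ 2 ∂(Measure.pi fun _ => ν))
      ≤ ρ * √(∫ e, Φ e ^ 2 ∂(Measure.pi fun _ => ν)) := by
    refine le_trans (Real.sqrt_le_sqrt (y := ρ ^ 2 * ∫ e, Φ e ^ 2 ∂(Measure.pi fun _ => ν)) ?_)
      (by rw [Real.sqrt_mul (sq_nonneg ρ), Real.sqrt_sq hρ])
    rw [← integral_const_mul]
    refine BddMeas.integral_mono (hΦ.bdd.abs.mul S.bddMeas_norm).sq (hΦ.bdd.sq.const_mul _)
      fun e => ?_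
    rw [mul_pow, sq_abs, mul_comm]
    exact mul_le_mul_of_nonneg_right (pow_le_pow_left₀ (norm_nonneg _) (S.norm_le e) 2)
      (sq_nonneg _)
  have t2 : ρ * √(2 * K * ∑ j, |⟪x j, w⟫| ^ 2 * ‖x j‖ ^ 2) ≤ √(2 * K) * b :=
    mul_sqrt_weighted_le hb hρ hb0 (by
      simp only [sq_abs]; rw [hx w]; exact pow_le_one₀ (norm_nonneg _) hw)
      (by linarith [N.K_pos])
  calc _ ≤ (ρ * √(∫ e, Φ e ^ 2 ∂(Measure.pi fun _ => ν)))
        * √(2 * K * ∑ j, |⟪x j, w⟫| ^ 2 * ‖x j‖ ^ 2) :=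
        mul_le_mul_of_nonneg_right t1 (Real.sqrt_nonneg _)
    _ = (ρ * √(2 * K * ∑ j, |⟪x j, w⟫| ^ 2 * ‖x j‖ ^ 2))
        * √(∫ e, Φ e ^ 2 ∂(Measure.pi fun _ => ν)) := by ring
    _ ≤ _ := mul_le_mul_of_nonneg_right t2 (Real.sqrt_nonneg _)

end QuantileNoise

end Selection

/-! ### The ridge-regularized quantile fit on a ball -/

lemma convexOn_quantileLoss (τ : ℝ) : ConvexOn ℝ Set.univ (quantileLoss τ) := by
  have h : quantileLoss τ = (fun u => τ * u) ⊔ fun u => (τ - 1) * u := by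
    ext u; exact quantileLoss_eq_max τ u
  rw [h]
  exact ((LinearMap.mulLeft ℝ τ).convexOn convex_univ).sup
    ((LinearMap.mulLeft ℝ (τ - 1)).convexOn convex_univ)

lemma checkLoss_smul_le (τ e z : ℝ) {l : ℝ} (h0 : 0 ≤ l) (h1 : l ≤ 1) :
    checkLoss τ e (l * z) ≤ l * checkLoss τ e z := by
  have := (convexOn_quantileLoss τ).2 (Set.mem_univ (e - z)) (Set.mem_univ e) h0
    (sub_nonneg.2 h1) (by ring)
  unfold checkLoss
  simp only [smul_eq_mul] at this
  rw [show l * (e - z) + (1 - l) * e = e - l * z by ring] at this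
  linarith

section Ridge

open scoped RealInnerProductSpace

variable {E : Type*} [NormedAddCommGroup E] [InnerProductSpace ℝ E] {n : ℕ}

/-- A linear term and a ridge penalty. -/
noncomputable def ridgeBase (κ : ℝ) (q t : E) : ℝ := ⟪q, t⟫ - κ / 2 * ‖t‖ ^ 2

variable {τ κ ρ b b₀ : ℝ} {x : Fin n → E} {q q' : E} {e e' : Fin n → ℝ}

lemma objective_ridge_zero : objective τ x (ridgeBase κ q) e 0 = 0 := by
  simp [objective, ridgeBase]

lemma objective_ridge_sub (t : E) : objective τ x (ridgeBase κ q') e t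
    = objective τ x (ridgeBase κ q) e t + ⟪q' - q, t⟫ := by
  simp only [objective, ridgeBase, inner_sub_left]; ring

/-- Both sources of strict concavity are kept: the ridge yields a unique, measurable maximizer,
while the kinks give a gain which does not depend on `κ` and later bounds the gap between two fits.
-/
lemma objective_ridge_midpoint (s t : E) :
    objective τ x (ridgeBase κ q) e s + objective τ x (ridgeBase κ q) e t + κ / 4 * ‖s - t‖ ^ 2
        + ∑ j, max 0 (min (e j - ⟪x j, s⟫) (⟪x j, t⟫ - e j))
      ≤ 2 * objective τ x (ridgeBase κ q) e ((1 / 2 : ℝ) • (s + t)) := by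
  have h1 : ∑ j, max 0 (min (e j - ⟪x j, s⟫) (⟪x j, t⟫ - e j))
      ≤ ∑ j, (checkLoss τ (e j) ⟪x j, s⟫ + checkLoss τ (e j) ⟪x j, t⟫
        - 2 * checkLoss τ (e j) ⟪x j, (1 / 2 : ℝ) • (s + t)⟫) := by
    refine Finset.sum_le_sum fun j _ => ?_
    rw [inner_smul_right, inner_add_right, one_div_mul_eq_div]
    exact checkLoss_midpoint τ (e j) _ _
  rw [Finset.sum_sub_distrib, Finset.sum_add_distrib, ← Finset.mul_sum] at h1
  have h2 : ‖s‖ ^ 2 + ‖t‖ ^ 2 - 2 * ‖(1 / 2 : ℝ) • (s + t)‖ ^ 2 = 1 / 2 * ‖s - t‖ ^ 2 := by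
    rw [norm_smul, mul_pow, norm_add_sq_real, norm_sub_sq_real]
    norm_num
    ring
  have h3 : ⟪q, (1 / 2 : ℝ) • (s + t)⟫ = (⟪q, s⟫ + ⟪q, t⟫) / 2 := by
    rw [inner_smul_right, inner_add_right]; ring
  simp only [objective, ridgeBase, h3]
  linear_combination h1 - κ / 2 * h2

lemma objective_ridge_smul (hκ : 0 ≤ κ) (t : E) {l : ℝ} (h0 : 0 ≤ l) (h1 : l ≤ 1) :
    l * objective τ x (ridgeBase κ q) e t ≤ objective τ x (ridgeBase κ q) e (l • t) := by
  have h2 : ∑ j, checkLoss τ (e j) ⟪x j, l • t⟫ ≤ l * ∑ j, checkLoss τ (e j) ⟪x j, t⟫ := by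
    rw [Finset.mul_sum]
    exact Finset.sum_le_sum fun j _ => by
      rw [inner_smul_right]; exact checkLoss_smul_le τ _ _ h0 h1
  simp only [objective, ridgeBase, inner_smul_right, norm_smul, Real.norm_eq_abs,
    abs_of_nonneg h0] at h2 ⊢
  have h3 : l ^ 2 * (κ * ‖t‖ ^ 2) ≤ l * (κ * ‖t‖ ^ 2) :=
    mul_le_mul_of_nonneg_right (by nlinarith) (by positivity)
  linear_combination h2 + h3 / 2

lemma objective_ridge_gap {t₀ : E}
    (hmem : t₀ ∈ Metric.closedBall (0 : E) ρ) (hmax : ∀ t ∈ Metric.closedBall (0 : E) ρ,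
      objective τ x (ridgeBase κ q) e t ≤ objective τ x (ridgeBase κ q) e t₀)
    {t : E} (ht : t ∈ Metric.closedBall (0 : E) ρ) :
    objective τ x (ridgeBase κ q) e t + κ / 4 * ‖t₀ - t‖ ^ 2
        + ∑ j, max 0 (min (e j - ⟪x j, t₀⟫) (⟪x j, t⟫ - e j))
      ≤ objective τ x (ridgeBase κ q) e t₀ := by
  have h1 := objective_ridge_midpoint (τ := τ) (κ := κ) (x := x) (q := q) (e := e) t₀ t
  have h2 : (1 / 2 : ℝ) • (t₀ + t) ∈ Metric.closedBall (0 : E) ρ := by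
    rw [smul_add]
    exact convex_closedBall (0 : E) ρ hmem ht (by norm_num) (by norm_num) (by norm_num)
  linarith [hmax _ h2]

lemma objective_ridge_gap' (hκ : 0 ≤ κ) {t₀ : E}
    (hmem : t₀ ∈ Metric.closedBall (0 : E) ρ) (hmax : ∀ t ∈ Metric.closedBall (0 : E) ρ,
      objective τ x (ridgeBase κ q) e t ≤ objective τ x (ridgeBase κ q) e t₀)
    {t : E} (ht : t ∈ Metric.closedBall (0 : E) ρ) :
    objective τ x (ridgeBase κ q) e t
        + ∑ j, max 0 (min (e j - ⟪x j, t₀⟫) (⟪x j, t⟫ - e j))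
      ≤ objective τ x (ridgeBase κ q) e t₀ := by
  have := objective_ridge_gap hmem hmax ht
  have h : 0 ≤ κ / 4 * ‖t₀ - t‖ ^ 2 := by positivity
  linarith

lemma abs_objective_sub_le (h0 : 0 ≤ τ) (h1 : τ ≤ 1) (base : E → ℝ) (t : E) :
    |objective τ x base e t - objective τ x base e' t| ≤ 2 * ∑ j, |e j - e' j| := by
  unfold objective
  rw [sub_sub_sub_cancel_left, ← Finset.sum_sub_distrib, Finset.mul_sum]
  refine (Finset.abs_sum_le_sum_abs _ _).trans (Finset.sum_le_sum fun j _ => ?_)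
  rw [abs_sub_comm (e j)]
  exact abs_checkLoss_sub_left_le h0 h1 _ _ _

lemma continuous_objective_ridge : Continuous (objective τ x (ridgeBase κ q) e) := by
  have := continuous_quantileLoss τ
  unfold objective ridgeBase checkLoss
  fun_prop

/-- Strong concavity makes the maximizer unique and Hölder continuous of order $1/2$ in the errors,
hence measurable, and no choice among ties is needed. -/
lemma exists_ridge_selection [FiniteDimensional ℝ E] [MeasurableSpace E] [BorelSpace E]
    (hτ0 : 0 ≤ τ) (hτ1 : τ ≤ 1) (hκ : 0 < κ) (hρ : 0 ≤ ρ) (x : Fin n → E) (q : E) :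
    ∃ θ, IsSelection τ x ρ (ridgeBase κ q) (Metric.closedBall 0 ρ) θ := by
  have : ProperSpace E := FiniteDimensional.proper ℝ E
  have hex : ∀ e : Fin n → ℝ, ∃ t₀ ∈ Metric.closedBall (0 : E) ρ,
      ∀ t ∈ Metric.closedBall (0 : E) ρ, objective τ x (ridgeBase κ q) e t
        ≤ objective τ x (ridgeBase κ q) e t₀ := fun e => by
    obtain ⟨t₀, h1, h2⟩ := (isCompact_closedBall (0 : E) ρ).exists_isMaxOn
      ⟨0, Metric.mem_closedBall_self hρ⟩ (continuous_objective_ridge (τ := τ) (x := x) (κ := κ)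
        (q := q) (e := e)).continuousOn
    exact ⟨t₀, h1, fun t ht => h2 ht⟩
  choose θ hmem hmax using hex
  have gap : ∀ e e', objective τ x (ridgeBase κ q) e (θ e')
      + κ / 4 * ‖θ e - θ e'‖ ^ 2 ≤ objective τ x (ridgeBase κ q) e (θ e) := fun e e' => by
    have h := objective_ridge_gap (hmem e) (hmax e) (hmem e')
    have h' : 0 ≤ ∑ j, max 0 (min (e j - ⟪x j, θ e⟫) (⟪x j, θ e'⟫ - e j)) :=
      Finset.sum_nonneg fun _ _ => le_max_left _ _
    linarith
  have hcont : Continuous θ := by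
    rw [continuous_iff_continuousAt]
    intro e
    have h1 : Tendsto (fun e' : Fin n → ℝ => √(16 / κ * ∑ j, |e j - e' j|)) (𝓝 e) (𝓝 0) := by
      have : Continuous fun e' : Fin n → ℝ => √(16 / κ * ∑ j, |e j - e' j|) := by fun_prop
      simpa using this.tendsto e
    rw [ContinuousAt, tendsto_iff_norm_sub_tendsto_zero]
    refine squeeze_zero (fun _ => norm_nonneg _) (fun e' => ?_) h1
    refine Real.le_sqrt_of_sq_le ?_
    have g1 := gap e e'
    have g2 := hmax e' (θ e) (hmem e)
    have g3 := abs_le.1 (abs_objective_sub_le (x := x) (e := e) (e' := e') hτ0 hτ1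
      (ridgeBase κ q) (θ e))
    have g4 := abs_le.1 (abs_objective_sub_le (x := x) (e := e) (e' := e') hτ0 hτ1
      (ridgeBase κ q) (θ e'))
    rw [norm_sub_rev]
    have g5 : κ * ‖θ e - θ e'‖ ^ 2 ≤ 16 * ∑ j, |e j - e' j| := by linarith
    rw [div_mul_eq_mul_div, le_div_iff₀ hκ]
    linarith
  refine ⟨θ, hcont.measurable, hmem, fun e => by simpa using hmem e, hmax, fun e e' h _ => ?_⟩
  have h1 := gap e e'
  have h2 : ‖θ e - θ e'‖ ^ 2 ≤ 0 := by
    have : κ * ‖θ e - θ e'‖ ^ 2 ≤ 0 := by linarith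
    exact nonpos_of_mul_nonpos_right this hκ
  rw [← sub_eq_zero, ← norm_eq_zero]
  exact pow_eq_zero_iff two_ne_zero |>.1 (le_antisymm h2 (sq_nonneg _))

end Ridge

/-! ### Values and fits of the localized ridge problem -/

section LocalModel

open scoped RealInnerProductSpace

variable {E : Type*} [NormedAddCommGroup E] [InnerProductSpace ℝ E] [FiniteDimensional ℝ E]
  [MeasurableSpace E] [BorelSpace E] {n : ℕ}

/-- A quantile regression with a Parseval frame of regressors, localized to a ball on which all the
fits are smaller than `b ≤ b₀`. -/
structure LocalModel (ν : Measure ℝ) (τ f₀ b₀ K : ℝ) (x : Fin n → E) (ρ b : ℝ) : Prop where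
  noise : QuantileNoise ν τ f₀ b₀ K
  parseval : IsParseval x
  radius_pos : 0 < ρ
  fit_le : ∀ j, ‖x j‖ * ρ ≤ b
  b_nonneg : 0 ≤ b
  b_le : b ≤ b₀
  b_le_one : b ≤ 1

/-- The maximizer over the ball of the ridge-regularized quantile objective. -/
noncomputable def ridgeFit (τ : ℝ) (x : Fin n → E) (ρ κ : ℝ) (q : E) : (Fin n → ℝ) → E :=
  Classical.epsilon (IsSelection τ x ρ (ridgeBase κ q) (Metric.closedBall 0 ρ))

/-- The maximum over the ball of the ridge-regularized quantile objective. -/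
noncomputable def ridgeValue (τ : ℝ) (x : Fin n → E) (ρ κ : ℝ) (q : E) (e : Fin n → ℝ) : ℝ :=
  objective τ x (ridgeBase κ q) e (ridgeFit τ x ρ κ q e)

/-- A bound for the oscillation of `ridgeValue q - ridgeValue q'` in the `j`-th error. -/
noncomputable def ridgeOsc (τ : ℝ) (x : Fin n → E) (ρ κ b₀ : ℝ) (q q' : E) (j : Fin n)
    (e : Fin n → ℝ) : ℝ :=
  max ⟪x j, ridgeFit τ x ρ κ q (Function.update e j b₀)⟫
      ⟪x j, ridgeFit τ x ρ κ q' (Function.update e j b₀)⟫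
    - min ⟪x j, ridgeFit τ x ρ κ q (Function.update e j (-b₀))⟫
      ⟪x j, ridgeFit τ x ρ κ q' (Function.update e j (-b₀))⟫

namespace LocalModel

variable {ν : Measure ℝ} [IsProbabilityMeasure ν] {τ f₀ b₀ K ρ b κ : ℝ} {x : Fin n → E}
  (M : LocalModel ν τ f₀ b₀ K x ρ b) (hκ : 0 < κ)
include M hκ

lemma selection (q : E) : IsSelection τ x ρ (ridgeBase κ q) (Metric.closedBall 0 ρ)
    (ridgeFit τ x ρ κ q) :=
  Classical.epsilon_spec (exists_ridge_selection M.noise.tau_pos.le M.noise.tau_lt_one.le hκ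
    M.radius_pos.le x q)

lemma ridgeValue_ge (q : E) (e : Fin n → ℝ) {t : E} (ht : ‖t‖ ≤ ρ) :
    objective τ x (ridgeBase κ q) e t ≤ ridgeValue τ x ρ κ q e :=
  (M.selection hκ q).isMaxOn e t (by simpa using ht)

lemma ridgeValue_nonneg (q : E) (e : Fin n → ℝ) : 0 ≤ ridgeValue τ x ρ κ q e := by
  rw [← objective_ridge_zero (τ := τ) (x := x) (κ := κ) (q := q) (e := e)]
  exact M.ridgeValue_ge hκ q e (by simpa using M.radius_pos.le)

/-- The fit is a subgradient of the value. -/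
lemma ridgeValue_subgradient (q q' : E) (e : Fin n → ℝ) :
    ridgeValue τ x ρ κ q e + ⟪q' - q, ridgeFit τ x ρ κ q e⟫ ≤ ridgeValue τ x ρ κ q' e := by
  unfold ridgeValue
  rw [← objective_ridge_sub]
  exact M.ridgeValue_ge hκ q' e ((M.selection hκ q).norm_le e)

lemma ridgeValue_le (q : E) (e : Fin n → ℝ) : ridgeValue τ x ρ κ q e
    ≤ ⟪q + ∑ j, checkScore τ (e j) • x j, ridgeFit τ x ρ κ q e⟫ := by
  have h : ∑ j, -checkScore τ (e j) * ⟪x j, ridgeFit τ x ρ κ q e⟫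
      ≤ ∑ j, checkLoss τ (e j) ⟪x j, ridgeFit τ x ρ κ q e⟫ :=
    Finset.sum_le_sum fun j _ => by
      rw [checkLoss_eq]; linarith [checkRem_nonneg (e j) ⟪x j, ridgeFit τ x ρ κ q e⟫]
  have h' : 0 ≤ κ / 2 * ‖ridgeFit τ x ρ κ q e‖ ^ 2 := by positivity
  simp only [ridgeValue, objective, ridgeBase, inner_add_left, sum_inner, inner_smul_left]
  simp only [neg_mul, Finset.sum_neg_distrib] at h
  simp only [conj_trivial]
  linarith

lemma bddMeas_ridgeValue (q : E) : BddMeas (ridgeValue τ x ρ κ q) := by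
  have S := M.selection hκ q
  unfold ridgeValue objective ridgeBase
  refine ((S.bddMeas_inner q).sub (S.bddMeas_norm.sq.const_mul _)).sub (BddMeas.sum _ fun j => ?_)
  refine ⟨(continuous_checkLoss τ).measurable.comp
    ((measurable_pi_apply j).prodMk (S.measurable_fit j)), b, fun e => ?_⟩
  exact (abs_checkLoss_le M.noise.tau_pos.le M.noise.tau_lt_one.le _ _).trans
    (S.abs_fit_le M.fit_le e j)

/-- First-order condition at the maximizer over the ball. -/
lemma score_le (q d : E) (e : Fin n → ℝ) :
    ∑ j, ⟪x j, d⟫ * checkScore τ (e j - ⟪x j, ridgeFit τ x ρ κ q e⟫) + ⟪q, d⟫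
        - κ * ⟪ridgeFit τ x ρ κ q e, d⟫
      ≤ max 0 ⟪ridgeFit τ x ρ κ q e, d⟫ / ρ ^ 2 * ridgeValue τ x ρ κ q e
        + ∑ j, |⟪x j, d⟫| * if e j = ⟪x j, ridgeFit τ x ρ κ q e⟫ then (1 : ℝ) else 0 := by
  set t := ridgeFit τ x ρ κ q e with ht
  set H := ridgeValue τ x ρ κ q e with hH
  have hρ := M.radius_pos
  have htρ : ‖t‖ ≤ ρ := (M.selection hκ q).norm_le e
  have hH0 : 0 ≤ H := M.ridgeValue_nonneg hκ q e
  have key : ∀ ε : ℝ, 0 < ε →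
      ∑ j, ⟪x j, d⟫ * checkScore τ (e j - ⟪x j, t⟫) + ⟪q, d⟫ - κ * ⟪t, d⟫
      ≤ (max 0 ⟪t, d⟫ + ε * ‖d‖ ^ 2 / 2) / ρ ^ 2 * H
        + ε * (κ / 2 * ‖d‖ ^ 2)
        + ∑ j, |⟪x j, d⟫| * if |e j - ⟪x j, t⟫| ≤ ε * |⟪x j, d⟫| then (1 : ℝ) else 0 := by
    intro ε hε
    -- The point $t+\varepsilon d$ may leave the ball, and division by $1+\varepsilon c$ brings it
    -- back. Since the objective is concave and vanishes at the origin, its value at $t+\varepsilon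
    -- d$ is at most $(1+\varepsilon c)H$. As $\varepsilon\to0$ this multiplier vanishes when
    -- $\langle t,d\rangle\le0$.
    set c := (max 0 ⟪t, d⟫ + ε * ‖d‖ ^ 2 / 2) / ρ ^ 2 with hc
    have hc0 : 0 ≤ c := by positivity
    have h1 : ‖t + ε • d‖ ≤ (1 + ε * c) * ρ := by
      refine abs_le_of_sq_le_sq' ?_ (by positivity) |>.2
      rw [norm_add_sq_real, inner_smul_right, norm_smul, mul_pow, Real.norm_eq_abs, sq_abs]
      have : c * ρ ^ 2 = max 0 ⟪t, d⟫ + ε * ‖d‖ ^ 2 / 2 := by rw [hc]; field_simp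
      have h2 : ‖t‖ ^ 2 ≤ ρ ^ 2 := pow_le_pow_left₀ (norm_nonneg _) htρ 2
      have h3 : ε * ⟪t, d⟫ ≤ ε * max 0 ⟪t, d⟫ := by gcongr; exact le_max_right _ _
      have h4 : 0 ≤ (ε * c * ρ) ^ 2 := sq_nonneg _
      linear_combination h2 + 2 * h3 + h4 - 2 * ε * this
    have h2 : objective τ x (ridgeBase κ q) e (t + ε • d) ≤ (1 + ε * c) * H := by
      have hpos : 0 < 1 + ε * c := by positivity
      have h3 := objective_ridge_smul (τ := τ) (x := x) (q := q) (e := e) hκ.le (t + ε • d)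
        (l := (1 + ε * c)⁻¹) (by positivity)
        (inv_le_one_of_one_le₀ (by nlinarith [mul_nonneg hε.le hc0]))
      have h4 := M.ridgeValue_ge hκ q e (t := (1 + ε * c)⁻¹ • (t + ε • d)) (by
        rw [norm_smul, Real.norm_eq_abs, abs_of_pos (inv_pos.2 hpos), inv_mul_le_iff₀ hpos]
        exact h1)
      exact (inv_mul_le_iff₀ hpos).1 (h3.trans h4)
    have h3 : ∑ j, (checkLoss τ (e j) ⟪x j, t + ε • d⟫ - checkLoss τ (e j) ⟪x j, t⟫)
        ≤ ∑ j, ε * (-(⟪x j, d⟫ * checkScore τ (e j - ⟪x j, t⟫))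
          + |⟪x j, d⟫| * if |e j - ⟪x j, t⟫| ≤ ε * |⟪x j, d⟫| then (1 : ℝ) else 0) := by
      refine Finset.sum_le_sum fun j _ => ?_
      rw [inner_add_right, inner_smul_right]
      refine (checkLoss_add_le _ _ _ _).trans (le_of_eq ?_)
      rw [abs_mul, abs_of_pos hε]
      split_ifs <;> ring
    rw [← Finset.mul_sum, Finset.sum_add_distrib, Finset.sum_neg_distrib,
      Finset.sum_sub_distrib] at h3
    have h4 : H = objective τ x (ridgeBase κ q) e t := rfl
    have h5 : ‖t + ε • d‖ ^ 2 = ‖t‖ ^ 2 + 2 * (ε * ⟪t, d⟫) + ε ^ 2 * ‖d‖ ^ 2 := by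
      rw [norm_add_sq_real, inner_smul_right, norm_smul, mul_pow, Real.norm_eq_abs, sq_abs]
    have h6 : ⟪q, t + ε • d⟫ = ⟪q, t⟫ + ε * ⟪q, d⟫ := by rw [inner_add_right, inner_smul_right]
    have h7 : objective τ x (ridgeBase κ q) e (t + ε • d) - objective τ x (ridgeBase κ q) e t
        = ε * ⟪q, d⟫ - κ / 2 * (2 * (ε * ⟪t, d⟫) + ε ^ 2 * ‖d‖ ^ 2)
          - (∑ j, checkLoss τ (e j) ⟪x j, t + ε • d⟫ - ∑ j, checkLoss τ (e j) ⟪x j, t⟫) := by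
      simp only [objective, ridgeBase, h5, h6]; ring
    refine le_of_mul_le_mul_left ?_ hε
    rw [← h4] at h7
    linear_combination h2 + h3 - h7
  -- For small $\varepsilon$ the observations within $\varepsilon|\langle x_j,d\rangle|$ of their
  -- fit are, at most, those interpolated exactly.
  have hev : ∀ᶠ ε : ℝ in 𝓝[>] 0,
      ∑ j, ⟪x j, d⟫ * checkScore τ (e j - ⟪x j, t⟫) + ⟪q, d⟫ - κ * ⟪t, d⟫
      ≤ (max 0 ⟪t, d⟫ + ε * ‖d‖ ^ 2 / 2) / ρ ^ 2 * H
        + ε * (κ / 2 * ‖d‖ ^ 2)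
        + ∑ j, |⟪x j, d⟫| * if e j = ⟪x j, t⟫ then (1 : ℝ) else 0 := by
    have h1 : ∀ᶠ ε : ℝ in 𝓝[>] 0, ∀ j, e j ≠ ⟪x j, t⟫ →
        ε * |⟪x j, d⟫| < |e j - ⟪x j, t⟫| := by
      rw [eventually_all]
      intro j
      by_cases hj : e j = ⟪x j, t⟫
      · exact Eventually.of_forall fun _ h => absurd hj h
      · have : Tendsto (fun ε : ℝ => ε * |⟪x j, d⟫|) (𝓝[>] 0) (𝓝 0) := by
          have h : Tendsto (fun ε : ℝ => ε * |⟪x j, d⟫|) (𝓝 0) (𝓝 (0 * |⟪x j, d⟫|)) :=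
            tendsto_id.mul_const _
          rw [zero_mul] at h
          exact h.mono_left nhdsWithin_le_nhds
        filter_upwards [this.eventually_lt_const (abs_pos.2 (sub_ne_zero.2 hj))] with ε h _ using h
    filter_upwards [h1, self_mem_nhdsWithin] with ε h1 hε
    refine (key ε hε).trans (add_le_add le_rfl (Finset.sum_le_sum fun j _ => ?_))
    refine mul_le_mul_of_nonneg_left ?_ (abs_nonneg _)
    by_cases hj : e j = ⟪x j, t⟫
    · rw [if_pos hj]; split_ifs <;> norm_num
    · rw [if_neg hj, if_neg (not_le.2 (h1 j hj))]
  refine ge_of_tendsto (x := 𝓝[>] (0 : ℝ)) ?_ hev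
  refine Tendsto.add_const _ ?_
  have hc : Continuous fun ε : ℝ => (max 0 ⟪t, d⟫ + ε * ‖d‖ ^ 2 / 2) / ρ ^ 2 * H
      + ε * (κ / 2 * ‖d‖ ^ 2) := by fun_prop
  have := (hc.tendsto 0).mono_left (nhdsWithin_le_nhds (s := Set.Ioi 0))
  simpa using this

/-- Envelope argument: the maximizer for one value of the error competes for the other. The
increment of `quantileLoss` does not depend on `q`; without it the slope in the error lies between
$-\tau$ and $1-\tau$. -/
lemma ridgeValue_update_sub_le (q : E) (e : Fin n → ℝ) (j : Fin n) {y y' : ℝ} (h : y ≤ y') :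
    ridgeValue τ x ρ κ q (Function.update e j y') - ridgeValue τ x ρ κ q (Function.update e j y)
      ≤ (1 - τ) * (y' - y) + (quantileLoss τ y' - quantileLoss τ y) := by
  set t := ridgeFit τ x ρ κ q (Function.update e j y') with ht
  have h1 : objective τ x (ridgeBase κ q) (Function.update e j y) t
      ≤ ridgeValue τ x ρ κ q (Function.update e j y) :=
    M.ridgeValue_ge hκ q _ ((M.selection hκ q).norm_le _)
  have h2 := objective_update_sub τ x (ridgeBase κ q) e j y' y t
  have h3 : ridgeValue τ x ρ κ q (Function.update e j y')
    = objective τ x (ridgeBase κ q) (Function.update e j y') t := rfl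
  have h4 := le_quantileLoss_sub (τ := τ) (u := y - ⟪x j, t⟫) (v := y' - ⟪x j, t⟫) (by linarith)
  unfold checkLoss at h2
  rw [h3]
  linarith

lemma le_ridgeValue_update_sub (q : E) (e : Fin n → ℝ) (j : Fin n) {y y' : ℝ} (h : y ≤ y') :
    -τ * (y' - y) + (quantileLoss τ y' - quantileLoss τ y) ≤
    ridgeValue τ x ρ κ q (Function.update e j y') - ridgeValue τ x ρ κ q (Function.update e j y)
       := by
  set t := ridgeFit τ x ρ κ q (Function.update e j y) with ht
  have h1 : objective τ x (ridgeBase κ q) (Function.update e j y') t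
      ≤ ridgeValue τ x ρ κ q (Function.update e j y') :=
    M.ridgeValue_ge hκ q _ ((M.selection hκ q).norm_le _)
  have h2 := objective_update_sub τ x (ridgeBase κ q) e j y' y t
  have h3 : ridgeValue τ x ρ κ q (Function.update e j y)
    = objective τ x (ridgeBase κ q) (Function.update e j y) t := rfl
  have h4 := quantileLoss_sub_le (τ := τ) (u := y - ⟪x j, t⟫) (v := y' - ⟪x j, t⟫) (by linarith)
  unfold checkLoss at h2
  rw [h3]
  linarith

/-- Below the fit the maximizer is frozen and the value changes by a function of `y` alone. This
function is the same for all `q`, so it cancels in differences of values. -/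
lemma ridgeValue_update_left (q : E) (e : Fin n → ℝ) (j : Fin n) {y : ℝ}
    (h : y ≤ ⟪x j, ridgeFit τ x ρ κ q (Function.update e j (-b₀))⟫) :
    ridgeValue τ x ρ κ q (Function.update e j y)
      = ridgeValue τ x ρ κ q (Function.update e j (-b₀))
        + ((τ - 1) * (-b₀ - y) + quantileLoss τ y - quantileLoss τ (-b₀)) := by
  have S := M.selection hκ q
  have hb := M.b_le
  have h1 := S.update_eq_left M.fit_le M.b_le h
  have h2 := objective_update_sub τ x (ridgeBase κ q) e j y (-b₀)
    (ridgeFit τ x ρ κ q (Function.update e j (-b₀)))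
  have h3 : -b₀ ≤ ⟪x j, ridgeFit τ x ρ κ q (Function.update e j (-b₀))⟫ := by
    linarith [neg_le_of_abs_le (S.abs_fit_le M.fit_le (Function.update e j (-b₀)) j)]
  rw [checkLoss_eq_left h, checkLoss_eq_left h3] at h2
  unfold ridgeValue
  rw [h1]
  linarith

lemma ridgeValue_update_right (q : E) (e : Fin n → ℝ) (j : Fin n) {y : ℝ}
    (h : ⟪x j, ridgeFit τ x ρ κ q (Function.update e j b₀)⟫ ≤ y) :
    ridgeValue τ x ρ κ q (Function.update e j y)
      = ridgeValue τ x ρ κ q (Function.update e j b₀)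
        + (τ * (b₀ - y) + quantileLoss τ y - quantileLoss τ b₀) := by
  have S := M.selection hκ q
  have hb := M.b_le
  have h1 := S.update_eq_right M.fit_le M.b_le h
  have h2 := objective_update_sub τ x (ridgeBase κ q) e j y b₀
    (ridgeFit τ x ρ κ q (Function.update e j b₀))
  have h3 : ⟪x j, ridgeFit τ x ρ κ q (Function.update e j b₀)⟫ ≤ b₀ := by
    linarith [le_of_abs_le (S.abs_fit_le M.fit_le (Function.update e j b₀) j)]
  rw [checkLoss_eq_right h, checkLoss_eq_right h3] at h2
  unfold ridgeValue
  rw [h1]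
  linarith

/-- Differences of values are test functions. -/
lemma isTest_ridgeValue_sub (q q' : E) :
    IsTest b₀ (fun e => ridgeValue τ x ρ κ q e - ridgeValue τ x ρ κ q' e)
      (ridgeOsc τ x ρ κ b₀ q q') := by
  have S := M.selection hκ q
  have S' := M.selection hκ q'
  have hb := M.b_le
  have hfz := fun e j => S.frozenProfile M.fit_le M.b_le e j
  have hfz' := fun e j => S'.frozenProfile M.fit_le M.b_le e j
  have hl : ∀ e j y, y ≤ min ⟪x j, ridgeFit τ x ρ κ q (Function.update e j (-b₀))⟫
      ⟪x j, ridgeFit τ x ρ κ q' (Function.update e j (-b₀))⟫ →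
      ridgeValue τ x ρ κ q (Function.update e j y) - ridgeValue τ x ρ κ q' (Function.update e j y)
      = ridgeValue τ x ρ κ q (Function.update e j (-b₀))
        - ridgeValue τ x ρ κ q' (Function.update e j (-b₀)) := fun e j y h => by
    rw [M.ridgeValue_update_left hκ q e j (h.trans (min_le_left _ _)),
      M.ridgeValue_update_left hκ q' e j (h.trans (min_le_right _ _))]
    ring
  have hr : ∀ e j y, max ⟪x j, ridgeFit τ x ρ κ q (Function.update e j b₀)⟫
      ⟪x j, ridgeFit τ x ρ κ q' (Function.update e j b₀)⟫ ≤ y →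
      ridgeValue τ x ρ κ q (Function.update e j y) - ridgeValue τ x ρ κ q' (Function.update e j y)
      = ridgeValue τ x ρ κ q (Function.update e j b₀)
        - ridgeValue τ x ρ κ q' (Function.update e j b₀) := fun e j y h => by
    rw [M.ridgeValue_update_right hκ q e j ((le_max_left _ _).trans h),
      M.ridgeValue_update_right hκ q' e j ((le_max_right _ _).trans h)]
    ring
  refine ⟨(M.bddMeas_ridgeValue hκ q).sub (M.bddMeas_ridgeValue hκ q'), fun j => ?_,
    fun e j y => ?_, fun e j y => ?_, fun e j y h => ?_, fun e j y h => ?_⟩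
  · exact (((S.bddMeas_fit M.fit_le j).comp (measurable_update_const j b₀)).max
      ((S'.bddMeas_fit M.fit_le j).comp (measurable_update_const j b₀))).sub
      (((S.bddMeas_fit M.fit_le j).comp (measurable_update_const j (-b₀))).min
      ((S'.bddMeas_fit M.fit_le j).comp (measurable_update_const j (-b₀))))
  · simp [ridgeOsc]
  · set lo := min ⟪x j, ridgeFit τ x ρ κ q (Function.update e j (-b₀))⟫
      ⟪x j, ridgeFit τ x ρ κ q' (Function.update e j (-b₀))⟫ with hlo
    set hi := max ⟪x j, ridgeFit τ x ρ κ q (Function.update e j b₀)⟫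
      ⟪x j, ridgeFit τ x ρ κ q' (Function.update e j b₀)⟫ with hhi
    have hlohi : lo ≤ hi := (min_le_left _ _).trans
      (((hfz e j).upper (-b₀)).trans (le_max_left _ _))
    change |_| ≤ hi - lo
    -- Apart from a common term, both values have slopes in $[-\tau,1-\tau]$, so their difference is
    -- 1-Lipschitz in the error. It is constant outside $[lo,hi]$, so its oscillation is at most `hi
    -- - lo`.
    have hstep : ∀ y y', y ≤ y' →
        |(ridgeValue τ x ρ κ q (Function.update e j y')
            - ridgeValue τ x ρ κ q' (Function.update e j y'))
          - (ridgeValue τ x ρ κ q (Function.update e j y)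
            - ridgeValue τ x ρ κ q' (Function.update e j y))| ≤ y' - y := by
      intro y y' h
      have a1 := M.ridgeValue_update_sub_le hκ q e j h
      have a2 := M.le_ridgeValue_update_sub hκ q e j h
      have a3 := M.ridgeValue_update_sub_le hκ q' e j h
      have a4 := M.le_ridgeValue_update_sub hκ q' e j h
      rw [abs_le]; constructor <;> linarith
    rcases le_total y lo with h1 | h1
    · rw [hl e j y h1, sub_self, abs_zero]; linarith
    · rcases le_total y hi with h2 | h2
      · rw [← hl e j lo le_rfl]
        exact (hstep lo y h1).trans (by linarith)
      · rw [← hl e j lo le_rfl, hr e j y h2, ← hr e j hi le_rfl]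
        exact hstep lo hi hlohi
  · refine hl e j y (h.trans (le_min ?_ ?_))
    · linarith [neg_le_of_abs_le ((hfz e j).abs_le (-b₀))]
    · linarith [neg_le_of_abs_le ((hfz' e j).abs_le (-b₀))]
  · refine hr e j y (le_trans (max_le ?_ ?_) h)
    · linarith [le_of_abs_le ((hfz e j).abs_le b₀)]
    · linarith [le_of_abs_le ((hfz' e j).abs_le b₀)]

end LocalModel

end LocalModel

/-! ### Operations on test functions -/

section Tests

variable {n : ℕ} {b₀ : ℝ} {Φ Ψ : (Fin n → ℝ) → ℝ} {D D' : Fin n → (Fin n → ℝ) → ℝ}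

lemma IsTest.add (h : IsTest b₀ Φ D) (h' : IsTest b₀ Ψ D') :
    IsTest b₀ (fun e => Φ e + Ψ e) (fun j e => D j e + D' j e) where
  bdd := h.bdd.add h'.bdd
  bdd_osc j := (h.bdd_osc j).add (h'.bdd_osc j)
  osc_update e j y := by rw [h.osc_update, h'.osc_update]
  osc_le e j y := by
    rw [add_sub_add_comm]
    exact (abs_add_le _ _).trans (add_le_add (h.osc_le e j y) (h'.osc_le e j y))
  left e j y hy := by rw [h.left e j y hy, h'.left e j y hy]
  right e j y hy := by rw [h.right e j y hy, h'.right e j y hy]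

/-- Composition with a Lipschitz function. -/
lemma IsTest.lipschitz (h : IsTest b₀ Φ D) {g : ℝ → ℝ} {C : ℝ≥0} (hg : LipschitzWith C g) :
    IsTest b₀ (fun e => g (Φ e)) (fun j e => C * D j e) where
  bdd := by
    obtain ⟨hm, B, hB⟩ := h.bdd
    refine ⟨hg.continuous.measurable.comp hm, |g 0| + C * B, fun e => ?_⟩
    have h1 := hg.dist_le_mul (Φ e) 0
    rw [Real.dist_eq, Real.dist_eq, sub_zero] at h1
    have h2 : |g (Φ e)| ≤ |g 0| + |g (Φ e) - g 0| := by
      have := abs_add_le (g 0) (g (Φ e) - g 0)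
      rwa [add_sub_cancel] at this
    have h3 : (C : ℝ) * |Φ e| ≤ C * B := mul_le_mul_of_nonneg_left (hB e) C.2
    linarith
  bdd_osc j := (h.bdd_osc j).const_mul _
  osc_update e j y := by rw [h.osc_update]
  osc_le e j y := by
    have h1 := hg.dist_le_mul (Φ (Function.update e j y)) (Φ (Function.update e j (-b₀)))
    rw [Real.dist_eq, Real.dist_eq] at h1
    exact h1.trans (mul_le_mul_of_nonneg_left (h.osc_le e j y) C.2)
  left e j y hy := by rw [h.left e j y hy]
  right e j y hy := by rw [h.right e j y hy]

/-- The score jumps by 1 at the origin, strictly inside $(-b_0,b_0)$, and is constant elsewhere. -/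
lemma isTest_sum_checkScore {τ : ℝ} (h0 : 0 ≤ τ) (h1 : τ ≤ 1) (hb₀ : 0 < b₀) (c : Fin n → ℝ)
    (a : ℝ) :
    IsTest b₀ (fun e => ∑ j, c j * checkScore τ (e j) + a) (fun j _ => |c j|) := by
  have hs : ∀ (e : Fin n → ℝ) j y, ∑ i, c i * checkScore τ (Function.update e j y i)
      = c j * checkScore τ y + ∑ i ∈ Finset.univ.erase j, c i * checkScore τ (e i) := by
    intro e j y
    rw [← Finset.add_sum_erase _ _ (Finset.mem_univ j), Function.update_self]
    congr 1
    exact Finset.sum_congr rfl fun i hi => by rw [Function.update_of_ne (Finset.ne_of_mem_erase hi)]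
  have hψ : BddMeas (checkScore τ) := ⟨measurable_checkScore τ, 1, abs_checkScore_le h0 h1⟩
  refine ⟨(BddMeas.sum _ fun j => (hψ.comp (measurable_pi_apply j)).const_mul (c j)).add
      (BddMeas.const a),
    fun j => BddMeas.const _, fun _ _ _ => rfl, fun e j y => ?_, fun e j y hy => ?_,
    fun e j y hy => ?_⟩
  · rw [hs, hs]
    have : |checkScore τ y - checkScore τ (-b₀)| ≤ 1 := by
      unfold checkScore; split_ifs <;> simp
    calc _ = |c j| * |checkScore τ y - checkScore τ (-b₀)| := by rw [← abs_mul]; congr 1; ring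
      _ ≤ _ := mul_le_of_le_one_right (abs_nonneg _) this
  · rw [hs, hs]; unfold checkScore; rw [if_pos (by linarith), if_pos (by linarith)]
  · rw [hs, hs]; unfold checkScore
    rw [if_neg (not_lt.2 (by linarith)), if_neg (not_lt.2 (by linarith))]

end Tests

/-- Energy of the gap between two ordered frozen fits. -/
lemma QuantileNoise.gap_sq_le {ν : Measure ℝ} [IsProbabilityMeasure ν] {τ f₀ b₀ K b : ℝ}
    (N : QuantileNoise ν τ f₀ b₀ K) (hb : b ≤ b₀) {z z' : ℝ → ℝ} (Z : FrozenProfile b₀ b z)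
    (Z' : FrozenProfile b₀ b z') :
    (max 0 (z' (-b₀) - z b₀)) ^ 2 ≤ 8 * K * ∫ y, max 0 (min (y - z y) (z' y - y)) ∂ν := by
  have hK := N.K_pos
  rcases le_or_gt (z' (-b₀) - z b₀) 0 with h | h
  · rw [max_eq_left h]
    have : 0 ≤ ∫ y, max 0 (min (y - z y) (z' y - y)) ∂ν :=
      integral_nonneg fun _ => le_max_left _ _
    rw [zero_pow two_ne_zero]; positivity
  · rw [max_eq_right h.le]
    set g := z' (-b₀) - z b₀ with hg
    have h1 := neg_le_of_abs_le (Z.abs_le b₀)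
    have h2 := le_of_abs_le (Z'.abs_le (-b₀))
    -- On the middle half of the gap, of length $g/2$ and mass at least $g/(2K)$, the error is at
    -- distance at least $g/4$ from both fits.
    have h3 := N.mass_lower (z b₀ + g / 4) (z' (-b₀) - g / 4) (by linarith) (by linarith)
      (by linarith)
    have h4 : g / 4 * ν.real (Set.Ioo (z b₀ + g / 4) (z' (-b₀) - g / 4))
        ≤ ∫ y, max 0 (min (y - z y) (z' y - y)) ∂ν := by
      rw [show ν.real (Set.Ioo (z b₀ + g / 4) (z' (-b₀) - g / 4)) =
        ∫ y, (if y ∈ Set.Ioo (z b₀ + g / 4) (z' (-b₀) - g / 4) then (1 : ℝ) else 0) ∂ν from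
        (integral_ite_eq (p := fun y => y ∈ Set.Ioo (z b₀ + g / 4) (z' (-b₀) - g / 4))
          measurableSet_Ioo).symm, ← integral_const_mul]
      have hm : BddMeas fun y => max 0 (min (y - z y) (z' y - y)) := by
        refine ⟨(measurable_const.max ((measurable_id.sub Z.meas).min (Z'.meas.sub measurable_id))),
          2 * b, fun y => ?_⟩
        have a1 := neg_le_of_abs_le (Z.abs_le y)
        have a2 := le_of_abs_le (Z'.abs_le y)
        rw [abs_of_nonneg (le_max_left _ _)]
        have hb0 : 0 ≤ b := (abs_nonneg _).trans (Z.abs_le 0)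
        refine max_le (by linarith) ?_
        rcases le_total (y - z y) (z' y - y) with h5 | h5
        · rw [min_eq_left h5]; linarith
        · rw [min_eq_right h5]; linarith
      refine BddMeas.integral_mono ((BddMeas.ite measurableSet_Ioo).const_mul _) hm fun y => ?_
      split_ifs with hy
      · rw [mul_one]
        refine le_max_of_le_right (le_min ?_ ?_)
        · linarith [hy.1, Z.upper y]
        · linarith [hy.2, Z'.lower y]
      · rw [mul_zero]; exact le_max_left _ _
    nlinarith

/-! ### Oscillation of differences of values -/

section LocalModel

open scoped RealInnerProductSpace

variable {E : Type*} [NormedAddCommGroup E] [InnerProductSpace ℝ E] [FiniteDimensional ℝ E]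
  [MeasurableSpace E] [BorelSpace E] {n : ℕ}

lemma IsParseval.sum_le_one {x : Fin n → E} (hx : IsParseval x) {w : E} (hw : ‖w‖ ≤ 1) :
    ∑ j, |⟪x j, w⟫| ^ 2 ≤ 1 := by
  simp only [sq_abs]; rw [hx w]; exact pow_le_one₀ (norm_nonneg _) hw

namespace LocalModel

variable {ν : Measure ℝ} [IsProbabilityMeasure ν] {τ f₀ b₀ K ρ b κ : ℝ} {x : Fin n → E}
  (M : LocalModel ν τ f₀ b₀ K x ρ b) (hκ : 0 < κ)
include M hκ

lemma sum_width_ridge_le (q : E) {c : Fin n → ℝ} (hc : ∀ j, 0 ≤ c j) (hc1 : ∑ j, c j ^ 2 ≤ 1) :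
    ∑ j, c j * ∫ e, (⟪x j, ridgeFit τ x ρ κ q (Function.update e j b₀)⟫
        - ⟪x j, ridgeFit τ x ρ κ q (Function.update e j (-b₀))⟫) ∂(Measure.pi fun _ => ν)
      ≤ √(2 * K) * b := by
  have S := M.selection hκ q
  refine (M.noise.sum_width_le S M.fit_le M.b_le hc).trans ?_
  refine le_trans ?_ (mul_sqrt_weighted_le M.fit_le M.radius_pos.le M.b_nonneg hc1
    (by linarith [M.noise.K_pos]))
  refine mul_le_mul_of_nonneg_right ?_ (Real.sqrt_nonneg _)
  rw [Real.sqrt_le_left M.radius_pos.le]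
  refine (BddMeas.integral_mono S.bddMeas_norm.sq (BddMeas.const (ρ ^ 2)) fun e =>
    pow_le_pow_left₀ (norm_nonneg _) (S.norm_le e) 2).trans ?_
  simp

lemma bddMeas_gap (q q' : E) (j : Fin n) : BddMeas fun e : Fin n → ℝ =>
    max 0 (min (e j - ⟪x j, ridgeFit τ x ρ κ q e⟫) (⟪x j, ridgeFit τ x ρ κ q' e⟫ - e j)) := by
  have S := M.selection hκ q
  have S' := M.selection hκ q'
  have hb := M.b_nonneg
  refine ⟨measurable_const.max (((measurable_pi_apply j).sub (S.measurable_fit j)).min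
    ((S'.measurable_fit j).sub (measurable_pi_apply j))), 2 * b, fun e => ?_⟩
  have a1 := neg_le_of_abs_le (S.abs_fit_le M.fit_le e j)
  have a2 := le_of_abs_le (S'.abs_fit_le M.fit_le e j)
  rw [abs_of_nonneg (le_max_left _ _)]
  refine max_le (by linarith) ?_
  rcases le_total (e j - ⟪x j, ridgeFit τ x ρ κ q e⟫) (⟪x j, ridgeFit τ x ρ κ q' e⟫ - e j)
    with h5 | h5
  · rw [min_eq_left h5]; linarith
  · rw [min_eq_right h5]; linarith

lemma sum_gap_sq_le (q q' : E) :
    ∑ j, ∫ e, (max 0 (⟪x j, ridgeFit τ x ρ κ q' (Function.update e j (-b₀))⟫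
        - ⟪x j, ridgeFit τ x ρ κ q (Function.update e j b₀)⟫)) ^ 2 ∂(Measure.pi fun _ => ν)
      ≤ 8 * K * ∫ e, ∑ j, max 0 (min (e j - ⟪x j, ridgeFit τ x ρ κ q e⟫)
          (⟪x j, ridgeFit τ x ρ κ q' e⟫ - e j)) ∂(Measure.pi fun _ => ν) := by
  have S := M.selection hκ q
  have S' := M.selection hκ q'
  have hm := M.bddMeas_gap hκ q q'
  rw [integral_finsetSum _ fun j _ => (hm j).integrable, Finset.mul_sum]
  refine Finset.sum_le_sum fun j _ => ?_
  rw [← integral_const_mul]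
  refine integral_le_of_resample j ((BddMeas.const 0).max
    (((S'.bddMeas_fit M.fit_le j).comp (measurable_update_const j _)).sub
    ((S.bddMeas_fit M.fit_le j).comp (measurable_update_const j _)))).sq
    ((hm j).const_mul _) fun e => ?_
  simp only [Function.update_idem, Function.update_self, integral_const_mul]
  have := M.noise.gap_sq_le M.b_le (S.frozenProfile M.fit_le M.b_le e j)
    (S'.frozenProfile M.fit_le M.b_le e j)
  simpa using this

/-- The energy of the gaps between two fits is controlled by the variation of the values. -/
lemma sum_gap_sq_add_le (q q' : E) :
    ∑ j, ∫ e, (max 0 (⟪x j, ridgeFit τ x ρ κ q' (Function.update e j (-b₀))⟫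
        - ⟪x j, ridgeFit τ x ρ κ q (Function.update e j b₀)⟫)) ^ 2 ∂(Measure.pi fun _ => ν)
      + ∑ j, ∫ e, (max 0 (⟪x j, ridgeFit τ x ρ κ q (Function.update e j (-b₀))⟫
        - ⟪x j, ridgeFit τ x ρ κ q' (Function.update e j b₀)⟫)) ^ 2 ∂(Measure.pi fun _ => ν)
      ≤ 8 * K * ∫ e, ⟪q' - q, ridgeFit τ x ρ κ q' e - ridgeFit τ x ρ κ q e⟫
          ∂(Measure.pi fun _ => ν) := by
  have S := M.selection hκ q
  have S' := M.selection hκ q'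
  have h1 := M.sum_gap_sq_le hκ q q'
  have h2 := M.sum_gap_sq_le hκ q' q
  refine (add_le_add h1 h2).trans ?_
  rw [← mul_add]
  refine mul_le_mul_of_nonneg_left ?_ (by linarith [M.noise.K_pos])
  have hm : ∀ q q' : E, BddMeas fun e : Fin n → ℝ =>
      ∑ j, max 0 (min (e j - ⟪x j, ridgeFit τ x ρ κ q e⟫)
      (⟪x j, ridgeFit τ x ρ κ q' e⟫ - e j)) := fun q q' =>
    BddMeas.sum _ fun j => M.bddMeas_gap hκ q q' j
  rw [← integral_add (hm q q').integrable (hm q' q).integrable]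
  have hi : BddMeas fun e => ⟪q' - q, ridgeFit τ x ρ κ q' e - ridgeFit τ x ρ κ q e⟫ := by
    simp only [inner_sub_right]
    exact (S'.bddMeas_inner _).sub (S.bddMeas_inner _)
  refine BddMeas.integral_mono ((hm q q').add (hm q' q)) hi fun e => ?_
  -- Each maximizer competes in the problem of the other. In the sum of the two inequalities the
  -- objectives cancel and only the change of linear term remains.
  have g1 := objective_ridge_gap' hκ.le (S.mem e) (fun t ht => S.isMaxOn e t ht) (S'.mem e)
  have g2 := objective_ridge_gap' hκ.le (S'.mem e) (fun t ht => S'.isMaxOn e t ht) (S.mem e)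
  rw [objective_ridge_sub (q := q) (q' := q'), objective_ridge_sub (q := q) (q' := q')] at g2
  rw [inner_sub_right]
  linarith

/-- Total weighted oscillation of a difference of values. -/
lemma sum_ridgeOsc_le (q q' : E) {c : Fin n → ℝ} (hc : ∀ j, 0 ≤ c j) (hc1 : ∑ j, c j ^ 2 ≤ 1) :
    ∑ j, c j * ∫ e, ridgeOsc τ x ρ κ b₀ q q' j e ∂(Measure.pi fun _ => ν)
      ≤ √(16 * K * ∫ e, ⟪q' - q, ridgeFit τ x ρ κ q' e - ridgeFit τ x ρ κ q e⟫
          ∂(Measure.pi fun _ => ν)) + 2 * (√(2 * K) * b) := by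
  have S := M.selection hκ q
  have S' := M.selection hκ q'
  set μ : Measure (Fin n → ℝ) := Measure.pi fun _ => ν with hμ
  set zp : Fin n → (Fin n → ℝ) → ℝ := fun j e =>
    ⟪x j, ridgeFit τ x ρ κ q (Function.update e j b₀)⟫ with hzp
  set zm : Fin n → (Fin n → ℝ) → ℝ := fun j e =>
    ⟪x j, ridgeFit τ x ρ κ q (Function.update e j (-b₀))⟫ with hzm
  set zp' : Fin n → (Fin n → ℝ) → ℝ := fun j e =>
    ⟪x j, ridgeFit τ x ρ κ q' (Function.update e j b₀)⟫ with hzp'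
  set zm' : Fin n → (Fin n → ℝ) → ℝ := fun j e =>
    ⟪x j, ridgeFit τ x ρ κ q' (Function.update e j (-b₀))⟫ with hzm'
  have bzp : ∀ j, BddMeas (zp j) := fun j =>
    (S.bddMeas_fit M.fit_le j).comp (measurable_update_const j _)
  have bzm : ∀ j, BddMeas (zm j) := fun j =>
    (S.bddMeas_fit M.fit_le j).comp (measurable_update_const j _)
  have bzp' : ∀ j, BddMeas (zp' j) := fun j =>
    (S'.bddMeas_fit M.fit_le j).comp (measurable_update_const j _)
  have bzm' : ∀ j, BddMeas (zm' j) := fun j =>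
    (S'.bddMeas_fit M.fit_le j).comp (measurable_update_const j _)
  set G : Fin n → (Fin n → ℝ) → ℝ := fun j e =>
    max 0 (zm' j e - zp j e) + max 0 (zm j e - zp' j e) with hG
  have bG1 : ∀ j, BddMeas fun e => max 0 (zm' j e - zp j e) := fun j =>
    (BddMeas.const 0).max ((bzm' j).sub (bzp j))
  have bG2 : ∀ j, BddMeas fun e => max 0 (zm j e - zp' j e) := fun j =>
    (BddMeas.const 0).max ((bzm j).sub (bzp' j))
  have bG : ∀ j, BddMeas (G j) := fun j => (bG1 j).add (bG2 j)
  have hG0 : ∀ j e, 0 ≤ G j e := fun j e => add_nonneg (le_max_left _ _) (le_max_left _ _)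
  -- The interval spanned by the two fits is covered by the interval of each fit and, when these are
  -- disjoint, by the gap between them.
  have hpt : ∀ j e, ridgeOsc τ x ρ κ b₀ q q' j e
      ≤ G j e + ((zp j e - zm j e) + (zp' j e - zm' j e)) := by
    intro j e
    change max (zp j e) (zp' j e) - min (zm j e) (zm' j e) ≤ _
    have a1 : zm j e ≤ zp j e := (S.frozenProfile M.fit_le M.b_le e j).upper (-b₀)
    have a2 : zm' j e ≤ zp' j e := (S'.frozenProfile M.fit_le M.b_le e j).upper (-b₀)
    have a3 : zm' j e - zp j e ≤ max 0 (zm' j e - zp j e) := le_max_right _ _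
    have a4 : zm j e - zp' j e ≤ max 0 (zm j e - zp' j e) := le_max_right _ _
    have a5 : 0 ≤ max 0 (zm' j e - zp j e) := le_max_left _ _
    have a6 : 0 ≤ max 0 (zm j e - zp' j e) := le_max_left _ _
    simp only [hG]
    rcases le_total (zp j e) (zp' j e) with h | h <;>
      rcases le_total (zm j e) (zm' j e) with h' | h' <;>
      simp only [max_eq_left h, max_eq_right h, min_eq_left h', min_eq_right h'] <;> linarith
  have hint : ∀ j, ∫ e, ridgeOsc τ x ρ κ b₀ q q' j e ∂μ
      ≤ ∫ e, G j e ∂μ + (∫ e, (zp j e - zm j e) ∂μ + ∫ e, (zp' j e - zm' j e) ∂μ) := by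
    intro j
    rw [← integral_add ((bzp j).sub (bzm j)).integrable ((bzp' j).sub (bzm' j)).integrable,
      ← integral_add (bG j).integrable
        (((bzp j).sub (bzm j)).add ((bzp' j).sub (bzm' j))).integrable]
    exact BddMeas.integral_mono ((M.isTest_ridgeValue_sub hκ q q').bdd_osc j)
      ((bG j).add (((bzp j).sub (bzm j)).add ((bzp' j).sub (bzm' j)))) (hpt j)
  have hsum : ∑ j, c j * ∫ e, ridgeOsc τ x ρ κ b₀ q q' j e ∂μ
      ≤ ∑ j, c j * ∫ e, G j e ∂μ + (∑ j, c j * ∫ e, (zp j e - zm j e) ∂μ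
        + ∑ j, c j * ∫ e, (zp' j e - zm' j e) ∂μ) := by
    rw [← Finset.sum_add_distrib, ← Finset.sum_add_distrib]
    refine Finset.sum_le_sum fun j _ => ?_
    have := mul_le_mul_of_nonneg_left (hint j) (hc j)
    linarith
  have w1 : ∑ j, c j * ∫ e, (zp j e - zm j e) ∂μ ≤ √(2 * K) * b := M.sum_width_ridge_le hκ q hc hc1
  have w2 : ∑ j, c j * ∫ e, (zp' j e - zm' j e) ∂μ ≤ √(2 * K) * b :=
    M.sum_width_ridge_le hκ q' hc hc1
  have w3 : ∑ j, c j * ∫ e, G j e ∂μ ≤ √(16 * K * ∫ e, ⟪q' - q, ridgeFit τ x ρ κ q' e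
      - ridgeFit τ x ρ κ q e⟫ ∂μ) := by
    refine Real.le_sqrt_of_sq_le ?_
    refine (Finset.sum_mul_sq_le_sq_mul_sq _ _ _).trans ?_
    have hGsq : ∀ j, (∫ e, G j e ∂μ) ^ 2 ≤ 2 * (∫ e, (max 0 (zm' j e - zp j e)) ^ 2 ∂μ)
        + 2 * ∫ e, (max 0 (zm j e - zp' j e)) ^ 2 ∂μ := by
      intro j
      have i1 : ∫ e, G j e ∂μ ≤ √(∫ e, G j e ^ 2 ∂μ) := by
        refine le_trans (BddMeas.integral_mono (bG j) (bG j).abs fun e => le_abs_self _) ?_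
        exact (bG j).integral_abs_le_sqrt
      have i2 : 0 ≤ ∫ e, G j e ∂μ := integral_nonneg (hG0 j)
      have i3 : 0 ≤ ∫ e, G j e ^ 2 ∂μ := integral_nonneg fun _ => sq_nonneg _
      rw [← integral_const_mul, ← integral_const_mul,
        ← integral_add ((bG1 j).sq.const_mul _).integrable ((bG2 j).sq.const_mul _).integrable]
      refine ((Real.le_sqrt i2 i3).1 i1).trans (BddMeas.integral_mono (bG j).sq
        (((bG1 j).sq.const_mul _).add ((bG2 j).sq.const_mul _)) fun e => ?_)
      simp only [hG]
      nlinarith [sq_nonneg (max 0 (zm' j e - zp j e) - max 0 (zm j e - zp' j e))]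
    have hs0 : 0 ≤ ∑ j, (∫ e, G j e ∂μ) ^ 2 := Finset.sum_nonneg fun _ _ => sq_nonneg _
    have hen := M.sum_gap_sq_add_le hκ q q'
    calc (∑ j, c j ^ 2) * ∑ j, (∫ e, G j e ∂μ) ^ 2 ≤ ∑ j, (∫ e, G j e ∂μ) ^ 2 :=
          mul_le_of_le_one_left hs0 hc1
      _ ≤ ∑ j, (2 * (∫ e, (max 0 (zm' j e - zp j e)) ^ 2 ∂μ)
        + 2 * ∫ e, (max 0 (zm j e - zp' j e)) ^ 2 ∂μ) := Finset.sum_le_sum fun j _ => hGsq j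
      _ = 2 * (∑ j, (∫ e, (max 0 (zm' j e - zp j e)) ^ 2 ∂μ)
        + ∑ j, ∫ e, (max 0 (zm j e - zp' j e)) ^ 2 ∂μ) := by
          rw [Finset.sum_add_distrib, ← Finset.mul_sum, ← Finset.mul_sum, mul_add]
      _ ≤ _ := by linarith
  linarith

end LocalModel

end LocalModel

/-- Solving a quadratic self-bounding inequality. -/
lemma sq_le_of_self_bounding {K b C m s A f₀ : ℝ} (hK : 1 ≤ K) (hb : 0 ≤ b) (hb1 : b ≤ 1)
    (hs1 : 1 ≤ s) (hss : s ^ 2 = C * m) (hf : 1 ≤ K * f₀)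
    (h4 : f₀ * A ^ 2 ≤ A * √(2 * m) + b * (7 * K ^ 2 * s * A + 121 * K ^ 2 * s)) (hm : 0 ≤ m) :
    A ^ 2 ≤ (4 * K ^ 2 + 340 * K ^ 6 * b * C) * m := by
  have hK0 : 0 < K := by linarith
  have h5 : A ^ 2 ≤ K * (f₀ * A ^ 2) := by
    have := mul_le_mul_of_nonneg_right hf (sq_nonneg A)
    linarith
  set Y := √(2 * m) + 7 * K ^ 2 * b * s with hY
  have h6 : A ^ 2 ≤ K * (A * Y) + 121 * K ^ 3 * b * s := by
    have := mul_le_mul_of_nonneg_left h4 hK0.le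
    refine h5.trans (this.trans (le_of_eq ?_))
    rw [hY]; ring
  have h7 : A ^ 2 ≤ K ^ 2 * Y ^ 2 + 242 * K ^ 3 * b * s := by
    have := sq_nonneg (A - K * Y)
    linear_combination 2 * h6 + this
  have h8 : Y ^ 2 ≤ 2 * (2 * m) + 2 * (7 * K ^ 2 * b * s) ^ 2 := by
    have h := Real.sq_sqrt (by linarith : 0 ≤ 2 * m)
    have := sq_nonneg (√(2 * m) - 7 * K ^ 2 * b * s)
    rw [← h, hY]; linear_combination this
  have h9 : K ^ 3 * b * s ≤ K ^ 6 * b * (C * m) := by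
    have e1 : K ^ 3 ≤ K ^ 6 := pow_le_pow_right₀ hK (by norm_num)
    have e2 : s ≤ C * m := by rw [← hss]; nlinarith
    have e3 : K ^ 3 * b ≤ K ^ 6 * b := mul_le_mul_of_nonneg_right e1 hb
    exact mul_le_mul e3 e2 (by linarith) (by positivity)
  have h10 : K ^ 6 * b ^ 2 * (C * m) ≤ K ^ 6 * b * (C * m) := by
    have : b ^ 2 ≤ b := by nlinarith [hb1]
    have h0 : 0 ≤ C * m := hss ▸ sq_nonneg s
    gcongr
  have h11 : K ^ 2 * Y ^ 2 ≤ 4 * K ^ 2 * m + 98 * (K ^ 6 * b ^ 2 * (C * m)) := by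
    have := mul_le_mul_of_nonneg_left h8 (sq_nonneg K)
    refine this.trans (le_of_eq ?_)
    rw [← hss]; ring
  linarith

/-! ### Second moments of the fits in a fixed direction -/

section LocalModel

open scoped RealInnerProductSpace

variable {E : Type*} [NormedAddCommGroup E] [InnerProductSpace ℝ E] [FiniteDimensional ℝ E]
  [MeasurableSpace E] [BorelSpace E] {n : ℕ}

/-- The fits have second moments of order one in every direction. -/
def HasMomentBound (ν : Measure ℝ) (τ : ℝ) (x : Fin n → E) (ρ κ C : ℝ) : Prop :=
  ∀ q w : E, ‖w‖ ≤ 1 →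
    ∫ e, ⟪w, ridgeFit τ x ρ κ q e⟫ ^ 2 ∂(Measure.pi fun _ => ν) ≤ C * (1 + ‖q‖ ^ 2)

namespace LocalModel

variable {ν : Measure ℝ} [IsProbabilityMeasure ν] {τ f₀ b₀ K ρ b κ C : ℝ} {x : Fin n → E}
  (M : LocalModel ν τ f₀ b₀ K x ρ b)
include M

lemma integral_score_sq_le {w : E} (hw : ‖w‖ ≤ 1) (a : ℝ) :
    ∫ e, (∑ j, ⟪x j, w⟫ * checkScore τ (e j) + a) ^ 2 ∂(Measure.pi fun _ => ν)
      ≤ 2 + 2 * a ^ 2 := by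
  have N := M.noise
  have hs : BddMeas fun e : Fin n → ℝ => ∑ j, ⟪x j, w⟫ * checkScore τ (e j) :=
    BddMeas.sum _ fun j => (N.bddMeas_checkScore.comp (measurable_pi_apply j)).const_mul _
  have h1 : ∫ e, (∑ j, ⟪x j, w⟫ * checkScore τ (e j)) ^ 2 ∂(Measure.pi fun _ => ν) ≤ 1 := by
    have h := integral_norm_sq_sum_le (n := n) N.bddMeas_checkScore N.integral_checkScore
      (N.integral_checkScore_sq.le.trans
        (by nlinarith [sq_nonneg (τ - 1 / 2)] : τ * (1 - τ) ≤ 1)) fun j => ⟪x j, w⟫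
    simp only [smul_eq_mul, Real.norm_eq_abs, one_mul, sq_abs] at h
    refine le_trans (le_of_eq ?_) (h.trans ?_)
    · congr 1; ext e; congr 1; exact Finset.sum_congr rfl fun j _ => mul_comm _ _
    · simpa using M.parseval.sum_le_one hw
  calc _ ≤ ∫ e, (2 * (∑ j, ⟪x j, w⟫ * checkScore τ (e j)) ^ 2 + 2 * a ^ 2)
        ∂(Measure.pi fun _ => ν) := by
        refine BddMeas.integral_mono (hs.add (BddMeas.const a)).sq
          ((hs.sq.const_mul 2).add (BddMeas.const _)) fun e => ?_
        nlinarith [sq_nonneg (∑ j, ⟪x j, w⟫ * checkScore τ (e j) - a)]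
    _ ≤ _ := by
        rw [integral_add (hs.sq.const_mul 2).integrable (integrable_const _), integral_const_mul]
        simp only [integral_const, probReal_univ, one_smul]
        linarith

variable (hκ : 0 < κ)
include hκ

lemma integral_fit_sq_le (hC : HasMomentBound ν τ x ρ κ C) (q : E) (j : Fin n) :
    ∫ e, ⟪x j, ridgeFit τ x ρ κ q e⟫ ^ 2 ∂(Measure.pi fun _ => ν)
      ≤ C * (1 + ‖q‖ ^ 2) * ‖x j‖ ^ 2 := by
  rcases eq_or_ne (x j) 0 with h | h
  · simp [h]
  · have hn : ‖x j‖ ≠ 0 := norm_ne_zero_iff.2 h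
    have h1 := hC q (‖x j‖⁻¹ • x j) (by rw [norm_smul, norm_inv, norm_norm, inv_mul_cancel₀ hn])
    simp only [inner_smul_left, conj_trivial, mul_pow] at h1
    rw [integral_const_mul, inv_pow, inv_mul_le_iff₀ (by positivity)] at h1
    linarith

/-- In $|\Phi|z_j^2=|\Phi z_j|\,|z_j|$ the directional moment bound is applied to the second factor,
while the squares of the first sum to $\Phi^2\|\theta\|^2\le\rho^2\Phi^2$ by Parseval. The radius is
then absorbed by $\|x_j\|\rho\le b$. -/
lemma sum_integral_sq_le (hC : HasMomentBound ν τ x ρ κ C) (hC0 : 0 ≤ C) (q : E) {w : E}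
    (hw : ‖w‖ ≤ 1) {Φ : (Fin n → ℝ) → ℝ} (hΦ : BddMeas Φ) :
    ∑ j, |⟪x j, w⟫| * ∫ e, |Φ e| * ⟪x j, ridgeFit τ x ρ κ q e⟫ ^ 2 ∂(Measure.pi fun _ => ν)
      ≤ b * √(C * (1 + ‖q‖ ^ 2)) * √(∫ e, Φ e ^ 2 ∂(Measure.pi fun _ => ν)) := by
  have S := M.selection hκ q
  set μ : Measure (Fin n → ℝ) := Measure.pi fun _ => ν with hμ
  set z : Fin n → (Fin n → ℝ) → ℝ := fun j e => ⟪x j, ridgeFit τ x ρ κ q e⟫ with hz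
  have bz : ∀ j, BddMeas (z j) := fun j => S.bddMeas_inner (x j)
  have h1 : ∀ j, ∫ e, |Φ e| * z j e ^ 2 ∂μ
      ≤ √(∫ e, (Φ e * z j e) ^ 2 ∂μ) * (√(C * (1 + ‖q‖ ^ 2)) * ‖x j‖) := fun j => by
    have a1 := (hΦ.mul (bz j)).abs.integral_mul_le (μ := μ) (bz j).abs
    simp only [sq_abs] at a1
    refine le_trans (le_of_eq ?_) (a1.trans (mul_le_mul_of_nonneg_left ?_ (Real.sqrt_nonneg _)))
    · congr 1; ext e; rw [abs_mul, mul_assoc, abs_mul_abs_self, sq]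
    · rw [← Real.sqrt_sq (norm_nonneg (x j)), ← Real.sqrt_mul (by positivity)]
      exact Real.sqrt_le_sqrt (M.integral_fit_sq_le hκ hC q j)
  have h2 : ∑ j, ∫ e, (Φ e * z j e) ^ 2 ∂μ ≤ ρ ^ 2 * ∫ e, Φ e ^ 2 ∂μ := by
    rw [← integral_finsetSum _ fun j _ => (hΦ.mul (bz j)).sq.integrable, ← integral_const_mul]
    refine BddMeas.integral_mono (BddMeas.sum _ fun j => (hΦ.mul (bz j)).sq) (hΦ.sq.const_mul _)
      fun e => ?_
    simp only [mul_pow]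
    rw [← Finset.mul_sum, M.parseval (ridgeFit τ x ρ κ q e), mul_comm]
    exact mul_le_mul_of_nonneg_right (pow_le_pow_left₀ (norm_nonneg _) (S.norm_le e) 2)
      (sq_nonneg _)
  calc ∑ j, |⟪x j, w⟫| * ∫ e, |Φ e| * z j e ^ 2 ∂μ
      ≤ ∑ j, √(C * (1 + ‖q‖ ^ 2)) * ((|⟪x j, w⟫| * ‖x j‖) * √(∫ e, (Φ e * z j e) ^ 2 ∂μ)) := by
        refine Finset.sum_le_sum fun j _ => ?_
        refine (mul_le_mul_of_nonneg_left (h1 j) (abs_nonneg _)).trans (le_of_eq (by ring))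
    _ = √(C * (1 + ‖q‖ ^ 2)) * ∑ j, (|⟪x j, w⟫| * ‖x j‖) * √(∫ e, (Φ e * z j e) ^ 2 ∂μ) := by
        rw [Finset.mul_sum]
    _ ≤ √(C * (1 + ‖q‖ ^ 2)) * (√(∑ j, (|⟪x j, w⟫| * ‖x j‖) ^ 2)
          * √(∑ j, √(∫ e, (Φ e * z j e) ^ 2 ∂μ) ^ 2)) := by
        refine mul_le_mul_of_nonneg_left ?_ (Real.sqrt_nonneg _)
        exact Real.sum_mul_le_sqrt_mul_sqrt _ _ _
    _ ≤ √(C * (1 + ‖q‖ ^ 2)) * (√(∑ j, (|⟪x j, w⟫| * ‖x j‖) ^ 2)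
          * (ρ * √(∫ e, Φ e ^ 2 ∂μ))) := by
        gcongr
        refine le_trans (Real.sqrt_le_sqrt (y := ρ ^ 2 * ∫ e, Φ e ^ 2 ∂μ) ?_)
          (by rw [Real.sqrt_mul (sq_nonneg ρ), Real.sqrt_sq M.radius_pos.le])
        refine le_trans (le_of_eq (Finset.sum_congr rfl fun j _ => ?_)) h2
        exact Real.sq_sqrt (integral_nonneg fun _ => sq_nonneg _)
    _ = √(C * (1 + ‖q‖ ^ 2)) * (ρ * √(1 * ∑ j, |⟪x j, w⟫| ^ 2 * ‖x j‖ ^ 2))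
          * √(∫ e, Φ e ^ 2 ∂μ) := by simp only [mul_pow, one_mul]; ring
    _ ≤ √(C * (1 + ‖q‖ ^ 2)) * (√1 * b) * √(∫ e, Φ e ^ 2 ∂μ) := by
        refine mul_le_mul_of_nonneg_right (mul_le_mul_of_nonneg_left ?_ (Real.sqrt_nonneg _))
          (Real.sqrt_nonneg _)
        exact mul_sqrt_weighted_le M.fit_le M.radius_pos.le M.b_nonneg (M.parseval.sum_le_one hw)
          zero_le_one
    _ = _ := by rw [Real.sqrt_one]; ring

/-- The fit in direction `w` is dominated, against nonnegative test functions, by the linear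
statistic. -/
lemma integral_test_mul_le (hC : HasMomentBound ν τ x ρ κ C) (hC0 : 0 ≤ C) (q : E) {w : E}
    (hw : ‖w‖ ≤ 1) {Φ : (Fin n → ℝ) → ℝ} {D : Fin n → (Fin n → ℝ) → ℝ} (hΦ : IsTest b₀ Φ D)
    (hΦ0 : ∀ e, 0 ≤ Φ e) :
    ∫ e, Φ e * (f₀ * ⟪w, ridgeFit τ x ρ κ q e⟫
        - (∑ j, ⟪x j, w⟫ * checkScore τ (e j) + ⟪q, w⟫) + κ * ⟪w, ridgeFit τ x ρ κ q e⟫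
        - max 0 (-⟪w, ridgeFit τ x ρ κ q e⟫) / ρ ^ 2 * ridgeValue τ x ρ κ q e)
          ∂(Measure.pi fun _ => ν)
      ≤ b * ((K ^ 2 * √(C * (1 + ‖q‖ ^ 2)) + 3 * K * √(2 * K))
          * √(∫ e, Φ e ^ 2 ∂(Measure.pi fun _ => ν))
        + 11 * K * ∑ j, |⟪x j, w⟫| * ∫ e, D j e ∂(Measure.pi fun _ => ν)) := by
  have N := M.noise
  have S := M.selection hκ q
  have hz := fun j => S.bddMeas_inner (x j)
  have hlin := N.integral_counting_le S M.parseval M.fit_le M.b_le hΦ M.radius_pos.le M.b_nonneg hw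
  have hsq := M.sum_integral_sq_le hκ hC hC0 q hw hΦ.bdd
  have hψ : ∀ j, BddMeas fun e : Fin n → ℝ => checkScore τ (e j) := fun j =>
    N.bddMeas_checkScore.comp (measurable_pi_apply j)
  have m5 : ∀ j, BddMeas fun e : Fin n → ℝ =>
      if e j < ⟪x j, ridgeFit τ x ρ κ q e⟫ then (1 : ℝ) else 0 := fun j =>
    BddMeas.ite (measurableSet_lt (measurable_pi_apply j) (hz j).1)
  have m6 : ∀ j, BddMeas fun e : Fin n → ℝ =>
      if e j = ⟪x j, ridgeFit τ x ρ κ q e⟫ then (1 : ℝ) else 0 := fun j =>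
    BddMeas.ite (measurableSet_eq_fun (measurable_pi_apply j) (hz j).1)
  have m2 : ∀ j, BddMeas fun e : Fin n → ℝ => if e j < 0 then (1 : ℝ) else 0 := fun j =>
    BddMeas.ite (measurableSet_lt (measurable_pi_apply j) measurable_const)
  refine le_trans (BddMeas.integral_mono ?_ ?_ fun e => ?_) (hlin.trans ?_)
  · have hw' := S.bddMeas_inner w
    have hmax : BddMeas fun e => max 0 (-⟪w, ridgeFit τ x ρ κ q e⟫) / ρ ^ 2 := by
      simp only [div_eq_inv_mul]
      exact ((BddMeas.const 0).max hw'.neg).const_mul _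
    exact hΦ.bdd.mul ((((hw'.const_mul _).sub ((BddMeas.sum _ fun j => (hψ j).const_mul _).add
      (BddMeas.const _))).add (hw'.const_mul _)).sub (hmax.mul (M.bddMeas_ridgeValue hκ q)))
  · exact (hΦ.bdd.mul (((S.bddMeas_inner w).const_mul _).sub (BddMeas.sum _ fun j =>
      ((m5 j).sub (m2 j)).const_mul _))).add (hΦ.bdd.abs.mul (BddMeas.sum _ fun j =>
        (m6 j).const_mul _))
  -- With the direction `-w` the multiplier of the ball acts only where $\langle w,\theta\rangle<0$.
  · have h1 := M.score_le hκ q (-w) e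
    have h2 : ∑ j, ⟪x j, w⟫ * ((if e j < ⟪x j, ridgeFit τ x ρ κ q e⟫ then (1 : ℝ) else 0)
        - if e j < 0 then (1 : ℝ) else 0)
        = ∑ j, ⟪x j, w⟫ * checkScore τ (e j)
          - ∑ j, ⟪x j, w⟫ * checkScore τ (e j - ⟪x j, ridgeFit τ x ρ κ q e⟫) := by
      rw [← Finset.sum_sub_distrib]
      refine Finset.sum_congr rfl fun j _ => ?_
      unfold checkScore
      simp only [sub_neg]
      split_ifs <;> ring
    rw [h2, abs_of_nonneg (hΦ0 e), ← mul_add]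
    refine mul_le_mul_of_nonneg_left ?_ (hΦ0 e)
    simp only [inner_neg_right, abs_neg, neg_mul, Finset.sum_neg_distrib] at h1
    rw [real_inner_comm w (ridgeFit τ x ρ κ q e)] at h1
    linarith
  · have hK := N.K_pos
    have h3 := mul_le_mul_of_nonneg_left hsq (by positivity : 0 ≤ K ^ 2)
    linarith

lemma integral_inner_sub_le (hC : HasMomentBound ν τ x ρ κ C) (q q' : E) {w : E} (hw : ‖w‖ ≤ 1) :
    ∫ e, ⟪w, ridgeFit τ x ρ κ q e - ridgeFit τ x ρ κ q' e⟫ ∂(Measure.pi fun _ => ν)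
      ≤ √(C * (1 + ‖q‖ ^ 2)) + √(C * (1 + ‖q'‖ ^ 2)) := by
  have S := (M.selection hκ q).bddMeas_inner w
  have S' := (M.selection hκ q').bddMeas_inner w
  simp only [inner_sub_right]
  refine (BddMeas.integral_mono (S.sub S') (S.abs.add S'.abs) fun e => ?_).trans ?_
  · linarith [le_abs_self ⟪w, ridgeFit τ x ρ κ q e⟫, neg_abs_le ⟪w, ridgeFit τ x ρ κ q' e⟫]
  · rw [integral_add S.abs.integrable S'.abs.integrable]
    exact add_le_add (S.integral_abs_le_sqrt.trans (Real.sqrt_le_sqrt (hC q w hw)))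
      (S'.integral_abs_le_sqrt.trans (Real.sqrt_le_sqrt (hC q' w hw)))

/-- A moment bound improves the second moment of the positive part of the increments of the
value. -/
lemma integral_posPart_sq_le (hC : HasMomentBound ν τ x ρ κ C) (hC1 : 1 ≤ C) (q : E) {w : E}
    (hw : ‖w‖ ≤ 1) :
    ∫ e, (max 0 (ridgeValue τ x ρ κ q e - ridgeValue τ x ρ κ (q - w) e)) ^ 2
        ∂(Measure.pi fun _ => ν)
      ≤ (4 * K ^ 2 + 340 * K ^ 6 * b * C) * (1 + ‖q‖ ^ 2) := by
  have N := M.noise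
  have hK := N.one_le
  have hK0 := N.K_pos
  have hb := M.b_nonneg
  set μ : Measure (Fin n → ℝ) := Measure.pi fun _ => ν with hμ
  set m := 1 + ‖q‖ ^ 2 with hm
  have hm1 : 1 ≤ m := by rw [hm]; nlinarith [sq_nonneg ‖q‖]
  set s := √(C * m) with hs
  have hCm : 1 ≤ C * m := one_le_mul_of_one_le_of_one_le hC1 hm1
  have hs1 : 1 ≤ s := Real.one_le_sqrt.2 hCm
  have hss : s ^ 2 = C * m := Real.sq_sqrt (by linarith)
  have hlip : LipschitzWith 1 fun u : ℝ => max 0 u := by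
    refine LipschitzWith.of_dist_le_mul fun u v => ?_
    simp only [Real.dist_eq, NNReal.coe_one, one_mul]
    exact (abs_max_sub_max_le_max _ _ _ _).trans (by simp)
  have hΦ := (M.isTest_ridgeValue_sub hκ q (q - w)).lipschitz hlip
  set Φ := fun e => max 0 (ridgeValue τ x ρ κ q e - ridgeValue τ x ρ κ (q - w) e) with hΦd
  have hΦ0 : ∀ e, 0 ≤ Φ e := fun e => le_max_left _ _
  -- Convexity of the value in `q` gives this comparison on one side only, which is enough: where
  -- $\Phi>0$ one has $\langle w,\theta\rangle\ge\Phi>0$, so the term due to the ball vanishes and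
  -- the ridge term is nonnegative.
  have hΦle : ∀ e, Φ e ≤ max 0 ⟪w, ridgeFit τ x ρ κ q e⟫ := fun e => by
    refine max_le_max le_rfl ?_
    have := M.ridgeValue_subgradient hκ q (q - w) e
    rw [show q - w - q = -w by abel, inner_neg_left] at this
    linarith
  have h1 := M.integral_test_mul_le hκ hC (by linarith) q hw hΦ hΦ0
  set A := √(∫ e, Φ e ^ 2 ∂μ) with hA
  have hA0 : 0 ≤ A := Real.sqrt_nonneg _
  have hAA : A ^ 2 = ∫ e, Φ e ^ 2 ∂μ := Real.sq_sqrt (integral_nonneg fun _ => sq_nonneg _)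
  have hL : BddMeas fun e : Fin n → ℝ => ∑ j, ⟪x j, w⟫ * checkScore τ (e j) + ⟪q, w⟫ :=
    (BddMeas.sum _ fun j => (N.bddMeas_checkScore.comp (measurable_pi_apply j)).const_mul _).add
      (BddMeas.const _)
  have hw' := (M.selection hκ q).bddMeas_inner w
  have hmax : BddMeas fun e => max 0 (-⟪w, ridgeFit τ x ρ κ q e⟫) / ρ ^ 2 := by
    simp only [div_eq_inv_mul]
    exact ((BddMeas.const 0).max hw'.neg).const_mul _
  have h2 : f₀ * A ^ 2 - ∫ e, Φ e * (∑ j, ⟪x j, w⟫ * checkScore τ (e j) + ⟪q, w⟫) ∂μ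
      ≤ ∫ e, Φ e * (f₀ * ⟪w, ridgeFit τ x ρ κ q e⟫
        - (∑ j, ⟪x j, w⟫ * checkScore τ (e j) + ⟪q, w⟫) + κ * ⟪w, ridgeFit τ x ρ κ q e⟫
        - max 0 (-⟪w, ridgeFit τ x ρ κ q e⟫) / ρ ^ 2 * ridgeValue τ x ρ κ q e) ∂μ := by
    rw [hAA, ← integral_const_mul, ← integral_sub (hΦ.bdd.sq.const_mul _).integrable
      (hΦ.bdd.mul hL).integrable]
    refine BddMeas.integral_mono ((hΦ.bdd.sq.const_mul _).sub (hΦ.bdd.mul hL))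
      (hΦ.bdd.mul ((((hw'.const_mul _).sub hL).add (hw'.const_mul _)).sub
        (hmax.mul (M.bddMeas_ridgeValue hκ q)))) fun e => ?_
    rcases (hΦ0 e).eq_or_lt with h | h
    · simp only [← h]; simp
    · have h3 : Φ e ≤ ⟪w, ridgeFit τ x ρ κ q e⟫ := by
        rcases le_max_iff.1 (hΦle e) with h4 | h4
        · linarith
        · exact h4
      have h5 : 0 < ⟪w, ridgeFit τ x ρ κ q e⟫ := h.trans_le h3
      rw [max_eq_left (by linarith : -⟪w, ridgeFit τ x ρ κ q e⟫ ≤ 0)]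
      have h6 : f₀ * Φ e ≤ f₀ * ⟪w, ridgeFit τ x ρ κ q e⟫ :=
        mul_le_mul_of_nonneg_left h3 N.f₀_pos.le
      have h7 : 0 ≤ κ * ⟪w, ridgeFit τ x ρ κ q e⟫ := by positivity
      have h8 := mul_le_mul_of_nonneg_left h6 h.le
      have h9 := mul_nonneg h.le h7
      simp only [zero_div, zero_mul, sub_zero]
      linarith
  have h3 : ∫ e, Φ e * (∑ j, ⟪x j, w⟫ * checkScore τ (e j) + ⟪q, w⟫) ∂μ ≤ A * √(2 * m) := by
    refine (hΦ.bdd.integral_mul_le hL).trans ?_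
    refine mul_le_mul_of_nonneg_left (Real.sqrt_le_sqrt ((M.integral_score_sq_le hw _).trans ?_))
      hA0
    have : ⟪q, w⟫ ^ 2 ≤ ‖q‖ ^ 2 := by
      rw [← sq_abs]
      refine pow_le_pow_left₀ (abs_nonneg _) ((abs_real_inner_le_norm _ _).trans ?_) 2
      exact mul_le_of_le_one_right (norm_nonneg _) hw
    rw [hm]; linarith
  have hsK : √(2 * K) ≤ 2 * K := by
    rw [Real.sqrt_le_left (by linarith)]; nlinarith
  have hosc : ∑ j, |⟪x j, w⟫| * ∫ e, ((1 : ℝ≥0) : ℝ) * ridgeOsc τ x ρ κ b₀ q (q - w) j e ∂μ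
      ≤ 11 * K * s := by
    simp only [NNReal.coe_one, one_mul]
    refine (M.sum_ridgeOsc_le hκ q (q - w) (fun j => abs_nonneg ⟪x j, w⟫)
      (M.parseval.sum_le_one hw)).trans ?_
    have g1 : ∫ e, ⟪q - w - q, ridgeFit τ x ρ κ (q - w) e - ridgeFit τ x ρ κ q e⟫ ∂μ ≤ 3 * s := by
      have g2 := M.integral_inner_sub_le hκ hC q (q - w) hw
      have g3 : ∀ e, ⟪q - w - q, ridgeFit τ x ρ κ (q - w) e - ridgeFit τ x ρ κ q e⟫
          = ⟪w, ridgeFit τ x ρ κ q e - ridgeFit τ x ρ κ (q - w) e⟫ := fun e => by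
        rw [show q - w - q = -w by abel, inner_neg_left, ← inner_neg_right, neg_sub]
      simp_rw [g3]
      refine g2.trans ?_
      have g4 : √(C * (1 + ‖q - w‖ ^ 2)) ≤ 2 * s := by
        rw [show (2 : ℝ) * s = √(4 * (C * m)) by
          rw [Real.sqrt_mul (by norm_num), show (4 : ℝ) = 2 ^ 2 by norm_num,
            Real.sqrt_sq (by norm_num)]]
        refine Real.sqrt_le_sqrt ?_
        have g5 : ‖q - w‖ ≤ ‖q‖ + 1 := (norm_sub_le _ _).trans (by linarith)
        have g6 : ‖q - w‖ ^ 2 ≤ (‖q‖ + 1) ^ 2 := pow_le_pow_left₀ (norm_nonneg _) g5 2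
        have g7 : 1 + ‖q - w‖ ^ 2 ≤ 4 * m := by rw [hm]; nlinarith [sq_nonneg (‖q‖ - 1)]
        nlinarith
      linarith
    have g2 : √(16 * K * ∫ e, ⟪q - w - q, ridgeFit τ x ρ κ (q - w) e - ridgeFit τ x ρ κ q e⟫ ∂μ)
        ≤ 7 * K * s := by
      rw [Real.sqrt_le_left (by positivity)]
      have g3 : 16 * K * ∫ e, ⟪q - w - q, ridgeFit τ x ρ κ (q - w) e - ridgeFit τ x ρ κ q e⟫ ∂μ
          ≤ 16 * K * (3 * s) := mul_le_mul_of_nonneg_left g1 (by linarith)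
      have g4 : 1 ≤ K * s := one_le_mul_of_one_le_of_one_le hK hs1
      nlinarith
    have g3 : √(2 * K) * b ≤ 2 * K * 1 := mul_le_mul hsK M.b_le_one hb (by linarith)
    have g4 : K ≤ K * s := le_mul_of_one_le_right hK0.le hs1
    linarith
  -- The assumed constant `C` enters only through `s`, and `s` always carries the factor `b`; for
  -- small `b` the bound therefore improves on itself.
  have h4 : f₀ * A ^ 2 ≤ A * √(2 * m) + b * (7 * K ^ 2 * s * A + 121 * K ^ 2 * s) := by
    have g1 : K ^ 2 * s + 3 * K * √(2 * K) ≤ 7 * K ^ 2 * s := by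
      have : K * √(2 * K) ≤ K * (2 * K) := mul_le_mul_of_nonneg_left hsK hK0.le
      nlinarith [sq_nonneg K]
    have g2 := mul_le_mul_of_nonneg_right g1 hA0
    have g3 := mul_le_mul_of_nonneg_left hosc (by linarith : 0 ≤ 11 * K)
    have g4 : (K ^ 2 * s + 3 * K * √(2 * K)) * A
        + 11 * K * ∑ j, |⟪x j, w⟫| * ∫ e, ((1 : ℝ≥0) : ℝ) * ridgeOsc τ x ρ κ b₀ q (q - w) j e ∂μ
        ≤ 7 * K ^ 2 * s * A + 121 * K ^ 2 * s := by linarith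
    have g5 := mul_le_mul_of_nonneg_left g4 hb
    linarith
  rw [← hAA]
  exact sq_le_of_self_bounding hK hb M.b_le_one hs1 hss N.density_lower h4 (by linarith)

/-- As $\langle w,\theta(q)\rangle\le H(q+w)-H(q)$, the bound on positive parts at $q+w$, used for
$w$ and $-w$, controls the second moment. Since $4080=12\cdot340$, the term in `b` is at most
$C/12$; the factor 3 in $1+\|q+w\|^2\le3(1+\|q\|^2)$ and the two signs turn it into $C/2$. -/
lemma hasMomentBound_improve (hC : HasMomentBound ν τ x ρ κ C) (hC1 : 1 ≤ C)
    (hb : 4080 * K ^ 6 * b ≤ 1) : HasMomentBound ν τ x ρ κ (24 * K ^ 2 + C / 2) := by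
  intro q w hw
  have hb' := M.b_nonneg
  have key : ∀ w : E, ‖w‖ ≤ 1 → ∫ e, (max 0 ⟪w, ridgeFit τ x ρ κ q e⟫) ^ 2
      ∂(Measure.pi fun _ => ν) ≤ (12 * K ^ 2 + C / 4) * (1 + ‖q‖ ^ 2) := by
    intro w hw
    have h1 := M.integral_posPart_sq_le hκ hC hC1 (q + w) hw
    have h2 : ∫ e, (max 0 ⟪w, ridgeFit τ x ρ κ q e⟫) ^ 2 ∂(Measure.pi fun _ => ν)
        ≤ ∫ e, (max 0 (ridgeValue τ x ρ κ (q + w) e - ridgeValue τ x ρ κ (q + w - w) e)) ^ 2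
          ∂(Measure.pi fun _ => ν) := by
      refine BddMeas.integral_mono ((BddMeas.const 0).max
        ((M.selection hκ q).bddMeas_inner w)).sq ((BddMeas.const 0).max
          ((M.bddMeas_ridgeValue hκ _).sub (M.bddMeas_ridgeValue hκ _))).sq fun e => ?_
      refine pow_le_pow_left₀ (le_max_left _ _) (max_le_max le_rfl ?_) 2
      have := M.ridgeValue_subgradient hκ q (q + w) e
      rw [add_sub_cancel_left] at this
      rw [add_sub_cancel_right]
      linarith
    refine h2.trans (h1.trans ?_)
    have h3 : 1 + ‖q + w‖ ^ 2 ≤ 3 * (1 + ‖q‖ ^ 2) := by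
      have : ‖q + w‖ ≤ ‖q‖ + 1 := (norm_add_le _ _).trans (by linarith)
      have := pow_le_pow_left₀ (norm_nonneg _) this 2
      nlinarith [sq_nonneg (‖q‖ - 1)]
    have h4 : 4 * K ^ 2 + 340 * K ^ 6 * b * C ≤ 4 * K ^ 2 + C / 12 := by
      have := mul_le_mul_of_nonneg_right hb (by linarith : 0 ≤ C)
      linarith
    calc _ ≤ (4 * K ^ 2 + C / 12) * (3 * (1 + ‖q‖ ^ 2)) :=
          mul_le_mul h4 h3 (by positivity) (by positivity)
      _ = _ := by ring
  have h1 := key w hw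
  have h2 := key (-w) (by rwa [norm_neg])
  have hw' := (M.selection hκ q).bddMeas_inner w
  have h3 : ∫ e, ⟪w, ridgeFit τ x ρ κ q e⟫ ^ 2 ∂(Measure.pi fun _ => ν)
      = ∫ e, (max 0 ⟪w, ridgeFit τ x ρ κ q e⟫) ^ 2 ∂(Measure.pi fun _ => ν)
        + ∫ e, (max 0 ⟪-w, ridgeFit τ x ρ κ q e⟫) ^ 2 ∂(Measure.pi fun _ => ν) := by
    rw [← integral_add ((BddMeas.const 0).max hw').sq.integrable
      ((BddMeas.const 0).max ((M.selection hκ q).bddMeas_inner (-w))).sq.integrable]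
    congr 1; ext e
    rw [inner_neg_left]
    rcases le_total 0 ⟪w, ridgeFit τ x ρ κ q e⟫ with h | h
    · rw [max_eq_right h, max_eq_left (by linarith)]; ring
    · rw [max_eq_left h, max_eq_right (by linarith)]; ring
  rw [h3]; linarith

/-- The fits have second moments of order one in every direction. -/
theorem hasMomentBound (hb : 4080 * K ^ 6 * b ≤ 1) : HasMomentBound ν τ x ρ κ (48 * K ^ 2) := by
  have hK := M.noise.one_le
  have hK2 : 1 ≤ K ^ 2 := one_le_pow₀ hK
  -- Iterates of $C\mapsto24K^2+C/2$, whose fixed point is $48K^2$. They start from the trivial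
  -- bound $\|\theta\|\le\rho$, and the limit removes the dependence on the radius.
  have h : ∀ k : ℕ, HasMomentBound ν τ x ρ κ (48 * K ^ 2 + ρ ^ 2 * (1 / 2) ^ k) := by
    intro k
    induction k with
    | zero =>
      intro q w hw
      have hw' := (M.selection hκ q).bddMeas_inner w
      refine (BddMeas.integral_mono hw'.sq (BddMeas.const (ρ ^ 2)) fun e => ?_).trans ?_
      · rw [← sq_abs]
        refine pow_le_pow_left₀ (abs_nonneg _) ((abs_real_inner_le_norm _ _).trans ?_) 2
        exact (mul_le_of_le_one_left (norm_nonneg _) hw).trans ((M.selection hκ q).norm_le e)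
      · simp only [integral_const, probReal_univ, one_smul, pow_zero, mul_one]
        nlinarith [sq_nonneg ρ, sq_nonneg ‖q‖, mul_nonneg (sq_nonneg ρ) (sq_nonneg ‖q‖),
          mul_nonneg (sq_nonneg K) (sq_nonneg ‖q‖)]
    | succ k ih =>
      have := M.hasMomentBound_improve hκ ih
        (by nlinarith [mul_nonneg (sq_nonneg ρ) (by positivity : (0 : ℝ) ≤ (1 / 2) ^ k)]) hb
      convert this using 1
      rw [pow_succ]; ring
  intro q w hw
  have ht : Tendsto (fun k : ℕ => (48 * K ^ 2 + ρ ^ 2 * (1 / 2) ^ k) * (1 + ‖q‖ ^ 2)) atTop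
      (𝓝 ((48 * K ^ 2 + ρ ^ 2 * 0) * (1 + ‖q‖ ^ 2))) :=
    ((tendsto_const_nhds.mul (tendsto_pow_atTop_nhds_zero_of_lt_one (by norm_num)
      (by norm_num))).const_add _).mul_const _
  rw [mul_zero, add_zero] at ht
  exact ge_of_tendsto' ht fun k => h k q w hw

end LocalModel

end LocalModel

/-! ### One-sided linearization of the values -/

section LocalModel

open scoped RealInnerProductSpace

variable {E : Type*} [NormedAddCommGroup E] [InnerProductSpace ℝ E] [FiniteDimensional ℝ E]
  [MeasurableSpace E] [BorelSpace E] {n : ℕ}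

lemma integral_norm_score_sq_le {ν : Measure ℝ} [IsProbabilityMeasure ν] {τ f₀ b₀ K : ℝ}
    (N : QuantileNoise ν τ f₀ b₀ K) (x : Fin n → E) :
    ∫ e, ‖∑ j, checkScore τ (e j) • x j‖ ^ 2 ∂(Measure.pi fun _ => ν) ≤ ∑ j, ‖x j‖ ^ 2 := by
  have := integral_norm_sq_sum_le (n := n) N.bddMeas_checkScore N.integral_checkScore
      (N.integral_checkScore_sq.le.trans
        (by nlinarith [sq_nonneg (τ - 1 / 2)] : τ * (1 - τ) ≤ 1)) x
  rwa [one_mul] at this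

lemma bddMeas_norm_score {ν : Measure ℝ} [IsProbabilityMeasure ν] {τ f₀ b₀ K : ℝ}
    (N : QuantileNoise ν τ f₀ b₀ K) (x : Fin n → E) (q : E) :
    BddMeas fun e : Fin n → ℝ => ‖q + ∑ j, checkScore τ (e j) • x j‖ := by
  obtain ⟨hm, C, hC⟩ := N.bddMeas_checkScore
  refine ⟨?_, ‖q‖ + ∑ j, C * ‖x j‖, fun e => ?_⟩
  · have hc : Continuous fun a : Fin n → ℝ => ‖q + ∑ j, a j • x j‖ := by fun_prop
    exact hc.measurable.comp (measurable_pi_lambda (fun e : Fin n → ℝ => fun j =>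
      checkScore τ (e j)) fun j => hm.comp (measurable_pi_apply j))
  · rw [abs_norm]
    refine (norm_add_le _ _).trans (add_le_add le_rfl ?_)
    refine (norm_sum_le _ _).trans (Finset.sum_le_sum fun j _ => ?_)
    rw [norm_smul]
    exact mul_le_mul_of_nonneg_right (hC _) (norm_nonneg _)

namespace LocalModel

variable {ν : Measure ℝ} [IsProbabilityMeasure ν] {τ f₀ b₀ K ρ b κ t : ℝ} {x : Fin n → E}
  (M : LocalModel ν τ f₀ b₀ K x ρ b)
include M

/-- This quantity, multiplied by $|\langle w,\theta\rangle|$, dominates the effects of the ridge and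
of the boundary of the ball. The score vector has second moment at most $\sum_j\|x_j\|^2$, so the
effect is small when $\rho^2$ is large compared with the dimension and `κ` is small. -/
lemma integral_radial_sq_le {q : E} (hq : ‖q‖ ≤ 1) :
    ∫ e, (κ + ‖q + ∑ j, checkScore τ (e j) • x j‖ / ρ) ^ 2 ∂(Measure.pi fun _ => ν)
      ≤ 2 * κ ^ 2 + 4 * (1 + ∑ j, ‖x j‖ ^ 2) / ρ ^ 2 := by
  have N := M.noise
  have hρ := M.radius_pos
  have h1 := bddMeas_norm_score N x q
  have h2 := bddMeas_norm_score N x 0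
  simp only [zero_add] at h2
  have h3 : BddMeas fun e : Fin n → ℝ => ‖q + ∑ j, checkScore τ (e j) • x j‖ / ρ := by
    simp only [div_eq_inv_mul]; exact h1.const_mul _
  calc _ ≤ ∫ e, (2 * κ ^ 2 + 4 / ρ ^ 2 + 4 / ρ ^ 2 * ‖∑ j, checkScore τ (e j) • x j‖ ^ 2)
        ∂(Measure.pi fun _ => ν) := by
        refine BddMeas.integral_mono ((BddMeas.const κ).add h3).sq
          ((BddMeas.const _).add (h2.sq.const_mul _)) fun e => ?_
        have a1 : ‖q + ∑ j, checkScore τ (e j) • x j‖ ^ 2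
            ≤ 2 + 2 * ‖∑ j, checkScore τ (e j) • x j‖ ^ 2 := by
          have a2 : ‖q + ∑ j, checkScore τ (e j) • x j‖
            ≤ 1 + ‖∑ j, checkScore τ (e j) • x j‖ := (norm_add_le _ _).trans (by linarith)
          have a3 := pow_le_pow_left₀ (norm_nonneg _) a2 2
          nlinarith [sq_nonneg (1 - ‖∑ j, checkScore τ (e j) • x j‖)]
        have a4 : (‖q + ∑ j, checkScore τ (e j) • x j‖ / ρ) ^ 2
            ≤ (2 + 2 * ‖∑ j, checkScore τ (e j) • x j‖ ^ 2) / ρ ^ 2 := by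
          rw [div_pow]; gcongr
        have a5 := sq_nonneg (κ - ‖q + ∑ j, checkScore τ (e j) • x j‖ / ρ)
        calc _ ≤ 2 * κ ^ 2 + 2 * (‖q + ∑ j, checkScore τ (e j) • x j‖ / ρ) ^ 2 := by linarith
          _ ≤ 2 * κ ^ 2 + 2 * ((2 + 2 * ‖∑ j, checkScore τ (e j) • x j‖ ^ 2) / ρ ^ 2) := by gcongr
          _ = _ := by ring
    _ = 2 * κ ^ 2 + 4 / ρ ^ 2
        + 4 / ρ ^ 2 * ∫ e, ‖∑ j, checkScore τ (e j) • x j‖ ^ 2 ∂(Measure.pi fun _ => ν) := by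
        rw [integral_add (integrable_const _) (h2.sq.const_mul _).integrable, integral_const_mul]
        simp
    _ ≤ 2 * κ ^ 2 + 4 / ρ ^ 2 + 4 / ρ ^ 2 * ∑ j, ‖x j‖ ^ 2 := by
        gcongr; exact integral_norm_score_sq_le N x
    _ = _ := by ring

variable (hκ : 0 < κ)
include hκ

/-- The increments of the value are asymptotically bounded above by the linear statistic. -/
theorem integral_clip_sq_le (hb : 4080 * K ^ 6 * b ≤ 1) {q w : E} (hq : ‖q‖ ≤ 1) (hw : ‖w‖ ≤ 1)
    (ht0 : 0 < t) (ht1 : t ≤ 1) :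
    ∫ e, (min 1 (max 0 (t⁻¹ * (ridgeValue τ x ρ κ q e - ridgeValue τ x ρ κ (q - t • w) e)
        - f₀⁻¹ * (∑ j, ⟪x j, w⟫ * checkScore τ (e j) + ⟪q, w⟫)))) ^ 2 ∂(Measure.pi fun _ => ν)
      ≤ 10 * K ^ 2 * √(2 * κ ^ 2 + 4 * (1 + ∑ j, ‖x j‖ ^ 2) / ρ ^ 2) + 302 * K ^ 4 * b / t := by
  have N := M.noise
  have hK := N.one_le
  have hK0 := N.K_pos
  have hf := N.f₀_pos
  have hb0 := M.b_nonneg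
  have hρ := M.radius_pos
  have hC := M.hasMomentBound hκ hb
  set μ : Measure (Fin n → ℝ) := Measure.pi fun _ => ν with hμ
  set Y := fun e : Fin n → ℝ => ∑ j, ⟪x j, w⟫ * checkScore τ (e j) + ⟪q, w⟫ with hY
  set A := fun e : Fin n → ℝ =>
    t⁻¹ * (ridgeValue τ x ρ κ q e - ridgeValue τ x ρ κ (q - t • w) e) with hA
  have hlip : LipschitzWith 1 fun u : ℝ => min 1 (max 0 u) := by
    refine LipschitzWith.of_dist_le_mul fun u v => ?_
    simp only [Real.dist_eq, NNReal.coe_one, one_mul]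
    refine (abs_min_sub_min_le_max _ _ _ _).trans ?_
    simp only [sub_self, abs_zero]
    rw [max_eq_right (abs_nonneg _)]
    exact (abs_max_sub_max_le_max _ _ _ _).trans (by simp)
  have T1 := (M.isTest_ridgeValue_sub hκ q (q - t • w)).lipschitz
    (g := fun u => t⁻¹ * u) (C := Real.toNNReal t⁻¹) (LipschitzWith.of_dist_le_mul fun u v => by
      rw [Real.dist_eq, Real.dist_eq, ← mul_sub, abs_mul, Real.coe_toNNReal _ (by positivity),
        abs_of_pos (by positivity : 0 < t⁻¹)])
  have T2 := (isTest_sum_checkScore N.tau_pos.le N.tau_lt_one.le N.b₀_pos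
    (fun j => ⟪x j, w⟫) ⟪q, w⟫).lipschitz (g := fun u => -(f₀⁻¹ * u)) (C := Real.toNNReal f₀⁻¹)
    (LipschitzWith.of_dist_le_mul fun u v => by
      rw [Real.dist_eq, Real.dist_eq, ← neg_sub', ← mul_sub, abs_neg, abs_mul,
        Real.coe_toNNReal _ (by positivity), abs_of_pos (by positivity : 0 < f₀⁻¹)])
  have T := (T1.add T2).lipschitz hlip
  simp only [Real.coe_toNNReal _ (by positivity : 0 ≤ t⁻¹),
    Real.coe_toNNReal _ (by positivity : 0 ≤ f₀⁻¹), NNReal.coe_one, one_mul, ← sub_eq_add_neg] at T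
  -- The clip keeps the second moment of $\Phi$ below 1 and removes $\Phi$ from the boundary term,
  -- where the other two factors already use up Cauchy-Schwarz.
  set Φ := fun e => min 1 (max 0 (A e - f₀⁻¹ * Y e)) with hΦ
  change IsTest b₀ Φ _ at T
  change ∫ e, Φ e ^ 2 ∂μ ≤ _
  have hΦ0 : ∀ e, 0 ≤ Φ e := fun e => le_min zero_le_one (le_max_left _ _)
  have hΦ1 : ∀ e, Φ e ≤ 1 := fun e => min_le_left _ _
  -- A backward difference quotient of a convex function lies below its slope. Where $\Phi>0$ it
  -- follows that $f_0\Phi\le f_0\langle w,\theta\rangle-Y$, so an upper bound on $\Phi$ tested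
  -- against the right side bounds $\Phi^2$.
  have hsub : ∀ e, A e ≤ ⟪w, ridgeFit τ x ρ κ q e⟫ := fun e => by
    have := M.ridgeValue_subgradient hκ q (q - t • w) e
    rw [show q - t • w - q = -(t • w) by abel, inner_neg_left, inner_smul_left] at this
    simp only [conj_trivial] at this
    rw [hA, inv_mul_le_iff₀ ht0]; linarith
  have h1 := M.integral_test_mul_le hκ hC (by positivity) q hw T hΦ0
  have hw' := (M.selection hκ q).bddMeas_inner w
  have hL : BddMeas Y :=
    (BddMeas.sum _ fun j => (N.bddMeas_checkScore.comp (measurable_pi_apply j)).const_mul _).add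
      (BddMeas.const _)
  have hmax : BddMeas fun e => max 0 (-⟪w, ridgeFit τ x ρ κ q e⟫) / ρ ^ 2 := by
    simp only [div_eq_inv_mul]
    exact ((BddMeas.const 0).max hw'.neg).const_mul _
  have hR : BddMeas fun e : Fin n → ℝ => κ + ‖q + ∑ j, checkScore τ (e j) • x j‖ / ρ := by
    simp only [div_eq_inv_mul]
    exact (BddMeas.const _).add ((bddMeas_norm_score N x q).const_mul _)
  have h2 : f₀ * ∫ e, Φ e ^ 2 ∂μ - ∫ e, |⟪w, ridgeFit τ x ρ κ q e⟫|
        * (κ + ‖q + ∑ j, checkScore τ (e j) • x j‖ / ρ) ∂μ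
      ≤ ∫ e, Φ e * (f₀ * ⟪w, ridgeFit τ x ρ κ q e⟫
        - (∑ j, ⟪x j, w⟫ * checkScore τ (e j) + ⟪q, w⟫) + κ * ⟪w, ridgeFit τ x ρ κ q e⟫
        - max 0 (-⟪w, ridgeFit τ x ρ κ q e⟫) / ρ ^ 2 * ridgeValue τ x ρ κ q e) ∂μ := by
    rw [← integral_const_mul, ← integral_sub (T.bdd.sq.const_mul _).integrable
      (hw'.abs.mul hR).integrable]
    refine BddMeas.integral_mono ((T.bdd.sq.const_mul _).sub (hw'.abs.mul hR))
      (T.bdd.mul ((((hw'.const_mul _).sub hL).add (hw'.const_mul _)).sub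
        (hmax.mul (M.bddMeas_ridgeValue hκ q)))) fun e => ?_
    set z := ⟪w, ridgeFit τ x ρ κ q e⟫ with hz
    set r := ‖q + ∑ j, checkScore τ (e j) • x j‖ with hr
    have hH : ridgeValue τ x ρ κ q e ≤ r * ρ := (M.ridgeValue_le hκ q e).trans
      ((real_inner_le_norm _ _).trans
        (mul_le_mul_of_nonneg_left ((M.selection hκ q).norm_le e) (norm_nonneg _)))
    have hH0 := M.ridgeValue_nonneg hκ q e
    have a1 : max 0 (-z) / ρ ^ 2 * ridgeValue τ x ρ κ q e ≤ |z| * (r / ρ) := by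
      calc _ ≤ |z| / ρ ^ 2 * (r * ρ) := by
            refine mul_le_mul ?_ hH hH0 (by positivity)
            gcongr
            exact max_le (abs_nonneg _) (neg_le_abs _)
        _ = _ := by field_simp
    have a2 : -(κ * z) ≤ |z| * κ := by
      have := mul_le_mul_of_nonneg_left (neg_le_abs z) hκ.le
      linarith
    have a3 : f₀ * Φ e ^ 2 ≤ Φ e * (f₀ * z - Y e) := by
      rcases (hΦ0 e).eq_or_lt with h | h
      · rw [← h]; simp
      · have h3 : Φ e ≤ max 0 (A e - f₀⁻¹ * Y e) := min_le_right _ _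
        have h4 : Φ e ≤ z - f₀⁻¹ * Y e := by
          rcases le_max_iff.1 h3 with h5 | h5
          · linarith
          · exact h5.trans (by linarith [hsub e])
        have h5 : f₀ * Φ e ≤ f₀ * z - Y e := by
          have := mul_le_mul_of_nonneg_left h4 hf.le
          rwa [mul_sub, ← mul_assoc, mul_inv_cancel₀ hf.ne', one_mul] at this
        have := mul_le_mul_of_nonneg_left h5 h.le
        linarith
    have a4 : Φ e * (-(κ * z) + max 0 (-z) / ρ ^ 2 * ridgeValue τ x ρ κ q e)
        ≤ |z| * (κ + r / ρ) := by
      have a5 : -(κ * z) + max 0 (-z) / ρ ^ 2 * ridgeValue τ x ρ κ q e ≤ |z| * (κ + r / ρ) := by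
        linarith
      refine (mul_le_mul_of_nonneg_left a5 (hΦ0 e)).trans ?_
      exact mul_le_of_le_one_left (by positivity) (hΦ1 e)
    have : Y e = ∑ j, ⟪x j, w⟫ * checkScore τ (e j) + ⟪q, w⟫ := rfl
    rw [← this]
    linarith
  have h3 : ∫ e, |⟪w, ridgeFit τ x ρ κ q e⟫|
        * (κ + ‖q + ∑ j, checkScore τ (e j) • x j‖ / ρ) ∂μ
      ≤ 10 * K * √(2 * κ ^ 2 + 4 * (1 + ∑ j, ‖x j‖ ^ 2) / ρ ^ 2) := by
    refine (hw'.abs.integral_mul_le hR).trans (mul_le_mul ?_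
      (Real.sqrt_le_sqrt (M.integral_radial_sq_le hq)) (Real.sqrt_nonneg _) (by positivity))
    simp only [sq_abs]
    rw [Real.sqrt_le_left (by positivity)]
    have := pow_le_one₀ (norm_nonneg q) hq (n := 2)
    refine (hC q w hw).trans ?_
    nlinarith [sq_nonneg K]
  have hsK : √(2 * K) ≤ 2 * K := by
    rw [Real.sqrt_le_left (by linarith)]; nlinarith
  have hosc : ∑ j, |⟪x j, w⟫| * ∫ e, ridgeOsc τ x ρ κ b₀ q (q - t • w) j e ∂μ ≤ 25 * K := by
    refine (M.sum_ridgeOsc_le hκ q (q - t • w) (fun j => abs_nonneg ⟪x j, w⟫)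
      (M.parseval.sum_le_one hw)).trans ?_
    have g2 := M.integral_inner_sub_le hκ hC q (q - t • w) hw
    have g3 : ∀ e, ⟪q - t • w - q, ridgeFit τ x ρ κ (q - t • w) e - ridgeFit τ x ρ κ q e⟫
        = t * ⟪w, ridgeFit τ x ρ κ q e - ridgeFit τ x ρ κ (q - t • w) e⟫ := fun e => by
      rw [show q - t • w - q = -(t • w) by abel, inner_neg_left, ← inner_neg_right, neg_sub,
        inner_smul_left]; simp
    simp_rw [g3]
    rw [integral_const_mul]
    have g4 : √(48 * K ^ 2 * (1 + ‖q‖ ^ 2)) ≤ 10 * K := by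
      rw [Real.sqrt_le_left (by positivity)]
      have := pow_le_one₀ (norm_nonneg q) hq (n := 2)
      nlinarith [sq_nonneg K]
    have g5 : √(48 * K ^ 2 * (1 + ‖q - t • w‖ ^ 2)) ≤ 16 * K := by
      rw [Real.sqrt_le_left (by positivity)]
      have g6 : ‖q - t • w‖ ≤ 2 := by
        refine (norm_sub_le _ _).trans ?_
        rw [norm_smul, Real.norm_eq_abs, abs_of_pos ht0]
        nlinarith [norm_nonneg w]
      have := pow_le_pow_left₀ (norm_nonneg _) g6 2
      nlinarith [sq_nonneg K]
    have g7 : t * ∫ e, ⟪w, ridgeFit τ x ρ κ q e - ridgeFit τ x ρ κ (q - t • w) e⟫ ∂μ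
        ≤ 26 * K := by
      have : ∫ e, ⟪w, ridgeFit τ x ρ κ q e - ridgeFit τ x ρ κ (q - t • w) e⟫ ∂μ ≤ 26 * K := by
        linarith
      refine (mul_le_mul_of_nonneg_left this ht0.le).trans ?_
      exact mul_le_of_le_one_left (by positivity) ht1
    have g8 : √(16 * K * (t * ∫ e, ⟪w, ridgeFit τ x ρ κ q e
        - ridgeFit τ x ρ κ (q - t • w) e⟫ ∂μ)) ≤ 21 * K := by
      rw [Real.sqrt_le_left (by positivity)]
      have := mul_le_mul_of_nonneg_left g7 (by linarith : 0 ≤ 16 * K)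
      nlinarith [sq_nonneg K]
    have g9 : √(2 * K) * b ≤ 2 * K * 1 := mul_le_mul hsK M.b_le_one hb0 (by linarith)
    linarith
  -- The difference quotient multiplies the oscillation by $1/t$. This produces the final term
  -- $b/t$, small once $t$ is fixed and `b` is chosen afterwards.
  have hD : ∑ j, |⟪x j, w⟫| * ∫ e, (t⁻¹ * ridgeOsc τ x ρ κ b₀ q (q - t • w) j e
      + f₀⁻¹ * |⟪x j, w⟫|) ∂μ ≤ 26 * K / t := by
    have e1 : ∀ j, ∫ e, (t⁻¹ * ridgeOsc τ x ρ κ b₀ q (q - t • w) j e + f₀⁻¹ * |⟪x j, w⟫|) ∂μ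
        = t⁻¹ * ∫ e, ridgeOsc τ x ρ κ b₀ q (q - t • w) j e ∂μ + f₀⁻¹ * |⟪x j, w⟫| := fun j => by
      rw [integral_add (((M.isTest_ridgeValue_sub hκ q (q - t • w)).bdd_osc j).const_mul
        _).integrable (integrable_const _), integral_const_mul]
      simp
    simp_rw [e1]
    have e2 : ∑ j, |⟪x j, w⟫| * (t⁻¹ * ∫ e, ridgeOsc τ x ρ κ b₀ q (q - t • w) j e ∂μ
          + f₀⁻¹ * |⟪x j, w⟫|)
        = t⁻¹ * ∑ j, |⟪x j, w⟫| * ∫ e, ridgeOsc τ x ρ κ b₀ q (q - t • w) j e ∂μ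
          + f₀⁻¹ * ∑ j, |⟪x j, w⟫| ^ 2 := by
      rw [Finset.mul_sum, Finset.mul_sum, ← Finset.sum_add_distrib]
      exact Finset.sum_congr rfl fun j _ => by ring
    rw [e2]
    have e3 : f₀⁻¹ ≤ K := by rw [inv_le_iff_one_le_mul₀ hf]; exact N.density_lower
    have e4 : f₀⁻¹ * ∑ j, |⟪x j, w⟫| ^ 2 ≤ K :=
      (mul_le_of_le_one_right (by positivity) (M.parseval.sum_le_one hw)).trans e3
    have e5 : K ≤ K / t := by rw [le_div_iff₀ ht0]; nlinarith
    have e6 := mul_le_mul_of_nonneg_left hosc (by positivity : 0 ≤ t⁻¹)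
    calc _ ≤ t⁻¹ * (25 * K) + K / t := by linarith
      _ = _ := by field_simp; norm_num
  have h4 : f₀ * ∫ e, Φ e ^ 2 ∂μ ≤ 10 * K * √(2 * κ ^ 2 + 4 * (1 + ∑ j, ‖x j‖ ^ 2) / ρ ^ 2)
      + b * (16 * K ^ 3 + 286 * K ^ 2 / t) := by
    have g1 : √(48 * K ^ 2 * (1 + ‖q‖ ^ 2)) ≤ 10 * K := by
      rw [Real.sqrt_le_left (by positivity)]
      have := pow_le_one₀ (norm_nonneg q) hq (n := 2)
      nlinarith [sq_nonneg K]
    have g2 : √(∫ e, Φ e ^ 2 ∂μ) ≤ 1 := by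
      rw [Real.sqrt_le_one]
      refine (BddMeas.integral_mono T.bdd.sq (BddMeas.const 1) fun e =>
        pow_le_one₀ (hΦ0 e) (hΦ1 e)).trans ?_
      simp
    have g3 : (K ^ 2 * √(48 * K ^ 2 * (1 + ‖q‖ ^ 2)) + 3 * K * √(2 * K)) * √(∫ e, Φ e ^ 2 ∂μ)
        ≤ 16 * K ^ 3 := by
      refine (mul_le_of_le_one_right (by positivity) g2).trans ?_
      have a1 := mul_le_mul_of_nonneg_left g1 (sq_nonneg K)
      have a2 := mul_le_mul_of_nonneg_left hsK (by linarith : 0 ≤ 3 * K)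
      have a3 : K ^ 2 ≤ K ^ 3 := pow_le_pow_right₀ hK (by norm_num)
      linarith
    have g4 : 11 * K * ∑ j, |⟪x j, w⟫| * ∫ e, (t⁻¹ * ridgeOsc τ x ρ κ b₀ q (q - t • w) j e
      + f₀⁻¹ * |⟪x j, w⟫|) ∂μ ≤ 286 * K ^ 2 / t := by
      refine (mul_le_mul_of_nonneg_left hD (by linarith)).trans (le_of_eq (by ring))
    have g5 := mul_le_mul_of_nonneg_left (add_le_add g3 g4) hb0
    linarith
  have h5 : ∫ e, Φ e ^ 2 ∂μ ≤ K * (f₀ * ∫ e, Φ e ^ 2 ∂μ) := by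
    have := mul_le_mul_of_nonneg_right N.density_lower
      (integral_nonneg fun e => sq_nonneg (Φ e) : 0 ≤ ∫ e, Φ e ^ 2 ∂μ)
    linarith
  have h6 := mul_le_mul_of_nonneg_left h4 hK0.le
  have h7 : K * (b * (16 * K ^ 3 + 286 * K ^ 2 / t)) ≤ 302 * K ^ 4 * b / t := by
    have a1 : K ^ 3 ≤ K ^ 4 := pow_le_pow_right₀ hK (by norm_num)
    have a2 : K ^ 4 ≤ K ^ 4 / t := by rw [le_div_iff₀ ht0]; nlinarith [pow_pos hK0 4]
    have a3 : K ^ 3 / t ≤ K ^ 4 / t := by gcongr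
    have a4 : 16 * K ^ 4 + 286 * K ^ 3 / t ≤ 302 * K ^ 4 / t := by
      rw [mul_div_assoc, mul_div_assoc]; linarith
    calc _ = b * (16 * K ^ 4 + 286 * K ^ 3 / t) := by ring
      _ ≤ b * (302 * K ^ 4 / t) := mul_le_mul_of_nonneg_left a4 hb0
      _ = _ := by ring
  linarith

end LocalModel

end LocalModel

/-! ### Quadratic growth of the quantile process -/

section Growth

open scoped RealInnerProductSpace

lemma checkRem_mono_right {y a z : ℝ} (ha : 0 ≤ a) (h : a ≤ z) : checkRem y a ≤ checkRem y z := by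
  unfold checkRem
  split_ifs with hy
  · rw [max_eq_right (by linarith)]; exact le_max_right _ _
  · exact max_le_max (by linarith) le_rfl

lemma checkRem_mono_left {y a z : ℝ} (ha : a ≤ 0) (h : z ≤ a) : checkRem y a ≤ checkRem y z := by
  unfold checkRem
  split_ifs with hy
  · exact max_le_max (by linarith) le_rfl
  · rw [max_eq_right (by linarith)]; exact le_max_right _ _

lemma abs_checkRem_le (y z : ℝ) : checkRem y z ≤ |z| := by
  unfold checkRem
  split_ifs with hy
  · exact max_le (by linarith [neg_le_abs z]) (abs_nonneg _)
  · exact max_le (by linarith [le_abs_self z]) (abs_nonneg _)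

lemma measurable_checkRem : Measurable fun p : ℝ × ℝ => checkRem p.1 p.2 := by
  unfold checkRem
  exact Measurable.ite (measurableSet_lt measurable_fst measurable_const)
    ((measurable_fst.sub measurable_snd).max measurable_const)
    ((measurable_snd.sub measurable_fst).max measurable_const)

namespace QuantileNoise

variable {ν : Measure ℝ} [IsProbabilityMeasure ν] {τ f₀ b₀ K b : ℝ}
  (N : QuantileNoise ν τ f₀ b₀ K)
include N

lemma bddMeas_checkRem {z : ℝ → ℝ} (Z : FrozenProfile b₀ b z) :
    BddMeas fun y => checkRem y (z y) :=
  ⟨measurable_checkRem.comp (measurable_id.prodMk Z.meas), b, fun y => by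
    rw [abs_of_nonneg (checkRem_nonneg _ _)]; exact (abs_checkRem_le _ _).trans (Z.abs_le y)⟩

lemma bddMeas_checkRem_const (a : ℝ) : BddMeas fun y => checkRem y a :=
  ⟨measurable_checkRem.comp (measurable_id.prodMk measurable_const), |a|, fun y => by
    rw [abs_of_nonneg (checkRem_nonneg _ _)]; exact abs_checkRem_le _ _⟩

/-- On the half of the segment from 0 to $a$ that is adjacent to 0, the remainder is at least
$|a|/2$, and the mass of this half is at least $|a|/(2K)$. -/
lemma integral_checkRem_const_ge {a : ℝ} (ha : |a| ≤ b₀) :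
    a ^ 2 / (4 * K) ≤ ∫ y, checkRem y a ∂ν := by
  have hK := N.K_pos
  have h1 := neg_le_of_abs_le ha
  have h2 := le_of_abs_le ha
  have hb := N.b₀_pos
  have key : ∀ u v : ℝ, -b₀ ≤ u → u ≤ v → v ≤ b₀ → v - u = |a| / 2 →
      (∀ y ∈ Set.Ioo u v, |a| / 2 ≤ checkRem y a) → a ^ 2 / (4 * K) ≤ ∫ y, checkRem y a ∂ν := by
    intro u v hu huv hv hlen hy
    have h3 := N.mass_lower u v hu huv hv
    have h4 : |a| / 2 * ν.real (Set.Ioo u v) ≤ ∫ y, checkRem y a ∂ν := by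
      rw [show ν.real (Set.Ioo u v) = ∫ y, (if y ∈ Set.Ioo u v then (1 : ℝ) else 0) ∂ν from
        (integral_ite_eq (p := fun y => y ∈ Set.Ioo u v) measurableSet_Ioo).symm,
        ← integral_const_mul]
      refine BddMeas.integral_mono ((BddMeas.ite measurableSet_Ioo).const_mul _)
        (N.bddMeas_checkRem_const a) fun y => ?_
      split_ifs with h
      · rw [mul_one]; exact hy y h
      · rw [mul_zero]; exact checkRem_nonneg _ _
    rw [div_le_iff₀ (by positivity), ← sq_abs]
    rw [hlen] at h3
    nlinarith [abs_nonneg a]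
  rcases le_or_gt 0 a with h | h
  · rw [abs_of_nonneg h] at key
    refine key 0 (a / 2) (by linarith) (by linarith) (by linarith) (by linarith) fun y hy => ?_
    unfold checkRem
    rw [if_neg (not_lt.2 hy.1.le)]
    exact le_max_of_le_left (by linarith [hy.2])
  · rw [abs_of_neg h] at key
    refine key (a / 2) 0 (by linarith) (by linarith) (by linarith) (by linarith) fun y hy => ?_
    unfold checkRem
    rw [if_pos hy.2]
    exact le_max_of_le_left (by linarith [hy.1])

/-- The remainder grows away from 0 on either side, so the profile may be replaced by a constant:
its end nearest to 0, or 0 itself if its range contains 0. Every value of the profile is within the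
width of that constant. -/
lemma integral_checkRem_ge (hb : b ≤ b₀) {z : ℝ → ℝ} (Z : FrozenProfile b₀ b z) :
    (8 * K)⁻¹ * ∫ y, z y ^ 2 ∂ν - (4 * K)⁻¹ * (z b₀ - z (-b₀)) ^ 2
      ≤ ∫ y, checkRem y (z y) ∂ν := by
  have hK := N.K_pos
  have hη : z (-b₀) ≤ z b₀ := Z.upper (-b₀)
  have key : ∀ a : ℝ, |a| ≤ b₀ → (∀ y, checkRem y a ≤ checkRem y (z y)) →
      (∀ y, |z y - a| ≤ z b₀ - z (-b₀)) →
      (8 * K)⁻¹ * ∫ y, z y ^ 2 ∂ν - (4 * K)⁻¹ * (z b₀ - z (-b₀)) ^ 2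
        ≤ ∫ y, checkRem y (z y) ∂ν := by
    intro a ha h1 h2
    have h3 := (N.integral_checkRem_const_ge ha).trans
      (BddMeas.integral_mono (N.bddMeas_checkRem_const a) (N.bddMeas_checkRem Z) h1)
    have h4 : ∫ y, z y ^ 2 ∂ν ≤ 2 * a ^ 2 + 2 * (z b₀ - z (-b₀)) ^ 2 := by
      refine (BddMeas.integral_mono Z.bddMeas.sq
        (BddMeas.const (2 * a ^ 2 + 2 * (z b₀ - z (-b₀)) ^ 2)) fun y => ?_).trans (by simp)
      have h5 : (z y - a) ^ 2 ≤ (z b₀ - z (-b₀)) ^ 2 := by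
        rw [← sq_abs]; exact pow_le_pow_left₀ (abs_nonneg _) (h2 y) 2
      nlinarith [sq_nonneg (z y - 2 * a)]
    refine le_trans ?_ h3
    calc _ ≤ (8 * K)⁻¹ * (2 * a ^ 2 + 2 * (z b₀ - z (-b₀)) ^ 2)
          - (4 * K)⁻¹ * (z b₀ - z (-b₀)) ^ 2 := by gcongr
      _ = _ := by field_simp; ring
  have hmz : ∀ y, z (-b₀) ≤ z y := Z.lower
  have hpz : ∀ y, z y ≤ z b₀ := Z.upper
  rcases le_or_gt 0 (z (-b₀)) with h | h
  · refine key (z (-b₀)) ((Z.abs_le _).trans hb) (fun y => checkRem_mono_right h (hmz y))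
      fun y => ?_
    rw [abs_of_nonneg (by linarith [hmz y])]; linarith [hpz y]
  · rcases le_or_gt (z b₀) 0 with h' | h'
    · refine key (z b₀) ((Z.abs_le _).trans hb) (fun y => checkRem_mono_left h' (hpz y))
        fun y => ?_
      rw [abs_of_nonpos (by linarith [hpz y])]; linarith [hmz y]
    · refine key 0 (by rw [abs_zero]; exact N.b₀_pos.le) (fun y => ?_) fun y => ?_
      · have : checkRem y 0 = 0 := by
          unfold checkRem; split_ifs with hy
          · rw [max_eq_right (by linarith)]
          · rw [max_eq_right (by linarith)]
        rw [this]; exact checkRem_nonneg _ _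
      · rw [sub_zero, abs_le]; constructor <;> linarith [hmz y, hpz y]

end QuantileNoise

variable {E : Type*} [NormedAddCommGroup E] [InnerProductSpace ℝ E] {n : ℕ}

lemma continuous_objective_errors (τ : ℝ) (x : Fin n → E) (base : E → ℝ) (t : E) :
    Continuous fun e => objective τ x base e t := by
  have := continuous_quantileLoss τ
  unfold objective checkLoss
  fun_prop

/-- On a finite set the maximizer of least index is measurable and consistent. This serves for the
convex base $\|t\|^2/(16K)$ of the growth bound, where strong concavity is not available. -/
lemma exists_finite_selection [MeasurableSpace E] (τ : ℝ) (x : Fin n → E) (base : E → ℝ) {ρ : ℝ}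
    (T : Finset E) (hT : T.Nonempty) (hρ : ∀ t ∈ T, ‖t‖ ≤ ρ) :
    ∃ θ, IsSelection τ x ρ base (T : Set E) θ := by
  classical
  set m := T.card with hm
  let t : Fin m → E := fun i => (T.equivFin.symm i : E)
  have htT : ∀ i, t i ∈ T := fun i => (T.equivFin.symm i).2
  have hsurj : ∀ s ∈ T, ∃ i, t i = s := fun s hs => ⟨T.equivFin ⟨s, hs⟩, by simp [t]⟩
  let I : (Fin n → ℝ) → Finset (Fin m) := fun e =>
    Finset.univ.filter fun i => ∀ i', objective τ x base e (t i') ≤ objective τ x base e (t i)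
  have hI : ∀ e, (I e).Nonempty := fun e => by
    obtain ⟨s, hs, hmax⟩ := T.exists_max_image (objective τ x base e) hT
    obtain ⟨i, rfl⟩ := hsurj s hs
    exact ⟨i, by simpa [I] using fun i' => hmax _ (htT i')⟩
  let sel : (Fin n → ℝ) → Fin m := fun e => (I e).min' (hI e)
  have hsel : ∀ e i', objective τ x base e (t i') ≤ objective τ x base e (t (sel e)) := fun e => by
    have := (I e).min'_mem (hI e)
    simpa [I] using this
  have hmin : ∀ e i, (∀ i', objective τ x base e (t i') ≤ objective τ x base e (t i)) →
      sel e ≤ i := fun e i h => (I e).min'_le _ (by simpa [I] using h)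
  have hmeasI : ∀ i, MeasurableSet {e | i ∈ I e} := fun i => by
    have : {e | i ∈ I e}
        = ⋂ i', {e | objective τ x base e (t i') ≤ objective τ x base e (t i)} := by
      ext e; simp [I]
    rw [this]
    exact MeasurableSet.iInter fun i' => measurableSet_le
      (continuous_objective_errors τ x base _).measurable
      (continuous_objective_errors τ x base _).measurable
  have hmsel : Measurable sel := by
    refine measurable_to_countable' fun i => ?_
    have : sel ⁻¹' {i} = {e | i ∈ I e} ∩ ⋂ i' : Fin m, {e | i' < i → i' ∉ I e} := by
      ext e
      simp only [Set.mem_preimage, Set.mem_singleton_iff, Set.mem_inter_iff, Set.mem_ofPred_eq,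
        Set.mem_iInter]
      constructor
      · rintro rfl
        exact ⟨(I e).min'_mem (hI e), fun i' h h' => absurd ((I e).min'_le i' h') (not_le.2 h)⟩
      · rintro ⟨h1, h2⟩
        refine le_antisymm ((I e).min'_le i h1) ?_
        by_contra h3
        exact h2 _ (not_le.1 h3) ((I e).min'_mem (hI e))
    rw [this]
    refine (hmeasI i).inter (MeasurableSet.iInter fun i' => ?_)
    by_cases h : i' < i
    · simp only [h, true_implies]
      exact (hmeasI i').compl
    · simp [h]
  refine ⟨fun e => t (sel e), (measurable_from_top (f := t)).comp hmsel, fun e => htT _,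
    fun e => hρ _ (htT _), fun e s hs => ?_, fun e e' h h' => ?_⟩
  · obtain ⟨i, rfl⟩ := hsurj s hs
    exact hsel e i
  · have h1 : sel e ≤ sel e' := hmin e _ fun i' => (hsel e i').trans h
    have h2 : sel e' ≤ sel e := hmin e' _ fun i' => (hsel e' i').trans h'
    rw [le_antisymm h1 h2]

variable [FiniteDimensional ℝ E] [MeasurableSpace E] [BorelSpace E]

namespace LocalModel

variable {ν : Measure ℝ} [IsProbabilityMeasure ν] {τ f₀ b₀ K ρ b : ℝ} {x : Fin n → E}
  (M : LocalModel ν τ f₀ b₀ K x ρ b)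
include M

/-- With $R^2=E\|\theta\|^2$ and $s=\sum_j\|x_j\|^2$, the remainders contribute $-R^2/(8K)$ up to
the widths, which cost at most $R\sqrt s$ as does the score, and the base adds $R^2/(16K)$. The
total $-R^2/(16K)+2R\sqrt s$ is at most $16Ks$. -/
lemma integral_growth_le {T : Set E} {θ : (Fin n → ℝ) → E}
    (S : IsSelection τ x ρ (fun t => (16 * K)⁻¹ * ‖t‖ ^ 2) T θ) :
    ∫ e, objective τ x (fun t => (16 * K)⁻¹ * ‖t‖ ^ 2) e (θ e) ∂(Measure.pi fun _ => ν)
      ≤ 16 * K * ∑ j, ‖x j‖ ^ 2 := by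
  have N := M.noise
  have hK := N.one_le
  have hK0 := N.K_pos
  set μ : Measure (Fin n → ℝ) := Measure.pi fun _ => ν with hμ
  set s := ∑ j, ‖x j‖ ^ 2 with hs
  have hs0 : 0 ≤ s := Finset.sum_nonneg fun _ _ => sq_nonneg _
  have bz : ∀ j, BddMeas fun e => ⟪x j, θ e⟫ := fun j => S.bddMeas_inner (x j)
  have bnorm := S.bddMeas_norm
  have bscore := bddMeas_norm_score N x 0
  simp only [zero_add] at bscore
  have brem : ∀ j, BddMeas fun e : Fin n → ℝ => checkRem (e j) ⟪x j, θ e⟫ := fun j =>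
    ⟨measurable_checkRem.comp ((measurable_pi_apply j).prodMk (bz j).1), b, fun e => by
      rw [abs_of_nonneg (checkRem_nonneg _ _)]
      exact (abs_checkRem_le _ _).trans (S.abs_fit_le M.fit_le e j)⟩
  set η : Fin n → (Fin n → ℝ) → ℝ := fun j e =>
    ⟪x j, θ (Function.update e j b₀)⟫ - ⟪x j, θ (Function.update e j (-b₀))⟫ with hη
  have bη : ∀ j, BddMeas (η j) := fun j =>
    ((bz j).comp (measurable_update_const j b₀)).sub ((bz j).comp (measurable_update_const j (-b₀)))
  have hη0 : ∀ j e, 0 ≤ η j e := fun j e =>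
    sub_nonneg.2 ((S.frozenProfile M.fit_le M.b_le e j).upper (-b₀))
  have hη2 : ∀ j e, η j e ≤ 2 * b := fun j e => by
    have h1 := le_of_abs_le (S.abs_fit_le M.fit_le (Function.update e j b₀) j)
    have h2 := neg_le_of_abs_le (S.abs_fit_le M.fit_le (Function.update e j (-b₀)) j)
    simp only [hη]; linarith
  set R := √(∫ e, ‖θ e‖ ^ 2 ∂μ) with hR
  have hR0 : 0 ≤ R := Real.sqrt_nonneg _
  have hRR : R ^ 2 = ∫ e, ‖θ e‖ ^ 2 ∂μ := Real.sq_sqrt (integral_nonneg fun _ => sq_nonneg _)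
  have hwidth : ∑ j, ∫ e, η j e ∂μ ≤ R * √(2 * K * s) := by
    have := N.sum_width_le S M.fit_le M.b_le (c := fun _ => 1) fun _ => zero_le_one
    simpa using this
  have hrem : (8 * K)⁻¹ * R ^ 2 - (2 * K)⁻¹ * b * (R * √(2 * K * s))
      ≤ ∑ j, ∫ e, checkRem (e j) ⟪x j, θ e⟫ ∂μ := by
    have h1 : ∀ j, (8 * K)⁻¹ * ∫ e, ⟪x j, θ e⟫ ^ 2 ∂μ - (2 * K)⁻¹ * b * ∫ e, η j e ∂μ
        ≤ ∫ e, checkRem (e j) ⟪x j, θ e⟫ ∂μ := fun j => by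
      rw [← integral_const_mul, ← integral_const_mul,
        ← integral_sub ((bz j).sq.const_mul _).integrable ((bη j).const_mul _).integrable]
      refine integral_le_of_resample j (((bz j).sq.const_mul _).sub ((bη j).const_mul _)) (brem j)
        fun e => ?_
      have h2 := N.integral_checkRem_ge M.b_le (S.frozenProfile M.fit_le M.b_le e j)
      have h3 : ∀ y, η j (Function.update e j y) = η j e := fun y => by simp [hη]
      simp only [h3, Function.update_self]
      refine le_trans ?_ h2
      have h4 : BddMeas fun y => ⟪x j, θ (Function.update e j y)⟫ ^ 2 :=
        (bz j).sq.comp (measurable_update_snd e j)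
      rw [integral_sub (h4.const_mul _).integrable (integrable_const _), integral_const_mul]
      simp only [integral_const, probReal_univ, one_smul]
      refine sub_le_sub_left ?_ _
      have h5 : η j e ^ 2 ≤ 2 * b * η j e := by
        rw [sq]; exact mul_le_mul_of_nonneg_right (hη2 j e) (hη0 j e)
      calc (4 * K)⁻¹ * η j e ^ 2 ≤ (4 * K)⁻¹ * (2 * b * η j e) := by gcongr
        _ = _ := by field_simp; norm_num
    refine le_trans ?_ (Finset.sum_le_sum fun j _ => h1 j)
    rw [Finset.sum_sub_distrib, ← Finset.mul_sum, ← Finset.mul_sum,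
      ← integral_finsetSum _ fun j _ => (bz j).sq.integrable]
    have h6 : ∫ e, ∑ j, ⟪x j, θ e⟫ ^ 2 ∂μ = R ^ 2 := by
      rw [hRR]; congr 1; ext e; exact M.parseval (θ e)
    rw [h6]
    have := mul_le_mul_of_nonneg_left hwidth
      (by have := M.b_nonneg; positivity : 0 ≤ (2 * K)⁻¹ * b)
    linarith
  have hscore : ∫ e, ‖θ e‖ * ‖∑ j, checkScore τ (e j) • x j‖ ∂μ ≤ R * √s :=
    (bnorm.integral_mul_le bscore).trans
      (mul_le_mul_of_nonneg_left (Real.sqrt_le_sqrt (integral_norm_score_sq_le N x)) hR0)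
  have hobj : ∫ e, objective τ x (fun t => (16 * K)⁻¹ * ‖t‖ ^ 2) e (θ e) ∂μ
      ≤ (16 * K)⁻¹ * R ^ 2 + R * √s - ∑ j, ∫ e, checkRem (e j) ⟪x j, θ e⟫ ∂μ := by
    rw [hRR, ← integral_const_mul, ← integral_finsetSum _ fun j _ => (brem j).integrable]
    refine le_trans ?_ (sub_le_sub_right (add_le_add_right hscore _) _)
    rw [← integral_add (bnorm.sq.const_mul _).integrable (bnorm.mul bscore).integrable,
      ← integral_sub ((bnorm.sq.const_mul _).add (bnorm.mul bscore)).integrable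
        (BddMeas.sum _ brem).integrable]
    have bobj : BddMeas fun e => objective τ x (fun t => (16 * K)⁻¹ * ‖t‖ ^ 2) e (θ e) := by
      unfold objective
      refine (bnorm.sq.const_mul _).sub (BddMeas.sum _ fun j =>
        ⟨(continuous_checkLoss τ).measurable.comp
        ((measurable_pi_apply j).prodMk (bz j).1), b, fun e => ?_⟩)
      exact (abs_checkLoss_le N.tau_pos.le N.tau_lt_one.le _ _).trans (S.abs_fit_le M.fit_le e j)
    refine BddMeas.integral_mono bobj
      (((bnorm.sq.const_mul _).add (bnorm.mul bscore)).sub (BddMeas.sum _ brem)) fun e => ?_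
    have h1 : ∑ j, checkLoss τ (e j) ⟪x j, θ e⟫
        = -⟪θ e, ∑ j, checkScore τ (e j) • x j⟫ + ∑ j, checkRem (e j) ⟪x j, θ e⟫ := by
      simp only [checkLoss_eq, Finset.sum_add_distrib, inner_sum, inner_smul_right]
      congr 1
      rw [← Finset.sum_neg_distrib]
      exact Finset.sum_congr rfl fun j _ => by rw [real_inner_comm]; ring
    unfold objective
    rw [h1]
    linarith [real_inner_le_norm (θ e) (∑ j, checkScore τ (e j) • x j)]
  have hsq : √(2 * K * s) ≤ 2 * K * √s := by
    rw [Real.sqrt_mul (by positivity)]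
    refine mul_le_mul_of_nonneg_right ?_ (Real.sqrt_nonneg _)
    rw [Real.sqrt_le_left (by positivity)]; nlinarith
  have h7 : (2 * K)⁻¹ * b * (R * √(2 * K * s)) ≤ R * √s := by
    calc _ ≤ (2 * K)⁻¹ * 1 * (R * (2 * K * √s)) := by
          have := M.b_le_one
          have := M.b_nonneg
          gcongr
      _ = _ := by field_simp
  have h8 : (16 * K)⁻¹ * R ^ 2 = (8 * K)⁻¹ * R ^ 2 - (16 * K)⁻¹ * R ^ 2 := by field_simp; norm_num
  have h9 : 2 * (R * √s) ≤ (16 * K)⁻¹ * R ^ 2 + 16 * K * s := by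
    have h10 := Real.sq_sqrt hs0
    have h11 := sq_nonneg (R - 16 * K * √s)
    have h12 : 0 < (16 * K)⁻¹ := by positivity
    have h13 : (16 * K)⁻¹ * (16 * K) = 1 := inv_mul_cancel₀ (by positivity)
    have h14 := mul_nonneg h12.le h11
    have h15 : (16 * K)⁻¹ * (R - 16 * K * √s) ^ 2
        = (16 * K)⁻¹ * R ^ 2 - 2 * ((16 * K)⁻¹ * (16 * K)) * (R * √s)
          + ((16 * K)⁻¹ * (16 * K)) * (16 * K) * √s ^ 2 := by ring
    rw [h15, h13, h10] at h14
    linarith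
  linarith

/-- Quadratic growth of the quantile process on the ball, up to a random constant of the order of
the dimension. -/
theorem exists_growth : ∃ V : (Fin n → ℝ) → ℝ, BddMeas V ∧ (∀ e, 0 ≤ V e) ∧
    ∫ e, V e ∂(Measure.pi fun _ => ν) ≤ 16 * K * ∑ j, ‖x j‖ ^ 2 ∧
    ∀ e t, ‖t‖ ≤ ρ → (16 * K)⁻¹ * ‖t‖ ^ 2 ≤ ∑ j, checkLoss τ (e j) ⟪x j, t⟫ + V e + 1 := by
  classical
  have : ProperSpace E := FiniteDimensional.proper ℝ E
  have N := M.noise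
  have hK0 := N.K_pos
  have hρ := M.radius_pos
  set base : E → ℝ := fun t => (16 * K)⁻¹ * ‖t‖ ^ 2 with hbase
  set Λ := (16 * K)⁻¹ * (2 * ρ) + ∑ j, ‖x j‖ with hΛ
  have hΛ0 : 0 ≤ Λ := by positivity
  -- `Λ` is a Lipschitz constant of the objective on the ball, so a net of mesh $(\Lambda+1)^{-1}$
  -- loses at most 1; this is the `+ 1` of the conclusion.
  obtain ⟨F, hFs, hFfin, hFc⟩ := (isCompact_closedBall (0 : E) ρ).finite_cover_balls
    (e := (Λ + 1)⁻¹) (by positivity)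
  set T : Finset E := insert 0 hFfin.toFinset with hT
  have hTρ : ∀ t ∈ T, ‖t‖ ≤ ρ := fun t ht => by
    rw [hT, Finset.mem_insert] at ht
    rcases ht with rfl | ht
    · simpa using hρ.le
    · simpa using hFs (hFfin.mem_toFinset.1 ht)
  obtain ⟨θ, S⟩ := exists_finite_selection τ x base T ⟨0, Finset.mem_insert_self _ _⟩ hTρ
  refine ⟨fun e => objective τ x base e (θ e), ?_, fun e => ?_, M.integral_growth_le S,
    fun e t ht => ?_⟩
  · unfold objective
    refine (S.bddMeas_norm.sq.const_mul _).sub (BddMeas.sum _ fun j =>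
      ⟨(continuous_checkLoss τ).measurable.comp
        ((measurable_pi_apply j).prodMk (S.measurable_fit j)), b, fun e => ?_⟩)
    exact (abs_checkLoss_le N.tau_pos.le N.tau_lt_one.le _ _).trans (S.abs_fit_le M.fit_le e j)
  · refine le_trans (le_of_eq ?_) (S.isMaxOn e 0 (Finset.mem_coe.2 (Finset.mem_insert_self _ _)))
    simp [objective, hbase]
  · have h1 : t ∈ ⋃ y ∈ F, Metric.ball y (Λ + 1)⁻¹ := hFc (by simpa using ht)
    simp only [Set.mem_iUnion, Metric.mem_ball, exists_prop] at h1
    obtain ⟨y, hy, hd⟩ := h1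
    have hyT : y ∈ T := Finset.mem_insert_of_mem (hFfin.mem_toFinset.2 hy)
    have h2 := S.isMaxOn e y hyT
    have h3 : objective τ x base e t - objective τ x base e y ≤ Λ * ‖t - y‖ := by
      have a1 : ‖t‖ ^ 2 - ‖y‖ ^ 2 ≤ 2 * ρ * ‖t - y‖ := by
        have b1 : ‖t‖ - ‖y‖ ≤ ‖t - y‖ := norm_sub_norm_le t y
        have b2 := hTρ y hyT
        have b3 : (‖t‖ - ‖y‖) * (‖t‖ + ‖y‖) ≤ ‖t - y‖ * (‖t‖ + ‖y‖) :=
          mul_le_mul_of_nonneg_right b1 (by positivity)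
        have b4 : ‖t - y‖ * (‖t‖ + ‖y‖) ≤ ‖t - y‖ * (2 * ρ) :=
          mul_le_mul_of_nonneg_left (by linarith) (norm_nonneg _)
        linarith
      have a2 : ∑ j, checkLoss τ (e j) ⟪x j, y⟫ - ∑ j, checkLoss τ (e j) ⟪x j, t⟫
          ≤ (∑ j, ‖x j‖) * ‖t - y‖ := by
        rw [← Finset.sum_sub_distrib, Finset.sum_mul]
        refine Finset.sum_le_sum fun j _ => ?_
        refine (le_abs_self _).trans
          ((abs_checkLoss_sub_le N.tau_pos.le N.tau_lt_one.le _ _ _).trans ?_)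
        rw [← inner_sub_right, norm_sub_rev]
        exact abs_real_inner_le_norm _ _
      have a3 := mul_le_mul_of_nonneg_left a1 (by positivity : 0 ≤ (16 * K)⁻¹)
      simp only [objective, hbase]
      rw [hΛ]
      linarith
    have h4 : Λ * ‖t - y‖ ≤ 1 := by
      rw [dist_eq_norm] at hd
      calc Λ * ‖t - y‖ ≤ (Λ + 1) * (Λ + 1)⁻¹ := by
            refine mul_le_mul (by linarith) hd.le (norm_nonneg _) (by linarith)
        _ = 1 := mul_inv_cancel₀ (by positivity)
    have h5 : objective τ x base e t = (16 * K)⁻¹ * ‖t‖ ^ 2 - ∑ j, checkLoss τ (e j) ⟪x j, t⟫ := rfl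
    linarith

end LocalModel

end Growth

/-! ### Upper bound for the quantile process -/

section Upper

open scoped RealInnerProductSpace

/-- A convex function on a ball is bounded by an integral of its exponential on a larger ball. -/
lemma measure_mul_exp_le {E : Type*} [NormedAddCommGroup E] [NormedSpace ℝ E] [MeasurableSpace E]
    [BorelSpace E] (m : Measure E) [m.IsAddLeftInvariant] [m.IsNegInvariant] {L : E → ℝ}
    (hL : Measurable L) (hmid : ∀ t y, 2 * L t ≤ L (t + y) + L (t - y)) {r : ℝ} {t : E}
    (ht : ‖t‖ ≤ r) :
    m (Metric.closedBall 0 r) * ENNReal.ofReal (Real.exp (L t))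
      ≤ ∫⁻ u in Metric.closedBall 0 (2 * r), ENNReal.ofReal (Real.exp (L u)) ∂m := by
  set F : E → ℝ≥0∞ := fun u => ENNReal.ofReal (Real.exp (L u)) with hF
  have hFm : Measurable F := (Real.measurable_exp.comp hL).ennreal_ofReal
  set B := Metric.closedBall (0 : E) r
  set B' := Metric.closedBall (0 : E) (2 * r)
  have hB : MeasurableSet B := Metric.isClosed_closedBall.measurableSet
  have hB' : MeasurableSet B' := Metric.isClosed_closedBall.measurableSet
  -- Midpoint convexity followed by the inequality of arithmetic and geometric means. Integration
  -- over $\|y\|\le r$ then keeps both $t\pm y$ in the ball of radius $2r$.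
  have hpt : ∀ y, 2 * F t ≤ F (t + y) + F (t - y) := fun y => by
    have h1 := hmid t y
    have h2 : Real.exp (L t) + Real.exp (L t) ≤ Real.exp (L (t + y)) + Real.exp (L (t - y)) := by
      set a := Real.exp (L (t + y) / 2)
      set c := Real.exp (L (t - y) / 2)
      have e1 : Real.exp (L (t + y)) = a * a := by rw [← Real.exp_add]; congr 1; ring
      have e2 : Real.exp (L (t - y)) = c * c := by rw [← Real.exp_add]; congr 1; ring
      have e3 : Real.exp (L t) ≤ a * c := by
        rw [← Real.exp_add]; exact Real.exp_le_exp.2 (by linarith)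
      nlinarith [sq_nonneg (a - c)]
    simp only [hF]
    rw [two_mul, ← ENNReal.ofReal_add (Real.exp_pos _).le (Real.exp_pos _).le,
      ← ENNReal.ofReal_add (Real.exp_pos _).le (Real.exp_pos _).le]
    exact ENNReal.ofReal_le_ofReal h2
  have hplus : ∫⁻ y in B, F (t + y) ∂m ≤ ∫⁻ u in B', F u ∂m := by
    rw [← lintegral_indicator hB, ← lintegral_indicator hB',
      ← lintegral_add_left_eq_self (B'.indicator F) t]
    refine lintegral_mono fun y => ?_
    by_cases hy : y ∈ B
    · have : t + y ∈ B' := by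
        simp only [B, B', mem_closedBall_zero_iff] at hy ⊢
        exact (norm_add_le _ _).trans (by linarith)
      rw [Set.indicator_of_mem hy, Set.indicator_of_mem this]
    · rw [Set.indicator_of_notMem hy]; exact zero_le
  have hminus : ∫⁻ y in B, F (t - y) ∂m ≤ ∫⁻ u in B', F u ∂m := by
    rw [← lintegral_indicator hB, ← lintegral_indicator hB',
      ← lintegral_sub_left_eq_self (B'.indicator F) t]
    refine lintegral_mono fun y => ?_
    by_cases hy : y ∈ B
    · have : t - y ∈ B' := by
        simp only [B, B', mem_closedBall_zero_iff] at hy ⊢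
        exact (norm_sub_le _ _).trans (by linarith)
      rw [Set.indicator_of_mem hy, Set.indicator_of_mem this]
    · rw [Set.indicator_of_notMem hy]; exact zero_le
  have h2 : 2 * (m B * F t) ≤ 2 * ∫⁻ u in B', F u ∂m := by
    calc 2 * (m B * F t) = ∫⁻ _ in B, 2 * F t ∂m := by
          rw [lintegral_const, Measure.restrict_apply_univ]; ring
      _ ≤ ∫⁻ y in B, (F (t + y) + F (t - y)) ∂m := lintegral_mono fun y => hpt y
      _ = ∫⁻ y in B, F (t + y) ∂m + ∫⁻ y in B, F (t - y) ∂m :=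
          lintegral_add_left (hFm.comp (measurable_const_add t)) _
      _ ≤ _ := by rw [two_mul]; exact add_le_add hplus hminus
  exact (ENNReal.mul_le_mul_iff_right (by norm_num) (by norm_num)).1 h2

lemma two_mul_checkLoss_le (τ e z d : ℝ) :
    2 * checkLoss τ e z ≤ checkLoss τ e (z + d) + checkLoss τ e (z - d) := by
  have h := checkLoss_midpoint τ e (z + d) (z - d)
  have h0 : 0 ≤ max 0 (min (e - (z + d)) (z - d - e)) := le_max_left _ _
  rw [show (z + d + (z - d)) / 2 = z by ring] at h
  linarith

namespace QuantileNoise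

variable {ν : Measure ℝ} [IsProbabilityMeasure ν] {τ f₀ b₀ K b : ℝ}
  (N : QuantileNoise ν τ f₀ b₀ K)
include N

lemma bddMeas_checkLoss_const (z : ℝ) : BddMeas fun y => checkLoss τ y z :=
  ⟨(continuous_checkLoss τ).measurable.comp (measurable_id.prodMk measurable_const), |z|,
    fun _ => abs_checkLoss_le N.tau_pos.le N.tau_lt_one.le _ _⟩

lemma bddMeas_exp_checkLoss (z : ℝ) : BddMeas fun y => Real.exp (checkLoss τ y z) :=
  ⟨Real.measurable_exp.comp (N.bddMeas_checkLoss_const z).1, Real.exp |z|, fun y => by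
    rw [abs_of_pos (Real.exp_pos _)]
    exact Real.exp_le_exp.2 ((le_abs_self _).trans
      (abs_checkLoss_le N.tau_pos.le N.tau_lt_one.le _ _))⟩

/-- For $|u|\le1$ one has $e^u\le1+u+u^2$. The score part of $u$ is centred, and the remainder is at
most $|z|$ on the segment from 0 to $z$, of mass at most $K|z|$, and zero elsewhere. -/
lemma integral_exp_checkLoss_le {z : ℝ} (hz : |z| ≤ b₀) (hz1 : |z| ≤ 1) :
    ∫ y, Real.exp (checkLoss τ y z) ∂ν ≤ Real.exp (2 * K * z ^ 2) := by
  have hK := N.one_le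
  have hψ := N.bddMeas_checkScore
  have hrem := N.bddMeas_checkRem_const z
  have h1 : ∫ y, Real.exp (checkLoss τ y z) ∂ν
      ≤ ∫ y, (1 + (-z * checkScore τ y + checkRem y z) + z ^ 2) ∂ν := by
    refine BddMeas.integral_mono (N.bddMeas_exp_checkLoss z)
      (((BddMeas.const 1).add ((hψ.const_mul _).add hrem)).add (BddMeas.const _)) fun y => ?_
    have h2 := abs_checkLoss_le N.tau_pos.le N.tau_lt_one.le y z
    have h3 := Real.abs_exp_sub_one_sub_id_le (h2.trans hz1)
    have h4 : checkLoss τ y z ^ 2 ≤ z ^ 2 := sq_le_sq.2 h2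
    have h5 := checkLoss_eq τ y z
    linarith [le_of_abs_le h3]
  have h2 : ∫ y, (1 + (-z * checkScore τ y + checkRem y z) + z ^ 2) ∂ν
      = 1 + ∫ y, checkRem y z ∂ν + z ^ 2 := by
    rw [integral_add ((BddMeas.const 1).add ((hψ.const_mul _).add hrem)).integrable
      (integrable_const _), integral_add (integrable_const _)
        ((hψ.const_mul _).add hrem).integrable,
      integral_add (hψ.const_mul _).integrable hrem.integrable, integral_const_mul,
      N.integral_checkScore]
    simp
  have h3 : ∫ y, checkRem y z ∂ν ≤ |z| * (K * |z|) := by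
    have h4 : ∫ y, checkRem y z ∂ν
        ≤ ∫ y, |z| * (if y ∈ Set.Icc (min z 0) (max z 0) then (1 : ℝ) else 0) ∂ν := by
      refine BddMeas.integral_mono hrem ((BddMeas.ite measurableSet_Icc).const_mul _) fun y => ?_
      split_ifs with hy
      · rw [mul_one]; exact abs_checkRem_le y z
      · rw [mul_zero]
        unfold checkRem
        rw [Set.mem_Icc, not_and_or, not_le, not_le] at hy
        split_ifs with h0
        · rcases hy with hy | hy
          · rw [lt_min_iff] at hy; rw [max_eq_right (by linarith)]
          · rw [max_lt_iff] at hy; linarith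
        · rcases hy with hy | hy
          · rw [lt_min_iff] at hy; linarith
          · rw [max_lt_iff] at hy; rw [max_eq_right (by linarith)]
    refine h4.trans ?_
    rw [integral_const_mul, integral_ite_eq (p := fun y => y ∈ Set.Icc (min z 0) (max z 0))
      measurableSet_Icc]
    exact mul_le_mul_of_nonneg_left (N.mass_between hz) (abs_nonneg _)
  have h4 : |z| * (K * |z|) = K * z ^ 2 := by rw [← sq_abs]; ring
  have h5 := Real.add_one_le_exp (2 * K * z ^ 2)
  nlinarith [sq_nonneg z]

end QuantileNoise

variable {E : Type*} [NormedAddCommGroup E] [InnerProductSpace ℝ E] [FiniteDimensional ℝ E]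
  [MeasurableSpace E] [BorelSpace E] {n : ℕ}

namespace LocalModel

variable {ν : Measure ℝ} [IsProbabilityMeasure ν] {τ f₀ b₀ K ρ b : ℝ} {x : Fin n → E}
  (M : LocalModel ν τ f₀ b₀ K x ρ b)
include M

lemma lintegral_exp_le {u : E} (hu : ‖u‖ ≤ ρ) :
    ∫⁻ e, ENNReal.ofReal (Real.exp (∑ j, checkLoss τ (e j) ⟪x j, u⟫)) ∂(Measure.pi fun _ => ν)
      ≤ ENNReal.ofReal (Real.exp (2 * K * ρ ^ 2)) := by
  have N := M.noise
  have hK := N.K_pos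
  have hb : ∀ j, |⟪x j, u⟫| ≤ b := fun j => (abs_real_inner_le_norm _ _).trans
    ((mul_le_mul_of_nonneg_left hu (norm_nonneg _)).trans (M.fit_le j))
  have hexp : ∀ e : Fin n → ℝ, Real.exp (∑ j, checkLoss τ (e j) ⟪x j, u⟫)
      = ∏ j, Real.exp (checkLoss τ (e j) ⟪x j, u⟫) := fun e => Real.exp_sum _ _
  have hint : Integrable (fun e : Fin n → ℝ => ∏ j, Real.exp (checkLoss τ (e j) ⟪x j, u⟫))
      (Measure.pi fun _ => ν) :=
    Integrable.fintype_prod (f := fun j y => Real.exp (checkLoss τ y ⟪x j, u⟫))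
      fun j => (N.bddMeas_exp_checkLoss _).integrable
  simp_rw [hexp]
  rw [← ofReal_integral_eq_lintegral_ofReal hint
    (ae_of_all _ fun e => Finset.prod_nonneg fun j _ => (Real.exp_pos _).le),
    integral_fintype_prod_eq_prod (fun j y => Real.exp (checkLoss τ y ⟪x j, u⟫))]
  refine ENNReal.ofReal_le_ofReal ?_
  calc ∏ j, ∫ y, Real.exp (checkLoss τ y ⟪x j, u⟫) ∂ν ≤ ∏ j, Real.exp (2 * K * ⟪x j, u⟫ ^ 2) :=
        Finset.prod_le_prod (fun j _ => integral_nonneg fun _ => (Real.exp_pos _).le) fun j _ =>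
          N.integral_exp_checkLoss_le ((hb j).trans M.b_le) ((hb j).trans M.b_le_one)
    _ = Real.exp (2 * K * ‖u‖ ^ 2) := by rw [← Real.exp_sum, ← Finset.mul_sum, M.parseval u]
    _ ≤ _ := by gcongr

/-- The quantile process is bounded above on the ball by a constant of the order of the dimension,
up to an event of small probability. -/
theorem exists_upper (a : ℝ) : ∃ A : Set (Fin n → ℝ), MeasurableSet A ∧
    (Measure.pi fun _ => ν).real A ≤ Real.exp (Module.finrank ℝ E + 2 * K * ρ ^ 2 - a) ∧
    ∀ e ∉ A, ∀ t, ‖t‖ ≤ ρ / 2 → ∑ j, checkLoss τ (e j) ⟪x j, t⟫ ≤ a := by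
  have : ProperSpace E := FiniteDimensional.proper ℝ E
  have hρ := M.radius_pos
  set μ : Measure (Fin n → ℝ) := Measure.pi fun _ => ν with hμ
  set m : Measure E := Measure.addHaar with hm
  set d := Module.finrank ℝ E with hd
  have hq := continuous_quantileLoss τ
  have hcont : Continuous fun p : (Fin n → ℝ) × E =>
      ENNReal.ofReal (Real.exp (∑ j, checkLoss τ (p.1 j) ⟪x j, p.2⟫)) := by
    refine ENNReal.continuous_ofReal.comp ?_
    unfold checkLoss
    fun_prop
  set Z : (Fin n → ℝ) → ℝ≥0∞ := fun e => ∫⁻ u in Metric.closedBall (0 : E) ρ,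
    ENNReal.ofReal (Real.exp (∑ j, checkLoss τ (e j) ⟪x j, u⟫)) ∂m with hZ
  have hZm : Measurable Z := hcont.measurable.lintegral_prod_right'
  have hvol : m (Metric.closedBall (0 : E) ρ) = 2 ^ d * m (Metric.closedBall (0 : E) (ρ / 2)) := by
    rw [Measure.addHaar_closedBall m _ hρ.le, Measure.addHaar_closedBall m _ (by positivity),
      ← mul_assoc]
    congr 1
    rw [← hd, show (2 : ℝ≥0∞) ^ d = ENNReal.ofReal (2 ^ d) by
      rw [ENNReal.ofReal_pow (by norm_num)]; norm_num, ← ENNReal.ofReal_mul (by positivity)]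
    congr 1
    rw [← mul_pow]; congr 1; ring
  set c := m (Metric.closedBall (0 : E) (ρ / 2)) with hc
  have hc0 : c ≠ 0 := (Metric.measure_closedBall_pos m _ (by positivity)).ne'
  have hct : c ≠ ∞ := measure_closedBall_lt_top.ne
  have hZint : ∫⁻ e, Z e ∂μ ≤ 2 ^ d * c * ENNReal.ofReal (Real.exp (2 * K * ρ ^ 2)) := by
    rw [hZ, lintegral_lintegral_swap hcont.measurable.aemeasurable]
    refine (setLIntegral_mono measurable_const fun u hu =>
      M.lintegral_exp_le (mem_closedBall_zero_iff.1 hu)).trans (le_of_eq ?_)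
    rw [lintegral_const, Measure.restrict_apply_univ, hvol, mul_comm]
  -- Markov's inequality for the integral of the exponential over the ball of radius $\rho$. The
  -- ratio of the volumes of the balls of radii $\rho$ and $\rho/2$ is $2^d\le e^d$. Off this event,
  -- `measure_mul_exp_le` bounds the convex loss at each point of the half ball.
  refine ⟨{e | c * ENNReal.ofReal (Real.exp a) ≤ Z e}, measurableSet_le measurable_const hZm, ?_,
    fun e he t ht => ?_⟩
  · have hmark := mul_meas_ge_le_lintegral (μ := μ) hZm (c * ENNReal.ofReal (Real.exp a))
    have h1 : ENNReal.ofReal (Real.exp a) * μ {e | c * ENNReal.ofReal (Real.exp a) ≤ Z e}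
        ≤ 2 ^ d * ENNReal.ofReal (Real.exp (2 * K * ρ ^ 2)) := by
      refine (ENNReal.mul_le_mul_iff_right hc0 hct).1 ?_
      calc _ = c * ENNReal.ofReal (Real.exp a) * μ {e | c * ENNReal.ofReal (Real.exp a) ≤ Z e} := by
            ring
        _ ≤ _ := hmark.trans hZint
        _ = _ := by ring
    have h2 := ENNReal.toReal_mono (by finiteness) h1
    rw [ENNReal.toReal_mul, ENNReal.toReal_mul, ENNReal.toReal_ofReal (Real.exp_pos _).le,
      ENNReal.toReal_ofReal (Real.exp_pos _).le, ENNReal.toReal_pow] at h2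
    have h3 : (ENNReal.toReal 2) ^ d ≤ Real.exp d := by
      rw [← Real.exp_one_pow]
      have : (2 : ℝ) ≤ Real.exp 1 := by linarith [Real.add_one_le_exp (1 : ℝ)]
      simpa using pow_le_pow_left₀ (by norm_num) this d
    rw [Real.exp_sub, Real.exp_add, le_div_iff₀ (Real.exp_pos _), mul_comm]
    refine h2.trans (mul_le_mul_of_nonneg_right h3 (Real.exp_pos _).le)
  · simp only [Set.mem_ofPred_eq, not_le] at he
    have hmeas : Measurable fun u : E => ∑ j, checkLoss τ (e j) ⟪x j, u⟫ := by
      refine Continuous.measurable ?_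
      unfold checkLoss
      fun_prop
    have h1 := measure_mul_exp_le m hmeas (fun t y => by
      rw [Finset.mul_sum, ← Finset.sum_add_distrib]
      refine Finset.sum_le_sum fun j _ => ?_
      rw [inner_add_right, inner_sub_right]
      exact two_mul_checkLoss_le τ _ _ _) ht
    rw [show 2 * (ρ / 2) = ρ by ring] at h1
    have h2 := (ENNReal.mul_lt_mul_iff_right hc0 hct).1 (h1.trans_lt he)
    have h3 := (ENNReal.ofReal_lt_ofReal_iff (Real.exp_pos _)).1 h2
    exact (Real.exp_lt_exp.1 h3).le

end LocalModel

end Upper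

/-! ### Central limit theorem for weighted sums -/

lemma norm_prod_sub_prod_le_sum {ι : Type*} (s : Finset ι) {a b : ι → ℂ}
    (ha : ∀ i ∈ s, ‖a i‖ ≤ 1) (hb : ∀ i ∈ s, ‖b i‖ ≤ 1) :
    ‖∏ i ∈ s, a i - ∏ i ∈ s, b i‖ ≤ ∑ i ∈ s, ‖a i - b i‖ := by
  classical
  induction s using Finset.induction_on with
  | empty => simp
  | insert i s hi ih =>
    rw [Finset.prod_insert hi, Finset.prod_insert hi, Finset.sum_insert hi]
    have h1 := ih (fun j hj => ha j (Finset.mem_insert_of_mem hj))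
      (fun j hj => hb j (Finset.mem_insert_of_mem hj))
    have h2 : ‖∏ j ∈ s, a j‖ ≤ 1 := by
      rw [norm_prod]
      exact Finset.prod_le_one (fun _ _ => norm_nonneg _)
        fun j hj => ha j (Finset.mem_insert_of_mem hj)
    have h3 := hb i (Finset.mem_insert_self _ _)
    calc ‖a i * ∏ j ∈ s, a j - b i * ∏ j ∈ s, b j‖
        = ‖(a i - b i) * ∏ j ∈ s, a j + b i * (∏ j ∈ s, a j - ∏ j ∈ s, b j)‖ := by
          congr 1; ring
      _ ≤ ‖a i - b i‖ * ‖∏ j ∈ s, a j‖ + ‖b i‖ * ‖∏ j ∈ s, a j - ∏ j ∈ s, b j‖ := by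
          refine (norm_add_le _ _).trans ?_
          rw [norm_mul, norm_mul]
      _ ≤ ‖a i - b i‖ * 1 + 1 * ‖∏ j ∈ s, a j - ∏ j ∈ s, b j‖ := by gcongr
      _ ≤ _ := by linarith

lemma isLittleO_exp_neg_sq :
    (fun t : ℝ => Complex.exp (-(t : ℂ) ^ 2 / 2) - (1 - (t : ℂ) ^ 2 / 2)) =o[𝓝 0]
      fun t : ℝ => t ^ 2 := by
  have h1 : (fun t : ℝ => Complex.exp (-(t : ℂ) ^ 2 / 2) - (1 - (t : ℂ) ^ 2 / 2)) =O[𝓝 0]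
      fun t : ℝ => t ^ 4 := by
    refine IsBigO.of_bound 1 ?_
    have : ∀ᶠ t : ℝ in 𝓝 0, |t| < 1 := by
      have := Metric.ball_mem_nhds (0 : ℝ) one_pos
      filter_upwards [this] with t ht
      simpa using ht
    filter_upwards [this] with t ht
    have hn : ‖-(t : ℂ) ^ 2 / 2‖ = t ^ 2 / 2 := by
      rw [norm_div, norm_neg, norm_pow, Complex.norm_real, Real.norm_eq_abs, sq_abs]; norm_num
    have ht2 : t ^ 2 ≤ 1 := by rw [← sq_abs]; exact pow_le_one₀ (abs_nonneg _) ht.le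
    have h2 := Complex.norm_exp_sub_one_sub_id_le (x := -(t : ℂ) ^ 2 / 2) (by rw [hn]; linarith)
    rw [hn] at h2
    have h3 : Complex.exp (-(t : ℂ) ^ 2 / 2) - (1 - (t : ℂ) ^ 2 / 2)
        = Complex.exp (-(t : ℂ) ^ 2 / 2) - 1 - -(t : ℂ) ^ 2 / 2 := by ring
    rw [h3, Real.norm_eq_abs, abs_of_nonneg (by positivity)]
    refine h2.trans ?_
    nlinarith [sq_nonneg (t ^ 2)]
  refine h1.trans_isLittleO ?_
  have h4 : (fun t : ℝ => t ^ 4) =o[𝓝 0] fun t : ℝ => t ^ 2 := isLittleO_pow_pow (by norm_num)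
  exact h4

/-- Central limit theorem for weighted sums of independent, identically distributed variables. -/
theorem tendstoInDistribution_weighted_sum {Ω : Type*} [MeasurableSpace Ω] {P : Measure Ω}
    [IsProbabilityMeasure P] {X : ℕ → Ω → ℝ} (hX : ∀ i, Measurable (X i)) (hindep : iIndepFun X P)
    (hident : ∀ i, P.map (X i) = P.map (X 0)) (h0 : P[X 0] = 0) (h1 : P[X 0 ^ 2] = 1)
    (W : ∀ n, Fin n → ℝ) {v : ℝ≥0} (hW : ∀ᶠ n in atTop, ∑ j, W n j ^ 2 = v)
    (hmax : ∀ δ > 0, ∀ᶠ n in atTop, ∀ j, |W n j| ≤ δ) :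
    TendstoInDistribution (fun n ω => ∑ j, W n j * X j ω) atTop (id : ℝ → ℝ) (fun _ => P)
      (gaussianReal 0 v) where
  forall_aemeasurable n :=
    (Finset.measurable_sum _ fun (j : Fin n) _ => (hX (j : ℕ)).const_mul (W n j)).aemeasurable
  aemeasurable_limit := aemeasurable_id
  tendsto := by
    refine ProbabilityMeasure.tendsto_iff_tendsto_charFun.2 fun t => ?_
    simp only [ProbabilityMeasure.coe_mk, Measure.map_id, charFun_gaussianReal]
    set φ : ℝ → ℂ := charFun (P.map (X 0)) with hφ
    have : IsProbabilityMeasure (P.map (X 0)) :=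
      Measure.isProbabilityMeasure_map (hX 0).aemeasurable
    have hchar : ∀ n, charFun (P.map fun ω => ∑ j, W n j * X j ω) t = ∏ j, φ (W n j * t) := by
      intro n
      have hind : iIndepFun (fun (j : Fin n) ω => W n j * X j ω) P :=
        (hindep.precomp Fin.val_injective).comp (fun j y => W n j * y)
          fun j => measurable_const_mul _
      rw [hind.charFun_map_fun_sum_eq_prod
        fun j : Fin n => ((hX (j : ℕ)).const_mul (W n j)).aemeasurable,
        Finset.prod_apply]
      refine Finset.prod_congr rfl fun j _ => ?_
      rw [charFun_map_mul_comp (hX j).aemeasurable, hident j]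
    have hlim : Complex.exp (t * ((0 : ℝ) : ℂ) * Complex.I - v * t ^ 2 / 2)
        = Complex.exp (-(v * t ^ 2) / 2) := by congr 1; simp; ring
    change Tendsto (fun n => charFun (P.map fun ω => ∑ j, W n j * X j ω) t) atTop _
    simp_rw [hchar]
    rw [hlim, tendsto_iff_norm_sub_tendsto_zero]
    -- Each factor differs from its Gaussian counterpart by $o(s^2)$ at $s=W_{n,j}t$. As
    -- $\sum_jW_{n,j}^2=v$ and the weights are uniformly small, the products differ by $o(1)$.
    have htay : (fun s : ℝ => φ s - Complex.exp (-(s : ℂ) ^ 2 / 2)) =o[𝓝 0] fun s : ℝ => s ^ 2 := by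
      have := (taylor_charFun_two (hX 0).aemeasurable h0 h1).sub isLittleO_exp_neg_sq
      refine this.congr_left fun s => ?_
      rw [hφ]; ring
    rw [Metric.tendsto_nhds]
    intro δ hδ
    set C := (v : ℝ) * t ^ 2 + 1 with hC
    have hC0 : 0 < C := by positivity
    have h2 := htay.def (c := δ / (2 * C)) (by positivity)
    rw [Metric.eventually_nhds_iff] at h2
    obtain ⟨r, hr, h2⟩ := h2
    filter_upwards [hW, hmax (r / (2 * (|t| + 1))) (by positivity)] with n hn hm
    rw [Real.dist_eq, sub_zero, abs_norm]
    have hsmall : ∀ j, ‖φ (W n j * t) - Complex.exp (-((W n j * t : ℝ) : ℂ) ^ 2 / 2)‖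
        ≤ δ / (2 * C) * (W n j ^ 2 * t ^ 2) := fun j => by
      have h3 : dist (W n j * t) 0 < r := by
        rw [Real.dist_eq, sub_zero, abs_mul]
        calc |W n j| * |t| ≤ r / (2 * (|t| + 1)) * (|t| + 1) := by
              gcongr
              · exact hm j
              · linarith
          _ = r / 2 := by field_simp
          _ < r := by linarith
      have h4 := h2 h3
      rwa [Real.norm_eq_abs, abs_of_nonneg (sq_nonneg _), mul_pow] at h4
    have hprod : Complex.exp (-(v * t ^ 2) / 2)
        = ∏ j, Complex.exp (-((W n j * t : ℝ) : ℂ) ^ 2 / 2) := by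
      rw [← Complex.exp_sum]
      congr 1
      have : (v : ℂ) = ((∑ j, W n j ^ 2 : ℝ) : ℂ) := by rw [hn]
      rw [this]
      push_cast
      rw [Finset.sum_mul, ← Finset.sum_neg_distrib, Finset.sum_div]
      exact Finset.sum_congr rfl fun j _ => by ring
    rw [hprod]
    calc ‖∏ j, φ (W n j * t) - ∏ j, Complex.exp (-((W n j * t : ℝ) : ℂ) ^ 2 / 2)‖
        ≤ ∑ j, ‖φ (W n j * t) - Complex.exp (-((W n j * t : ℝ) : ℂ) ^ 2 / 2)‖ := by
          refine norm_prod_sub_prod_le_sum _ (fun j _ => norm_charFun_le_one _) fun j _ => ?_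
          rw [Complex.norm_exp, Real.exp_le_one_iff]
          have : -((W n j * t : ℝ) : ℂ) ^ 2 / 2 = ((-(W n j * t) ^ 2 / 2 : ℝ) : ℂ) := by
            push_cast; ring
          rw [this, Complex.ofReal_re]
          nlinarith [sq_nonneg (W n j * t)]
      _ ≤ ∑ j, δ / (2 * C) * (W n j ^ 2 * t ^ 2) := Finset.sum_le_sum fun j _ => hsmall j
      _ = δ / (2 * C) * (v * t ^ 2) := by rw [← Finset.mul_sum, ← Finset.sum_mul, hn]
      _ ≤ δ / (2 * C) * C := by gcongr; linarith
      _ = δ / 2 := by field_simp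
      _ < δ := by linarith

/-! ### Error laws with a density -/

section Density

lemma measureReal_withDensity_mem_Icc {f : ℝ → ℝ} {ν : Measure ℝ}
    [IsProbabilityMeasure ν] (hν : ν = volume.withDensity fun x => ENNReal.ofReal (f x))
    {s : Set ℝ} (hs : MeasurableSet s) (hvol : volume s ≠ ∞) {c₁ c₂ : ℝ} (h0 : 0 ≤ c₁)
    (h : ∀ x ∈ s, c₁ ≤ f x ∧ f x ≤ c₂) :
    ν.real s ∈ Set.Icc (c₁ * volume.real s) (c₂ * volume.real s) := by
  have e : ν s = ∫⁻ x in s, ENNReal.ofReal (f x) := by rw [hν, withDensity_apply _ hs]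
  have h1 : ENNReal.ofReal c₁ * volume s ≤ ν s := by
    rw [e, ← setLIntegral_const]
    exact setLIntegral_mono' hs fun x hx => ENNReal.ofReal_le_ofReal (h x hx).1
  have h2 : ν s ≤ ENNReal.ofReal c₂ * volume s := by
    rw [e, ← setLIntegral_const]
    exact setLIntegral_mono' hs fun x hx => ENNReal.ofReal_le_ofReal (h x hx).2
  constructor
  · have := ENNReal.toReal_mono (measure_ne_top _ _) h1
    rwa [ENNReal.toReal_mul, ENNReal.toReal_ofReal h0] at this
  · rcases s.eq_empty_or_nonempty with rfl | ⟨x, hx⟩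
    · simp
    · have := ENNReal.toReal_mono (ENNReal.mul_ne_top ENNReal.ofReal_ne_top hvol) h2
      rwa [ENNReal.toReal_mul, ENNReal.toReal_ofReal (h0.trans ((h x hx).1.trans (h x hx).2))]
        at this

/-- A law whose density is positive and differentiable with bounded derivative around its
quantile `0` satisfies `QuantileNoise`. -/
theorem exists_quantileNoise {f : ℝ → ℝ} {ν : Measure ℝ} [IsProbabilityMeasure ν]
    (hν : ν = volume.withDensity fun x => ENNReal.ofReal (f x)) {τ : ℝ} (hτ0 : 0 < τ) (hτ1 : τ < 1)
    (hq : ν.real (Set.Iio 0) = τ)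
    (hf : ∃ K : ℝ, ∀ᶠ x in 𝓝 (0 : ℝ), 0 < f x ∧ DifferentiableAt ℝ f x ∧ |deriv f x| ≤ K) :
    ∃ b₀ K, QuantileNoise ν τ (f 0) b₀ K := by
  obtain ⟨D, hD⟩ := hf
  obtain ⟨r, hr, hD⟩ := Metric.eventually_nhds_iff_ball.1 hD
  have hf0 : 0 < f 0 := (hD 0 (Metric.mem_ball_self hr)).1
  have hD0 : 0 ≤ D := (abs_nonneg _).trans (hD 0 (Metric.mem_ball_self hr)).2.2
  have hlip : ∀ x ∈ Metric.ball (0 : ℝ) r, |f x - f 0| ≤ D * |x| := fun x hx => by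
    have := (convex_ball (0 : ℝ) r).norm_image_sub_le_of_norm_deriv_le (f := f) (C := D)
      (fun y hy => (hD y hy).2.1) (fun y hy => (hD y hy).2.2) (Metric.mem_ball_self hr) hx
    simpa using this
  -- The first two bounds keep the density between $f(0)/2$ and $2f(0)$ on $[-b_0,b_0]$; the last
  -- two leave each tail at least half of its mass $\tau$ or $1-\tau$. The `D + 1` allows $D=0$.
  set b₀ := min (min (r / 2) (f 0 / (2 * (D + 1)))) (min (τ / (4 * f 0)) ((1 - τ) / (4 * f 0)))
    with hb₀
  have hb1 : b₀ ≤ r / 2 := (min_le_left _ _).trans (min_le_left _ _)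
  have hb2 : b₀ ≤ f 0 / (2 * (D + 1)) := (min_le_left _ _).trans (min_le_right _ _)
  have hb3 : b₀ ≤ τ / (4 * f 0) := (min_le_right _ _).trans (min_le_left _ _)
  have hb4 : b₀ ≤ (1 - τ) / (4 * f 0) := (min_le_right _ _).trans (min_le_right _ _)
  have hτ1' : 0 < 1 - τ := by linarith
  have hbpos : 0 < b₀ := by positivity
  have hDb : D * b₀ ≤ f 0 / 2 := by
    calc D * b₀ ≤ (D + 1) * (f 0 / (2 * (D + 1))) := by gcongr; linarith
      _ = f 0 / 2 := by field_simp
  have hfb3 : 2 * f 0 * b₀ ≤ τ / 2 := by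
    calc 2 * f 0 * b₀ ≤ 2 * f 0 * (τ / (4 * f 0)) := by gcongr
      _ = τ / 2 := by field_simp; ring
  have hfb4 : 2 * f 0 * b₀ ≤ (1 - τ) / 2 := by
    calc 2 * f 0 * b₀ ≤ 2 * f 0 * ((1 - τ) / (4 * f 0)) := by gcongr
      _ = (1 - τ) / 2 := by field_simp; ring
  have hloc : ∀ x z, |x| ≤ z → z ≤ b₀ → f 0 - D * z ≤ f x ∧ f x ≤ f 0 + D * z := fun x z hx hz => by
    have h1 := hlip x (by rw [Metric.mem_ball, Real.dist_eq, sub_zero]; linarith)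
    have h2 : D * |x| ≤ D * z := by gcongr
    constructor <;> linarith [abs_le.1 (h1.trans h2)]
  have hloc' : ∀ x, |x| ≤ b₀ → f 0 / 2 ≤ f x ∧ f x ≤ 2 * f 0 := fun x hx => by
    have := hloc x b₀ hx le_rfl
    constructor <;> linarith
  have hmass : ∀ x y, -b₀ ≤ x → x ≤ y → y ≤ b₀ → ∀ s ⊆ Set.Icc x y, MeasurableSet s →
      ν.real s ∈ Set.Icc (f 0 / 2 * volume.real s) (2 * f 0 * volume.real s) := by
    intro x y hx hxy hy s hs hsm
    refine measureReal_withDensity_mem_Icc hν hsm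
      (ne_top_of_le_ne_top (by simp) (measure_mono hs)) (by positivity) fun u hu => ?_
    have := hs hu
    exact hloc' u (abs_le.2 ⟨hx.trans this.1, this.2.trans hy⟩)
  set K := 1 + 2 / f 0 + 2 * f 0 + D + 2 / τ + 2 / (1 - τ) with hK
  have p1 : 0 ≤ 2 / f 0 := by positivity
  have p2 : 0 ≤ 2 / τ := by positivity
  have p3 : 0 ≤ 2 / (1 - τ) := by positivity
  have hKpos : 0 < K := by positivity
  have k1 : 2 / f 0 ≤ K := by linarith
  have k2 : 2 * f 0 ≤ K := by linarith
  have k3 : D ≤ K := by linarith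
  have k4 : 2 / τ ≤ K := by linarith
  have k5 : 2 / (1 - τ) ≤ K := by linarith
  refine ⟨b₀, K, ⟨by linarith, hτ0, hτ1, hbpos, ?_, by linarith, ?_, ?_, hq, ?_, ?_, ?_⟩⟩
  · calc (1 : ℝ) ≤ 2 / f 0 * f 0 := by field_simp; norm_num
      _ ≤ K * f 0 := by gcongr
  · intro x y hx hxy hy
    have := (hmass x y hx hxy hy _ Set.Ioo_subset_Icc_self measurableSet_Ioo).1
    rw [Real.volume_real_Ioo_of_le hxy] at this
    calc y - x = 2 / f 0 * (f 0 / 2 * (y - x)) := by field_simp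
      _ ≤ 2 / f 0 * ν.real (Set.Ioo x y) := by gcongr
      _ ≤ K * ν.real (Set.Ioo x y) := by gcongr
  · intro x y hx hxy hy
    have := (hmass x y hx hxy hy _ subset_rfl measurableSet_Icc).2
    rw [Real.volume_real_Icc_of_le hxy] at this
    have h1 : 0 ≤ y - x := by linarith
    exact this.trans (by gcongr)
  · intro z hz
    rcases le_total 0 z with h | h
    · rw [abs_of_nonneg h] at hz
      have h1 : ν.real (Set.Iio z) = τ + ν.real (Set.Ico 0 z) := by
        rw [← hq, ← measureReal_union (by
          rw [Set.disjoint_left]; intro a ha hb; exact absurd hb.1 (not_le.2 ha)) measurableSet_Ico,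
          Set.Iio_union_Ico_eq_Iio h]
      have h2 := measureReal_withDensity_mem_Icc hν (measurableSet_Ico (a := 0) (b := z)) (by simp)
        (c₁ := f 0 - D * z) (c₂ := f 0 + D * z) (by nlinarith) fun x hx =>
          hloc x z (by rw [abs_of_nonneg hx.1]; exact hx.2.le) hz
      rw [Real.volume_real_Ico_of_le h, sub_zero] at h2
      rw [h1, abs_le]
      have := h2.1; have := h2.2
      constructor <;> nlinarith [mul_le_mul_of_nonneg_right k3 (sq_nonneg z)]
    · rw [abs_of_nonpos h] at hz
      have h1 : τ = ν.real (Set.Iio z) + ν.real (Set.Ico z 0) := by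
        rw [← hq, ← measureReal_union (by
          rw [Set.disjoint_left]; intro a ha hb; exact absurd hb.1 (not_le.2 ha)) measurableSet_Ico,
          Set.Iio_union_Ico_eq_Iio h]
      have h2 := measureReal_withDensity_mem_Icc hν (measurableSet_Ico (a := z) (b := 0)) (by simp)
        (c₁ := f 0 - D * -z) (c₂ := f 0 + D * -z) (by nlinarith) fun x hx =>
          hloc x (-z) (by rw [abs_of_neg hx.2]; linarith [hx.1]) hz
      rw [Real.volume_real_Ico_of_le h] at h2
      rw [abs_le]
      have := h2.1; have := h2.2
      constructor <;> nlinarith [mul_le_mul_of_nonneg_right k3 (sq_nonneg z)]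
  · have h1 : ν.real (Set.Ico 0 b₀) + ν.real (Set.Ici b₀) = 1 - τ := by
      rw [← measureReal_union (by
          rw [Set.disjoint_left]; intro a ha hb; exact absurd ha.2 (not_lt.2 hb)) measurableSet_Ici,
          Set.Ico_union_Ici_eq_Ici hbpos.le, ← Set.compl_Iio, probReal_compl_eq_one_sub
            measurableSet_Iio, hq]
    have h2 := (hmass 0 b₀ (by linarith) hbpos.le le_rfl _ Set.Ico_subset_Icc_self
      measurableSet_Ico).2
    rw [Real.volume_real_Ico_of_le hbpos.le, sub_zero] at h2
    calc (1 : ℝ) = 2 / (1 - τ) * ((1 - τ) / 2) := by field_simp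
      _ ≤ 2 / (1 - τ) * ν.real (Set.Ici b₀) := by gcongr; linarith
      _ ≤ K * ν.real (Set.Ici b₀) := by gcongr
  · have hb' : -b₀ ≤ 0 := by linarith
    have h1 : ν.real (Set.Iic (-b₀)) + ν.real (Set.Ioo (-b₀) 0) = τ := by
      rw [← hq, ← measureReal_union (by
          rw [Set.disjoint_left]; intro a ha hb; exact absurd ha (not_le.2 hb.1)) measurableSet_Ioo,
          Set.Iic_union_Ioo_eq_Iio (by linarith)]
    have h2 := (hmass (-b₀) 0 le_rfl hb' hbpos.le _ Set.Ioo_subset_Icc_self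
      measurableSet_Ioo).2
    rw [Real.volume_real_Ioo_of_le hb'] at h2
    calc (1 : ℝ) = 2 / τ * (τ / 2) := by field_simp
      _ ≤ 2 / τ * ν.real (Set.Iic (-b₀)) := by gcongr; linarith
      _ ≤ K * ν.real (Set.Iic (-b₀)) := by gcongr

/-- The joint law of independent errors with a common law. -/
lemma map_errors_eq_pi {Ω : Type*} [MeasurableSpace Ω] {P : Measure Ω} [IsProbabilityMeasure P]
    {ε : ℕ → Ω → ℝ} (hε : ∀ i, Measurable (ε i)) (hind : iIndepFun ε P) {ν : Measure ℝ}
    (hν : ∀ i, P.map (ε i) = ν) (n : ℕ) :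
    P.map (fun ω (j : Fin n) => ε j ω) = Measure.pi fun _ : Fin n => ν := by
  have h := (iIndepFun_iff_map_fun_eq_pi_map (f := fun (j : Fin n) => ε j)
    fun j => (hε j).aemeasurable).1 (hind.precomp (Fin.val_injective (n := n)))
  simp only [hν] at h
  exact h

end Density

/-! ### Whitening a design -/

section Whitening

open scoped RealInnerProductSpace

variable {V : Type*} [NormedAddCommGroup V] [InnerProductSpace ℝ V] [FiniteDimensional ℝ V] {n : ℕ}

/-- `T` is a change of variables which turns the regressors `x` into the Parseval frame `y`. -/
structure IsWhitening (x : Fin n → V) (T : V ≃ₗ[ℝ] V) (y : Fin n → V) : Prop where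
  parseval : IsParseval y
  inner_apply : ∀ j θ, ⟪y j, T θ⟫ = ⟪x j, θ⟫

/-- The design `x` is well conditioned: its quadratic form lies between `m` and `M`. -/
def IsConditioned (x : Fin n → V) (m M : ℝ) : Prop :=
  ∀ θ, m * ‖θ‖ ^ 2 ≤ ∑ j, ⟪x j, θ⟫ ^ 2 ∧ ∑ j, ⟪x j, θ⟫ ^ 2 ≤ M * ‖θ‖ ^ 2

/-- The lower bound makes $\theta\mapsto(\langle x_j,\theta\rangle)_j$ injective. `T` is this map
followed by an isometry of its range onto `V`, and the frame consists of the regressors transported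
by the adjoint of $T^{-1}$. -/
lemma IsConditioned.exists_isWhitening {x : Fin n → V} {m M : ℝ} (hm : 0 < m)
    (h : IsConditioned x m M) : ∃ T y, IsWhitening x T y := by
  let L : V →ₗ[ℝ] EuclideanSpace ℝ (Fin n) :=
    (WithLp.linearEquiv 2 ℝ (Fin n → ℝ)).symm.toLinearMap ∘ₗ
      LinearMap.pi fun j => (innerSL ℝ (x j)).toLinearMap
  have hL : ∀ θ j, L θ j = ⟪x j, θ⟫ := fun θ j => rfl
  have hLn : ∀ θ, ‖L θ‖ ^ 2 = ∑ j, ⟪x j, θ⟫ ^ 2 := fun θ => by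
    rw [EuclideanSpace.norm_sq_eq]; simp [hL]
  have hinj : Function.Injective L := by
    rw [← LinearMap.ker_eq_bot, LinearMap.ker_eq_bot']
    intro θ hθ
    have h1 := (h θ).1
    rw [← hLn, hθ, norm_zero] at h1
    have : ‖θ‖ ^ 2 ≤ 0 := by
      by_contra hh
      push Not at hh
      nlinarith
    exact norm_eq_zero.1 (pow_eq_zero_iff (two_ne_zero) |>.1 (le_antisymm this (sq_nonneg _)))
  let e := LinearEquiv.ofInjective L hinj
  have hdim : Module.finrank ℝ (LinearMap.range L) = Module.finrank ℝ V := e.symm.finrank_eq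
  let i : LinearMap.range L ≃ₗᵢ[ℝ] V :=
    (stdOrthonormalBasis ℝ (LinearMap.range L)).equiv (stdOrthonormalBasis ℝ V) (finCongr hdim)
  let T : V ≃ₗ[ℝ] V := e.trans i.toLinearEquiv
  have hT : ∀ θ, ‖T θ‖ ^ 2 = ∑ j, ⟪x j, θ⟫ ^ 2 := fun θ => by
    have : ‖T θ‖ = ‖L θ‖ := by
      change ‖i (e θ)‖ = _
      rw [i.norm_map]; rfl
    rw [this, hLn]
  refine ⟨T, fun j => LinearMap.adjoint T.symm.toLinearMap (x j), ⟨fun t => ?_, fun j θ => ?_⟩⟩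
  · obtain ⟨θ, rfl⟩ := T.surjective t
    rw [hT]
    exact Finset.sum_congr rfl fun j _ => by rw [LinearMap.adjoint_inner_left]; simp
  · rw [LinearMap.adjoint_inner_left]; simp

namespace IsWhitening

variable {x y : Fin n → V} {T : V ≃ₗ[ℝ] V} (W : IsWhitening x T y)
include W

lemma norm_sq_apply (θ : V) : ‖T θ‖ ^ 2 = ∑ j, ⟪x j, θ⟫ ^ 2 := by
  rw [← W.parseval]; simp only [W.inner_apply]

lemma inner_apply_apply (θ η : V) : ⟪T θ, T η⟫ = ∑ j, ⟪x j, θ⟫ * ⟪x j, η⟫ := by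
  rw [← W.parseval.sum_mul]; simp only [W.inner_apply]

variable {m M : ℝ} (hm : 0 < m) (h : IsConditioned x m M)
include hm h

lemma norm_le (θ : V) : ‖θ‖ ≤ (√m)⁻¹ * ‖T θ‖ := by
  have h1 := (h θ).1
  rw [← W.norm_sq_apply] at h1
  have h2 : √m * ‖θ‖ ≤ ‖T θ‖ := by
    refine le_of_sq_le_sq ?_ (norm_nonneg _)
    rwa [mul_pow, Real.sq_sqrt hm.le]
  rw [inv_mul_eq_div, le_div_iff₀ (Real.sqrt_pos.2 hm), mul_comm]
  exact h2

lemma norm_apply_le (hM : 0 ≤ M) (θ : V) : ‖T θ‖ ≤ √M * ‖θ‖ := by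
  have h1 := (h θ).2
  rw [← W.norm_sq_apply] at h1
  refine le_of_sq_le_sq ?_ (by positivity)
  rwa [mul_pow, Real.sq_sqrt hM]

/-- The functional `⟪v, ·⟫` in the new variables. -/
lemma exists_dual (v : V) : ∃ v', ‖v'‖ ≤ (√m)⁻¹ * ‖v‖ ∧ ∀ θ, ⟪v', T θ⟫ = ⟪v, θ⟫ := by
  refine ⟨LinearMap.adjoint T.symm.toLinearMap v, ?_, fun θ => ?_⟩
  · set v' := LinearMap.adjoint T.symm.toLinearMap v with hv'
    have e : ‖v'‖ ^ 2 = ⟪v, T.symm v'⟫ := by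
      rw [← real_inner_self_eq_norm_sq]
      nth_rewrite 1 [hv']
      rw [LinearMap.adjoint_inner_left]; rfl
    have h1 := W.norm_le hm h (T.symm v')
    rw [LinearEquiv.apply_symm_apply] at h1
    have h2 : ‖v'‖ ^ 2 ≤ ‖v‖ * ((√m)⁻¹ * ‖v'‖) := by
      rw [e]
      exact (real_inner_le_norm _ _).trans (by gcongr)
    rcases (norm_nonneg v').eq_or_lt with h3 | h3
    · rw [← h3]; positivity
    · nlinarith
  · rw [LinearMap.adjoint_inner_left]; simp

lemma norm_frame_le (j : Fin n) : ‖y j‖ ≤ (√m)⁻¹ * ‖x j‖ := by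
  obtain ⟨v, hv, hv'⟩ := W.exists_dual hm h (x j)
  have : y j = v := by
    refine ext_inner_right ℝ fun t => ?_
    obtain ⟨θ, rfl⟩ := T.surjective t
    rw [W.inner_apply, hv']
  rw [this]; exact hv

end IsWhitening

/-- The trace of the identity, computed in an orthonormal basis. It turns every bound in
$\sum_j\|y_j\|^2$ into one in the number of parameters. -/
lemma IsParseval.sum_norm_sq {y : Fin n → V} (hy : IsParseval y) :
    ∑ j, ‖y j‖ ^ 2 = Module.finrank ℝ V := by
  have h1 : ∀ j, ‖y j‖ ^ 2 = ∑ i, ⟪y j, stdOrthonormalBasis ℝ V i⟫ ^ 2 := fun j => by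
    rw [← (stdOrthonormalBasis ℝ V).sum_sq_norm_inner_left (y j)]
    simp
  simp only [h1]
  rw [Finset.sum_comm]
  simp only [hy _, OrthonormalBasis.norm_eq_one]
  simp

end Whitening

/-! ### The Gram matrix and the conditioning of the design -/

section Gram

open scoped RealInnerProductSpace

variable {ι : Type*} [Fintype ι] {n : ℕ}

lemma dotProduct_gramMatrix_mulVec (x : Fin n → EuclideanSpace ℝ ι) (θ η : EuclideanSpace ℝ ι) :
    θ ⬝ᵥ (gramMatrix x).mulVec η = (n : ℝ)⁻¹ * ∑ j, ⟪x j, θ⟫ * ⟪x j, η⟫ := by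
  have h : ∀ j, (x j : ι → ℝ) ⬝ᵥ η = ⟪x j, η⟫ := fun j => by
    simp [PiLp.inner_apply, dotProduct, mul_comm]
  have h' : ∀ j, (θ : ι → ℝ) ⬝ᵥ x j = ⟪x j, θ⟫ := fun j => by
    simp [PiLp.inner_apply, dotProduct]
  unfold gramMatrix
  rw [Matrix.smul_mulVec, Matrix.sum_mulVec, dotProduct_smul, dotProduct_sum, smul_eq_mul]
  congr 1
  refine Finset.sum_congr rfl fun j _ => ?_
  rw [Matrix.vecMulVec_mulVec, h]
  simp [h', mul_comm]

lemma isHermitian_gramMatrix (x : Fin n → EuclideanSpace ℝ ι) : (gramMatrix x).IsHermitian := by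
  ext i k
  simp [gramMatrix, Matrix.sum_apply, Matrix.vecMulVec_apply, mul_comm]

lemma sum_inner_mul_inner_eq (hn : 0 < n) (x : Fin n → EuclideanSpace ℝ ι)
    (θ η : EuclideanSpace ℝ ι) :
    ∑ j, ⟪x j, θ⟫ * ⟪x j, η⟫ = n * (θ ⬝ᵥ (gramMatrix x).mulVec η) := by
  have : (n : ℝ) ≠ 0 := by positivity
  rw [dotProduct_gramMatrix_mulVec, mul_inv_cancel_left₀ this]

/-- The eigenvalues of the Gram matrix control the conditioning of the design. -/
lemma isConditioned_of_spectrum [DecidableEq ι] (hn : 0 < n) (x : Fin n → EuclideanSpace ℝ ι)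
    {m M : ℝ} (h : ∀ μ ∈ spectrum ℝ (gramMatrix x), m ≤ μ ∧ μ ≤ M) :
    IsConditioned x (n * m) (n * M) := by
  have H := isHermitian_gramMatrix x
  intro θ
  have e : ∑ j, ⟪x j, θ⟫ ^ 2
      = n * ∑ i, H.eigenvalues i * ⟪H.eigenvectorBasis i, θ⟫ ^ 2 := by
    have h1 : ∑ j, ⟪x j, θ⟫ ^ 2
        = n * ⟪Matrix.toEuclideanLin (gramMatrix x) θ, θ⟫ := by
      simp only [pow_two]
      rw [sum_inner_mul_inner_eq hn]
      simp [PiLp.inner_apply, dotProduct, Matrix.toLpLin_apply]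
    have h2 : ∀ i, ⟪H.eigenvectorBasis i, Matrix.toEuclideanLin (gramMatrix x) θ⟫
        = H.eigenvalues i * ⟪H.eigenvectorBasis i, θ⟫ := fun i => by
      have hs := (Matrix.isSymmetric_toEuclideanLin_iff.2 H)
      rw [← hs]
      have : Matrix.toEuclideanLin (gramMatrix x) (H.eigenvectorBasis i)
          = H.eigenvalues i • H.eigenvectorBasis i := by
        ext k
        have := congrFun (H.mulVec_eigenvectorBasis i) k
        simpa [Matrix.toLpLin_apply] using this
      rw [this, inner_smul_left]; simp
    rw [h1, ← H.eigenvectorBasis.sum_inner_mul_inner]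
    congr 1
    refine Finset.sum_congr rfl fun i _ => ?_
    rw [real_inner_comm, h2]; ring
  have hN : ‖θ‖ ^ 2 = ∑ i, ⟪H.eigenvectorBasis i, θ⟫ ^ 2 := by
    rw [← H.eigenvectorBasis.sum_sq_norm_inner_right θ]; simp
  have hn0 : (0 : ℝ) ≤ n := Nat.cast_nonneg n
  rw [e, hN, mul_assoc, mul_assoc]
  constructor <;> refine mul_le_mul_of_nonneg_left ?_ hn0 <;> rw [Finset.mul_sum] <;>
    refine Finset.sum_le_sum fun i _ => ?_
  · exact mul_le_mul_of_nonneg_right (h _ (H.eigenvalues_mem_spectrum_real i)).1 (sq_nonneg _)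
  · exact mul_le_mul_of_nonneg_right (h _ (H.eigenvalues_mem_spectrum_real i)).2 (sq_nonneg _)

lemma isUnit_gramMatrix [DecidableEq ι] (hn : 0 < n) (x : Fin n → EuclideanSpace ℝ ι) {m M : ℝ}
    (hm : 0 < m) (h : IsConditioned x m M) : IsUnit (gramMatrix x) := by
  rw [← Matrix.mulVec_injective_iff_isUnit]
  refine (injective_iff_map_eq_zero (Matrix.mulVecLin (gramMatrix x))).2 fun v hv => ?_
  have h1 := sum_inner_mul_inner_eq hn x (WithLp.toLp 2 v) (WithLp.toLp 2 v)
  have h2 := (h (WithLp.toLp 2 v)).1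
  simp only [Matrix.mulVecLin_apply] at hv
  simp only [hv, dotProduct_zero, mul_zero, ← pow_two] at h1
  rw [h1] at h2
  have h3 : ‖(WithLp.toLp 2 v : EuclideanSpace ℝ ι)‖ ^ 2 = 0 :=
    le_antisymm (by by_contra hh; push Not at hh; nlinarith) (sq_nonneg _)
  have h4 := norm_eq_zero.1 (pow_eq_zero_iff two_ne_zero |>.1 h3)
  simpa using h4

/-- The inverse Gram matrix gives the dual norm in the whitened variables. -/
lemma IsWhitening.norm_sq_dual [DecidableEq ι] (hn : 0 < n) {x : Fin n → EuclideanSpace ℝ ι}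
    {T : EuclideanSpace ℝ ι ≃ₗ[ℝ] EuclideanSpace ℝ ι} {y : Fin n → EuclideanSpace ℝ ι}
    (W : IsWhitening x T y) (hU : IsUnit (gramMatrix x)) (u : EuclideanSpace ℝ ι) :
    (∀ θ, ⟪T (WithLp.toLp 2 ((gramMatrix x)⁻¹.mulVec u)), T θ⟫ = n * ⟪u, θ⟫) ∧
      ‖T (WithLp.toLp 2 ((gramMatrix x)⁻¹.mulVec u))‖ ^ 2
        = n * (u ⬝ᵥ (gramMatrix x)⁻¹.mulVec u) := by
  have hdet := (Matrix.isUnit_iff_isUnit_det _).1 hU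
  have key : ∀ θ, ⟪T (WithLp.toLp 2 ((gramMatrix x)⁻¹.mulVec u)), T θ⟫ = n * ⟪u, θ⟫ := fun θ => by
    rw [real_inner_comm, W.inner_apply_apply, sum_inner_mul_inner_eq hn]
    simp only [Matrix.mulVec_mulVec, Matrix.mul_nonsing_inv _ hdet, Matrix.one_mulVec]
    simp [PiLp.inner_apply, dotProduct]
  refine ⟨key, ?_⟩
  rw [← real_inner_self_eq_norm_sq, key]
  simp [PiLp.inner_apply, dotProduct, mul_comm]

end Gram

/-! ### Groups of coordinates -/

section Blocks

open scoped RealInnerProductSpace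

variable {g p n : ℕ}

@[simp] lemma block_apply (β : GroupVec g p) (j : Fin g) (k : Fin p) : block β j k = β (j, k) := rfl

lemma block_add (β δ : GroupVec g p) (j : Fin g) : block (β + δ) j = block β j + block δ j := rfl

lemma block_sub (β δ : GroupVec g p) (j : Fin g) : block (β - δ) j = block β j - block δ j := rfl

lemma block_smul (l : ℝ) (β : GroupVec g p) (j : Fin g) : block (l • β) j = l • block β j := rfl

@[simp] lemma block_zero (j : Fin g) : block (0 : GroupVec g p) j = 0 := rfl

lemma sum_inner_block (β δ : GroupVec g p) : ∑ j, ⟪block β j, block δ j⟫ = ⟪β, δ⟫ := by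
  simp only [PiLp.inner_apply, block_apply, Fintype.sum_prod_type]

lemma sum_norm_block_sq (β : GroupVec g p) : ∑ j, ‖block β j‖ ^ 2 = ‖β‖ ^ 2 := by
  simp only [← real_inner_self_eq_norm_sq, sum_inner_block]

lemma norm_block_le (β : GroupVec g p) (j : Fin g) : ‖block β j‖ ≤ ‖β‖ := by
  refine le_of_sq_le_sq ?_ (norm_nonneg _)
  rw [← sum_norm_block_sq]
  exact Finset.single_le_sum (f := fun j => ‖block β j‖ ^ 2) (fun _ _ => sq_nonneg _)
    (Finset.mem_univ j)

lemma sum_norm_block_mul_le (β δ : GroupVec g p) :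
    ∑ j, ‖block β j‖ * ‖block δ j‖ ≤ ‖β‖ * ‖δ‖ := by
  refine le_of_sq_le_sq ?_ (by positivity)
  rw [mul_pow, ← sum_norm_block_sq, ← sum_norm_block_sq]
  exact Finset.sum_mul_sq_le_sq_mul_sq _ _ _

lemma sum_norm_block_le (δ : GroupVec g p) : ∑ j, ‖block δ j‖ ≤ √g * ‖δ‖ := by
  refine le_of_sq_le_sq ?_ (by positivity)
  rw [mul_pow, ← sum_norm_block_sq, Real.sq_sqrt (Nat.cast_nonneg _)]
  have := sq_sum_le_card_mul_sum_sq (s := (Finset.univ : Finset (Fin g)))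
    (f := fun j => ‖block δ j‖)
  simpa using this

lemma norm_le_sum_norm_block (δ : GroupVec g p) : ‖δ‖ ≤ ∑ j, ‖block δ j‖ := by
  refine le_of_sq_le_sq ?_ (Finset.sum_nonneg fun _ _ => norm_nonneg _)
  rw [← sum_norm_block_sq]
  exact Finset.sum_sq_le_sq_sum_of_nonneg fun _ _ => norm_nonneg _

lemma norm_le_sqrt_mul {β : GroupVec g p} {b : ℝ} (hb : 0 ≤ b) (h : ∀ j, ‖block β j‖ ≤ b) :
    ‖β‖ ≤ √g * b := by
  refine le_of_sq_le_sq ?_ (by positivity)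
  rw [mul_pow, ← sum_norm_block_sq, Real.sq_sqrt (Nat.cast_nonneg _)]
  calc ∑ j, ‖block β j‖ ^ 2 ≤ ∑ _j : Fin g, b ^ 2 :=
        Finset.sum_le_sum fun j _ => pow_le_pow_left₀ (norm_nonneg _) (h j) 2
    _ = g * b ^ 2 := by simp

lemma mem_activeSet {β : GroupVec g p} {j : Fin g} : j ∈ activeSet β ↔ block β j ≠ 0 := by
  classical simp [activeSet]

/-- The vector `β` with the groups outside `A` set to zero. -/
def keepGroups (A : Finset (Fin g)) (β : GroupVec g p) : GroupVec g p :=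
  WithLp.toLp 2 fun k => if k.1 ∈ A then β k else 0

lemma block_keepGroups (A : Finset (Fin g)) (β : GroupVec g p) (j : Fin g) :
    block (keepGroups A β) j = if j ∈ A then block β j else 0 := by
  ext k
  by_cases h : j ∈ A <;> simp [keepGroups, h]

lemma groupVec_ext {β δ : GroupVec g p} (h : ∀ j, block β j = block δ j) : β = δ := by
  ext ⟨j, k⟩
  rw [← block_apply, ← block_apply, h]

lemma norm_keepGroups_le (A : Finset (Fin g)) (β : GroupVec g p) : ‖keepGroups A β‖ ≤ ‖β‖ := by
  refine le_of_sq_le_sq ?_ (norm_nonneg _)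
  rw [← sum_norm_block_sq, ← sum_norm_block_sq]
  refine Finset.sum_le_sum fun j _ => ?_
  rw [block_keepGroups]
  split_ifs
  · exact le_rfl
  · simp

/-- The vector with groups `θ` on `A` and zero outside. -/
def extendGroups (A : Finset (Fin g)) (θ : EuclideanSpace ℝ (A × Fin p)) : GroupVec g p :=
  WithLp.toLp 2 fun k => if h : k.1 ∈ A then θ (⟨k.1, h⟩, k.2) else 0

lemma block_extendGroups_of_notMem {A : Finset (Fin g)} (θ : EuclideanSpace ℝ (A × Fin p))
    {j : Fin g} (h : j ∉ A) : block (extendGroups A θ) j = 0 := by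
  ext k; simp [extendGroups, h]

lemma inner_extendGroups (A : Finset (Fin g)) (x : GroupVec g p)
    (θ : EuclideanSpace ℝ (A × Fin p)) : ⟪x, extendGroups A θ⟫ = ⟪restrictGroups A x, θ⟫ := by
  have h : ∀ j : Fin g, (∑ k, ⟪x (j, k), extendGroups A θ (j, k)⟫)
      = if h : j ∈ A then ∑ k, ⟪x (j, k), θ (⟨j, h⟩, k)⟫ else 0 := fun j => by
    by_cases h : j ∈ A <;> simp [extendGroups, h]
  simp only [PiLp.inner_apply, Fintype.sum_prod_type, h]
  rw [← Finset.sum_subset (Finset.subset_univ A) fun j _ hj => by simp [hj], ← Finset.sum_coe_sort]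
  exact Finset.sum_congr rfl fun j _ => by simp [restrictGroups]

lemma restrictGroups_extendGroups (A : Finset (Fin g)) (θ : EuclideanSpace ℝ (A × Fin p)) :
    restrictGroups A (extendGroups A θ) = θ := by
  ext ⟨j, k⟩; simp [restrictGroups, extendGroups]

lemma norm_extendGroups (A : Finset (Fin g)) (θ : EuclideanSpace ℝ (A × Fin p)) :
    ‖extendGroups A θ‖ = ‖θ‖ := by
  rw [← sq_eq_sq₀ (norm_nonneg _) (norm_nonneg _), ← real_inner_self_eq_norm_sq,
    inner_extendGroups, restrictGroups_extendGroups, real_inner_self_eq_norm_sq]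

lemma extendGroups_restrictGroups {A : Finset (Fin g)} {δ : GroupVec g p}
    (h : ∀ j ∉ A, block δ j = 0) : extendGroups A (restrictGroups A δ) = δ := by
  ext ⟨j, k⟩
  by_cases hj : j ∈ A
  · simp [restrictGroups, extendGroups, hj]
  · have : block δ j k = 0 := by rw [h j hj]; rfl
    simp only [block_apply] at this
    simp [extendGroups, hj, this]

lemma norm_restrictGroups_le (A : Finset (Fin g)) (δ : GroupVec g p) :
    ‖restrictGroups A δ‖ ≤ ‖δ‖ := by
  rcases (norm_nonneg (restrictGroups A δ)).eq_or_lt with h | h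
  · rw [← h]; positivity
  · have h1 : ‖restrictGroups A δ‖ ^ 2 ≤ ‖δ‖ * ‖restrictGroups A δ‖ := by
      rw [← real_inner_self_eq_norm_sq, ← inner_extendGroups]
      refine (real_inner_le_norm _ _).trans (le_of_eq ?_)
      rw [norm_extendGroups]
    nlinarith

lemma IsConditioned.restrictGroups {X : Fin n → GroupVec g p} {m M : ℝ} (h : IsConditioned X m M)
    (A : Finset (Fin g)) : IsConditioned (fun i => restrictGroups A (X i)) m M := fun θ => by
  have := h (extendGroups A θ)
  simpa only [inner_extendGroups, norm_extendGroups] using this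

end Blocks

/-! ### The adaptive elastic-net penalty -/

section Penalty

open scoped RealInnerProductSpace

variable {g p n : ℕ} {τ γ : ℝ}

/-- The elastic-net group penalty with weights `w`. -/
noncomputable def groupPenalty (lam1 lam2 : ℝ) (w : Fin g → ℝ) (β : GroupVec g p) : ℝ :=
  lam1 * ∑ j, w j * ‖block β j‖ + lam2 * ‖β‖ ^ 2

/-- The weights of the adaptive penalty. -/
noncomputable def adaptiveWeight (γ : ℝ) (β' : GroupVec g p) (j : Fin g) : ℝ := ‖block β' j‖ ^ (-γ)

lemma adaptiveWeight_nonneg (γ : ℝ) (β' : GroupVec g p) (j : Fin g) : 0 ≤ adaptiveWeight γ β' j :=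
  Real.rpow_nonneg (norm_nonneg _) _

lemma quantileProcess_nonneg (h0 : 0 ≤ τ) (h1 : τ ≤ 1) (X : Fin n → GroupVec g p) (Y : Fin n → ℝ)
    (β : GroupVec g p) : 0 ≤ quantileProcess τ X Y β := by
  refine Finset.sum_nonneg fun i _ => ?_
  rcases lt_or_ge (Y i - ⟪X i, β⟫) 0 with h | h
  · rw [quantileLoss_of_neg h]; nlinarith
  · rw [quantileLoss_of_nonneg h]; positivity

/-- For $\gamma>0$ the real power $0^{-\gamma}$ is 0, not $\infty$, so the real-valued process is
faithful only at vectors vanishing wherever the preliminary estimator does; there both conventions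
give the product 0. -/
lemma elasticNetProcess_eq_ofReal (h0 : 0 ≤ τ) (h1 : τ ≤ 1) (lam1 lam2 : ℝ≥0)
    (X : Fin n → GroupVec g p) (Y : Fin n → ℝ) {β' β : GroupVec g p}
    (h : ∀ j, block β' j = 0 → block β j = 0) :
    elasticNetProcess τ γ lam1 lam2 X Y β' β = ENNReal.ofReal
      (quantileProcess τ X Y β + groupPenalty lam1 lam2 (adaptiveWeight γ β') β) := by
  have e1 : ∀ j, ‖block β' j‖ₑ ^ (-γ) * ‖block β j‖ₑ
      = ENNReal.ofReal (adaptiveWeight γ β' j * ‖block β j‖) := fun j => by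
    by_cases hj : block β' j = 0
    · simp [h j hj]
    · rw [ENNReal.ofReal_mul (adaptiveWeight_nonneg _ _ _), adaptiveWeight,
        ← ENNReal.ofReal_rpow_of_pos (norm_pos_iff.2 hj), ofReal_norm,
        ofReal_norm]
  have e2 : ∀ j, ‖block β j‖ₑ ^ 2 = ENNReal.ofReal (‖block β j‖ ^ 2) := fun j => by
    rw [ENNReal.ofReal_pow (norm_nonneg _), ofReal_norm]
  have s1 : 0 ≤ ∑ j, adaptiveWeight γ β' j * ‖block β j‖ :=
    Finset.sum_nonneg fun j _ => mul_nonneg (adaptiveWeight_nonneg _ _ _) (norm_nonneg _)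
  unfold elasticNetProcess groupPenalty
  simp only [e1, e2]
  rw [← ENNReal.ofReal_sum_of_nonneg fun j _ =>
      mul_nonneg (adaptiveWeight_nonneg _ _ _) (norm_nonneg _),
    ← ENNReal.ofReal_sum_of_nonneg fun j _ => sq_nonneg _, sum_norm_block_sq,
    ← ENNReal.ofReal_coe_nnreal, ← ENNReal.ofReal_coe_nnreal,
    ← ENNReal.ofReal_mul (NNReal.coe_nonneg _), ← ENNReal.ofReal_mul (NNReal.coe_nonneg _),
    ← ENNReal.ofReal_add (quantileProcess_nonneg h0 h1 X Y β) (by positivity),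
    ← ENNReal.ofReal_add (add_nonneg (quantileProcess_nonneg h0 h1 X Y β) (by positivity))
      (by positivity), add_assoc]

/-- A minimizer of the elastic-net process vanishes where the weights are infinite, and minimizes
the real-valued process among the vectors with this property. -/
lemma isMinOn_elasticNetProcess (h0 : 0 ≤ τ) (h1 : τ ≤ 1) (hγ : 0 < γ) {lam1 lam2 : ℝ≥0}
    (hlam : 0 < lam1) {X : Fin n → GroupVec g p} {Y : Fin n → ℝ} {β' βhat : GroupVec g p}
    (h : IsMinOn (elasticNetProcess τ γ lam1 lam2 X Y β') Set.univ βhat) :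
    (∀ j, block β' j = 0 → block βhat j = 0) ∧ ∀ β, (∀ j, block β' j = 0 → block β j = 0) →
      quantileProcess τ X Y βhat + groupPenalty lam1 lam2 (adaptiveWeight γ β') βhat
        ≤ quantileProcess τ X Y β + groupPenalty lam1 lam2 (adaptiveWeight γ β') β := by
  have hmin := isMinOn_iff.1 h
  have hz : ∀ j, block β' j = 0 → block βhat j = 0 := by
    intro j hj
    by_contra hne
    have h2 := hmin 0 (Set.mem_univ _)
    rw [elasticNetProcess_eq_ofReal (β := 0) h0 h1 lam1 lam2 X Y fun j _ => block_zero j] at h2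
    have h3 : elasticNetProcess τ γ lam1 lam2 X Y β' βhat = ∞ := by
      have h4 : ∑ j, ‖block β' j‖ₑ ^ (-γ) * ‖block βhat j‖ₑ = ∞ := by
        rw [ENNReal.sum_eq_top]
        refine ⟨j, Finset.mem_univ _, ?_⟩
        rw [hj, enorm_zero, ENNReal.zero_rpow_of_neg (by linarith)]
        exact ENNReal.top_mul (by simpa using hne)
      unfold elasticNetProcess
      rw [h4, ENNReal.mul_top (by exact_mod_cast hlam.ne')]
      simp
    rw [h3] at h2
    exact absurd h2 (by simp)
  refine ⟨hz, fun β hβ => ?_⟩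
  have h2 := hmin β (Set.mem_univ _)
  rw [elasticNetProcess_eq_ofReal h0 h1 lam1 lam2 X Y hz,
    elasticNetProcess_eq_ofReal h0 h1 lam1 lam2 X Y hβ, ENNReal.ofReal_le_ofReal_iff] at h2
  · exact h2
  · refine add_nonneg (quantileProcess_nonneg h0 h1 X Y β) ?_
    have s1 : 0 ≤ ∑ j, adaptiveWeight γ β' j * ‖block β j‖ :=
      Finset.sum_nonneg fun j _ => mul_nonneg (adaptiveWeight_nonneg _ _ _) (norm_nonneg _)
    unfold groupPenalty
    positivity

variable {lam1 lam2 : ℝ} (hl1 : 0 ≤ lam1) (hl2 : 0 ≤ lam2)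
include hl1 hl2

lemma groupPenalty_segment_le {w : Fin g → ℝ} (hw : ∀ j, 0 ≤ w j) (β δ : GroupVec g p) {l : ℝ}
    (h0 : 0 ≤ l) (h1 : l ≤ 1) : groupPenalty lam1 lam2 w (β + l • δ) - groupPenalty lam1 lam2 w β
      ≤ l * (groupPenalty lam1 lam2 w (β + δ) - groupPenalty lam1 lam2 w β) := by
  have e : β + l • δ = (1 - l) • β + l • (β + δ) := by module
  have a1 : ∑ j, w j * ‖block (β + l • δ) j‖
      ≤ (1 - l) * ∑ j, w j * ‖block β j‖ + l * ∑ j, w j * ‖block (β + δ) j‖ := by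
    rw [Finset.mul_sum, Finset.mul_sum, ← Finset.sum_add_distrib]
    refine Finset.sum_le_sum fun j _ => ?_
    have : ‖block (β + l • δ) j‖ ≤ (1 - l) * ‖block β j‖ + l * ‖block (β + δ) j‖ := by
      rw [e, block_add, block_smul, block_smul]
      refine (norm_add_le _ _).trans (le_of_eq ?_)
      rw [norm_smul, norm_smul, Real.norm_of_nonneg h0, Real.norm_of_nonneg (by linarith)]
    nlinarith [hw j]
  have a2 : ‖β + l • δ‖ ^ 2 ≤ (1 - l) * ‖β‖ ^ 2 + l * ‖β + δ‖ ^ 2 := by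
    rw [norm_add_sq_real, norm_add_sq_real, norm_smul, inner_smul_right, Real.norm_of_nonneg h0]
    nlinarith [sq_nonneg ‖δ‖, mul_nonneg h0 (sub_nonneg.2 h1),
      mul_nonneg (mul_nonneg h0 (sub_nonneg.2 h1)) (sq_nonneg ‖δ‖)]
  unfold groupPenalty
  nlinarith [mul_le_mul_of_nonneg_left a1 hl1, mul_le_mul_of_nonneg_left a2 hl2]

/-- The decrease of the penalty away from a vector with bounded weights on its active groups. -/
lemma groupPenalty_sub_le {w : Fin g → ℝ} (hw : ∀ j, 0 ≤ w j) {β : GroupVec g p} {W : ℝ}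
    (hW0 : 0 ≤ W) (hW : ∀ j ∈ activeSet β, w j ≤ W) (δ : GroupVec g p) :
    groupPenalty lam1 lam2 w β - groupPenalty lam1 lam2 w (β + δ)
      ≤ (lam1 * (W * √g) + 2 * lam2 * ‖β‖) * ‖δ‖ := by
  have a1 : ∑ j, w j * ‖block β j‖ - ∑ j, w j * ‖block (β + δ) j‖ ≤ W * (√g * ‖δ‖) := by
    rw [← Finset.sum_sub_distrib]
    calc ∑ j, (w j * ‖block β j‖ - w j * ‖block (β + δ) j‖) ≤ ∑ j, W * ‖block δ j‖ := by
          refine Finset.sum_le_sum fun j _ => ?_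
          rw [block_add]
          by_cases hj : j ∈ activeSet β
          · have : ‖block β j‖ - ‖block β j + block δ j‖ ≤ ‖block δ j‖ := by
              have := norm_sub_norm_le (block β j) (block β j + block δ j)
              simpa using this
            nlinarith [hw j, hW j hj, norm_nonneg (block δ j)]
          · rw [mem_activeSet, not_not] at hj
            simp only [hj, norm_zero, mul_zero, zero_add]
            nlinarith [hw j, norm_nonneg (block δ j), mul_nonneg (hw j) (norm_nonneg (block δ j)),
              mul_nonneg hW0 (norm_nonneg (block δ j))]
      _ = W * ∑ j, ‖block δ j‖ := by rw [Finset.mul_sum]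
      _ ≤ _ := by gcongr; exact sum_norm_block_le δ
  have a2 : ‖β‖ ^ 2 - ‖β + δ‖ ^ 2 ≤ 2 * (‖β‖ * ‖δ‖) := by
    rw [norm_add_sq_real]
    nlinarith [abs_le.1 (abs_real_inner_le_norm β δ), sq_nonneg ‖δ‖]
  unfold groupPenalty
  nlinarith [mul_le_mul_of_nonneg_left a1 hl1, mul_le_mul_of_nonneg_left a2 hl2]

/-- The cost of the groups outside `A`. -/
lemma groupPenalty_keepGroups_le {w : Fin g → ℝ} {A : Finset (Fin g)} {β : GroupVec g p} {W : ℝ}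
    (hW0 : 0 ≤ W) (hW : ∀ j ∉ A, block β j ≠ 0 → W ≤ w j) :
    groupPenalty lam1 lam2 w (keepGroups A β) + lam1 * W * ‖β - keepGroups A β‖
      ≤ groupPenalty lam1 lam2 w β := by
  have a1 : ∑ j, w j * ‖block (keepGroups A β) j‖ + W * ‖β - keepGroups A β‖
      ≤ ∑ j, w j * ‖block β j‖ := by
    have := mul_le_mul_of_nonneg_left (norm_le_sum_norm_block (β - keepGroups A β)) hW0
    rw [Finset.mul_sum] at this
    refine (add_le_add_right this _).trans ?_
    rw [← Finset.sum_add_distrib]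
    refine Finset.sum_le_sum fun j _ => ?_
    rw [block_sub, block_keepGroups]
    by_cases hj : j ∈ A
    · simp [hj]
    · by_cases hb : block β j = 0
      · simp [hj, hb]
      · simp only [hj, if_false, norm_zero, mul_zero, sub_zero, zero_add]
        exact mul_le_mul_of_nonneg_right (hW j hj hb) (norm_nonneg _)
  have a2 : ‖keepGroups A β‖ ^ 2 ≤ ‖β‖ ^ 2 :=
    pow_le_pow_left₀ (norm_nonneg _) (norm_keepGroups_le A β) 2
  unfold groupPenalty
  nlinarith [mul_le_mul_of_nonneg_left a1 hl1, mul_le_mul_of_nonneg_left a2 hl2]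

end Penalty

/-! ### Linearization of the penalty -/

section PenaltySlope

open scoped RealInnerProductSpace

variable {g p n : ℕ} {γ : ℝ}

/-- Below, Cauchy-Schwarz for $\langle b,b+d\rangle$; above,
$\|b\|\,\|b+d\|\le(\|b\|^2+\|b+d\|^2)/2$. -/
lemma norm_add_sub_norm_mem_Icc {F : Type*} [NormedAddCommGroup F] [InnerProductSpace ℝ F] {b : F}
    (hb : b ≠ 0) (d : F) :
    ‖b + d‖ - ‖b‖ - ‖b‖⁻¹ * ⟪b, d⟫ ∈ Set.Icc 0 (‖b‖⁻¹ * ‖d‖ ^ 2) := by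
  have hb' : 0 < ‖b‖ := norm_pos_iff.2 hb
  have h1 := norm_add_sq_real b d
  have h2 : ‖b‖ ^ 2 + ⟪b, d⟫ ≤ ‖b‖ * ‖b + d‖ := by
    rw [← real_inner_self_eq_norm_sq, ← inner_add_right]
    exact real_inner_le_norm _ _
  have e : ‖b‖ * (‖b + d‖ - ‖b‖ - ‖b‖⁻¹ * ⟪b, d⟫) = ‖b‖ * ‖b + d‖ - ‖b‖ ^ 2 - ⟪b, d⟫ := by
    field_simp
  have e' : ‖b‖ * (‖b‖⁻¹ * ‖d‖ ^ 2) = ‖d‖ ^ 2 := by field_simp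
  constructor
  · refine le_of_mul_le_mul_left ?_ hb'
    rw [e]; linarith
  · refine le_of_mul_le_mul_left ?_ hb'
    rw [e, e']
    nlinarith [sq_nonneg (‖b + d‖ - ‖b‖), sq_nonneg ‖d‖]

lemma abs_rpow_neg_sub_le (hγ : 0 < γ) {a b μ : ℝ} (hμ : 0 < μ) (ha : μ ≤ a) (hb : μ ≤ b) :
    |a ^ (-γ) - b ^ (-γ)| ≤ γ * μ ^ (-γ - 1) * |a - b| := by
  have hpos : ∀ x ∈ Set.Ici μ, 0 < x := fun x hx => lt_of_lt_of_le hμ hx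
  have := (convex_Ici μ).norm_image_sub_le_of_norm_hasDerivWithin_le
    (f := fun x : ℝ => x ^ (-γ)) (f' := fun x => -γ * x ^ (-γ - 1)) (C := γ * μ ^ (-γ - 1))
    (fun x hx => (Real.hasDerivAt_rpow_const (Or.inl (hpos x hx).ne')).hasDerivWithinAt)
    (fun x hx => by
      rw [norm_mul, norm_neg, Real.norm_of_nonneg hγ.le,
        Real.norm_of_nonneg (Real.rpow_nonneg (hpos x hx).le _)]
      exact mul_le_mul_of_nonneg_left (Real.rpow_le_rpow_of_nonpos hμ hx (by linarith)) hγ.le)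
    hb ha
  simpa only [Real.norm_eq_abs] using this

/-- Minus the gradient of the penalty whose weights are computed at `β` itself. -/
noncomputable def penaltySlope (γ lam1 lam2 : ℝ) (β : GroupVec g p) : GroupVec g p :=
  WithLp.toLp 2 fun k => -(lam1 * ‖block β k.1‖ ^ (-γ - 1) + 2 * lam2) * β k

lemma block_penaltySlope (lam1 lam2 : ℝ) (β : GroupVec g p) (j : Fin g) :
    block (penaltySlope γ lam1 lam2 β) j
      = (-(lam1 * ‖block β j‖ ^ (-γ - 1) + 2 * lam2)) • block β j := by
  ext k; simp [penaltySlope]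

variable {lam1 lam2 : ℝ} (hl1 : 0 ≤ lam1) (hl2 : 0 ≤ lam2)
include hl1 hl2

lemma norm_penaltySlope_le (hγ : 0 < γ) {β : GroupVec g p} {μ b : ℝ} (hμ : 0 < μ) (hb0 : 0 ≤ b)
    (hμβ : ∀ j ∈ activeSet β, μ ≤ ‖block β j‖) (hb : ∀ j, ‖block β j‖ ≤ b) :
    ‖penaltySlope γ lam1 lam2 β‖ ≤ √g * (lam1 * μ ^ (-γ) + 2 * lam2 * b) := by
  have := Real.rpow_nonneg hμ.le (-γ)
  refine norm_le_sqrt_mul (by positivity) fun j => ?_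
  rw [block_penaltySlope, norm_smul, norm_neg, Real.norm_of_nonneg (by positivity)]
  by_cases hj : block β j = 0
  · rw [hj, norm_zero, mul_zero]; positivity
  · have h1 : 0 < ‖block β j‖ := norm_pos_iff.2 hj
    have h2 : ‖block β j‖ ^ (-γ - 1) * ‖block β j‖ = ‖block β j‖ ^ (-γ) := by
      rw [← Real.rpow_add_one h1.ne']; congr 1; ring
    have h3 : ‖block β j‖ ^ (-γ) ≤ μ ^ (-γ) :=
      Real.rpow_le_rpow_of_nonpos hμ (hμβ j (mem_activeSet.2 hj)) (by linarith)
    calc (lam1 * ‖block β j‖ ^ (-γ - 1) + 2 * lam2) * ‖block β j‖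
        = lam1 * (‖block β j‖ ^ (-γ - 1) * ‖block β j‖) + 2 * lam2 * ‖block β j‖ := by ring
      _ ≤ _ := by rw [h2]; gcongr; exact hb j

/-- Along the active groups the adaptive penalty is almost linear. -/
lemma abs_groupPenalty_sub_le (hγ : 0 < γ) {β β' δ : GroupVec g p} {μ : ℝ} (hμ : 0 < μ)
    (hβ : ∀ j ∈ activeSet β, μ ≤ ‖block β j‖) (hβ' : ∀ j ∈ activeSet β, μ ≤ ‖block β' j‖)
    (hδ : ∀ j ∉ activeSet β, block δ j = 0) :
    |groupPenalty lam1 lam2 (adaptiveWeight γ β') (β + δ)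
        - groupPenalty lam1 lam2 (adaptiveWeight γ β') β + ⟪penaltySlope γ lam1 lam2 β, δ⟫|
      ≤ lam1 * μ ^ (-γ - 1) * (γ * ‖β' - β‖ + ‖δ‖) * ‖δ‖ + lam2 * ‖δ‖ ^ 2 := by
  have hC := Real.rpow_nonneg hμ.le (-γ - 1)
  have hj : ∀ j, |adaptiveWeight γ β' j * ‖block (β + δ) j‖ - adaptiveWeight γ β' j * ‖block β j‖
      - ‖block β j‖ ^ (-γ - 1) * ⟪block β j, block δ j⟫|
      ≤ μ ^ (-γ - 1) * (γ * (‖block (β' - β) j‖ * ‖block δ j‖) + ‖block δ j‖ ^ 2) := by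
    intro j
    by_cases hact : j ∈ activeSet β
    · have hne : block β j ≠ 0 := mem_activeSet.1 hact
      have h1 : 0 < ‖block β j‖ := norm_pos_iff.2 hne
      have h2 : ‖block β j‖ ^ (-γ) = ‖block β j‖ ^ (-γ - 1) * ‖block β j‖ := by
        rw [← Real.rpow_add_one h1.ne']; congr 1; ring
      obtain ⟨h3, h4⟩ := norm_add_sub_norm_mem_Icc hne (block δ j)
      have h5 := abs_rpow_neg_sub_le hγ hμ (hβ' j hact) (hβ j hact)
      have h6 : |‖block β' j‖ - ‖block β j‖| ≤ ‖block (β' - β) j‖ := by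
        rw [block_sub]; exact abs_norm_sub_norm_le _ _
      have h7 : |‖block β j + block δ j‖ - ‖block β j‖| ≤ ‖block δ j‖ := by
        have := abs_norm_sub_norm_le (block β j + block δ j) (block β j)
        simpa using this
      have h8 : ‖block β j‖ ^ (-γ - 1) ≤ μ ^ (-γ - 1) :=
        Real.rpow_le_rpow_of_nonpos hμ (hβ j hact) (by linarith)
      have h9 := Real.rpow_nonneg (norm_nonneg (block β j)) (-γ - 1)
      set r := ‖block β j + block δ j‖ - ‖block β j‖ - ‖block β j‖⁻¹ * ⟪block β j, block δ j⟫
        with hr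
      -- Two errors of second order: the weight is taken at `β'` instead of `β`, and the norm is
      -- replaced by its differential at `β`.
      have e : adaptiveWeight γ β' j * ‖block (β + δ) j‖ - adaptiveWeight γ β' j * ‖block β j‖
          - ‖block β j‖ ^ (-γ - 1) * ⟪block β j, block δ j⟫
          = (‖block β' j‖ ^ (-γ) - ‖block β j‖ ^ (-γ)) * (‖block β j + block δ j‖ - ‖block β j‖)
            + ‖block β j‖ ^ (-γ - 1) * (‖block β j‖ * r) := by
        rw [hr, block_add, adaptiveWeight, h2]
        field_simp
        ring
      have h10 : ‖block β j‖ * r ≤ ‖block δ j‖ ^ 2 := by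
        calc ‖block β j‖ * r ≤ ‖block β j‖ * (‖block β j‖⁻¹ * ‖block δ j‖ ^ 2) := by gcongr
          _ = _ := by field_simp
      rw [e]
      refine (abs_add_le _ _).trans ?_
      rw [abs_mul, abs_mul, abs_of_nonneg h9, abs_of_nonneg (mul_nonneg h1.le h3)]
      calc _ ≤ (γ * μ ^ (-γ - 1) * ‖block (β' - β) j‖) * ‖block δ j‖
            + μ ^ (-γ - 1) * ‖block δ j‖ ^ 2 := by
            refine add_le_add (mul_le_mul (h5.trans (by gcongr)) h7 (abs_nonneg _)
              (by positivity)) (mul_le_mul h8 h10 (mul_nonneg h1.le h3) hC)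
        _ = _ := by ring
    · have h0 : block β j = 0 := by rwa [mem_activeSet, not_not] at hact
      simp [block_add, h0, hδ j hact]
  have hsum : |∑ j, (adaptiveWeight γ β' j * ‖block (β + δ) j‖ - adaptiveWeight γ β' j * ‖block β j‖
      - ‖block β j‖ ^ (-γ - 1) * ⟪block β j, block δ j⟫)|
      ≤ μ ^ (-γ - 1) * (γ * (‖β' - β‖ * ‖δ‖) + ‖δ‖ ^ 2) := by
    refine (Finset.abs_sum_le_sum_abs _ _).trans ((Finset.sum_le_sum fun j _ => hj j).trans ?_)
    rw [← Finset.mul_sum, Finset.sum_add_distrib, ← Finset.mul_sum, sum_norm_block_sq]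
    gcongr
    exact sum_norm_block_mul_le _ _
  have hin : ⟪penaltySlope γ lam1 lam2 β, δ⟫
      = -(lam1 * ∑ j, ‖block β j‖ ^ (-γ - 1) * ⟪block β j, block δ j⟫) - 2 * lam2 * ⟪β, δ⟫ := by
    rw [← sum_inner_block, ← sum_inner_block, Finset.mul_sum, Finset.mul_sum,
      ← Finset.sum_neg_distrib, ← Finset.sum_sub_distrib]
    refine Finset.sum_congr rfl fun j _ => ?_
    rw [block_penaltySlope, inner_smul_left]
    simp only [conj_trivial]
    ring
  have e : groupPenalty lam1 lam2 (adaptiveWeight γ β') (β + δ)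
        - groupPenalty lam1 lam2 (adaptiveWeight γ β') β + ⟪penaltySlope γ lam1 lam2 β, δ⟫
      = lam1 * ∑ j, (adaptiveWeight γ β' j * ‖block (β + δ) j‖
          - adaptiveWeight γ β' j * ‖block β j‖
          - ‖block β j‖ ^ (-γ - 1) * ⟪block β j, block δ j⟫) + lam2 * ‖δ‖ ^ 2 := by
    rw [hin, Finset.sum_sub_distrib, Finset.sum_sub_distrib]
    unfold groupPenalty
    rw [norm_add_sq_real]
    ring
  rw [e]
  refine (abs_add_le _ _).trans ?_
  rw [abs_mul, abs_of_nonneg hl1, abs_of_nonneg (a := lam2 * ‖δ‖ ^ 2) (by positivity)]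
  have := mul_le_mul_of_nonneg_left hsum hl1
  linarith

end PenaltySlope

/-! ### Deterministic analysis of the estimators -/

section LocalLoss

open scoped RealInnerProductSpace

variable {V : Type*} [NormedAddCommGroup V] [InnerProductSpace ℝ V] {n : ℕ} {τ : ℝ}

/-- The increment of the quantile process in local coordinates. -/
noncomputable def localLoss (τ : ℝ) (y : Fin n → V) (e : Fin n → ℝ) (t : V) : ℝ :=
  ∑ j, checkLoss τ (e j) ⟪y j, t⟫

lemma localLoss_smul_le (y : Fin n → V) (e : Fin n → ℝ) (t : V) {l : ℝ} (h0 : 0 ≤ l) (h1 : l ≤ 1) :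
    localLoss τ y e (l • t) ≤ l * localLoss τ y e t := by
  unfold localLoss
  rw [Finset.mul_sum]
  refine Finset.sum_le_sum fun j _ => ?_
  rw [inner_smul_right]
  exact checkLoss_smul_le τ (e j) _ h0 h1

lemma localLoss_combo_le (y : Fin n → V) (e : Fin n → ℝ) (s t : V) {a b : ℝ} (ha : 0 ≤ a)
    (hb : 0 ≤ b) (hab : a + b = 1) :
    localLoss τ y e (a • s + b • t) ≤ a * localLoss τ y e s + b * localLoss τ y e t := by
  unfold localLoss
  rw [Finset.mul_sum, Finset.mul_sum, ← Finset.sum_add_distrib]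
  refine Finset.sum_le_sum fun j _ => ?_
  have := (convexOn_quantileLoss τ).2 (Set.mem_univ (e j - ⟪y j, s⟫))
    (Set.mem_univ (e j - ⟪y j, t⟫)) ha hb hab
  simp only [smul_eq_mul] at this
  have e1 : e j - ⟪y j, a • s + b • t⟫ = a * (e j - ⟪y j, s⟫) + b * (e j - ⟪y j, t⟫) := by
    rw [inner_add_right, inner_smul_right, inner_smul_right]
    linear_combination (-(e j)) * hab
  unfold checkLoss
  rw [e1]
  have : quantileLoss τ (e j) = (a + b) * quantileLoss τ (e j) := by rw [hab, one_mul]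
  linarith

/-- A quadratic lower bound on a ball traps the points reached by a segment of small loss. -/
lemma norm_lt_of_growth {y : Fin n → V} {e : Fin n → ℝ} {c B D ρ : ℝ} (hρ : 0 < ρ)
    (hgrow : ∀ t, ‖t‖ ≤ ρ → c * ‖t‖ ^ 2 ≤ localLoss τ y e t + B) {s : V}
    (hs : ∀ l : ℝ, 0 ≤ l → l ≤ 1 → localLoss τ y e (l • s) ≤ D * ‖l • s‖)
    (h : B + D * ρ < c * ρ ^ 2) : ‖s‖ < ρ := by
  by_contra! hn
  have hs0 : 0 < ‖s‖ := hρ.trans_le hn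
  have e1 : ‖(ρ / ‖s‖) • s‖ = ρ := by
    rw [norm_smul, Real.norm_of_nonneg (by positivity)]; field_simp
  have h1 := hgrow ((ρ / ‖s‖) • s) e1.le
  have h2 := hs (ρ / ‖s‖) (by positivity) ((div_le_one hs0).2 hn)
  rw [e1] at h1 h2
  linarith

end LocalLoss

/-! ### Localization and support of the estimators -/

section Regression

open scoped RealInnerProductSpace

variable {g p n : ℕ} {τ γ : ℝ}

/-- The responses of the linear model with parameter `β₀` and errors `e`. -/
noncomputable def responses (X : Fin n → GroupVec g p) (β₀ : GroupVec g p) (e : Fin n → ℝ) :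
    Fin n → ℝ :=
  fun i => inner ℝ (X i) β₀ + e i

variable {X : Fin n → GroupVec g p} {β₀ βq βhat : GroupVec g p} {e : Fin n → ℝ}
  {T : GroupVec g p ≃ₗ[ℝ] GroupVec g p} {y : Fin n → GroupVec g p}

lemma quantileProcess_add {V : Type*} [NormedAddCommGroup V] [InnerProductSpace ℝ V]
    {y : Fin n → V} {δ : GroupVec g p} {t : V} (h : ∀ j, ⟪y j, t⟫ = ⟪X j, δ⟫) :
    quantileProcess τ X (responses X β₀ e) (β₀ + δ)
      = quantileProcess τ X (responses X β₀ e) β₀ + localLoss τ y e t := by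
  unfold quantileProcess localLoss checkLoss responses
  rw [← Finset.sum_add_distrib]
  refine Finset.sum_congr rfl fun j _ => ?_
  rw [h, inner_add_right, add_sub_cancel_left, add_sub_add_left_eq_sub]
  ring

lemma quantileProcess_eq_add (W : IsWhitening X T y) (β : GroupVec g p) :
    quantileProcess τ X (responses X β₀ e) β
      = quantileProcess τ X (responses X β₀ e) β₀ + localLoss τ y e (T (β - β₀)) := by
  have := quantileProcess_add (τ := τ) (β₀ := β₀) (e := e) (W.inner_apply · (β - β₀))
  rwa [add_sub_cancel] at this

/-- The quantile estimator is trapped by the growth of the loss. -/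
lemma quantile_norm_lt (W : IsWhitening X T y)
    (hmin : IsMinOn (quantileProcess τ X (responses X β₀ e)) Set.univ βq) {c B ρ : ℝ} (hρ : 0 < ρ)
    (hgrow : ∀ t, ‖t‖ ≤ ρ → c * ‖t‖ ^ 2 ≤ localLoss τ y e t + B) (h : B < c * ρ ^ 2) :
    ‖T (βq - β₀)‖ < ρ := by
  refine norm_lt_of_growth (D := 0) hρ hgrow (fun l h0 h1 => ?_) (by linarith)
  have h2 := isMinOn_iff.1 hmin β₀ (Set.mem_univ _)
  rw [quantileProcess_eq_add W] at h2
  have h3 : localLoss τ y e (T (βq - β₀)) ≤ 0 := by linarith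
  have := localLoss_smul_le (τ := τ) y e (T (βq - β₀)) h0 h1
  nlinarith

variable {m M : ℝ} (hm : 0 < m) (hX : IsConditioned X m M) {lam1 lam2 : ℝ≥0} (hlam : 0 < lam1)
  (h0 : 0 ≤ τ) (h1 : τ ≤ 1) (hγ : 0 < γ)
  (hhat : IsMinOn (elasticNetProcess τ γ lam1 lam2 X (responses X β₀ e) βq) Set.univ βhat)
include hlam h0 h1 hγ hhat

/-- The comparison of the elastic-net estimator with a vector active on the groups of `β₀`. -/
lemma elasticNet_le (hq : ∀ j ∈ activeSet β₀, block βq j ≠ 0) {β : GroupVec g p}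
    (hβ : ∀ j ∉ activeSet β₀, block β j = 0) :
    quantileProcess τ X (responses X β₀ e) βhat
        + groupPenalty lam1 lam2 (adaptiveWeight γ βq) βhat
      ≤ quantileProcess τ X (responses X β₀ e) β
        + groupPenalty lam1 lam2 (adaptiveWeight γ βq) β :=
  (isMinOn_elasticNetProcess h0 h1 hγ hlam hhat).2 β fun j hj =>
    hβ j fun hact => hq j hact hj

include hm hX

/-- The elastic-net estimator is trapped by the growth of the loss. -/
lemma elasticNet_norm_lt (W : IsWhitening X T y) {μ b : ℝ} (hμ : 0 < μ)
    (hq : ∀ j ∈ activeSet β₀, μ ≤ ‖block βq j‖) (hb0 : 0 ≤ b) (hb : ∀ j, ‖block β₀ j‖ ≤ b)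
    {c B ρ : ℝ} (hρ : 0 < ρ) (hgrow : ∀ t, ‖t‖ ≤ ρ → c * ‖t‖ ^ 2 ≤ localLoss τ y e t + B)
    (h : B + (√m)⁻¹ * (√g * (lam1 * μ ^ (-γ) + 2 * lam2 * b)) * ρ < c * ρ ^ 2) :
    ‖T (βhat - β₀)‖ < ρ := by
  have hμ' := Real.rpow_nonneg hμ.le (-γ)
  have hl1 : (0 : ℝ) ≤ lam1 := lam1.2
  have hl2 : (0 : ℝ) ≤ lam2 := lam2.2
  refine norm_lt_of_growth hρ hgrow (fun l hl0 hl1' => ?_) h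
  set δ := βhat - β₀ with hδ
  have hmin := elasticNet_le (β := β₀) hlam h0 h1 hγ hhat
    (fun j hj => norm_pos_iff.1 (hμ.trans_le (hq j hj)))
    fun j hj => by rwa [mem_activeSet, not_not] at hj
  rw [quantileProcess_eq_add W] at hmin
  have a1 := localLoss_smul_le (τ := τ) y e (T δ) hl0 hl1'
  have a2 := groupPenalty_segment_le hl1 hl2 (adaptiveWeight_nonneg γ βq) β₀ δ hl0 hl1'
  have a3 := groupPenalty_sub_le hl1 hl2 (adaptiveWeight_nonneg γ βq) (β := β₀) hμ'
    (fun j hj => Real.rpow_le_rpow_of_nonpos hμ (hq j hj) (by linarith)) (l • δ)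
  have e1 : β₀ + δ = βhat := by rw [hδ]; abel
  rw [e1] at a2
  have a4 := mul_le_mul_of_nonneg_left hmin hl0
  have a5 := W.norm_le hm hX (l • δ)
  have a6 := norm_le_sqrt_mul hb0 hb
  rw [map_smul] at a5
  have a7 : (lam1 * (μ ^ (-γ) * √g) + 2 * lam2 * ‖β₀‖) * ‖l • δ‖
      ≤ (√g * (lam1 * μ ^ (-γ) + 2 * lam2 * b)) * ((√m)⁻¹ * ‖l • T δ‖) := by
    refine mul_le_mul ?_ a5 (norm_nonneg _) (by positivity)
    have : 2 * (lam2 : ℝ) * ‖β₀‖ ≤ 2 * lam2 * (√g * b) := by gcongr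
    linarith
  linarith

/-- No group outside the true support is selected when its weight is large. -/
lemma elasticNet_keepGroups_eq (W : IsWhitening X T y) (hM : 0 ≤ M)
    (hq : ∀ j ∈ activeSet β₀, block βq j ≠ 0) {c a B ρ ρ₁ : ℝ} (hc : 0 ≤ c) (hρ : 0 < ρ)
    (hρ₁ : (√M * (√m)⁻¹ + 1) * ρ ≤ ρ₁)
    (hgrow : ∀ t, ‖t‖ ≤ ρ₁ → c * ‖t‖ ^ 2 ≤ localLoss τ y e t + B)
    (hupper : ∀ t, ‖t‖ ≤ ρ₁ → localLoss τ y e t ≤ a)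
    (hρq : ‖T (βq - β₀)‖ ≤ ρ) (hρhat : ‖T (βhat - β₀)‖ ≤ ρ)
    (h : √M * (a + B) < lam1 * ((√m)⁻¹ * ρ) ^ (-γ) * ρ) :
    keepGroups (activeSet β₀) βhat = βhat := by
  have hl1 : (0 : ℝ) ≤ lam1 := lam1.2
  have hl2 : (0 : ℝ) ≤ lam2 := lam2.2
  set A := activeSet β₀ with hA
  have hsm : 0 < (√m)⁻¹ := inv_pos.2 (Real.sqrt_pos.2 hm)
  set ω := ((√m)⁻¹ * ρ) ^ (-γ) with hω
  have hω0 : 0 ≤ ω := Real.rpow_nonneg (by positivity) _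
  set v := βhat - keepGroups A βhat with hv
  by_contra hne
  have hv0 : v ≠ 0 := fun hh => hne (sub_eq_zero.1 hh).symm
  have hTv : 0 < ‖T v‖ := norm_pos_iff.2 fun hh => hv0 (by simpa using hh)
  have b1 := (isMinOn_elasticNetProcess h0 h1 hγ hlam hhat).1
  have b2 := elasticNet_le (β := keepGroups A βhat) hlam h0 h1 hγ hhat hq
    fun j hj => by rw [block_keepGroups, if_neg hj]
  have b3 : groupPenalty lam1 lam2 (adaptiveWeight γ βq) (keepGroups A βhat) + lam1 * ω * ‖v‖
      ≤ groupPenalty lam1 lam2 (adaptiveWeight γ βq) βhat := by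
    refine groupPenalty_keepGroups_le hl1 hl2 hω0 fun j hj hbj => ?_
    have c0 : block β₀ j = 0 := by rwa [hA, mem_activeSet, not_not] at hj
    have c1 : block βq j ≠ 0 := fun hh => hbj (b1 j hh)
    refine Real.rpow_le_rpow_of_nonpos (norm_pos_iff.2 c1) ?_ (by linarith)
    calc ‖block βq j‖ = ‖block (βq - β₀) j‖ := by rw [block_sub, c0, sub_zero]
      _ ≤ ‖βq - β₀‖ := norm_block_le _ _
      _ ≤ (√m)⁻¹ * ‖T (βq - β₀)‖ := W.norm_le hm hX _
      _ ≤ _ := by gcongr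
  rw [quantileProcess_eq_add W βhat, quantileProcess_eq_add W (keepGroups A βhat)] at b2
  have e0 : keepGroups A βhat - β₀ = keepGroups A (βhat - β₀) := by
    refine groupVec_ext fun j => ?_
    rw [block_sub, block_keepGroups, block_keepGroups, block_sub]
    by_cases hj : j ∈ A
    · simp [hj]
    · have c0 : block β₀ j = 0 := by rwa [hA, mem_activeSet, not_not] at hj
      simp [hj, c0]
  set s := T (keepGroups A βhat - β₀) with hs
  have hs_norm : ‖s‖ ≤ √M * (√m)⁻¹ * ρ := by
    calc ‖s‖ ≤ √M * ‖keepGroups A (βhat - β₀)‖ := by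
          rw [hs, e0]; exact W.norm_apply_le hm hX hM _
      _ ≤ √M * ‖βhat - β₀‖ := by gcongr; exact norm_keepGroups_le _ _
      _ ≤ √M * ((√m)⁻¹ * ‖T (βhat - β₀)‖) := by gcongr; exact W.norm_le hm hX _
      _ ≤ √M * ((√m)⁻¹ * ρ) := by gcongr
      _ = _ := by ring
  -- `s` lies on the segment from `T (βhat - β₀)`, equal to $s+Tv$, to the extrapolated point
  -- $s-l\,Tv$ at distance $\rho$ from `s`. By convexity the groups gathered in `v` lower the loss
  -- by at most $(a+B)\|Tv\|/\rho$, which `h` makes smaller than the penalty they cost.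
  set l := ρ / ‖T v‖ with hl
  have hl0 : 0 < l := by positivity
  have hlv : ‖l • T v‖ = ρ := by
    rw [norm_smul, Real.norm_of_nonneg hl0.le, hl]; field_simp
  have hz : ‖s - l • T v‖ ≤ ρ₁ := by
    refine (norm_sub_le _ _).trans ?_
    rw [hlv]
    refine le_trans ?_ hρ₁
    linarith
  have hsρ : ‖s‖ ≤ ρ₁ := hs_norm.trans (le_trans (by linarith) hρ₁)
  have e2 : s = (1 / (1 + l)) • (s - l • T v) + (l / (1 + l)) • T (βhat - β₀) := by
    have : T (βhat - β₀) = s + T v := by rw [hs, hv, ← map_add]; congr 1; abel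
    rw [this, smul_add, smul_sub, smul_smul, sub_add_eq_add_sub, ← add_assoc, ← add_smul]
    have f1 : 1 / (1 + l) + l / (1 + l) = 1 := by field_simp
    have f2 : 1 / (1 + l) * l = l / (1 + l) := by field_simp
    rw [f1, f2]; simp
  have b4 := localLoss_combo_le (τ := τ) y e (s - l • T v) (T (βhat - β₀))
    (a := 1 / (1 + l)) (b := l / (1 + l)) (by positivity) (by positivity) (by field_simp)
  rw [← e2] at b4
  have b5 : (1 + l) * localLoss τ y e s
      ≤ localLoss τ y e (s - l • T v) + l * localLoss τ y e (T (βhat - β₀)) := by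
    calc _ ≤ (1 + l) * _ := mul_le_mul_of_nonneg_left b4 (by positivity)
      _ = _ := by field_simp
  have b6 := hupper _ hz
  have b7 := hgrow s hsρ
  have b8 : 0 ≤ c * ‖s‖ ^ 2 := by positivity
  have b9 : l * (lam1 * ω * ‖v‖) ≤ a + B := by
    have : lam1 * ω * ‖v‖ ≤ localLoss τ y e s - localLoss τ y e (T (βhat - β₀)) := by linarith
    have := mul_le_mul_of_nonneg_left this hl0.le
    linarith
  have b10 : ‖T v‖ ≤ √M * ‖v‖ := W.norm_apply_le hm hX hM v
  have hvpos : 0 < ‖v‖ := norm_pos_iff.2 hv0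
  have b11 : ρ * (lam1 * ω * ‖v‖) ≤ ‖T v‖ * (a + B) := by
    calc ρ * (lam1 * ω * ‖v‖) = ‖T v‖ * (l * (lam1 * ω * ‖v‖)) := by rw [hl]; field_simp
      _ ≤ _ := mul_le_mul_of_nonneg_left b9 hTv.le
  have haB : 0 ≤ a + B := le_trans (by positivity) b9
  have b12 : ρ * (lam1 * ω * ‖v‖) ≤ √M * ‖v‖ * (a + B) := b11.trans (by gcongr)
  nlinarith

/-- Deterministic support recovery. -/
theorem elasticNet_support (W : IsWhitening X T y) (hM : 0 ≤ M)
    (hmin : IsMinOn (quantileProcess τ X (responses X β₀ e)) Set.univ βq)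
    {μ b : ℝ} (hμ : 0 < μ) (hact : ∀ j ∈ activeSet β₀, 2 * μ ≤ ‖block β₀ j‖)
    (hb0 : 0 ≤ b) (hb : ∀ j, ‖block β₀ j‖ ≤ b)
    {c a B ρ ρ₁ : ℝ} (hc : 0 ≤ c) (hρ : 0 < ρ) (hρ₁ : (√M * (√m)⁻¹ + 1) * ρ ≤ ρ₁)
    (hgrow : ∀ t, ‖t‖ ≤ ρ₁ → c * ‖t‖ ^ 2 ≤ localLoss τ y e t + B)
    (hupper : ∀ t, ‖t‖ ≤ ρ₁ → localLoss τ y e t ≤ a)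
    (hμρ : (√m)⁻¹ * ρ ≤ μ)
    (hgap : B + (√m)⁻¹ * (√g * (lam1 * μ ^ (-γ) + 2 * lam2 * b)) * ρ < c * ρ ^ 2)
    (hsel : √M * (a + B) < lam1 * ((√m)⁻¹ * ρ) ^ (-γ) * ρ) :
    ‖T (βq - β₀)‖ ≤ ρ ∧ ‖T (βhat - β₀)‖ ≤ ρ ∧ (∀ j ∈ activeSet β₀, μ ≤ ‖block βq j‖) ∧
      activeSet βhat = activeSet β₀ := by
  have hsm : 0 < (√m)⁻¹ := inv_pos.2 (Real.sqrt_pos.2 hm)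
  have hρρ₁ : ρ ≤ ρ₁ := by
    refine le_trans ?_ hρ₁
    have : 0 ≤ √M * (√m)⁻¹ * ρ := by positivity
    linarith
  have hgrow' : ∀ t, ‖t‖ ≤ ρ → c * ‖t‖ ^ 2 ≤ localLoss τ y e t + B :=
    fun t ht => hgrow t (ht.trans hρρ₁)
  have hD : 0 ≤ (√m)⁻¹ * (√g * (lam1 * μ ^ (-γ) + 2 * lam2 * b)) * ρ := by
    have := Real.rpow_nonneg hμ.le (-γ)
    have hl1 : (0 : ℝ) ≤ lam1 := lam1.2
    have hl2 : (0 : ℝ) ≤ lam2 := lam2.2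
    positivity
  have c1 := (quantile_norm_lt W hmin hρ hgrow' (by linarith)).le
  have near : ∀ β, ‖T (β - β₀)‖ ≤ ρ → ∀ j, ‖block β j - block β₀ j‖ ≤ μ := fun β hβ j => by
    rw [← block_sub]
    calc _ ≤ ‖β - β₀‖ := norm_block_le _ _
      _ ≤ (√m)⁻¹ * ‖T (β - β₀)‖ := W.norm_le hm hX _
      _ ≤ (√m)⁻¹ * ρ := by gcongr
      _ ≤ μ := hμρ
  have far : ∀ β, ‖T (β - β₀)‖ ≤ ρ → ∀ j ∈ activeSet β₀, μ ≤ ‖block β j‖ := fun β hβ j hj => by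
    have h2 := near β hβ j
    have h3 := hact j hj
    have h4 := norm_sub_norm_le (block β₀ j) (block β j)
    rw [norm_sub_rev] at h4
    linarith
  have c2 := far βq c1
  have c3 := (elasticNet_norm_lt hm hX hlam h0 h1 hγ hhat W hμ c2 hb0 hb hρ hgrow' hgap).le
  refine ⟨c1, c3, c2, ?_⟩
  have c4 := elasticNet_keepGroups_eq hm hX hlam h0 h1 hγ hhat W hM
    (fun j hj => norm_pos_iff.1 (hμ.trans_le (c2 j hj))) hc hρ hρ₁ hgrow hupper c1 c3 hsel
  ext j
  constructor
  · intro hj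
    by_contra hj'
    rw [mem_activeSet, ← c4, block_keepGroups, if_neg hj'] at hj
    exact hj rfl
  · intro hj
    exact mem_activeSet.2 (norm_pos_iff.1 (hμ.trans_le (far βhat c3 j hj)))

/-- On the true support the elastic-net estimator almost minimizes a linearly perturbed loss. -/
theorem elasticNet_almost_min (W : IsWhitening X T y) (hM : 0 ≤ M) {μ : ℝ} (hμ : 0 < μ)
    (hact : ∀ j ∈ activeSet β₀, μ ≤ ‖block β₀ j‖)
    {ρ : ℝ} (hρq : ‖T (βq - β₀)‖ ≤ ρ) (hρhat : ‖T (βhat - β₀)‖ ≤ ρ)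
    (hq : ∀ j ∈ activeSet β₀, μ ≤ ‖block βq j‖) (hsupp : activeSet βhat = activeSet β₀)
    {S : EuclideanSpace ℝ (activeSet β₀ × Fin p) ≃ₗ[ℝ] EuclideanSpace ℝ (activeSet β₀ × Fin p)}
    {z : Fin n → EuclideanSpace ℝ (activeSet β₀ × Fin p)}
    (W' : IsWhitening (fun i => restrictGroups (activeSet β₀) (X i)) S z)
    {q : EuclideanSpace ℝ (activeSet β₀ × Fin p)}
    (hqS : ∀ θ, ⟪q, S θ⟫ = ⟪restrictGroups (activeSet β₀) (penaltySlope γ lam1 lam2 β₀), θ⟫)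
    {ρ' : ℝ} (hρ' : √M * ((√m)⁻¹ * ρ) ≤ ρ') {t : EuclideanSpace ℝ (activeSet β₀ × Fin p)}
    (ht : ‖t‖ ≤ ρ') :
    let s := S (restrictGroups (activeSet β₀) (βhat - β₀))
    ‖s‖ ≤ ρ' ∧ localLoss τ z e s - ⟪q, s⟫ ≤ localLoss τ z e t - ⟪q, t⟫
      + 2 * (lam1 * μ ^ (-γ - 1) * (γ * ((√m)⁻¹ * ρ) + (√m)⁻¹ * ρ') * ((√m)⁻¹ * ρ')
        + lam2 * ((√m)⁻¹ * ρ') ^ 2) := by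
  intro s
  have hl1 : (0 : ℝ) ≤ lam1 := lam1.2
  have hl2 : (0 : ℝ) ≤ lam2 := lam2.2
  have hsm : 0 < (√m)⁻¹ := inv_pos.2 (Real.sqrt_pos.2 hm)
  have hρ0 : 0 ≤ ρ := (norm_nonneg _).trans hρq
  have hρ0' : 0 ≤ ρ' := (norm_nonneg _).trans ht
  have hX' := hX.restrictGroups (activeSet β₀)
  have hμ' := Real.rpow_nonneg hμ.le (-γ - 1)
  have hβ : ‖βhat - β₀‖ ≤ (√m)⁻¹ * ρ := (W.norm_le hm hX _).trans (by gcongr)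
  have hβq : ‖βq - β₀‖ ≤ (√m)⁻¹ * ρ := (W.norm_le hm hX _).trans (by gcongr)
  have hs : ‖s‖ ≤ ρ' := by
    refine (W'.norm_apply_le hm hX' hM _).trans (le_trans ?_ hρ')
    gcongr
    exact (norm_restrictGroups_le _ _).trans hβ
  refine ⟨hs, ?_⟩
  have hsupp' : ∀ j ∉ activeSet β₀, block (βhat - β₀) j = 0 := fun j hj => by
    have a1 : block β₀ j = 0 := by rwa [mem_activeSet, not_not] at hj
    have a2 : block βhat j = 0 := by rwa [← hsupp, mem_activeSet, not_not] at hj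
    rw [block_sub, a1, a2, sub_zero]
  -- Used for the estimator and for an arbitrary competitor; each linearization of the penalty costs
  -- the same error, hence the factor 2 in the conclusion.
  have expand : ∀ δ : GroupVec g p, (∀ j ∉ activeSet β₀, block δ j = 0) →
      ‖S (restrictGroups (activeSet β₀) δ)‖ ≤ ρ' →
      quantileProcess τ X (responses X β₀ e) (β₀ + δ)
        = quantileProcess τ X (responses X β₀ e) β₀
          + localLoss τ z e (S (restrictGroups (activeSet β₀) δ)) ∧
      |groupPenalty lam1 lam2 (adaptiveWeight γ βq) (β₀ + δ)
        - groupPenalty lam1 lam2 (adaptiveWeight γ βq) β₀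
        + ⟪q, S (restrictGroups (activeSet β₀) δ)⟫|
      ≤ lam1 * μ ^ (-γ - 1) * (γ * ((√m)⁻¹ * ρ) + (√m)⁻¹ * ρ') * ((√m)⁻¹ * ρ')
        + lam2 * ((√m)⁻¹ * ρ') ^ 2 := by
    intro δ hδ hn
    have e1 := extendGroups_restrictGroups hδ
    have hδn : ‖δ‖ ≤ (√m)⁻¹ * ρ' := by
      rw [← e1, norm_extendGroups]
      exact (W'.norm_le hm hX' _).trans (by gcongr)
    constructor
    · refine quantileProcess_add fun j => ?_
      rw [W'.inner_apply, ← inner_extendGroups, e1]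
    · rw [hqS, ← inner_extendGroups, e1]
      refine (abs_groupPenalty_sub_le hl1 hl2 hγ hμ hact hq hδ).trans ?_
      gcongr
  obtain ⟨t, rfl⟩ := S.surjective t
  have x1 := expand (βhat - β₀) hsupp' hs
  have x2 := expand (extendGroups _ t) (fun j hj => block_extendGroups_of_notMem t hj)
    (by rwa [restrictGroups_extendGroups])
  rw [restrictGroups_extendGroups] at x2
  rw [add_sub_cancel] at x1
  have hmin := elasticNet_le (β := β₀ + extendGroups _ t) hlam h0 h1 hγ hhat
    (fun j hj => norm_pos_iff.1 (hμ.trans_le (hq j hj))) fun j hj => by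
      have a1 : block β₀ j = 0 := by rwa [mem_activeSet, not_not] at hj
      rw [block_add, a1, block_extendGroups_of_notMem t hj, add_zero]
  have y1 := abs_le.1 x1.2
  have y2 := abs_le.1 x2.2
  rw [x1.1, x2.1] at hmin
  change localLoss τ z e s - ⟪q, s⟫ ≤ _
  have z1 : localLoss τ z e s = localLoss τ z e (S (restrictGroups (activeSet β₀) (βhat - β₀))) :=
    rfl
  have z2 : ⟪q, s⟫ = ⟪q, S (restrictGroups (activeSet β₀) (βhat - β₀))⟫ := rfl
  rw [z1, z2]
  linarith [y1.1, y1.2, y2.1, y2.2]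

end Regression

/-! ### Linearization of almost minimizers -/

section AlmostMin

open scoped RealInnerProductSpace

variable {E : Type*} [NormedAddCommGroup E] [InnerProductSpace ℝ E] [FiniteDimensional ℝ E]
  [MeasurableSpace E] [BorelSpace E] {n : ℕ}

namespace LocalModel

variable {ν : Measure ℝ} [IsProbabilityMeasure ν] {τ f₀ b₀ K ρ b κ t : ℝ} {x : Fin n → E}
  (M : LocalModel ν τ f₀ b₀ K x ρ b) (hκ : 0 < κ)
include M hκ

/-- `s` competes in the problem with linear term $q+tw$ and nearly attains the maximum for $q$; the
ridge costs at most $\kappa\rho^2/2$. Increments of the value thus control every almost minimizer,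
not only `ridgeFit`. -/
lemma mul_inner_le_ridgeValue_sub {q s : E} (w : E) {e : Fin n → ℝ} {η : ℝ} (t : ℝ) (hs : ‖s‖ ≤ ρ)
    (hmin : ∀ u, ‖u‖ ≤ ρ → localLoss τ x e s - ⟪q, s⟫ ≤ localLoss τ x e u - ⟪q, u⟫ + 2 * η) :
    t * ⟪w, s⟫ ≤ ridgeValue τ x ρ κ (q + t • w) e - ridgeValue τ x ρ κ q e
      + (2 * η + κ / 2 * ρ ^ 2) := by
  have h1 := M.ridgeValue_ge hκ (q + t • w) e hs
  have h2 := hmin _ ((M.selection hκ q).norm_le e)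
  have h3 : ridgeValue τ x ρ κ q e = ⟪q, ridgeFit τ x ρ κ q e⟫
      - κ / 2 * ‖ridgeFit τ x ρ κ q e‖ ^ 2 - localLoss τ x e (ridgeFit τ x ρ κ q e) := rfl
  have h4 : objective τ x (ridgeBase κ (q + t • w)) e s
      = ⟪q + t • w, s⟫ - κ / 2 * ‖s‖ ^ 2 - localLoss τ x e s := rfl
  rw [h4, inner_add_left, inner_smul_left] at h1
  simp only [conj_trivial] at h1
  have h5 : 0 ≤ κ / 2 * ‖ridgeFit τ x ρ κ q e‖ ^ 2 := by positivity
  have h6 : κ / 2 * ‖s‖ ^ 2 ≤ κ / 2 * ρ ^ 2 := by gcongr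
  linarith

/-- With large probability every almost minimizer is bounded above, in the direction `w`, by its
linearization. -/
theorem exists_inner_le (hb : 4080 * K ^ 6 * b ≤ 1) {q w : E} (hw : ‖w‖ ≤ 1)
    (hq : ‖q + t • w‖ ≤ 1) (ht0 : 0 < t) (ht1 : t ≤ 1) {δ : ℝ} (hδ0 : 0 < δ) (hδ1 : δ ≤ 1) :
    ∃ A : Set (Fin n → ℝ), MeasurableSet A ∧
      (Measure.pi fun _ => ν).real A ≤ (10 * K ^ 2
        * √(2 * κ ^ 2 + 4 * (1 + ∑ j, ‖x j‖ ^ 2) / ρ ^ 2) + 302 * K ^ 4 * b / t) / δ ^ 2 ∧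
      ∀ e ∉ A, ∀ s η, ‖s‖ ≤ ρ →
        (∀ u, ‖u‖ ≤ ρ → localLoss τ x e s - ⟪q, s⟫ ≤ localLoss τ x e u - ⟪q, u⟫ + 2 * η) →
        ⟪w, s⟫ ≤ f₀⁻¹ * (∑ j, ⟪x j, w⟫ * checkScore τ (e j) + ⟪q, w⟫ + t) + δ
          + (2 * η + κ / 2 * ρ ^ 2) / t := by
  set Φ : (Fin n → ℝ) → ℝ := fun e =>
    min 1 (max 0 (t⁻¹ * (ridgeValue τ x ρ κ (q + t • w) e - ridgeValue τ x ρ κ q e)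
      - f₀⁻¹ * (∑ j, ⟪x j, w⟫ * checkScore τ (e j) + ⟪q + t • w, w⟫))) with hΦ
  have hclip := M.integral_clip_sq_le hκ hb hq hw ht0 ht1
  rw [add_sub_cancel_right] at hclip
  have hmeas : Measurable Φ := by
    refine measurable_const.min (measurable_const.max (Measurable.sub ?_ ?_))
    · exact ((M.bddMeas_ridgeValue hκ _).1.sub (M.bddMeas_ridgeValue hκ _).1).const_mul _
    · refine Measurable.const_mul (Measurable.add_const (Finset.measurable_sum _ fun j _ => ?_) _) _
      exact ((measurable_checkScore τ).comp (measurable_pi_apply j)).const_mul _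
  have h01 : ∀ e, 0 ≤ Φ e ∧ Φ e ≤ 1 := fun e =>
    ⟨le_min zero_le_one (le_max_left _ _), min_le_left _ _⟩
  have hbdd : BddMeas Φ := ⟨hmeas, 1, fun e => by rw [abs_of_nonneg (h01 e).1]; exact (h01 e).2⟩
  refine ⟨{e | δ ≤ Φ e}, measurableSet_le measurable_const hmeas, ?_, fun e he s η hs hmin => ?_⟩
  · have h1 := mul_meas_ge_le_integral_of_nonneg (μ := Measure.pi fun _ : Fin n => ν)
      (ae_of_all _ fun e => sq_nonneg (Φ e)) hbdd.sq.integrable (δ ^ 2)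
    have h2 : {e | δ ^ 2 ≤ Φ e ^ 2} = {e | δ ≤ Φ e} := by
      ext e
      exact sq_le_sq₀ hδ0.le (h01 e).1
    rw [h2] at h1
    rw [le_div_iff₀ (by positivity), mul_comm]
    exact h1.trans hclip
  · have h1 := M.mul_inner_le_ridgeValue_sub hκ w t hs hmin
    set D := t⁻¹ * (ridgeValue τ x ρ κ (q + t • w) e - ridgeValue τ x ρ κ q e)
      - f₀⁻¹ * (∑ j, ⟪x j, w⟫ * checkScore τ (e j) + ⟪q + t • w, w⟫) with hD
    -- Off the event the clipped variable is below $\delta\le1$, so the clip is inactive.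
    have h2 : D < δ := by
      by_contra! hh
      exact he (le_min hδ1 (hh.trans (le_max_right _ _)))
    have h3 : ⟪w, s⟫ ≤ t⁻¹ * (ridgeValue τ x ρ κ (q + t • w) e - ridgeValue τ x ρ κ q e)
        + (2 * η + κ / 2 * ρ ^ 2) / t := by
      rw [← mul_le_mul_iff_right₀ ht0, mul_add, mul_inv_cancel_left₀ ht0.ne',
        mul_div_cancel₀ _ ht0.ne']
      exact h1
    have h4 : ⟪q + t • w, w⟫ ≤ ⟪q, w⟫ + t := by
      rw [inner_add_left, inner_smul_left, real_inner_self_eq_norm_sq]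
      simp only [conj_trivial]
      have : ‖w‖ ^ 2 ≤ 1 := pow_le_one₀ (norm_nonneg _) hw
      nlinarith
    have h5 : f₀⁻¹ * (∑ j, ⟪x j, w⟫ * checkScore τ (e j) + ⟪q + t • w, w⟫)
        ≤ f₀⁻¹ * (∑ j, ⟪x j, w⟫ * checkScore τ (e j) + ⟪q, w⟫ + t) := by
      have := M.noise.f₀_pos
      gcongr _ * ?_
      linarith
    linarith

/-- With large probability every almost minimizer is close, in the direction `w`, to its
linearization. -/
theorem exists_abs_inner_sub_le (hb : 4080 * K ^ 6 * b ≤ 1) {q w : E} (hw : ‖w‖ ≤ 1)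
    (hq : ‖q‖ ≤ 1 / 2) (ht0 : 0 < t) (ht1 : t ≤ 1 / 2) {δ : ℝ} (hδ0 : 0 < δ) (hδ1 : δ ≤ 1) :
    ∃ A : Set (Fin n → ℝ), MeasurableSet A ∧
      (Measure.pi fun _ => ν).real A ≤ 2 * ((10 * K ^ 2
        * √(2 * κ ^ 2 + 4 * (1 + ∑ j, ‖x j‖ ^ 2) / ρ ^ 2) + 302 * K ^ 4 * b / t) / δ ^ 2) ∧
      ∀ e ∉ A, ∀ s η, ‖s‖ ≤ ρ →
        (∀ u, ‖u‖ ≤ ρ → localLoss τ x e s - ⟪q, s⟫ ≤ localLoss τ x e u - ⟪q, u⟫ + 2 * η) →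
        |⟪w, s⟫ - f₀⁻¹ * ∑ j, ⟪x j, w⟫ * checkScore τ (e j)|
          ≤ f₀⁻¹ * (‖q‖ + t) + δ + (2 * η + κ / 2 * ρ ^ 2) / t := by
  have hf := M.noise.f₀_pos
  have bound : ∀ w' : E, ‖w'‖ ≤ 1 → ‖q + t • w'‖ ≤ 1 := fun w' hw' => by
    refine (norm_add_le _ _).trans ?_
    rw [norm_smul, Real.norm_of_nonneg ht0.le]
    nlinarith [norm_nonneg w']
  have hqw : |⟪q, w⟫| ≤ ‖q‖ :=
    (abs_real_inner_le_norm q w).trans (mul_le_of_le_one_right (norm_nonneg _) hw)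
  obtain ⟨A, hA, hA1, hA2⟩ :=
    M.exists_inner_le hκ hb hw (bound w hw) ht0 (by linarith) hδ0 hδ1
  have hw' : ‖-w‖ ≤ 1 := by rwa [norm_neg]
  obtain ⟨A', hA', hA1', hA2'⟩ :=
    M.exists_inner_le hκ hb hw' (bound (-w) hw') ht0 (by linarith) hδ0 hδ1
  refine ⟨A ∪ A', hA.union hA', ?_, fun e he s η hs hmin => ?_⟩
  · refine (measureReal_union_le _ _).trans ?_
    linarith
  · have h1 := hA2 e (fun h => he (Or.inl h)) s η hs hmin
    have h2 := hA2' e (fun h => he (Or.inr h)) s η hs hmin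
    simp only [inner_neg_right, inner_neg_left, neg_mul, Finset.sum_neg_distrib] at h2
    have h3 : f₀⁻¹ * ⟪q, w⟫ ≤ f₀⁻¹ * ‖q‖ := by gcongr; exact (le_abs_self _).trans hqw
    have h4 : f₀⁻¹ * -⟪q, w⟫ ≤ f₀⁻¹ * ‖q‖ := by gcongr; exact (neg_le_abs _).trans hqw
    rw [abs_le]
    constructor <;> linarith

end LocalModel

end AlmostMin

/-! ### Probabilistic analysis for a fixed sample size -/

section FixedSample

open scoped RealInnerProductSpace

/-- The regime of the sample: `k` bounds the number of groups, `s` is the rate of estimation, `μ`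
separates the active groups from zero and `b` bounds them. -/
structure SampleRegime {g p n : ℕ} (X : Fin n → GroupVec g p) (β₀ : GroupVec g p)
    (m₀ M₀ k s μ b : ℝ) : Prop where
  n_pos : 0 < n
  m₀_pos : 0 < m₀
  M₀_nonneg : 0 ≤ M₀
  one_le_k : 1 ≤ k
  g_le : (g : ℝ) ≤ k
  s_eq : s = √k / √n
  cond : IsConditioned X (n * m₀) (n * M₀)
  μ_pos : 0 < μ
  b_nonneg : 0 ≤ b
  le_norm : ∀ j ∈ activeSet β₀, 2 * μ ≤ ‖block β₀ j‖
  norm_le : ∀ j, ‖block β₀ j‖ ≤ b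

variable {g p n : ℕ} {τ γ f₀ b₀ K m₀ M₀ k s μ b : ℝ} {X : Fin n → GroupVec g p}
  {β₀ : GroupVec g p} {lam1 lam2 : ℝ≥0} {ν : Measure ℝ} [IsProbabilityMeasure ν]

namespace SampleRegime

variable (H : SampleRegime X β₀ m₀ M₀ k s μ b)
include H

lemma sqrt_n_pos : 0 < √(n : ℝ) := Real.sqrt_pos.2 (by exact_mod_cast H.n_pos)

lemma k_pos : 0 < k := one_pos.trans_le H.one_le_k

lemma s_pos : 0 < s := by
  rw [H.s_eq]
  exact div_pos (Real.sqrt_pos.2 H.k_pos) H.sqrt_n_pos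

lemma inv_sqrt_mul_sqrt : (√(n * m₀))⁻¹ * √k = (√m₀)⁻¹ * s := by
  have := H.sqrt_n_pos
  have := Real.sqrt_pos.2 H.m₀_pos
  rw [H.s_eq, Real.sqrt_mul (Nat.cast_nonneg _)]
  field_simp

lemma ratio_eq : √(n * M₀) * (√(n * m₀))⁻¹ = √M₀ * (√m₀)⁻¹ := by
  have := H.sqrt_n_pos
  have := Real.sqrt_pos.2 H.m₀_pos
  rw [Real.sqrt_mul (Nat.cast_nonneg _), Real.sqrt_mul (Nat.cast_nonneg _)]
  field_simp

lemma nm_pos : 0 < n * m₀ := mul_pos (by exact_mod_cast H.n_pos) H.m₀_pos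

lemma nM_nonneg : 0 ≤ n * M₀ := mul_nonneg (Nat.cast_nonneg _) H.M₀_nonneg

/-- The local models attached to a design dominated by `X`. -/
lemma localModel {V : Type*} [NormedAddCommGroup V] [InnerProductSpace ℝ V]
    [FiniteDimensional ℝ V] [MeasurableSpace V] [BorelSpace V] (N : QuantileNoise ν τ f₀ b₀ K)
    {x y : Fin n → V} {T : V ≃ₗ[ℝ] V} (W : IsWhitening x T y)
    (hx : IsConditioned x (n * m₀) (n * M₀)) (hxX : ∀ j, ‖x j‖ ≤ ‖X j‖) {R b₁ : ℝ} (hR : 0 < R)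
    (hfit : ∀ j, R * (√m₀)⁻¹ * (s * ‖X j‖) ≤ b₁) (hb0 : 0 ≤ b₁) (hb1 : b₁ ≤ b₀) (hb2 : b₁ ≤ 1) :
    LocalModel ν τ f₀ b₀ K y (R * √k) b₁ where
  noise := N
  parseval := W.parseval
  radius_pos := mul_pos hR (Real.sqrt_pos.2 H.k_pos)
  fit_le j := by
    have hm : 0 ≤ (√(n * m₀))⁻¹ := by positivity
    have hs : 0 ≤ (√m₀)⁻¹ * s := mul_nonneg (by positivity) H.s_pos.le
    calc ‖y j‖ * (R * √k) ≤ ((√(n * m₀))⁻¹ * ‖x j‖) * (R * √k) := by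
          gcongr; exact W.norm_frame_le H.nm_pos hx j
      _ = ((√(n * m₀))⁻¹ * √k) * R * ‖x j‖ := by ring
      _ = ((√m₀)⁻¹ * s) * R * ‖x j‖ := by rw [H.inv_sqrt_mul_sqrt]
      _ ≤ ((√m₀)⁻¹ * s) * R * ‖X j‖ := by gcongr; exact hxX j
      _ = R * (√m₀)⁻¹ * (s * ‖X j‖) := by ring
      _ ≤ b₁ := hfit j
  b_nonneg := hb0
  b_le := hb1
  b_le_one := hb2

set_option maxHeartbeats 1600000 in
/-- With large probability both estimators have the rate `s` and the elastic net recovers the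
support. -/
theorem exists_support_event (N : QuantileNoise ν τ f₀ b₀ K) (hlam : 0 < lam1) (hγ : 0 < γ)
    {T : GroupVec g p ≃ₗ[ℝ] GroupVec g p} {y : Fin n → GroupVec g p} (W : IsWhitening X T y)
    {R R₁ h b₁ : ℝ} (hR : 0 < R) (hR₁ : (√M₀ * (√m₀)⁻¹ + 1) * R = R₁) (hh : 0 ≤ h)
    (hfit : ∀ j, 2 * R₁ * (√m₀)⁻¹ * (s * ‖X j‖) ≤ b₁) (hb0 : 0 ≤ b₁) (hb1 : b₁ ≤ b₀) (hb2 : b₁ ≤ 1)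
    (hsep : (√m₀)⁻¹ * (R * s) ≤ μ)
    (hgap : (√m₀)⁻¹ * (s * (lam1 * μ ^ (-γ) + 2 * lam2 * b)) ≤ (16 * K)⁻¹ * R / 4)
    (hsel : √M₀ * (p + 8 * K * R₁ ^ 2 + h + (16 * K)⁻¹ * R ^ 2 / 2) * (n * s)
      < lam1 * ((√m₀)⁻¹ * (R * s)) ^ (-γ) * R) :
    ∃ A : Set (Fin n → ℝ), MeasurableSet A ∧
      (Measure.pi fun _ => ν).real A ≤ 32 * K * (16 * K * p + 1) / R ^ 2 + Real.exp (-h) ∧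
      ∀ e ∉ A, ∀ βq βhat, IsMinOn (quantileProcess τ X (responses X β₀ e)) Set.univ βq →
        IsMinOn (elasticNetProcess τ γ lam1 lam2 X (responses X β₀ e) βq) Set.univ βhat →
        ‖T (βq - β₀)‖ ≤ R * √k ∧ ‖T (βhat - β₀)‖ ≤ R * √k ∧
          (∀ j ∈ activeSet β₀, μ ≤ ‖block βq j‖) ∧ activeSet βhat = activeSet β₀ := by
  have hK := N.K_pos
  have hk := H.k_pos
  have hk1 := H.one_le_k
  have hsk : 0 < √k := Real.sqrt_pos.2 hk
  have hsk2 : √k ^ 2 = k := Real.sq_sqrt hk.le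
  have hrat : 0 ≤ √M₀ * (√m₀)⁻¹ := by positivity
  have hR1 : R ≤ R₁ := by rw [← hR₁]; nlinarith
  have hR1' : 0 < R₁ := hR.trans_le hR1
  have hs := H.s_pos
  have hdim : (Module.finrank ℝ (GroupVec g p) : ℝ) ≤ p * k := by
    simp only [finrank_euclideanSpace, Fintype.card_prod, Fintype.card_fin]
    push_cast
    have := H.g_le
    nlinarith [Nat.cast_nonneg (α := ℝ) p]
  have M1 : LocalModel ν τ f₀ b₀ K y (R₁ * √k) b₁ :=
    H.localModel N W H.cond (fun _ => le_rfl) hR1' (fun j => le_trans (by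
      have : 0 ≤ R₁ * (√m₀)⁻¹ * (s * ‖X j‖) := by positivity
      linarith) (hfit j)) hb0 hb1 hb2
  -- The radius is doubled because `exists_upper` bounds the loss only on the ball of half the
  -- radius.
  have M2 : LocalModel ν τ f₀ b₀ K y (2 * R₁ * √k) b₁ :=
    H.localModel N W H.cond (fun _ => le_rfl) (by positivity) hfit hb0 hb1 hb2
  obtain ⟨Vg, hVm, hV0, hVi, hV⟩ := M1.exists_growth
  set c := (16 * K)⁻¹ with hc
  have hc0 : 0 < c := by positivity
  -- Half of the growth $cR^2k$ reached at radius $R\sqrt k$; the penalty uses at most a quarter of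
  -- it, so strict growth remains.
  set B := c * R ^ 2 / 2 * k with hB
  have hBpos : 0 < B := by positivity
  -- The exponent of `exists_upper` at radius $2R_1\sqrt k$ then becomes at most $-hk\le-h$.
  set a := (p + 8 * K * R₁ ^ 2 + h) * k with ha
  obtain ⟨A, hA, hAp, hAu⟩ := M2.exists_upper a
  refine ⟨A ∪ {e | B ≤ Vg e + 1}, hA.union (measurableSet_le measurable_const
    (hVm.1.add_const _)), ?_, fun e he βq βhat hq hhat => ?_⟩
  · refine (measureReal_union_le _ _).trans ?_
    rw [add_comm]
    refine add_le_add ?_ (hAp.trans (Real.exp_le_exp.2 ?_))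
    · have h1 := mul_meas_ge_le_integral_of_nonneg (μ := Measure.pi fun _ : Fin n => ν)
        (ae_of_all _ fun e => show 0 ≤ Vg e + 1 by linarith [hV0 e])
        (hVm.add (BddMeas.const 1)).integrable B
      rw [integral_add hVm.integrable (integrable_const _)] at h1
      rw [W.parseval.sum_norm_sq] at hVi
      simp only [integral_const, probReal_univ, smul_eq_mul, mul_one] at h1
      set pr := (Measure.pi fun _ : Fin n => ν).real {e | B ≤ Vg e + 1} with hpr
      have h2 : B * pr ≤ (16 * K * p + 1) * k := by
        refine h1.trans ?_
        have : 16 * K * (Module.finrank ℝ (GroupVec g p) : ℝ) ≤ 16 * K * (p * k) := by gcongr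
        linarith
      rw [le_div_iff₀ (by positivity)]
      have e1 : B = c / 2 * R ^ 2 * k := by rw [hB]; ring
      have e2 : c * (32 * K) = 2 := by rw [hc]; field_simp; norm_num
      rw [e1] at h2
      have h3 : c / 2 * R ^ 2 * pr ≤ 16 * K * p + 1 := by
        rw [← mul_le_mul_iff_left₀ hk]
        linarith
      have h4 := mul_le_mul_of_nonneg_left h3 (show 0 ≤ 32 * K by positivity)
      calc pr * R ^ 2 = 32 * K * (c / 2 * R ^ 2 * pr) := by
            linear_combination (-(R ^ 2) / 2 * pr) * e2
        _ ≤ _ := h4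
    · have : 2 * K * (2 * R₁ * √k) ^ 2 = 8 * K * R₁ ^ 2 * k := by rw [mul_pow, hsk2]; ring
      rw [this, ha]
      nlinarith
  · have heA : e ∉ A := fun hh => he (Or.inl hh)
    have heV : Vg e + 1 < B := by
      by_contra! hh
      exact he (Or.inr hh)
    refine elasticNet_support (c := c) (a := a) (B := B) (ρ₁ := R₁ * √k) H.nm_pos H.cond hlam
      N.tau_pos.le N.tau_lt_one.le hγ hhat W H.nM_nonneg hq H.μ_pos H.le_norm H.b_nonneg H.norm_le
      hc0.le (by positivity) ?_ (fun t ht => ?_) (fun t ht => ?_) ?_ ?_ ?_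
    · rw [H.ratio_eq, ← hR₁, mul_assoc]
    · have := hV e t ht
      change c * ‖t‖ ^ 2 ≤ localLoss τ y e t + Vg e + 1 at this
      linarith
    · exact hAu e heA t (ht.trans (by linarith))
    · rw [mul_left_comm, H.inv_sqrt_mul_sqrt]
      linarith
    · have e1 : (√(n * m₀))⁻¹ * (√g * (lam1 * μ ^ (-γ) + 2 * lam2 * b)) * (R * √k)
          = √g * R * ((√m₀)⁻¹ * (s * (lam1 * μ ^ (-γ) + 2 * lam2 * b))) := by
        linear_combination (√g * R * (lam1 * μ ^ (-γ) + 2 * lam2 * b)) * H.inv_sqrt_mul_sqrt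
      have e2 : √(g : ℝ) ≤ k := by
        refine (Real.sqrt_le_sqrt H.g_le).trans ?_
        nlinarith [Real.one_le_sqrt.2 hk1]
      have e3 : √g * R * ((√m₀)⁻¹ * (s * (lam1 * μ ^ (-γ) + 2 * lam2 * b)))
          ≤ k * R * (c * R / 4) := by
        calc _ ≤ √g * R * (c * R / 4) := by gcongr
          _ ≤ _ := by gcongr
      rw [e1, mul_pow, hsk2]
      have e4 : 0 < c * R ^ 2 * k := by positivity
      have e5 : B = c * R ^ 2 * k / 2 := by rw [hB]; ring
      have e6 : k * R * (c * R / 4) = c * R ^ 2 * k / 4 := by ring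
      have e7 : c * (R ^ 2 * k) = c * R ^ 2 * k := by ring
      linarith
    · have e1 : (√(n * m₀))⁻¹ * (R * √k) = (√m₀)⁻¹ * (R * s) := by
        rw [mul_left_comm, H.inv_sqrt_mul_sqrt]; ring
      have e2 : √(n : ℝ) * k = n * s * √k := by
        have h1 := H.sqrt_n_pos
        have h2 : √(n : ℝ) ^ 2 = n := Real.sq_sqrt (Nat.cast_nonneg _)
        rw [H.s_eq]
        nth_rewrite 2 [← h2]
        field_simp
        rw [hsk2]
      rw [e1, Real.sqrt_mul (Nat.cast_nonneg _)]
      calc √(n : ℝ) * √M₀ * (a + B)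
          = (√M₀ * (p + 8 * K * R₁ ^ 2 + h + c * R ^ 2 / 2)) * (√(n : ℝ) * k) := by
            rw [ha, hB]; ring
        _ = (√M₀ * (p + 8 * K * R₁ ^ 2 + h + c * R ^ 2 / 2) * (n * s)) * √k := by rw [e2]; ring
        _ < (lam1 * ((√m₀)⁻¹ * (R * s)) ^ (-γ) * R) * √k := by gcongr
        _ = _ := by ring

end SampleRegime

end FixedSample

/-! ### Linearization of the estimator for a fixed sample size -/

section FixedSampleLinearization

open scoped RealInnerProductSpace

variable {g p n : ℕ} {τ γ f₀ b₀ K m₀ M₀ k s μ b : ℝ} {X : Fin n → GroupVec g p}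
  {β₀ : GroupVec g p} {lam1 lam2 : ℝ≥0} {ν : Measure ℝ} [IsProbabilityMeasure ν]

/-- The weights of the scores in the linearization of the direction `u` of the estimator. -/
noncomputable def scoreWeight {ι : Type*} [Fintype ι] [DecidableEq ι] {n : ℕ}
    (x : Fin n → EuclideanSpace ℝ ι) (u : EuclideanSpace ℝ ι) (j : Fin n) : ℝ :=
  (√(n * (u ⬝ᵥ (gramMatrix x)⁻¹.mulVec u)))⁻¹
    * ⟪x j, WithLp.toLp 2 ((gramMatrix x)⁻¹.mulVec u)⟫

/-- In the whitened variables the normalized direction is a unit vector `w`. -/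
lemma IsWhitening.exists_unit {ι : Type*} [Fintype ι] [DecidableEq ι] {n : ℕ} (hn : 0 < n)
    {x : Fin n → EuclideanSpace ℝ ι} {T : EuclideanSpace ℝ ι ≃ₗ[ℝ] EuclideanSpace ℝ ι}
    {y : Fin n → EuclideanSpace ℝ ι} (W : IsWhitening x T y) (hU : IsUnit (gramMatrix x))
    {u : EuclideanSpace ℝ ι} (hu : u ≠ 0) :
    ∃ w, ‖w‖ = 1 ∧ (∀ j, ⟪y j, w⟫ = scoreWeight x u j) ∧ ∀ θ, ⟪w, T θ⟫
      = (n : ℝ) ^ (1 / 2 : ℝ) * (u ⬝ᵥ (gramMatrix x)⁻¹.mulVec u) ^ (-(1 / 2) : ℝ) * ⟪u, θ⟫ := by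
  obtain ⟨h1, h2⟩ := W.norm_sq_dual hn hU u
  set d := u ⬝ᵥ (gramMatrix x)⁻¹.mulVec u with hd
  set v := T (WithLp.toLp 2 ((gramMatrix x)⁻¹.mulVec u)) with hv
  have hn' : (0 : ℝ) < n := by exact_mod_cast hn
  have hv0 : 0 < ‖v‖ := by
    refine norm_pos_iff.2 fun hh => hu ?_
    have h3 := h1 u
    rw [hh, inner_zero_left, real_inner_self_eq_norm_sq] at h3
    have h4 : ‖u‖ ^ 2 = 0 := by
      rcases mul_eq_zero.1 h3.symm with h | h
      · exact absurd h hn'.ne'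
      · exact h
    exact norm_eq_zero.1 (pow_eq_zero_iff two_ne_zero |>.1 h4)
  have hd0 : 0 < d := by
    by_contra! hh
    have : 0 < ‖v‖ ^ 2 := by positivity
    nlinarith
  have hnorm : ‖v‖ = √(n * d) := by rw [← h2, Real.sqrt_sq hv0.le]
  refine ⟨‖v‖⁻¹ • v, ?_, fun j => ?_, fun θ => ?_⟩
  · rw [norm_smul, norm_inv, norm_norm, inv_mul_cancel₀ hv0.ne']
  · rw [inner_smul_right, W.inner_apply, hnorm, scoreWeight]
  · rw [inner_smul_left, h1, hnorm, Real.rpow_neg hd0.le, ← Real.sqrt_eq_rpow, ← Real.sqrt_eq_rpow,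
      Real.sqrt_mul hn'.le]
    simp only [conj_trivial]
    have e1 : √(n : ℝ) * √(n : ℝ) = n := Real.mul_self_sqrt hn'.le
    have e2 := Real.sqrt_pos.2 hn'
    have e3 := Real.sqrt_pos.2 hd0
    nth_rewrite 2 [← e1]
    field_simp

/-- Here $\kappa=2t\delta/\rho^2$ with $\rho=R\sqrt k$. The dimension, at most $pk$, is compensated
by $\rho^2$, so the bound is free of $k$ and small for large $R$. -/
lemma ridge_bound_le {R k t δ σ : ℝ} {p : ℕ} (hR : 1 ≤ R) (hk : 1 ≤ k) (ht0 : 0 < t)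
    (ht1 : t ≤ 1 / 2) (hδ0 : 0 < δ) (hδ1 : δ ≤ 1) (hσ : σ ≤ p * k) :
    2 * (2 * (t * δ) / (R * √k) ^ 2) ^ 2 + 4 * (1 + σ) / (R * √k) ^ 2 ≤ (6 + 4 * p) / R ^ 2 := by
  have hR0 : 0 < R := one_pos.trans_le hR
  have hk0 : 0 < k := one_pos.trans_le hk
  have hp : (0 : ℝ) ≤ p := Nat.cast_nonneg p
  rw [mul_pow, Real.sq_sqrt hk0.le]
  have e1 : 2 * (2 * (t * δ) / (R ^ 2 * k)) ^ 2 ≤ 2 / R ^ 2 := by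
    have h1 : 2 * (t * δ) / (R ^ 2 * k) ≤ 1 / R := by
      rw [div_le_div_iff₀ (by positivity) hR0]
      have h2 : 2 * (t * δ) ≤ 1 := by nlinarith
      have h3 : 1 ≤ R * k := by nlinarith
      calc 2 * (t * δ) * R ≤ 1 * R := by gcongr
        _ ≤ (R * k) * R := by gcongr
        _ = 1 * (R ^ 2 * k) := by ring
    calc 2 * (2 * (t * δ) / (R ^ 2 * k)) ^ 2 ≤ 2 * (1 / R) ^ 2 := by gcongr
      _ = _ := by field_simp
  have e2 : 4 * (1 + σ) / (R ^ 2 * k) ≤ (4 + 4 * p) / R ^ 2 := by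
    rw [div_le_div_iff₀ (by positivity) (by positivity)]
    have : 4 * (1 + σ) ≤ (4 + 4 * p) * k := by nlinarith
    calc 4 * (1 + σ) * R ^ 2 ≤ (4 + 4 * p) * k * R ^ 2 := by gcongr
      _ = _ := by ring
  calc _ ≤ 2 / R ^ 2 + (4 + 4 * p) / R ^ 2 := add_le_add e1 e2
    _ = _ := by ring

namespace SampleRegime

variable (H : SampleRegime X β₀ m₀ M₀ k s μ b)
include H

/-- The weights are the coefficients of a unit vector in a Parseval frame. This normalization gives
the limit law its fixed variance. -/
lemma sum_scoreWeight_sq {u : EuclideanSpace ℝ (activeSet β₀ × Fin p)} (hu : u ≠ 0) :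
    ∑ j, scoreWeight (fun i => restrictGroups (activeSet β₀) (X i)) u j ^ 2 = 1 := by
  have hX' := H.cond.restrictGroups (activeSet β₀)
  obtain ⟨S, z, W'⟩ := hX'.exists_isWhitening H.nm_pos
  obtain ⟨w, hw, hw1, -⟩ := W'.exists_unit H.n_pos (isUnit_gramMatrix H.n_pos _ H.nm_pos hX') hu
  simp only [← hw1]
  rw [W'.parseval, hw, one_pow]

lemma abs_scoreWeight_le {u : EuclideanSpace ℝ (activeSet β₀ × Fin p)} (hu : u ≠ 0) (j : Fin n) :
    |scoreWeight (fun i => restrictGroups (activeSet β₀) (X i)) u j| ≤ (√m₀)⁻¹ * (s * ‖X j‖) := by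
  have hX' := H.cond.restrictGroups (activeSet β₀)
  obtain ⟨S, z, W'⟩ := hX'.exists_isWhitening H.nm_pos
  obtain ⟨w, hw, hw1, -⟩ := W'.exists_unit H.n_pos (isUnit_gramMatrix H.n_pos _ H.nm_pos hX') hu
  have hk : 1 ≤ √k := Real.one_le_sqrt.2 H.one_le_k
  rw [← hw1]
  calc |⟪z j, w⟫| ≤ ‖z j‖ * 1 := by rw [← hw]; exact abs_real_inner_le_norm _ _
    _ ≤ (√(n * m₀))⁻¹ * ‖X j‖ * 1 := by
        gcongr
        exact (W'.norm_frame_le H.nm_pos hX' j).trans (by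
          gcongr; exact norm_restrictGroups_le _ _)
    _ ≤ (√(n * m₀))⁻¹ * ‖X j‖ * √k := by gcongr
    _ = ((√(n * m₀))⁻¹ * √k) * ‖X j‖ := by ring
    _ = _ := by rw [H.inv_sqrt_mul_sqrt]; ring

set_option maxHeartbeats 800000 in
/-- With large probability the elastic net recovers the support and its normalized error in the
direction `u` is close to a weighted sum of scores. -/
theorem exists_linearization_event (N : QuantileNoise ν τ f₀ b₀ K) (hlam : 0 < lam1) (hγ : 0 < γ)
    {R R₁ h b₁ : ℝ} (hR : 1 ≤ R) (hR₁ : (√M₀ * (√m₀)⁻¹ + 1) * R = R₁) (hh : 0 ≤ h)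
    (hfit : ∀ j, 2 * R₁ * (√m₀)⁻¹ * (s * ‖X j‖) ≤ b₁) (hb0 : 0 ≤ b₁) (hb1 : b₁ ≤ b₀) (hb2 : b₁ ≤ 1)
    (hsep : (√m₀)⁻¹ * (R * s) ≤ μ)
    (hgap : (√m₀)⁻¹ * (s * (lam1 * μ ^ (-γ) + 2 * lam2 * b)) ≤ (16 * K)⁻¹ * R / 4)
    (hsel : √M₀ * (p + 8 * K * R₁ ^ 2 + h + (16 * K)⁻¹ * R ^ 2 / 2) * (n * s)
      < lam1 * ((√m₀)⁻¹ * (R * s)) ^ (-γ) * R)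
    (hb3 : 4080 * K ^ 6 * b₁ ≤ 1) {δ t : ℝ} (hδ0 : 0 < δ) (hδ1 : δ ≤ 1) (ht0 : 0 < t)
    (ht1 : t ≤ 1 / 2) (htδ : f₀⁻¹ * t ≤ δ)
    (hq1 : (√m₀)⁻¹ * (s * (lam1 * μ ^ (-γ) + 2 * lam2 * b)) ≤ 1 / 2)
    (hqδ : f₀⁻¹ * ((√m₀)⁻¹ * (s * (lam1 * μ ^ (-γ) + 2 * lam2 * b))) ≤ δ)
    (hη : 2 * ((lam1 * μ ^ (-γ - 1) * (γ + 1) + lam2) * ((√m₀)⁻¹ * R₁ * s) ^ 2) ≤ t * δ)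
    {u : EuclideanSpace ℝ (activeSet β₀ × Fin p)} (hu : u ≠ 0) :
    ∃ A : Set (Fin n → ℝ), MeasurableSet A ∧
      (Measure.pi fun _ => ν).real A ≤ 32 * K * (16 * K * p + 1) / R ^ 2 + Real.exp (-h)
        + 2 * ((10 * K ^ 2 * √((6 + 4 * p) / R₁ ^ 2) + 302 * K ^ 4 * b₁ / t) / δ ^ 2) ∧
      ∀ e ∉ A, ∀ βq βhat, IsMinOn (quantileProcess τ X (responses X β₀ e)) Set.univ βq →
        IsMinOn (elasticNetProcess τ γ lam1 lam2 X (responses X β₀ e) βq) Set.univ βhat →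
        |(n : ℝ) ^ (1 / 2 : ℝ) * (u ⬝ᵥ ((gramMatrix fun i =>
              restrictGroups (activeSet β₀) (X i))⁻¹.mulVec u)) ^ (-(1 / 2) : ℝ)
            * ⟪u, restrictGroups (activeSet β₀) (βhat - β₀)⟫
          - f₀⁻¹ * ∑ j, scoreWeight (fun i => restrictGroups (activeSet β₀) (X i)) u j
            * checkScore τ (e j)| ≤ 5 * δ := by
  have hK := N.K_pos
  have hk := H.k_pos
  have hs := H.s_pos
  have hm := H.nm_pos
  have hR0 : 0 < R := one_pos.trans_le hR
  have hsk : 0 < √k := Real.sqrt_pos.2 hk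
  have hsk2 : √k ^ 2 = k := Real.sq_sqrt hk.le
  have hrat : 0 ≤ √M₀ * (√m₀)⁻¹ := by positivity
  have hRR₁ : R ≤ R₁ := by rw [← hR₁]; nlinarith
  have hR1 : 1 ≤ R₁ := hR.trans hRR₁
  have hR1' : 0 < R₁ := one_pos.trans_le hR1
  have hμ := H.μ_pos
  have hl1 : (0 : ℝ) ≤ lam1 := lam1.2
  have hl2 : (0 : ℝ) ≤ lam2 := lam2.2
  have hX' := H.cond.restrictGroups (activeSet β₀)
  obtain ⟨T, y, W⟩ := H.cond.exists_isWhitening hm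
  obtain ⟨S, z, W'⟩ := hX'.exists_isWhitening hm
  obtain ⟨w, hw, hw1, hw2⟩ := W'.exists_unit H.n_pos (isUnit_gramMatrix H.n_pos _ hm hX') hu
  obtain ⟨q, hqn, hqS⟩ := W'.exists_dual hm hX'
    (restrictGroups (activeSet β₀) (penaltySlope γ lam1 lam2 β₀))
  have hQ : ‖q‖ ≤ (√m₀)⁻¹ * (s * (lam1 * μ ^ (-γ) + 2 * lam2 * b)) := by
    have hμγ := Real.rpow_nonneg hμ.le (-γ)
    have hb := H.b_nonneg
    have h1 := norm_penaltySlope_le hl1 hl2 hγ hμ H.b_nonneg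
      (fun j hj => by linarith [H.le_norm j hj]) H.norm_le
    calc ‖q‖ ≤ (√(n * m₀))⁻¹ * (√g * (lam1 * μ ^ (-γ) + 2 * lam2 * b)) := by
          refine hqn.trans ?_
          gcongr
          exact (norm_restrictGroups_le _ _).trans h1
      _ ≤ (√(n * m₀))⁻¹ * (√k * (lam1 * μ ^ (-γ) + 2 * lam2 * b)) := by
          gcongr; exact H.g_le
      _ = ((√(n * m₀))⁻¹ * √k) * (lam1 * μ ^ (-γ) + 2 * lam2 * b) := by ring
      _ = _ := by rw [H.inv_sqrt_mul_sqrt]; ring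
  have LM : LocalModel ν τ f₀ b₀ K z (R₁ * √k) b₁ :=
    H.localModel N W' hX' (fun j => norm_restrictGroups_le _ _) hR1' (fun j => le_trans (by
      have : 0 ≤ R₁ * (√m₀)⁻¹ * (s * ‖X j‖) := by positivity
      linarith) (hfit j)) hb0 hb1 hb2
  -- Chosen so that the ridge costs exactly $t\delta$, that is $\delta$ after division by $t$.
  set κ := 2 * (t * δ) / (R₁ * √k) ^ 2 with hκ
  have hκ0 : 0 < κ := by positivity
  have hκeq : κ / 2 * (R₁ * √k) ^ 2 = t * δ := by rw [hκ]; field_simp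
  obtain ⟨A, hA, hAp, hAe⟩ := H.exists_support_event N hlam hγ W hR0 hR₁ hh hfit hb0 hb1 hb2 hsep
    hgap hsel
  obtain ⟨A', hA', hAp', hAe'⟩ := LM.exists_abs_inner_sub_le hκ0 hb3 hw.le (hQ.trans hq1) ht0 ht1
    hδ0 hδ1
  refine ⟨A ∪ A', hA.union hA', ?_, fun e he βq βhat hq hhat => ?_⟩
  · refine (measureReal_union_le _ _).trans (add_le_add hAp (hAp'.trans ?_))
    have hdim : (∑ j, ‖z j‖ ^ 2) ≤ p * k := by
      rw [W'.parseval.sum_norm_sq]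
      simp only [finrank_euclideanSpace, Fintype.card_prod, Fintype.card_fin, Fintype.card_coe]
      push_cast
      have h1 : ((activeSet β₀).card : ℝ) ≤ g := by
        have := Finset.card_le_univ (activeSet β₀)
        rw [Fintype.card_fin] at this
        exact_mod_cast this
      have h2 := H.g_le
      nlinarith [Nat.cast_nonneg (α := ℝ) p]
    have e3 := ridge_bound_le (p := p) hR1 H.one_le_k ht0 ht1 hδ0 hδ1 hdim
    rw [← hκ] at e3
    have := Real.sqrt_le_sqrt e3
    gcongr
  · obtain ⟨c1, c2, c3, c4⟩ := hAe e (fun h => he (Or.inl h)) βq βhat hq hhat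
    have e1 : (√(n * m₀))⁻¹ * (R * √k) = (√m₀)⁻¹ * R * s := by
      rw [mul_left_comm, H.inv_sqrt_mul_sqrt]; ring
    have e1' : (√(n * m₀))⁻¹ * (R₁ * √k) = (√m₀)⁻¹ * R₁ * s := by
      rw [mul_left_comm, H.inv_sqrt_mul_sqrt]; ring
    have hρ' : √(n * M₀) * ((√(n * m₀))⁻¹ * (R * √k)) ≤ R₁ * √k := by
      rw [← mul_assoc, H.ratio_eq, ← mul_assoc, ← hR₁]
      gcongr
      linarith
    have key := fun t' ht' => elasticNet_almost_min (t := t') hm H.cond hlam N.tau_pos.le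
      N.tau_lt_one.le hγ hhat W H.nM_nonneg hμ (fun j hj => by linarith [H.le_norm j hj]) c1 c2 c3
      c4 W' hqS hρ' ht'
    have hs0 := (key 0 (by simpa using (mul_pos hR1' hsk).le)).1
    have := hAe' e (fun h => he (Or.inr h)) _ _ hs0 fun t' ht' => (key t' ht').2
    rw [hw2] at this
    simp only [hw1] at this
    refine this.trans ?_
    rw [e1, e1', hκeq]
    have hμ' := Real.rpow_nonneg hμ.le (-γ - 1)
    have f1 : lam1 * μ ^ (-γ - 1) * (γ * ((√m₀)⁻¹ * R * s) + (√m₀)⁻¹ * R₁ * s)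
        * ((√m₀)⁻¹ * R₁ * s) + lam2 * ((√m₀)⁻¹ * R₁ * s) ^ 2
        ≤ (lam1 * μ ^ (-γ - 1) * (γ + 1) + lam2) * ((√m₀)⁻¹ * R₁ * s) ^ 2 := by
      have g1 : (√m₀)⁻¹ * R * s ≤ (√m₀)⁻¹ * R₁ * s := by gcongr
      calc _ ≤ lam1 * μ ^ (-γ - 1) * (γ * ((√m₀)⁻¹ * R₁ * s) + (√m₀)⁻¹ * R₁ * s)
            * ((√m₀)⁻¹ * R₁ * s) + lam2 * ((√m₀)⁻¹ * R₁ * s) ^ 2 := by gcongr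
        _ = _ := by ring
    have f2 : f₀⁻¹ * ‖q‖ ≤ δ := le_trans (by have := N.f₀_pos; gcongr) hqδ
    have f3 : (2 * (lam1 * μ ^ (-γ - 1) * (γ * ((√m₀)⁻¹ * R * s) + (√m₀)⁻¹ * R₁ * s)
        * ((√m₀)⁻¹ * R₁ * s) + lam2 * ((√m₀)⁻¹ * R₁ * s) ^ 2) + t * δ) / t ≤ 2 * δ := by
      rw [div_le_iff₀ ht0]
      linarith
    -- One $\delta$ each from $\|q\|$, from $t$ and from the clipping level, and two from `f3`.
    rw [mul_add]
    linarith

end SampleRegime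

end FixedSampleLinearization

/-! ### Rates -/

section Rates

/-- The rate of estimation of `g n` groups from `n` observations. -/
noncomputable def groupRate (g : ℕ → ℕ) (n : ℕ) : ℝ := √(max (g n : ℝ) 1) / √n

lemma exists_groupRate_le {g : ℕ → ℕ} {c : ℝ} (hc : 0 ≤ c)
    (hg : (fun n : ℕ => (g n : ℝ)) =O[atTop] fun n : ℕ => (n : ℝ) ^ c) :
    ∃ C : ℝ, 0 < C ∧ ∀ᶠ n : ℕ in atTop, groupRate g n ≤ C * (n : ℝ) ^ ((c - 1) / 2) := by
  obtain ⟨D, hD⟩ := hg.bound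
  refine ⟨√(max D 1), by positivity, ?_⟩
  filter_upwards [hD, eventually_ge_atTop 1] with n hn hn1
  have hn1' : (1 : ℝ) ≤ n := by exact_mod_cast hn1
  have hn0 : (0 : ℝ) < n := by linarith
  have h1 : (1 : ℝ) ≤ (n : ℝ) ^ c := Real.one_le_rpow hn1' hc
  rw [Real.norm_of_nonneg (Nat.cast_nonneg _), Real.norm_of_nonneg (by positivity)] at hn
  have h2 : max (g n : ℝ) 1 ≤ max D 1 * (n : ℝ) ^ c := by
    refine max_le (hn.trans ?_) ?_
    · gcongr; exact le_max_left _ _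
    · nlinarith [le_max_right D 1]
  have h3 : (n : ℝ) ^ ((c - 1) / 2) = √((n : ℝ) ^ c) / √n := by
    rw [Real.sqrt_eq_rpow, Real.sqrt_eq_rpow, ← Real.rpow_mul hn0.le, ← Real.rpow_sub hn0]
    congr 1; ring
  rw [h3, groupRate, ← mul_div_assoc, ← Real.sqrt_mul (by positivity)]
  gcongr

lemma groupRate_pos (g : ℕ → ℕ) {n : ℕ} (hn : 0 < n) : 0 < groupRate g n := by
  have : (0 : ℝ) < n := by exact_mod_cast hn
  unfold groupRate
  positivity

/-- The limits which drive the asymptotic analysis. -/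
structure RegimeLimits (γ : ℝ) (s μ l₁ l₂ : ℕ → ℝ) : Prop where
  rate : Tendsto s atTop (𝓝 0)
  separation : Tendsto (fun n => s n / μ n) atTop (𝓝 0)
  adaptive : Tendsto (fun n => s n * (l₁ n * μ n ^ (-γ))) atTop (𝓝 0)
  ridge : Tendsto (fun n => s n * l₂ n) atTop (𝓝 0)
  selection : ∀ D, ∀ᶠ n : ℕ in atTop, D * (n * s n) < l₁ n * s n ^ (-γ)

/-- An upper bound on the rate suffices throughout: even in the selection condition, where the rate
has the exponent $-\gamma$ on the large side, a smaller rate only helps. -/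
lemma regimeLimits {g : ℕ → ℕ} {γ c α M : ℝ} (hγ : 0 < γ) (hc0 : 0 ≤ c) (hc1 : c < 1) (hM : 0 < M)
    {l₁ l₂ : ℕ → ℝ} (hl₁ : ∀ n, 0 ≤ l₁ n) (hl₂ : ∀ n, 0 ≤ l₂ n)
    (hg : (fun n : ℕ => (g n : ℝ)) =O[atTop] fun n : ℕ => (n : ℝ) ^ c) (hα : (c - 1) / 2 < α)
    (h1 : Tendsto (fun n : ℕ => l₁ n * (n : ℝ) ^ ((c - 1) / 2 - α * γ)) atTop (𝓝 0))
    (h2 : Tendsto (fun n : ℕ => l₂ n * (n : ℝ) ^ ((c - 1) / 2)) atTop (𝓝 0))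
    (hsel : Tendsto (fun n : ℕ => l₁ n * (n : ℝ) ^ ((1 - c) * (1 + γ) / 2 - 1)) atTop atTop) :
    RegimeLimits γ (groupRate g) (fun n => M * (n : ℝ) ^ α) l₁ l₂ := by
  obtain ⟨C, hC, hs⟩ := exists_groupRate_le hc0 hg
  have pw : ∀ a : ℝ, a < 0 → Tendsto (fun n : ℕ => (n : ℝ) ^ a) atTop (𝓝 0) := fun a ha => by
    have := (tendsto_rpow_neg_atTop (y := -a) (by linarith)).comp tendsto_natCast_atTop_atTop
    rw [neg_neg] at this
    exact this
  have sq : ∀ {a b : ℕ → ℝ} (D : ℝ), Tendsto b atTop (𝓝 0) →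
      (∀ᶠ n in atTop, 0 ≤ a n ∧ a n ≤ D * b n) → Tendsto a atTop (𝓝 0) := fun D hb hab => by
    have := hb.const_mul D
    rw [mul_zero] at this
    exact squeeze_zero' (hab.mono fun n h => h.1) (hab.mono fun n h => h.2) this
  have hpos := eventually_gt_atTop 0
  refine ⟨?_, ?_, ?_, ?_, fun D => ?_⟩
  · refine sq C (pw ((c - 1) / 2) (by linarith)) ?_
    filter_upwards [hs, hpos] with n h hn
    exact ⟨(groupRate_pos g hn).le, h⟩
  · refine sq (C / M) (pw ((c - 1) / 2 - α) (by linarith)) ?_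
    filter_upwards [hs, hpos] with n h hn
    have hn0 : (0 : ℝ) < n := by exact_mod_cast hn
    have := groupRate_pos g hn
    refine ⟨by positivity, ?_⟩
    rw [Real.rpow_sub hn0, div_mul_div_comm]
    gcongr
  · refine sq (C * M ^ (-γ)) h1 ?_
    filter_upwards [hs, hpos] with n h hn
    have hn0 : (0 : ℝ) < n := by exact_mod_cast hn
    have := groupRate_pos g hn
    have h3 := hl₁ n
    refine ⟨by positivity, ?_⟩
    rw [Real.mul_rpow hM.le (by positivity), ← Real.rpow_mul hn0.le]
    have e : (n : ℝ) ^ ((c - 1) / 2 - α * γ) = (n : ℝ) ^ ((c - 1) / 2) * (n : ℝ) ^ (α * -γ) := by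
      rw [← Real.rpow_add hn0]; congr 1; ring
    rw [e]
    calc _ ≤ (C * (n : ℝ) ^ ((c - 1) / 2)) * (l₁ n * (M ^ (-γ) * (n : ℝ) ^ (α * -γ))) := by gcongr
      _ = _ := by ring
  · refine sq C h2 ?_
    filter_upwards [hs, hpos] with n h hn
    have := groupRate_pos g hn
    have h3 := hl₂ n
    refine ⟨by positivity, ?_⟩
    calc _ ≤ (C * (n : ℝ) ^ ((c - 1) / 2)) * l₂ n := by gcongr
      _ = _ := by ring
  -- The exponents match since $\frac{(1-c)(1+\gamma)}2-1+1+\frac{c-1}2=\frac{(1-c)\gamma}2$; the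
  -- threshold $|D|\,C\,C^\gamma$ absorbs the constants on both sides.
  · filter_upwards [hs, hpos, hsel.eventually_gt_atTop (|D| * C * C ^ γ)] with n h hn hbig
    have hn0 : (0 : ℝ) < n := by exact_mod_cast hn
    have hs0 := groupRate_pos g hn
    have h3 := hl₁ n
    set S := C * (n : ℝ) ^ ((c - 1) / 2) with hS
    have hS0 : 0 < S := by positivity
    have a1 : D * (n * groupRate g n) ≤ |D| * (n * S) := by
      calc _ ≤ |D| * (n * groupRate g n) := by gcongr; exact le_abs_self D
        _ ≤ _ := by gcongr
    have a2 : S ^ (-γ) ≤ groupRate g n ^ (-γ) := Real.rpow_le_rpow_of_nonpos hs0 h (by linarith)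
    have e1 : S ^ (-γ) = C ^ (-γ) * (n : ℝ) ^ ((1 - c) * γ / 2) := by
      rw [hS, Real.mul_rpow hC.le (by positivity), ← Real.rpow_mul hn0.le]
      congr 2; ring
    have e2 : (n : ℝ) ^ ((1 - c) * (1 + γ) / 2 - 1) * (n * (n : ℝ) ^ ((c - 1) / 2))
        = (n : ℝ) ^ ((1 - c) * γ / 2) := by
      nth_rewrite 2 [← Real.rpow_one (n : ℝ)]
      rw [← Real.rpow_add hn0, ← Real.rpow_add hn0]
      congr 1; ring
    have e3 : C ^ γ * C ^ (-γ) = 1 := by rw [← Real.rpow_add hC]; simp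
    have hx : 0 < C ^ (-γ) * (n * (n : ℝ) ^ ((c - 1) / 2)) := by positivity
    have a3 := mul_lt_mul_of_pos_right hbig hx
    calc D * (n * groupRate g n) ≤ |D| * (n * S) := a1
      _ = |D| * C * C ^ γ * (C ^ (-γ) * (n * (n : ℝ) ^ ((c - 1) / 2))) := by
          rw [hS]; linear_combination (-(|D| * C * (n * (n : ℝ) ^ ((c - 1) / 2)))) * e3
      _ < _ := a3
      _ = l₁ n * S ^ (-γ) := by
          rw [e1]; linear_combination (l₁ n * C ^ (-γ)) * e2
      _ ≤ _ := by gcongr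

/-- The fits are uniformly small. -/
lemma eventually_groupRate_mul_norm_le {p : ℕ} {g : ℕ → ℕ} {X : ∀ n, Fin n → GroupVec (g n) p}
    (hX : Tendsto (fun n : ℕ => ((g n : ℝ) / n) ^ (1 / 2 : ℝ) * ⨆ i, ‖X n i‖) atTop (𝓝 0))
    {δ : ℝ} (hδ : 0 < δ) : ∀ᶠ n in atTop, ∀ j, groupRate g n * ‖X n j‖ ≤ δ := by
  filter_upwards [hX.eventually_lt_const hδ] with n hn j
  rcases Nat.eq_zero_or_pos (g n) with h | h
  -- Without groups the rate is still positive, because of the maximum with 1, but every regressor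
  -- is zero.
  · have : IsEmpty (Fin (g n) × Fin p) := by
      rw [h]; infer_instance
    have : X n j = 0 := Subsingleton.elim _ _
    rw [this, norm_zero, mul_zero]
    exact hδ.le
  · have h1 : (1 : ℝ) ≤ g n := by exact_mod_cast h
    have h2 : groupRate g n = ((g n : ℝ) / n) ^ (1 / 2 : ℝ) := by
      rw [groupRate, max_eq_left h1, ← Real.sqrt_eq_rpow, Real.sqrt_div (by positivity)]
    rw [h2]
    refine le_trans ?_ hn.le
    gcongr
    exact le_ciSup (f := fun i => ‖X n i‖) (Set.finite_range _).bddAbove j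

end Rates

/-! ### Passage from fixed samples to the asymptotic regime -/

section Asymptotic

open scoped RealInnerProductSpace

/-- A sequence of samples in the asymptotic regime. -/
structure AsymptoticRegime {p : ℕ} {g : ℕ → ℕ} (X : ∀ n, Fin n → GroupVec (g n) p)
    (β₀ : ∀ n, GroupVec (g n) p) (lam1 lam2 : ℕ → ℝ≥0) (γ m₀ M₀ b : ℝ) (μ : ℕ → ℝ) : Prop where
  γ_pos : 0 < γ
  sample : ∀ᶠ n in atTop,
    SampleRegime (X n) (β₀ n) m₀ M₀ (max (g n : ℝ) 1) (groupRate g n) (μ n) b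
  limits : RegimeLimits γ (groupRate g) μ (fun n => lam1 n) fun n => lam2 n
  fit : ∀ δ > 0, ∀ᶠ n in atTop, ∀ j, groupRate g n * ‖X n j‖ ≤ δ
  lam_pos : ∀ᶠ n in atTop, 0 < lam1 n

variable {p : ℕ} {g : ℕ → ℕ} {X : ∀ n, Fin n → GroupVec (g n) p} {β₀ : ∀ n, GroupVec (g n) p}
  {lam1 lam2 : ℕ → ℝ≥0} {γ m₀ M₀ b τ f₀ b₀ K : ℝ} {μ : ℕ → ℝ} {ν : Measure ℝ}
  [IsProbabilityMeasure ν]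

namespace AsymptoticRegime

variable (H : AsymptoticRegime X β₀ lam1 lam2 γ m₀ M₀ b μ)
include H

/-- These are the numerical conditions of the two fixed-sample theorems. They hold for large $n$
once the radius and the precision are fixed. -/
lemma eventually_rates {R : ℝ} (hR : 0 < R) (D : ℝ) {δ : ℝ} (hδ : 0 < δ) :
    ∀ᶠ n : ℕ in atTop, (√m₀)⁻¹ * (R * groupRate g n) ≤ μ n ∧
      (√m₀)⁻¹ * (groupRate g n * (lam1 n * μ n ^ (-γ) + 2 * lam2 n * b)) ≤ δ ∧
      D * (n * groupRate g n) < lam1 n * ((√m₀)⁻¹ * (R * groupRate g n)) ^ (-γ) * R ∧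
      2 * ((lam1 n * μ n ^ (-γ - 1) * (γ + 1) + lam2 n) * (D * groupRate g n) ^ 2) ≤ δ := by
  have L := H.limits
  have t1 : Tendsto (fun n => (√m₀)⁻¹ * R * (groupRate g n / μ n)) atTop (𝓝 0) := by
    simpa using L.separation.const_mul ((√m₀)⁻¹ * R)
  have t2 : Tendsto (fun n => (√m₀)⁻¹ * (groupRate g n * (lam1 n * μ n ^ (-γ))
      + 2 * b * (groupRate g n * lam2 n))) atTop (𝓝 0) := by
    simpa using (L.adaptive.add (L.ridge.const_mul (2 * b))).const_mul ((√m₀)⁻¹)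
  have t3 : Tendsto (fun n => 2 * D ^ 2 * ((γ + 1) * (groupRate g n * (lam1 n * μ n ^ (-γ))
      * (groupRate g n / μ n)) + groupRate g n * lam2 n * groupRate g n)) atTop (𝓝 0) := by
    simpa using (((L.adaptive.mul L.separation).const_mul (γ + 1)).add
      (L.ridge.mul L.rate)).const_mul (2 * D ^ 2)
  obtain ⟨n₀, hn₀⟩ := H.sample.exists
  have hm : 0 < (√m₀)⁻¹ := inv_pos.2 (Real.sqrt_pos.2 hn₀.m₀_pos)
  filter_upwards [H.sample, t1.eventually_le_const one_pos, t2.eventually_le_const hδ,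
    t3.eventually_le_const hδ, L.selection (D / (((√m₀)⁻¹ * R) ^ (-γ) * R))] with n S a1 a2 a3 a4
  have hμ := S.μ_pos
  have hs := S.s_pos
  refine ⟨?_, ?_, ?_, ?_⟩
  · rw [← mul_div_assoc, div_le_one hμ] at a1
    linarith
  · refine le_trans (le_of_eq ?_) a2
    ring
  · have hx : 0 < ((√m₀)⁻¹ * R) ^ (-γ) * R := by positivity
    have := mul_lt_mul_of_pos_right a4 hx
    rw [← mul_assoc ((√m₀)⁻¹), Real.mul_rpow (by positivity) hs.le]
    calc D * (n * groupRate g n) = D / (((√m₀)⁻¹ * R) ^ (-γ) * R) * (n * groupRate g n)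
          * (((√m₀)⁻¹ * R) ^ (-γ) * R) := by
            rw [div_mul_eq_mul_div, div_mul_cancel₀ _ hx.ne']
      _ < _ := this
      _ = _ := by ring
  · refine le_trans (le_of_eq ?_) a3
    have e : μ n ^ (-γ - 1) = μ n ^ (-γ) / μ n := by rw [Real.rpow_sub hμ, Real.rpow_one]
    rw [e]
    field_simp

/-- The elastic net recovers the support with probability tending to one. -/
theorem eventually_support (N : QuantileNoise ν τ f₀ b₀ K) {ζ : ℝ} (hζ : 0 < ζ) :
    ∀ᶠ n in atTop, ∃ A : Set (Fin n → ℝ), MeasurableSet A ∧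
      (Measure.pi fun _ => ν).real A ≤ ζ ∧
      ∀ e ∉ A, ∀ βq βhat, IsMinOn (quantileProcess τ (X n) (responses (X n) (β₀ n) e)) Set.univ βq →
        IsMinOn (elasticNetProcess τ γ (lam1 n) (lam2 n) (X n) (responses (X n) (β₀ n) e) βq)
          Set.univ βhat → activeSet βhat = activeSet (β₀ n) := by
  have hK := N.K_pos
  have hb₀ := N.b₀_pos
  have T1 : Tendsto (fun R : ℝ => 32 * K * (16 * K * p + 1) / R ^ 2 + Real.exp (-R)) atTop
      (𝓝 0) := by
    simpa using (tendsto_const_nhds.div_atTop (tendsto_pow_atTop two_ne_zero)).add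
      Real.tendsto_exp_neg_atTop_nhds_zero
  -- `R` also plays the part of `h`, so a single large number makes both exceptional probabilities
  -- small.
  obtain ⟨R, hRζ, hR⟩ := ((T1.eventually_le_const hζ).and (eventually_gt_atTop 0)).exists
  set R₁ := (√M₀ * (√m₀)⁻¹ + 1) * R with hR₁
  have hR₁0 : 0 < R₁ := by positivity
  set b₁ := min b₀ 1 with hb₁
  have hb₁0 : 0 < b₁ := by positivity
  obtain ⟨n₀, hn₀⟩ := H.sample.exists
  have hm : 0 < (√m₀)⁻¹ := inv_pos.2 (Real.sqrt_pos.2 hn₀.m₀_pos)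
  filter_upwards [H.sample, H.lam_pos, H.fit (b₁ / (2 * R₁ * (√m₀)⁻¹)) (by positivity),
    H.eventually_rates hR (√M₀ * (p + 8 * K * R₁ ^ 2 + R + (16 * K)⁻¹ * R ^ 2 / 2))
      (δ := (16 * K)⁻¹ * R / 4) (by positivity)] with n S hl hfit hr
  obtain ⟨T, y, W⟩ := S.cond.exists_isWhitening S.nm_pos
  obtain ⟨A, hA, hAp, hAe⟩ := S.exists_support_event N hl H.γ_pos W hR rfl hR.le
    (fun j => by
      have := hfit j
      rw [le_div_iff₀ (by positivity)] at this
      linarith) hb₁0.le (min_le_left _ _) (min_le_right _ _) hr.1 hr.2.1 hr.2.2.1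
  exact ⟨A, hA, hAp.trans hRζ, fun e he βq βhat h1 h2 => (hAe e he βq βhat h1 h2).2.2.2⟩

/-- The normalized error of the elastic net is asymptotically a weighted sum of scores. -/
theorem eventually_linearization (N : QuantileNoise ν τ f₀ b₀ K)
    {u : ∀ n, EuclideanSpace ℝ (activeSet (β₀ n) × Fin p)} (hu : ∀ᶠ n in atTop, u n ≠ 0)
    {ζ δ : ℝ} (hζ : 0 < ζ) (hδ0 : 0 < δ) (hδ1 : δ ≤ 1) :
    ∀ᶠ n in atTop, ∃ A : Set (Fin n → ℝ), MeasurableSet A ∧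
      (Measure.pi fun _ => ν).real A ≤ ζ ∧
      ∀ e ∉ A, ∀ βq βhat, IsMinOn (quantileProcess τ (X n) (responses (X n) (β₀ n) e)) Set.univ βq →
        IsMinOn (elasticNetProcess τ γ (lam1 n) (lam2 n) (X n) (responses (X n) (β₀ n) e) βq)
          Set.univ βhat →
        |(n : ℝ) ^ (1 / 2 : ℝ) * (u n ⬝ᵥ ((gramMatrix fun i =>
              restrictGroups (activeSet (β₀ n)) (X n i))⁻¹.mulVec (u n))) ^ (-(1 / 2) : ℝ)
            * ⟪u n, restrictGroups (activeSet (β₀ n)) (βhat - β₀ n)⟫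
          - f₀⁻¹ * ∑ j, scoreWeight (fun i => restrictGroups (activeSet (β₀ n)) (X n i)) (u n) j
            * checkScore τ (e j)| ≤ 5 * δ := by
  have hK := N.K_pos
  have hb₀ := N.b₀_pos
  have hf₀ := N.f₀_pos
  -- Order of the choices: `t` from `δ`, then `R` large enough for the terms in $1/R$, then the
  -- bound `b₁` on the fits small enough for the term in $b_1/t$, and $n$ last.
  set t := min (1 / 2) (f₀ * δ) with ht
  have ht0 : 0 < t := by positivity
  set C := √M₀ * (√m₀)⁻¹ + 1 with hC
  have hC0 : 0 < C := by positivity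
  have T1 : Tendsto (fun R : ℝ => 32 * K * (16 * K * p + 1) / R ^ 2 + Real.exp (-R)
      + 2 * (10 * K ^ 2 * √((6 + 4 * p) / (C * R) ^ 2) / δ ^ 2)) atTop (𝓝 0) := by
    have a1 : Tendsto (fun R : ℝ => (6 + 4 * (p : ℝ)) / (C * R) ^ 2) atTop (𝓝 0) :=
      tendsto_const_nhds.div_atTop
        ((tendsto_pow_atTop two_ne_zero).comp (tendsto_id.const_mul_atTop hC0))
    have a2 := (((a1.sqrt.const_mul (10 * K ^ 2)).div_const (δ ^ 2)).const_mul 2)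
    simpa using ((tendsto_const_nhds.div_atTop (tendsto_pow_atTop two_ne_zero)).add
      Real.tendsto_exp_neg_atTop_nhds_zero).add a2
  obtain ⟨R, hRζ, hR⟩ := ((T1.eventually_le_const (half_pos hζ)).and (eventually_ge_atTop 1)).exists
  have hR0 : 0 < R := one_pos.trans_le hR
  set R₁ := C * R with hR₁
  have hR₁0 : 0 < R₁ := by positivity
  set b₁ := min (min b₀ 1) (min (4080 * K ^ 6)⁻¹
    (ζ / 2 / (2 * (302 * K ^ 4 / t / δ ^ 2)))) with hb₁
  have hb₁0 : 0 < b₁ := by positivity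
  have hb₁1 : b₁ ≤ b₀ := (min_le_left _ _).trans (min_le_left _ _)
  have hb₁2 : b₁ ≤ 1 := (min_le_left _ _).trans (min_le_right _ _)
  have hb₁3 : 4080 * K ^ 6 * b₁ ≤ 1 := by
    have : b₁ ≤ (4080 * K ^ 6)⁻¹ := (min_le_right _ _).trans (min_le_left _ _)
    calc _ ≤ 4080 * K ^ 6 * (4080 * K ^ 6)⁻¹ := by gcongr
      _ = 1 := mul_inv_cancel₀ (by positivity)
  have hb₁4 : 2 * (302 * K ^ 4 * b₁ / t / δ ^ 2) ≤ ζ / 2 := by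
    have : b₁ ≤ ζ / 2 / (2 * (302 * K ^ 4 / t / δ ^ 2)) :=
      (min_le_right _ _).trans (min_le_right _ _)
    rw [le_div_iff₀ (by positivity)] at this
    refine le_trans (le_of_eq ?_) this
    ring
  obtain ⟨n₀, hn₀⟩ := H.sample.exists
  have hm : 0 < (√m₀)⁻¹ := inv_pos.2 (Real.sqrt_pos.2 hn₀.m₀_pos)
  filter_upwards [H.sample, H.lam_pos, hu, H.fit (b₁ / (2 * R₁ * (√m₀)⁻¹)) (by positivity),
    H.eventually_rates hR0 (√M₀ * (p + 8 * K * R₁ ^ 2 + R + (16 * K)⁻¹ * R ^ 2 / 2))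
      (δ := (16 * K)⁻¹ * R / 4) (by positivity),
    H.eventually_rates hR0 ((√m₀)⁻¹ * R₁)
      (δ := min (min (1 / 2) (f₀ * δ)) (t * δ)) (by positivity)] with n S hl hu hfit hr hr'
  have q1 := hr'.2.1.trans ((min_le_left _ _).trans (min_le_left _ _))
  have q2 := hr'.2.1.trans ((min_le_left _ _).trans (min_le_right _ _))
  obtain ⟨A, hA, hAp, hAe⟩ := S.exists_linearization_event N hl H.γ_pos hR hR₁.symm hR0.le
    (fun j => by
      have := hfit j
      rw [le_div_iff₀ (by positivity)] at this
      linarith) hb₁0.le hb₁1 hb₁2 hr.1 hr.2.1 hr.2.2.1 hb₁3 hδ0 hδ1 ht0 (min_le_left _ _)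
    (by rw [inv_mul_le_iff₀ hf₀]; exact min_le_right _ _) q1
    (by rw [inv_mul_le_iff₀ hf₀]; exact q2) (hr'.2.2.2.trans (min_le_right _ _)) hu
  refine ⟨A, hA, hAp.trans ?_, hAe⟩
  have := add_le_add hRζ hb₁4
  rw [add_halves] at this
  refine le_trans (le_of_eq ?_) this
  ring

end AsymptoticRegime

end Asymptotic

/-! ### Convergence in probability and in law -/

section Probability

variable {Ω : Type*} [MeasurableSpace Ω] {P : Measure Ω} [IsProbabilityMeasure P]
  {ε : ℕ → Ω → ℝ} {ν : Measure ℝ} [IsProbabilityMeasure ν]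

/-- An event which contains the complement of small events of the errors has probability tending
to one. -/
lemma tendsto_measure_one (hε : ∀ i, Measurable (ε i)) (hind : iIndepFun ε P)
    (hν : ∀ i, P.map (ε i) = ν) {S : ℕ → Set Ω}
    (h : ∀ ζ > 0, ∀ᶠ n in atTop, ∃ A : Set (Fin n → ℝ), MeasurableSet A ∧
      (Measure.pi fun _ => ν).real A ≤ ζ ∧ ∀ ω, (fun j : Fin n => ε j ω) ∉ A → ω ∈ S n) :
    Tendsto (fun n => P (S n)) atTop (𝓝 1) := by
  rw [← ENNReal.tendsto_toReal_iff (fun n => measure_ne_top P _) ENNReal.one_ne_top,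
    ENNReal.toReal_one, Metric.tendsto_nhds]
  intro δ hδ
  filter_upwards [h (δ / 2) (by positivity)] with n ⟨A, hA, hAp, hAS⟩
  have hm : Measurable fun ω (j : Fin n) => ε j ω := measurable_pi_lambda _ fun j => hε j
  have h1 : P.real ((fun ω (j : Fin n) => ε j ω) ⁻¹' A) ≤ δ / 2 := by
    rw [← map_measureReal_apply hm hA, map_errors_eq_pi hε hind hν]
    exact hAp
  have h2 : 1 - P.real ((fun ω (j : Fin n) => ε j ω) ⁻¹' A) ≤ P.real (S n) := by
    rw [← probReal_compl_eq_one_sub (hm hA)]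
    exact measureReal_mono fun ω hω => hAS ω hω
  have h3 : P.real (S n) ≤ 1 := measureReal_le_one
  change |P.real (S n) - 1| < δ
  rw [abs_lt]
  constructor <;> linarith

lemma tendstoInMeasure_zero (hε : ∀ i, Measurable (ε i)) (hind : iIndepFun ε P)
    (hν : ∀ i, P.map (ε i) = ν) {D : ℕ → Ω → ℝ}
    (h : ∀ ζ > 0, ∀ δ : ℝ, 0 < δ → δ ≤ 1 → ∀ᶠ n in atTop, ∃ A : Set (Fin n → ℝ), MeasurableSet A ∧
      (Measure.pi fun _ => ν).real A ≤ ζ ∧ ∀ ω, (fun j : Fin n => ε j ω) ∉ A → |D n ω| ≤ 5 * δ) :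
    TendstoInMeasure P D atTop 0 := by
  rw [tendstoInMeasure_iff_measureReal_norm]
  intro δ hδ
  rw [Metric.tendsto_nhds]
  intro ζ hζ
  filter_upwards [h (ζ / 2) (by positivity) (min (δ / 6) 1) (by positivity) (min_le_right _ _)]
    with n ⟨A, hA, hAp, hAS⟩
  have hm : Measurable fun ω (j : Fin n) => ε j ω := measurable_pi_lambda _ fun j => hε j
  have h1 : P.real ((fun ω (j : Fin n) => ε j ω) ⁻¹' A) ≤ ζ / 2 := by
    rw [← map_measureReal_apply hm hA, map_errors_eq_pi hε hind hν]
    exact hAp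
  have h2 : {ω | δ ≤ ‖D n ω - (0 : Ω → ℝ) ω‖} ⊆ (fun ω (j : Fin n) => ε j ω) ⁻¹' A := by
    intro ω hω
    by_contra hh
    have h3 := hAS ω hh
    have h4 : δ ≤ |D n ω| := by simpa using hω
    linarith [min_le_left (δ / 6) 1]
  have h3 := (measureReal_mono (μ := P) h2).trans h1
  rw [Real.dist_eq, sub_zero, abs_of_nonneg measureReal_nonneg]
  linarith

/-- Asymptotic normality of the weighted sums of scores. -/
lemma tendstoInDistribution_scores {τ f₀ b₀ K : ℝ} (N : QuantileNoise ν τ f₀ b₀ K)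
    (hε : ∀ i, Measurable (ε i)) (hind : iIndepFun ε P) (hν : ∀ i, P.map (ε i) = ν)
    (W : ∀ n, Fin n → ℝ) (hW : ∀ᶠ n in atTop, ∑ j, W n j ^ 2 = 1)
    (hmax : ∀ δ > 0, ∀ᶠ n in atTop, ∀ j, |W n j| ≤ δ) :
    TendstoInDistribution (fun n ω => f₀⁻¹ * ∑ j, W n j * checkScore τ (ε j ω)) atTop
      (id : ℝ → ℝ) (fun _ => P) (gaussianReal 0 (Real.toNNReal (τ * (1 - τ) / f₀ ^ 2))) := by
  have hf₀ := N.f₀_pos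
  have hτ : 0 < τ * (1 - τ) := mul_pos N.tau_pos (by linarith [N.tau_lt_one])
  set σ := √(τ * (1 - τ)) with hσ
  have hσ0 : 0 < σ := Real.sqrt_pos.2 hτ
  have hσ2 : σ ^ 2 = τ * (1 - τ) := Real.sq_sqrt hτ.le
  have hψ := measurable_checkScore τ
  have hψ' : Measurable fun y => σ⁻¹ * checkScore τ y := hψ.const_mul _
  have hint : ∀ φ : ℝ → ℝ, Measurable φ → ∫ ω, φ (ε 0 ω) ∂P = ∫ y, φ y ∂ν := fun φ hφ => by
    rw [← hν 0, integral_map (hε 0).aemeasurable hφ.aestronglyMeasurable]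
  have key := tendstoInDistribution_weighted_sum (P := P)
    (X := fun i ω => σ⁻¹ * checkScore τ (ε i ω)) (fun i => hψ'.comp (hε i))
    (hind.comp (fun _ y => σ⁻¹ * checkScore τ y) fun _ => hψ') (fun i => ?_) ?_ ?_
    (fun n j => f₀⁻¹ * (σ * W n j)) (v := Real.toNNReal (τ * (1 - τ) / f₀ ^ 2)) ?_ ?_
  · convert key using 3 with n ω
    rw [Finset.mul_sum]
    refine Finset.sum_congr rfl fun j _ => ?_
    field_simp
  · have e : ∀ i, P.map (fun ω => σ⁻¹ * checkScore τ (ε i ω))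
        = ν.map fun y => σ⁻¹ * checkScore τ y := fun i => by
      rw [← hν i, Measure.map_map hψ' (hε i)]; rfl
    rw [e, e]
  · rw [hint _ hψ', integral_const_mul, N.integral_checkScore, mul_zero]
  · have e : ((fun ω => σ⁻¹ * checkScore τ (ε 0 ω)) ^ 2 : Ω → ℝ)
        = fun ω => (σ⁻¹ * checkScore τ (ε 0 ω)) ^ 2 := rfl
    rw [e, hint (fun y => (σ⁻¹ * checkScore τ y) ^ 2) (hψ'.pow_const 2)]
    simp only [mul_pow]
    rw [integral_const_mul, N.integral_checkScore_sq, ← hσ2]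
    field_simp
  · filter_upwards [hW] with n hn
    rw [Real.coe_toNNReal _ (by positivity)]
    simp only [mul_pow]
    rw [← Finset.mul_sum, ← Finset.mul_sum, hn, hσ2]
    field_simp
  · intro δ hδ
    filter_upwards [hmax (δ / (f₀⁻¹ * σ)) (by positivity)] with n hn j
    have := hn j
    rw [le_div_iff₀ (by positivity)] at this
    rw [abs_mul, abs_mul, abs_of_pos hσ0, abs_of_pos (inv_pos.2 hf₀)]
    linarith

end Probability

theorem theorem2
    {Ω : Type*} [MeasurableSpace Ω] (P : Measure Ω) [IsProbabilityMeasure P]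
    -- `g n` groups of `p` variables; deterministic design; true parameter; errors
    (p : ℕ) (g : ℕ → ℕ) (X : ∀ n, Fin n → GroupVec (g n) p) (β₀ : ∀ n, GroupVec (g n) p)
    (ε : ℕ → Ω → ℝ) (f : ℝ → ℝ) (τ γ c α : ℝ) (lam1 lam2 : ℕ → ℝ≥0)
    -- the responses, the quantile estimator and the adaptive elastic-net estimator
    (Y : ∀ n, Ω → Fin n → ℝ) (βq βhat : ∀ n, Ω → GroupVec (g n) p)
    (hY : ∀ n ω i, Y n ω i = inner ℝ (X n i) (β₀ n) + ε i ω)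
    (hβq_meas : ∀ n, Measurable (βq n)) (hβhat_meas : ∀ n, Measurable (βhat n))
    (hβq : ∀ n ω, IsMinOn (quantileProcess τ (X n) (Y n ω)) Set.univ (βq n ω))
    (hβhat : ∀ n ω, IsMinOn
      (elasticNetProcess τ γ (lam1 n) (lam2 n) (X n) (Y n ω) (βq n ω)) Set.univ (βhat n ω))
    (hτ : τ ∈ Set.Ioo (0 : ℝ) 1) (hγ : 0 < γ) (hc0 : 0 ≤ c) (hc1 : c < 1)
    -- i.i.d. errors with density `f` and `P[ε < 0] = τ`
    (hε_meas : ∀ i, Measurable (ε i)) (hε_indep : iIndepFun ε P)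
    (hf_meas : Measurable f) (hf_nonneg : ∀ x, 0 ≤ f x)
    (hε_law : ∀ i, P.map (ε i) = volume.withDensity fun x => ENNReal.ofReal (f x))
    (hε_quantile : ∀ i, P.real {ω | ε i ω < 0} = τ)
    (hf_zero : ∃ K : ℝ, ∀ᶠ x in 𝓝 (0 : ℝ), 0 < f x ∧ DifferentiableAt ℝ f x ∧ |deriv f x| ≤ K)
    -- eigenvalues of the design matrix
    (hX_eig : ∃ m₀ M₀ : ℝ, 0 < m₀ ∧ m₀ ≤ M₀ ∧
      ∀ᶠ n in atTop, ∀ μ ∈ spectrum ℝ (gramMatrix (X n)), m₀ ≤ μ ∧ μ ≤ M₀)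
    (hX_max : Tendsto (fun n : ℕ => ((g n : ℝ) / n) ^ (1 / 2 : ℝ) * ⨆ i, ‖X n i‖) atTop (𝓝 0))
    -- number of groups
    (hg : (fun n : ℕ => (g n : ℝ)) =O[atTop] fun n : ℕ => (n : ℝ) ^ c)
    -- size of the nonzero groups
    (hα : (c - 1) / 2 < α)
    (hβ₀_lower : ∃ M : ℝ, 0 < M ∧
      ∀ᶠ n : ℕ in atTop, ∀ j ∈ activeSet (β₀ n), M ≤ (n : ℝ) ^ (-α) * ‖block (β₀ n) j‖)
    (hβ₀_upper : ∃ K : ℝ, ∀ᶠ n : ℕ in atTop, ∀ j, ‖block (β₀ n) j‖ ≤ K)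
    -- tuning parameters
    (hlam1 : Tendsto (fun n => (lam1 n : ℝ)) atTop atTop)
    (hlam1' : Tendsto (fun n : ℕ => lam1 n * (n : ℝ) ^ ((c - 1) / 2 - α * γ)) atTop (𝓝 0))
    (hlam2 : Tendsto (fun n => (lam2 n : ℝ)) atTop atTop)
    (hlam2' : Tendsto (fun n : ℕ => lam2 n * (n : ℝ) ^ ((c - 1) / 2)) atTop (𝓝 0))
    (hlam1_sel : Tendsto (fun n : ℕ => lam1 n * (n : ℝ) ^ ((1 - c) * (1 + γ) / 2 - 1)) atTop atTop)
    (hlam1_norm : Tendsto (fun n : ℕ => lam1 n * (activeSet (β₀ n)).card *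
      (n : ℝ) ^ (-(1 + c) / 2)) atTop (𝓝 0))
    (hlam2_norm : Tendsto (fun n : ℕ => lam2 n * (activeSet (β₀ n)).card *
      (n : ℝ) ^ (-(1 + c) / 2)) atTop (𝓝 0)) :
    Tendsto (fun n => P {ω | activeSet (βhat n ω) = activeSet (β₀ n)}) atTop (𝓝 1) ∧
    ∀ u : ∀ n, EuclideanSpace ℝ (activeSet (β₀ n) × Fin p), (∀ᶠ n in atTop, ‖u n‖ = 1) →
      TendstoInDistribution
        (fun (n : ℕ) (ω : Ω) =>
          (n : ℝ) ^ (1 / 2 : ℝ) *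
            (u n ⬝ᵥ ((gramMatrix fun i => restrictGroups (activeSet (β₀ n)) (X n i))⁻¹.mulVec
              (u n))) ^ (-(1 / 2) : ℝ) *
            inner ℝ (u n) (restrictGroups (activeSet (β₀ n)) (βhat n ω - β₀ n)))
        atTop (id : ℝ → ℝ) (fun _ => P)
        (gaussianReal 0 (Real.toNNReal (τ * (1 - τ) / f 0 ^ 2))) := by
  obtain ⟨hτ0, hτ1⟩ := hτ
  set ν : Measure ℝ := volume.withDensity fun x => ENNReal.ofReal (f x) with hν
  have hνP : IsProbabilityMeasure ν := by
    rw [← hε_law 0]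
    exact Measure.isProbabilityMeasure_map (hε_meas 0).aemeasurable
  obtain ⟨b₀, K, N⟩ := exists_quantileNoise hν hτ0 hτ1
    (by rw [← hε_law 0, map_measureReal_apply (hε_meas 0) measurableSet_Iio]; exact hε_quantile 0)
    hf_zero
  obtain ⟨m₀, M₀, hm₀, hmM, hspec⟩ := hX_eig
  obtain ⟨M, hM, hlow⟩ := hβ₀_lower
  obtain ⟨B, hup⟩ := hβ₀_upper
  have hfit : ∀ δ > 0, ∀ᶠ n in atTop, ∀ j, groupRate g n * ‖X n j‖ ≤ δ :=
    fun δ hδ => eventually_groupRate_mul_norm_le hX_max hδ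
  -- The constant is halved because the regime asks that active groups have norm at least $2\mu$:
  -- one $\mu$ is left after estimation errors of size $\mu$.
  have H : AsymptoticRegime X β₀ lam1 lam2 γ m₀ M₀ (max B 0)
      (fun n => M / 2 * (n : ℝ) ^ α) := by
    refine ⟨hγ, ?_, regimeLimits hγ hc0 hc1 (half_pos hM) (fun n => (lam1 n).2)
      (fun n => (lam2 n).2) hg hα hlam1' hlam2' hlam1_sel, hfit, ?_⟩
    · filter_upwards [hspec, hlow, hup, eventually_gt_atTop 0] with n h1 h2 h3 hn
      have hn0 : (0 : ℝ) < n := by exact_mod_cast hn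
      refine ⟨hn, hm₀, hm₀.le.trans hmM, le_max_right _ _, le_max_left _ _, rfl,
        isConditioned_of_spectrum hn _ h1, by positivity, le_max_right _ _, fun j hj => ?_,
        fun j => (h3 j).trans (le_max_left _ _)⟩
      have h4 := h2 j hj
      rw [Real.rpow_neg hn0.le, inv_mul_eq_div, le_div_iff₀ (by positivity)] at h4
      linarith
    · filter_upwards [hlam1.eventually_gt_atTop 0] with n hn
      exact_mod_cast hn
  have hresp : ∀ n ω, Y n ω = responses (X n) (β₀ n) fun j : Fin n => ε j ω :=
    fun n ω => funext fun i => hY n ω i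
  simp only [hresp] at hβq hβhat
  refine ⟨tendsto_measure_one hε_meas hε_indep hε_law fun ζ hζ => ?_, fun u hu => ?_⟩
  · filter_upwards [H.eventually_support N hζ] with n ⟨A, hA, hAp, hAe⟩
    exact ⟨A, hA, hAp, fun ω hω => hAe _ hω _ _ (hβq n ω) (hβhat n ω)⟩
  · have hu0 : ∀ᶠ n in atTop, u n ≠ 0 := hu.mono fun n hn h => by simp [h] at hn
    -- Slutsky's lemma: the weighted sum of scores is asymptotically normal, and its difference with
    -- the normalized error tends to zero in probability.
    refine tendstoInDistribution_of_tendstoInMeasure_sub _ _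
      (tendstoInDistribution_scores N hε_meas hε_indep hε_law (fun n => scoreWeight (fun i =>
        restrictGroups (activeSet (β₀ n)) (X n i)) (u n)) ?_ fun δ hδ => ?_) ?_ fun n => ?_
    · filter_upwards [H.sample, hu0] with n S hn using S.sum_scoreWeight_sq hn
    · filter_upwards [H.sample, hu0, hfit (√m₀ * δ) (by positivity)] with n S hn hf j
      refine (S.abs_scoreWeight_le hn j).trans ?_
      rw [inv_mul_le_iff₀ (Real.sqrt_pos.2 hm₀)]
      exact hf j
    · refine tendstoInMeasure_zero hε_meas hε_indep hε_law fun ζ hζ δ hδ0 hδ1 => ?_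
      filter_upwards [H.eventually_linearization N hu0 hζ hδ0 hδ1] with n ⟨A, hA, hAp, hAe⟩
      exact ⟨A, hA, hAp, fun ω hω => hAe _ hω _ _ (hβq n ω) (hβhat n ω)⟩
    · have h1 : ∀ ω, inner ℝ (u n) (restrictGroups (activeSet (β₀ n)) (βhat n ω - β₀ n))
          = inner ℝ (βhat n ω - β₀ n) (extendGroups (activeSet (β₀ n)) (u n)) := fun ω => by
        rw [inner_extendGroups, real_inner_comm]
      simp only [h1]
      exact ((((hβhat_meas n).sub_const _).inner_const).const_mul _).aemeasurable
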